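/- **Conventions.** For $k,l\ge 0$, an *even partition* in $P_{even}(k,l)$ is a partition of the set $\{1,\dots,k\}\sqcup\{1',\dots,l'\}$ of $k$ lower and $l$ upper vertices all of whose blocks have an even number of elements. For $p\in P_{even}(k,l)$ and $q\in P_{even}(l,m)$ let $qp\in P_{even}(k,m)$ be the vertical concatenation ($q$ stacked on top of $p$, restricted to the outer rows), and let $l(q,p)$ be the number of connected components of the stacked diagram that lie entirely in the middle row. Let $t\in\mathbb C$. The category $\underline{\mathrm{Rep}}_0(H_t)$ has the objects $[n]$, $n\in\mathbb N=\{0,1,2,\dots\}$, the morphism spaces $\mathrm{Hom}([k],[l])=\mathbb C P_{even}(k,l)$, and the bilinear composition with $q\circ p=t^{\,l(q,p)}\,qp$. It is a $\mathbb C$-linear symmetric monoidal category with $[n]\otimes[m]=[n+m]$, horizontal concatenation as tensor product of morphisms, and the permutations that interchange the two groups of strands as symmetry. $\underline{\mathrm{Rep}}(H_t)$ is its Karoubian envelope, i.e. the idempotent completion of its additive envelope, with the induced $\mathbb C$-linear symmetric monoidal structure. A $\mathbb C$-linear symmetric monoidal category has $\mathbb C$-vector spaces as morphism sets and $\mathbb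 C$-bilinear composition and tensor product. It is *Karoubi* if it has finite biproducts and all its idempotents split. Symmetric monoidal functors are strong. Let $\mathcal C$ be a $\mathbb C$-linear symmetric monoidal category. A *$t$-dimensional rigid self-dual object with neutralizer* in $\mathcal C$ is a tuple $(A,\alpha,\beta,\delta)$ of an object $A$ and morphisms $\alpha\colon A\otimes A\to A\otimes A$, $\beta\colon A\otimes A\to\mathbf 1$, $\delta\colon\mathbf 1\to A\otimes A$ such that, with $\gamma\colon A\otimes A\to A\otimes A$ the symmetry and associators and unitors suppressed, 1. $(\mathrm{id}_A\otimes\beta)\circ(\delta\otimes \mathrm{id}_A)=\mathrm{id}_A=(\beta\otimes \mathrm{id}_A)\circ(\mathrm{id}_A\otimes\delta)$; 2. $\beta\circ\delta=t\cdot\mathrm{id}_{\mathbf 1}$; 3. $\alpha\circ\alpha=\alpha$ and $(\mathrm{id}_A\otimes\alpha)\circ(\alpha\otimes \mathrm{id}_A)=(\alpha\otimes \mathrm{id}_A)\circ(\mathrm{id}_A\otimes\alpha)$; 4. $\alpha\circ\delta=\delta$, $\ \beta\circ\alpha=\beta$, $\ (\mathrm{id}_A\otimes\alpha)\circ(\delta\otimes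 \mathrm{id}_A)=(\alpha\otimes \mathrm{id}_A)\circ(\mathrm{id}_A\otimes\delta)$, $\ (\beta\otimes \mathrm{id}_A)\circ(\mathrm{id}_A\otimes\alpha)=(\mathrm{id}_A\otimes\beta)\circ(\alpha\otimes \mathrm{id}_A)$; 5. $\beta\circ\gamma=\beta$, $\ \gamma\circ\delta=\delta$, $\ \alpha\circ\gamma=\alpha=\gamma\circ\alpha$. An isomorphism $(A,\alpha,\beta,\delta)\to(A',\alpha',\beta',\delta')$ of such objects is an isomorphism $f\colon A\to A'$ in $\mathcal C$ with $(f\otimes f)\circ\alpha=\alpha'\circ(f\otimes f)$, $\beta'\circ(f\otimes f)=\beta$ and $(f\otimes f)\circ\delta=\delta'$. These objects and isomorphisms form a groupoid $\mathrm{Rig}^{sd,neutr}_{\mathbb C}(\mathcal C,t)$. **Corollary.** Let $t\in\mathbb C$ and let $\mathcal C$ be a $\mathbb C$-linear symmetric monoidal Karoubi category. Let $\mathrm{Fun}^{\otimes,Symm}_{\mathbb C}(\underline{\mathrm{Rep}}(H_t),\mathcal C)$ be the category of $\mathbb C$-linear symmetric monoidal functors $\underline{\mathrm{Rep}}(H_t)\to\mathcal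 C$ and monoidal natural isomorphisms. Then there is an equivalence of categories $$\mathrm{Fun}^{\otimes,Symm}_{\mathbb C}(\underline{\mathrm{Rep}}(H_t),\mathcal C)\;\simeq\;\mathrm{Rig}^{sd,neutr}_{\mathbb C}(\mathcal C,t).$$ It can be chosen naturally isomorphic to the evaluation at $[1]$, which sends a functor $F$ to $F([1])$ with the morphisms $\alpha,\beta,\delta$ that are obtained, through the monoidal structure of $F$, from the images of the one-block partitions $\{\{1,2,1',2'\}\}$, $\{\{1,2\}\}$ and $\{\{1',2'\}\}$, and which sends a natural isomorphism $\kappa$ to $\kappa_{[1]}$. -/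

import Mathlib

open CategoryTheory MonoidalCategory Limits

universe v u

noncomputable section

set_option linter.unusedSectionVars false

namespace HypDeligne

/-! ### Partition diagrams -/

section Setoids

variable {X Y Z : Type} (p : Setoid (X ⊕ Y)) (q : Setoid (Y ⊕ Z))

/-- The stacking of `q` on top of `p`: the equivalence relation on the three rows
`X`, `Y`, `Z` which is generated by `p` and `q`. -/
def stack : Setoid (X ⊕ (Y ⊕ Z)) :=
  p.map (Sum.map id Sum.inl) ⊔ q.map Sum.inr

/-- The vertical concatenation: the restriction of the stacking to the outer rows. -/
def stackRel : Setoid (X ⊕ Z) := (stack p q).comap (Sum.map id Sum.inr)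

/-- The components of the stacking that lie entirely in the middle row. -/
def Loop : Type :=
  {c : Quotient (stack p q) // ∀ x, Quotient.mk _ x = c → ∃ y : Y, x = Sum.inr (Sum.inl y)}

/-- The number of loops. -/
def numLoops : ℕ := Nat.card (Loop p q)

/-- The labellings of the two rows of `p` that are constant on the blocks of `p`. -/
def Compat (p : Setoid (X ⊕ Y)) (f : X → Bool) (g : Y → Bool) : Prop :=
  p ≤ Setoid.ker (Sum.elim f g)

theorem map_le_iff {A B : Type} (r : Setoid A) (i : A → B) (s : Setoid B) :
    r.map i ≤ s ↔ r ≤ s.comap i := by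
  constructor
  · intro h x y hxy
    exact h (Relation.EqvGen.rel _ _ ⟨x, y, hxy, rfl, rfl⟩)
  · intro h
    refine Setoid.eqvGen_le ?_
    rintro _ _ ⟨x, y, hxy, rfl, rfl⟩
    exact h hxy

theorem stack_le_iff (F : X ⊕ (Y ⊕ Z) → Bool) :
    stack p q ≤ Setoid.ker F ↔
      Compat p (fun x => F (.inl x)) (fun y => F (.inr (.inl y))) ∧
      Compat q (fun y => F (.inr (.inl y))) (fun z => F (.inr (.inr z))) := by
  rw [stack, sup_le_iff, map_le_iff, map_le_iff]
  have h1 : (Setoid.ker F).comap (Sum.map id Sum.inl) =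
      Setoid.ker (Sum.elim (fun x => F (.inl x)) (fun y => F (.inr (.inl y)))) := by
    ext a b; rcases a with a | a <;> rcases b with b | b <;> rfl
  have h2 : (Setoid.ker F).comap Sum.inr =
      Setoid.ker (Sum.elim (fun y => F (.inr (.inl y))) (fun z => F (.inr (.inr z)))) := by
    ext a b; rcases a with a | a <;> rcases b with b | b <;> rfl
  rw [h1, h2]; rfl

theorem setoid_le_of_ker {A : Type} (r s : Setoid A)
    (h : ∀ F : A → Bool, r ≤ Setoid.ker F → s ≤ Setoid.ker F) : s ≤ r := by
  classical
  intro v w hvw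
  have := h (fun x => decide (r v x)) (fun x y hxy => by
    have : r v x ↔ r v y := ⟨fun h => r.trans' h hxy, fun h => r.trans' h (r.symm' hxy)⟩
    simp [Setoid.ker_def, this]) hvw
  have h2 : r v v := r.refl' v
  simpa [Setoid.ker_def, h2] using this

theorem compat_ext {p p' : Setoid (X ⊕ Y)} (h : ∀ f g, Compat p f g ↔ Compat p' f g) :
    p = p' := by
  apply le_antisymm <;> apply setoid_le_of_ker <;> intro F
  · have := (h (fun x => F (.inl x)) (fun y => F (.inr y))).2
    simp only [Compat] at this
    have e : Sum.elim (fun x => F (.inl x)) (fun y => F (.inr y)) = F := by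
      ext a; cases a <;> rfl
    rwa [e] at this
  · have := (h (fun x => F (.inl x)) (fun y => F (.inr y))).1
    simp only [Compat] at this
    have e : Sum.elim (fun x => F (.inl x)) (fun y => F (.inr y)) = F := by
      ext a; cases a <;> rfl
    rwa [e] at this

open Classical in
/-- The incidence matrix of `p` on labellings by two colours. -/
def mat (p : Setoid (X ⊕ Y)) (f : X → Bool) (g : Y → Bool) : ℕ := if Compat p f g then 1 else 0

theorem compat_const (b : Bool) : Compat p (fun _ => b) (fun _ => b) := by
  intro x y _
  rcases x with x | x <;> rcases y with y | y <;> rfl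

theorem mat_const (b : Bool) : mat p (fun _ => b) (fun _ => b) = 1 := by
  simp [mat, compat_const]

theorem eq_of_mat {p p' : Setoid (X ⊕ Y)} {a b : ℕ}
    (h : ∀ f g, 2 ^ a * mat p f g = 2 ^ b * mat p' f g) : a = b ∧ p = p' := by
  have h0 := h (fun _ => true) (fun _ => true)
  simp only [mat_const, mul_one] at h0
  have hab : a = b := Nat.pow_right_injective le_rfl h0
  subst hab
  refine ⟨rfl, compat_ext fun f g => ?_⟩
  have := h f g
  have h2 : (2 : ℕ) ^ a ≠ 0 := by positivity
  have := mul_left_cancel₀ h2 this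
  unfold mat at this
  split_ifs at this <;> simp_all

theorem exists_of_not_loop (c : Quotient (stack p q))
    (hc : ¬ ∀ x, Quotient.mk _ x = c → ∃ y : Y, x = Sum.inr (Sum.inl y)) :
    ∃ x : X ⊕ Z, Quotient.mk (stack p q) (Sum.map id Sum.inr x) = c := by
  push Not at hc
  obtain ⟨x, hx, hy⟩ := hc
  rcases x with x | y | z
  · exact ⟨.inl x, hx⟩
  · exact absurd rfl (hy y)
  · exact ⟨.inr z, hx⟩

/-- The common labellings of the middle row correspond to labellings of the loops. -/
theorem card_compat (f : X → Bool) (g : Z → Bool) (hfg : Compat (stackRel p q) f g) :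
    Nonempty ({h : Y → Bool // Compat p f h ∧ Compat q h g} ≃ (Loop p q → Bool)) := by
  classical
  let s := stack p q
  let isLoop : Quotient s → Prop := fun c => ∀ x, Quotient.mk _ x = c → ∃ y : Y,
    x = Sum.inr (Sum.inl y)
  have hrep : ∀ c : Loop p q, ∃ y : Y, Quotient.mk s (.inr (.inl y)) = c.1 := by
    rintro ⟨c, hc⟩
    induction c using Quotient.inductionOn with
    | _ x => obtain ⟨y, rfl⟩ := hc x rfl; exact ⟨y, rfl⟩
  choose rep hrep using hrep
  have hout : ∀ c : Quotient s, ¬ isLoop c →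
      ∃ x : X ⊕ Z, Quotient.mk s (Sum.map id Sum.inr x) = c := fun c hc =>
    exists_of_not_loop p q c hc
  choose out hout using hout
  -- the labelling of all components induced by a labelling of the loops
  let G : (Loop p q → Bool) → Quotient s → Bool := fun l c =>
    if hc : isLoop c then l ⟨c, hc⟩ else Sum.elim f g (out c hc)
  have hG : ∀ l (x : X ⊕ Z), G l (Quotient.mk s (Sum.map id Sum.inr x)) = Sum.elim f g x := by
    intro l x
    have hn : ¬ isLoop (Quotient.mk s (Sum.map id Sum.inr x)) := by
      intro hc
      obtain ⟨y, hy⟩ := hc _ rfl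
      rcases x with x | z <;> simp at hy
    simp only [G, dif_neg hn]
    have h1 := Quotient.exact (hout _ hn)
    exact hfg (show stackRel p q _ _ from h1)
  have key : ∀ h : Y → Bool, (Compat p f h ∧ Compat q h g) ↔
      s ≤ Setoid.ker (Sum.elim f (Sum.elim h g)) := fun h =>
    (stack_le_iff p q (Sum.elim f (Sum.elim h g))).symm
  refine ⟨⟨fun h c => h.1 (rep c), fun l => ⟨fun y => G l (Quotient.mk s (.inr (.inl y))), ?_⟩,
    ?_, ?_⟩⟩
  · rw [key]
    have : (Sum.elim f (Sum.elim (fun y => G l (Quotient.mk s (.inr (.inl y)))) g)) =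
        fun x => G l (Quotient.mk s x) := by
      ext x
      rcases x with x | y | z
      · exact (hG l (.inl x)).symm
      · rfl
      · exact (hG l (.inr z)).symm
    rw [this]
    intro x y hxy
    exact congrArg (G l) (Quotient.sound hxy)
  · rintro ⟨h, hh⟩
    have hs := (key h).1 hh
    ext y
    simp only [G]
    split_ifs with hc
    · exact hs (Quotient.exact (hrep ⟨_, hc⟩))
    · have := hs (Quotient.exact (hout _ hc))
      rw [Setoid.ker_def] at this
      rw [Sum.elim_inr, Sum.elim_inl] at this
      rw [← this]
      rcases out _ hc with x | z <;> rfl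
  · intro l
    funext c
    have : isLoop (Quotient.mk s (.inr (.inl (rep c)))) := by rw [hrep]; exact c.2
    simp only [G, dif_pos this]
    congr 1
    exact Subtype.ext (hrep c)

theorem compat_stackRel {f : X → Bool} {h : Y → Bool} {g : Z → Bool}
    (hp : Compat p f h) (hq : Compat q h g) : Compat (stackRel p q) f g := by
  have := (stack_le_iff p q (Sum.elim f (Sum.elim h g))).2 ⟨hp, hq⟩
  intro x y hxy
  have h3 := this hxy
  rw [Setoid.ker_def] at h3 ⊢
  rcases x with x | x <;> rcases y with y | y <;> exact h3

theorem sum_mat [Fintype X] [Fintype Y] [DecidableEq Y] [Fintype Z]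
    (f : X → Bool) (g : Z → Bool) :
    ∑ h : Y → Bool, mat p f h * mat q h g =
      2 ^ numLoops p q * mat (stackRel p q) f g := by
  classical
  have e : ∀ h, mat p f h * mat q h g = if Compat p f h ∧ Compat q h g then 1 else 0 := by
    intro h; unfold mat; split_ifs <;> simp_all
  simp only [e]
  rw [Finset.sum_boole]
  by_cases hfg : Compat (stackRel p q) f g
  · obtain ⟨E⟩ := card_compat p q f g hfg
    have h1 := Nat.card_congr E
    have : Finite (Loop p q) := inferInstanceAs (Finite (Subtype _))
    rw [Nat.card_fun, Nat.card_eq_fintype_card, Fintype.card_subtype] at h1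
    simpa [mat, hfg, numLoops] using h1
  · have : ∀ h, ¬ (Compat p f h ∧ Compat q h g) := fun h hh =>
      hfg (compat_stackRel p q hh.1 hh.2)
    simp [mat, hfg, this]

/-- All blocks of `r` have an even number of elements. -/
def IsEven {A : Type} (r : Setoid A) : Prop := ∀ v, Even {w | r v w}.ncard

theorem isEven_iff {A : Type} [Finite A] (r : Setoid A) :
    IsEven r ↔ ∀ F : A → Bool, r ≤ Setoid.ker F → Even {v | F v = true}.ncard := by
  classical
  have := Fintype.ofFinite A
  constructor
  · intro h F hF
    rw [Set.ncard_eq_toFinset_card', Finset.card_eq_sum_card_fiberwise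
      (f := fun v => Quotient.mk r v) (t := Finset.univ) (by intro x _; simp)]
    refine Finset.even_sum _ fun c _ => ?_
    induction c using Quotient.inductionOn with
    | _ v =>
      by_cases hv : F v = true
      · have hv' := h v
        rw [Set.ncard_eq_toFinset_card'] at hv'
        convert! hv' using 2
        ext w
        simp only [Finset.mem_filter, Set.mem_toFinset, Set.mem_ofPred_eq]
        constructor
        · rintro ⟨_, h2⟩; exact r.symm' (Quotient.exact h2)
        · intro h2; exact ⟨(hF h2).symm.trans hv, Quotient.sound (r.symm' h2)⟩
      · convert Even.zero
        rw [Finset.card_eq_zero, Finset.filter_eq_empty_iff]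
        intro w hw h2
        simp only [Set.mem_toFinset, Set.mem_ofPred_eq] at hw
        exact hv ((hF (Quotient.exact h2)).symm.trans hw)
  · intro h v
    have := h (fun x => decide (r v x)) (fun x y hxy => by
      have : r v x ↔ r v y := ⟨fun h => r.trans' h hxy, fun h => r.trans' h (r.symm' hxy)⟩
      simp [Setoid.ker_def, this])
    simpa using this

/-- The number of vertices with label `true`. -/
def cnt {A : Type} (f : A → Bool) : ℕ := {v | f v = true}.ncard

theorem cnt_sum [Finite X] [Finite Y] (F : X ⊕ Y → Bool) :
    {v | F v = true}.ncard = cnt (fun x => F (.inl x)) + cnt (fun y => F (.inr y)) := by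
  classical
  have := Fintype.ofFinite X
  have := Fintype.ofFinite Y
  simp only [cnt, ← Nat.card_coe_set_eq, Set.coe_ofPred]
  rw [← Nat.card_sum]
  exact Nat.card_congr (Equiv.subtypeSum)

theorem isEven_sum_iff [Finite X] [Finite Y] (r : Setoid (X ⊕ Y)) :
    IsEven r ↔ ∀ f g, Compat r f g → Even (cnt f + cnt g) := by
  rw [isEven_iff]
  constructor
  · intro h f g hfg
    have := h _ hfg
    rwa [cnt_sum] at this
  · intro h F hF
    rw [cnt_sum]
    apply h
    have e : Sum.elim (fun x => F (.inl x)) (fun y => F (.inr y)) = F := by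
      ext a; cases a <;> rfl
    rwa [Compat, e]

theorem isEven_stackRel [Finite X] [Finite Y] [Finite Z] (hp : IsEven p) (hq : IsEven q) :
    IsEven (stackRel p q) := by
  rw [isEven_sum_iff] at *
  intro f g hfg
  obtain ⟨E⟩ := card_compat p q f g hfg
  obtain ⟨h, h1, h2⟩ := E.symm (fun _ => true)
  have := (hp f h h1).add (hq h g h2)
  rw [Nat.even_iff] at this ⊢
  omega

end Setoids

/-- Partitions of the set with `k` lower and `l` upper vertices into blocks of even size. -/
structure EvenPartition (k l : ℕ) where
  /-- two vertices are related if they lie in the same block -/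
  rel : Setoid (Fin k ⊕ Fin l)
  /-- every block has an even number of vertices -/
  even : IsEven rel

namespace EvenPartition

variable {k l m k' l' m' : ℕ}

theorem ext' {p q : EvenPartition k l} (h : p.rel = q.rel) : p = q := by
  cases p; cases q; cases h; rfl

/-- The incidence matrix. -/
abbrev M (p : EvenPartition k l) (f : Fin k → Bool) (g : Fin l → Bool) : ℕ := mat p.rel f g

/-- Vertical concatenation, with `q` on top of `p`. -/
def vcomp (p : EvenPartition k l) (q : EvenPartition l m) : EvenPartition k m :=
  ⟨stackRel p.rel q.rel, isEven_stackRel _ _ p.even q.even⟩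

/-- The number of loops that arise in the vertical concatenation of `q` on top of `p`. -/
def loops (p : EvenPartition k l) (q : EvenPartition l m) : ℕ := numLoops p.rel q.rel

theorem sum_M (p : EvenPartition k l) (q : EvenPartition l m) (f g) :
    ∑ h, p.M f h * q.M h g = 2 ^ loops p q * (vcomp p q).M f g := sum_mat _ _ f g

theorem eq_of_M {p q : EvenPartition k l} {a b : ℕ}
    (h : ∀ f g, 2 ^ a * p.M f g = 2 ^ b * q.M f g) : a = b ∧ p = q :=
  ⟨(eq_of_mat h).1, ext' (eq_of_mat h).2⟩

theorem assoc_aux {n : ℕ} (p : EvenPartition k l) (q : EvenPartition l m)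
    (r : EvenPartition m n) :
    loops p q + loops (vcomp p q) r = loops q r + loops p (vcomp q r) ∧
      vcomp (vcomp p q) r = vcomp p (vcomp q r) := by
  apply eq_of_M
  intro f g
  rw [pow_add, mul_assoc, ← sum_M, pow_add, mul_assoc, ← sum_M, Finset.mul_sum, Finset.mul_sum]
  have h1 : ∀ h, 2 ^ loops p q * ((vcomp p q).M f h * r.M h g) =
      ∑ h', p.M f h' * q.M h' h * r.M h g := by
    intro h; rw [← mul_assoc, ← sum_M, Finset.sum_mul]
  have h2 : ∀ h', 2 ^ loops q r * (p.M f h' * (vcomp q r).M h' g) =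
      ∑ h, p.M f h' * q.M h' h * r.M h g := by
    intro h; rw [mul_left_comm, ← sum_M, Finset.mul_sum]; simp only [mul_assoc]
  simp only [h1, h2]
  rw [Finset.sum_comm]

/-- The partition whose blocks are `{i, e(i)'}`. -/
def ofEquiv (e : Fin k ≃ Fin l) : EvenPartition k l where
  rel := Setoid.ker (Sum.elim e id)
  even := by
    rw [isEven_sum_iff]
    intro f g hfg
    have : f = fun i => g (e i) := by
      ext i
      exact hfg (show Setoid.ker (Sum.elim e id) (.inl i) (.inr (e i)) from rfl)
    subst this
    have : cnt (fun i => g (e i)) = cnt g := by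
      simp only [cnt, ← Nat.card_coe_set_eq, Set.coe_ofPred]
      exact Nat.card_congr (e.subtypeEquiv fun _ => Iff.rfl)
    rw [this]
    exact ⟨_, rfl⟩

theorem compat_ofEquiv (e : Fin k ≃ Fin l) (f g) :
    Compat (ofEquiv e).rel f g ↔ f = fun i => g (e i) := by
  constructor
  · intro hfg
    ext i
    exact hfg (show Setoid.ker (Sum.elim e id) (.inl i) (.inr (e i)) from rfl)
  · rintro rfl
    have : Sum.elim (fun i => g (e i)) g = g ∘ Sum.elim e id := by
      ext x; rcases x with x | x <;> rfl
    intro x y hxy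
    rw [this, Setoid.ker_def]
    exact congrArg g hxy

theorem M_ofEquiv (e : Fin k ≃ Fin l) (f g) :
    (ofEquiv e).M f g = if f = fun i => g (e i) then 1 else 0 := by
  classical
  simp only [M, mat, compat_ofEquiv]

theorem M_ofEquiv' (e : Fin k ≃ Fin l) (f g) :
    (ofEquiv e).M f g = if g = fun i => f (e.symm i) then 1 else 0 := by
  rw [M_ofEquiv]
  congr 1
  apply propext
  constructor
  · rintro rfl; ext i; simp
  · rintro rfl; ext i; simp

theorem sum_ofEquiv_left (e : Fin k ≃ Fin l) (q : EvenPartition l m) (f g) :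
    ∑ h, (ofEquiv e).M f h * q.M h g = q.M (fun i => f (e.symm i)) g := by
  simp [M_ofEquiv']

theorem sum_ofEquiv_right (q : EvenPartition k l) (e : Fin l ≃ Fin m) (f g) :
    ∑ h, q.M f h * (ofEquiv e).M h g = q.M f (fun i => g (e i)) := by
  simp [M_ofEquiv]

/-- The partition with at most one block. -/
def block (k l : ℕ) (h : Even (k + l)) : EvenPartition k l where
  rel := ⊤
  even := by
    intro v
    have : {w : Fin k ⊕ Fin l | (⊤ : Setoid _) v w} = Set.univ := by
      ext w; simp
    rw [this, Set.ncard_univ]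
    simpa using h

theorem cnt_fin (f : Fin (k + k') → Bool) :
    cnt f = cnt (fun i => f (Fin.castAdd k' i)) + cnt (fun i => f (Fin.natAdd k i)) := by
  refine Eq.trans ?_ (cnt_sum (fun x => f (finSumFinEquiv x)))
  simp only [cnt, ← Nat.card_coe_set_eq, Set.coe_ofPred]
  exact (Nat.card_congr (finSumFinEquiv.subtypeEquiv fun _ => Iff.rfl)).symm

/-- Horizontal concatenation of equivalence relations, with `q` on the right of `p`. -/
def hrel (p : Setoid (Fin k ⊕ Fin l)) (q : Setoid (Fin k' ⊕ Fin l')) :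
    Setoid (Fin (k + k') ⊕ Fin (l + l')) :=
  p.map (Sum.map (Fin.castAdd k') (Fin.castAdd l')) ⊔
    q.map (Sum.map (Fin.natAdd k) (Fin.natAdd l))

theorem compat_hrel (p : Setoid (Fin k ⊕ Fin l)) (q : Setoid (Fin k' ⊕ Fin l')) (f g) :
    Compat (hrel p q) f g ↔
      Compat p (fun i => f (Fin.castAdd k' i)) (fun i => g (Fin.castAdd l' i)) ∧
      Compat q (fun i => f (Fin.natAdd k i)) (fun i => g (Fin.natAdd l i)) := by
  rw [hrel, Compat, sup_le_iff, map_le_iff, map_le_iff]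
  have h1 : (Setoid.ker (Sum.elim f g)).comap (Sum.map (Fin.castAdd k') (Fin.castAdd l')) =
      Setoid.ker (Sum.elim (fun i => f (Fin.castAdd k' i)) (fun i => g (Fin.castAdd l' i))) := by
    ext a b; rcases a with a | a <;> rcases b with b | b <;> rfl
  have h2 : (Setoid.ker (Sum.elim f g)).comap (Sum.map (Fin.natAdd k) (Fin.natAdd l)) =
      Setoid.ker (Sum.elim (fun i => f (Fin.natAdd k i)) (fun i => g (Fin.natAdd l i))) := by
    ext a b; rcases a with a | a <;> rcases b with b | b <;> rfl
  rw [h1, h2]; rfl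

/-- Horizontal concatenation, with `q` on the right of `p`. -/
def hcomp (p : EvenPartition k l) (q : EvenPartition k' l') :
    EvenPartition (k + k') (l + l') where
  rel := hrel p.rel q.rel
  even := by
    have hp := (isEven_sum_iff _).1 p.even
    have hq := (isEven_sum_iff _).1 q.even
    rw [isEven_sum_iff]
    intro f g hfg
    rw [compat_hrel] at hfg
    have := (hp _ _ hfg.1).add (hq _ _ hfg.2)
    rw [cnt_fin f, cnt_fin g]
    rw [Nat.even_iff] at this ⊢
    omega

theorem M_hcomp (p : EvenPartition k l) (q : EvenPartition k' l') (f g) :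
    (hcomp p q).M f g =
      p.M (fun i => f (Fin.castAdd k' i)) (fun i => g (Fin.castAdd l' i)) *
      q.M (fun i => f (Fin.natAdd k i)) (fun i => g (Fin.natAdd l i)) := by
  have := compat_hrel p.rel q.rel f g
  have e : Compat (hcomp p q).rel f g ↔ _ := this
  unfold M mat
  by_cases h1 : Compat p.rel (fun i => f (Fin.castAdd k' i)) (fun i => g (Fin.castAdd l' i)) <;>
  by_cases h2 : Compat q.rel (fun i => f (Fin.natAdd k i)) (fun i => g (Fin.natAdd l i)) <;>
  simp [e, h1, h2]

theorem sum_fin (F : (Fin (k + k') → Bool) → ℕ) :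
    ∑ h, F h = ∑ h₁ : Fin k → Bool, ∑ h₂ : Fin k' → Bool, F (Fin.append h₁ h₂) := by
  rw [← Fintype.sum_prod_type' (f := fun h₁ h₂ => F (Fin.append h₁ h₂))]
  exact (Fintype.sum_equiv (Fin.appendEquiv k k') _ _ fun _ => rfl).symm

theorem interchange_aux (p : EvenPartition k l) (q : EvenPartition l m)
    (p' : EvenPartition k' l') (q' : EvenPartition l' m') :
    loops (hcomp p p') (hcomp q q') = loops p q + loops p' q' ∧
      vcomp (hcomp p p') (hcomp q q') = hcomp (vcomp p q) (vcomp p' q') := by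
  apply eq_of_M
  intro f g
  rw [← sum_M, sum_fin, M_hcomp, pow_add, mul_mul_mul_comm, ← sum_M, ← sum_M,
    Finset.sum_mul_sum]
  refine Finset.sum_congr rfl fun h₁ _ => Finset.sum_congr rfl fun h₂ _ => ?_
  simp only [M_hcomp, Fin.append_left, Fin.append_right]
  ring

/-- The sum of two bijections, acting on left and right parts. -/
def sumEquiv (e : Fin k ≃ Fin l) (e' : Fin k' ≃ Fin l') : Fin (k + k') ≃ Fin (l + l') :=
  finSumFinEquiv.symm.trans ((Equiv.sumCongr e e').trans finSumFinEquiv)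

@[simp] theorem sumEquiv_castAdd (e : Fin k ≃ Fin l) (e' : Fin k' ≃ Fin l') (i : Fin k) :
    sumEquiv e e' (Fin.castAdd k' i) = Fin.castAdd l' (e i) := by simp [sumEquiv]

@[simp] theorem sumEquiv_natAdd (e : Fin k ≃ Fin l) (e' : Fin k' ≃ Fin l') (i : Fin k') :
    sumEquiv e e' (Fin.natAdd k i) = Fin.natAdd l (e' i) := by simp [sumEquiv]

theorem eq_of_M' {p q : EvenPartition k l} (h : ∀ f g, p.M f g = q.M f g) : p = q :=
  (eq_of_M (a := 0) (b := 0) (by simpa using h)).2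

theorem hcomp_ofEquiv (e : Fin k ≃ Fin l) (e' : Fin k' ≃ Fin l') :
    hcomp (ofEquiv e) (ofEquiv e') = ofEquiv (sumEquiv e e') := by
  apply eq_of_M'
  intro f g
  rw [M_hcomp, M_ofEquiv, M_ofEquiv, M_ofEquiv]
  have : (f = fun i => g (sumEquiv e e' i)) ↔
      ((fun i => f (Fin.castAdd k' i)) = fun i => g (Fin.castAdd l' (e i))) ∧
      ((fun i => f (Fin.natAdd k i)) = fun i => g (Fin.natAdd l (e' i))) := by
    constructor
    · rintro rfl; simp
    · rintro ⟨h1, h2⟩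
      ext i
      refine Fin.addCases (fun i => ?_) (fun i => ?_) i
      · simpa using congrFun h1 i
      · simpa using congrFun h2 i
  simp only [this]
  split_ifs <;> simp_all

theorem vcomp_ofEquiv (e : Fin k ≃ Fin l) (e' : Fin l ≃ Fin m) :
    loops (ofEquiv e) (ofEquiv e') = 0 ∧
      vcomp (ofEquiv e) (ofEquiv e') = ofEquiv (e.trans e') := by
  apply eq_of_M
  intro f g
  rw [← sum_M, sum_ofEquiv_left, M_ofEquiv', M_ofEquiv', pow_zero, one_mul]
  rfl

theorem hcomp_assoc {k'' l'' : ℕ} (p : EvenPartition k l) (p' : EvenPartition k' l')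
    (p'' : EvenPartition k'' l'') (f g) :
    (hcomp (hcomp p p') p'').M f (fun i => g (finCongr (add_assoc l l' l'') i)) =
      (hcomp p (hcomp p' p'')).M (fun i => f ((finCongr (add_assoc k k' k'')).symm i)) g := by
  have h1 : ∀ i, finCongr (add_assoc l l' l'') (Fin.natAdd (l + l') i) =
      Fin.natAdd l (Fin.natAdd l' i) := fun i => Fin.ext (add_assoc _ _ _)
  have h2 : ∀ i, (finCongr (add_assoc k k' k'')).symm (Fin.natAdd k (Fin.natAdd k' i)) =
      Fin.natAdd (k + k') i := fun i => Fin.ext (add_assoc _ _ _).symm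
  simp only [M_hcomp, mul_assoc, h1, h2]
  rfl

end EvenPartition

/-! ### The category of even partition diagrams -/

section RepZero

open EvenPartition

variable (t : ℂ)

/-- The objects `[n]` of the category of even partition diagrams with loop parameter `t`. -/
@[ext] structure RepZero (t : ℂ) where
  n : ℕ

namespace RepZero

/-- The `ℂ`-linear combinations of even partitions. -/
abbrev LinPart (k l : ℕ) : Type := EvenPartition k l →₀ ℂ

variable {k l m k' l' m' n : ℕ}

/-- The bilinear composition, `q ∘ p = t ^ loops • (q stacked on p)`. -/
def compL (k l m : ℕ) : LinPart k l →ₗ[ℂ] LinPart l m →ₗ[ℂ] LinPart k m :=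
  Finsupp.linearCombination ℂ fun p => Finsupp.linearCombination ℂ fun q =>
    Finsupp.single (vcomp p q) (t ^ loops p q)

/-- The bilinear extension of horizontal concatenation. -/
def tensL (k l k' l' : ℕ) : LinPart k l →ₗ[ℂ] LinPart k' l' →ₗ[ℂ] LinPart (k + k') (l + l') :=
  Finsupp.linearCombination ℂ fun p => Finsupp.linearCombination ℂ fun q =>
    Finsupp.single (hcomp p q) 1

theorem compL_single (p : EvenPartition k l) (q : EvenPartition l m) (a b : ℂ) :
    compL t k l m (.single p a) (.single q b) =
      .single (vcomp p q) (a * b * t ^ loops p q) := by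
  simp only [compL, Finsupp.linearCombination_single, LinearMap.smul_apply, Finsupp.smul_single,
    smul_eq_mul, mul_assoc]

theorem tensL_single (p : EvenPartition k l) (q : EvenPartition k' l') (a b : ℂ) :
    tensL k l k' l' (.single p a) (.single q b) = .single (hcomp p q) (a * b) := by
  simp only [tensL, Finsupp.linearCombination_single, LinearMap.smul_apply, Finsupp.smul_single,
    smul_eq_mul, mul_one]

/-- The morphism given by a bijection of the vertices. -/
def permL (e : Fin k ≃ Fin l) : LinPart k l := .single (ofEquiv e) 1

theorem compL_assoc (x : LinPart k l) (y : LinPart l m) (z : LinPart m n) :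
    compL t k m n (compL t k l m x y) z = compL t k l n x (compL t l m n y z) := by
  induction x using Finsupp.induction_linear with
  | zero => simp
  | add x x' h h' => simp [h, h']
  | single p a =>
  induction y using Finsupp.induction_linear with
  | zero => simp
  | add x x' h h' => simp [h, h']
  | single q b =>
  induction z using Finsupp.induction_linear with
  | zero => simp
  | add x x' h h' => simp [h, h']
  | single r c =>
  obtain ⟨h1, h2⟩ := assoc_aux p q r
  simp only [compL_single, h2]
  congr 1
  calc _ = a * b * c * t ^ (loops p q + loops (vcomp p q) r) := by rw [pow_add]; ring
    _ = _ := by rw [h1, pow_add]; ring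

theorem tensL_compL (x : LinPart k l) (y : LinPart l m) (x' : LinPart k' l')
    (y' : LinPart l' m') :
    compL t _ _ _ (tensL _ _ _ _ x x') (tensL _ _ _ _ y y') =
      tensL _ _ _ _ (compL t _ _ _ x y) (compL t _ _ _ x' y') := by
  induction x using Finsupp.induction_linear with
  | zero => simp
  | add x x' h h' => simp [h, h']
  | single p a =>
  induction y using Finsupp.induction_linear with
  | zero => simp
  | add x x' h h' => simp [h, h']
  | single q b =>
  induction x' using Finsupp.induction_linear with
  | zero => simp
  | add x x' h h' => simp [h, h']
  | single p' a' =>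
  induction y' using Finsupp.induction_linear with
  | zero => simp
  | add x x' h h' => simp [h, h']
  | single q' b' =>
  obtain ⟨h1, h2⟩ := interchange_aux p q p' q'
  simp only [compL_single, tensL_single, h1, h2]
  congr 1
  rw [pow_add]; ring

theorem permL_trans (e : Fin k ≃ Fin l) (e' : Fin l ≃ Fin m) :
    compL t _ _ _ (permL e) (permL e') = permL (e.trans e') := by
  simp [permL, compL_single, vcomp_ofEquiv]

theorem tensL_permL (e : Fin k ≃ Fin l) (e' : Fin k' ≃ Fin l') :
    tensL _ _ _ _ (permL e) (permL e') = permL (sumEquiv e e') := by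
  simp [permL, tensL_single, hcomp_ofEquiv]

theorem compL_permL_eq (p : EvenPartition k l) (e : Fin l ≃ Fin m) (e' : Fin k ≃ Fin n)
    (q : EvenPartition n m)
    (h : ∀ f g, p.M f (fun i => g (e i)) = q.M (fun i => f (e'.symm i)) g) (a : ℂ) :
    compL t _ _ _ (.single p a) (permL e) = compL t _ _ _ (permL e') (.single q a) := by
  have key : loops p (ofEquiv e) = loops (ofEquiv e') q ∧
      vcomp p (ofEquiv e) = vcomp (ofEquiv e') q := by
    apply eq_of_M
    intro f g
    rw [← sum_M, ← sum_M, sum_ofEquiv_left, sum_ofEquiv_right, h]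
  simp only [permL, compL_single, key.1, key.2]
  simp

theorem permL_refl_compL (x : LinPart k l) : compL t _ _ _ (permL (Equiv.refl _)) x = x := by
  induction x using Finsupp.induction_linear with
  | zero => simp
  | add x x' h h' => simp [h, h']
  | single p a =>
  have key : loops (ofEquiv (Equiv.refl _)) p = 0 ∧ vcomp (ofEquiv (Equiv.refl _)) p = p := by
    apply eq_of_M
    intro f g
    rw [← sum_M, sum_ofEquiv_left]
    simp
  simp only [permL, compL_single, key.1, key.2]
  simp

theorem compL_permL_refl (x : LinPart k l) : compL t _ _ _ x (permL (Equiv.refl _)) = x := by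
  induction x using Finsupp.induction_linear with
  | zero => simp
  | add x x' h h' => simp [h, h']
  | single p a =>
  have key : loops p (ofEquiv (Equiv.refl _)) = 0 ∧ vcomp p (ofEquiv (Equiv.refl _)) = p := by
    apply eq_of_M
    intro f g
    rw [← sum_M, sum_ofEquiv_right]
    simp
  simp only [permL, compL_single, key.1, key.2]
  simp

variable {t}

instance : Category (RepZero t) where
  Hom X Y := LinPart X.n Y.n
  id _ := permL (Equiv.refl _)
  comp f g := compL t _ _ _ f g
  id_comp f := permL_refl_compL t f
  comp_id f := compL_permL_refl t f
  assoc f g h := compL_assoc t f g h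

instance (X Y : RepZero t) : AddCommGroup (X ⟶ Y) :=
  inferInstanceAs (AddCommGroup (LinPart X.n Y.n))

instance (X Y : RepZero t) : Module ℂ (X ⟶ Y) :=
  inferInstanceAs (Module ℂ (LinPart X.n Y.n))

instance : Preadditive (RepZero t) where
  add_comp X Y Z f g h := by
    change compL t _ _ _ (_ + _) _ = compL t _ _ _ _ _ + compL t _ _ _ _ _
    rw [map_add, LinearMap.add_apply]
  comp_add X Y Z f g h := map_add (compL t X.n Y.n Z.n f) g h

instance : Linear ℂ (RepZero t) where
  smul_comp X Y Z r f g := by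
    change compL t _ _ _ (r • _) _ = r • compL t _ _ _ _ _
    rw [map_smul, LinearMap.smul_apply]
  comp_smul X Y Z f r g := map_smul (compL t X.n Y.n Z.n f) r g

/-- The morphism of the category given by an even partition. -/
def ofPart {X Y : RepZero t} (p : EvenPartition X.n Y.n) : X ⟶ Y :=
  (Finsupp.single p 1 : LinPart X.n Y.n)

/-- The isomorphism of the category given by a bijection of the vertices. -/
def permIso {X Y : RepZero t} (e : Fin X.n ≃ Fin Y.n) : X ≅ Y where
  hom := permL e
  inv := permL e.symm
  hom_inv_id := by
    change compL t _ _ _ (permL e) (permL e.symm) = permL (Equiv.refl _)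
    rw [permL_trans]; simp
  inv_hom_id := by
    change compL t _ _ _ (permL e.symm) (permL e) = permL (Equiv.refl _)
    rw [permL_trans]; simp

instance : MonoidalCategoryStruct (RepZero t) where
  tensorObj X Y := ⟨X.n + Y.n⟩
  tensorUnit := ⟨0⟩
  tensorHom f g := tensL _ _ _ _ f g
  whiskerLeft _ _ _ f := tensL _ _ _ _ (permL (Equiv.refl _)) f
  whiskerRight f _ := tensL _ _ _ _ f (permL (Equiv.refl _))
  associator X Y Z := permIso (finCongr (add_assoc X.n Y.n Z.n))
  leftUnitor X := permIso (finCongr (zero_add X.n))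
  rightUnitor X := permIso (finCongr (add_zero X.n))

theorem sumEquiv_refl : sumEquiv (Equiv.refl (Fin k)) (Equiv.refl (Fin l)) = Equiv.refl _ := by
  simp [sumEquiv]

theorem sumEquiv_finCongr (h : k = l) (h' : k' = l') :
    sumEquiv (finCongr h) (finCongr h') = finCongr (by rw [h, h']) := by
  subst h h'
  exact sumEquiv_refl

theorem associator_nat {k'' l'' : ℕ} (x : LinPart k l) (y : LinPart k' l')
    (z : LinPart k'' l'') :
    compL t _ _ _ (tensL _ _ _ _ (tensL _ _ _ _ x y) z) (permL (finCongr (add_assoc l l' l''))) =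
      compL t _ _ _ (permL (finCongr (add_assoc k k' k'')))
        (tensL _ _ _ _ x (tensL _ _ _ _ y z)) := by
  induction x using Finsupp.induction_linear with
  | zero => simp
  | add x x' h h' => simp only [map_add, LinearMap.add_apply, h, h']
  | single p a =>
  induction y using Finsupp.induction_linear with
  | zero => simp
  | add x x' h h' => simp only [map_add, LinearMap.add_apply, h, h']
  | single q b =>
  induction z using Finsupp.induction_linear with
  | zero => simp
  | add x x' h h' => simp only [map_add, LinearMap.add_apply, h, h']
  | single r c =>
  simp only [tensL_single, mul_assoc]
  exact compL_permL_eq t _ _ _ _ (hcomp_assoc p q r) _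

theorem leftUnitor_nat (x : LinPart k l) :
    compL t _ _ _ (tensL 0 0 _ _ (permL (Equiv.refl _)) x) (permL (finCongr (zero_add l))) =
      compL t _ _ _ (permL (finCongr (zero_add k))) x := by
  induction x using Finsupp.induction_linear with
  | zero => simp
  | add x x' h h' => simp only [map_add, LinearMap.add_apply, h, h']
  | single p a =>
  rw [show (permL (Equiv.refl (Fin 0))) = .single (ofEquiv (Equiv.refl (Fin 0))) 1 from rfl,
    tensL_single, one_mul]
  refine compL_permL_eq t _ _ _ _ (fun f g => ?_) _
  rw [M_hcomp, M_ofEquiv, if_pos (Subsingleton.elim _ _), one_mul]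
  congr 1
  · funext i; congr 1; ext; simp
  · funext i; congr 1; ext; simp

theorem rightUnitor_nat (x : LinPart k l) :
    compL t _ _ _ (tensL _ _ 0 0 x (permL (Equiv.refl _))) (permL (finCongr (add_zero l))) =
      compL t _ _ _ (permL (finCongr (add_zero k))) x := by
  induction x using Finsupp.induction_linear with
  | zero => simp
  | add x x' h h' => simp only [map_add, LinearMap.add_apply, h, h']
  | single p a =>
  rw [show (permL (Equiv.refl (Fin 0))) = .single (ofEquiv (Equiv.refl (Fin 0))) 1 from rfl,
    tensL_single, mul_one]
  refine compL_permL_eq t _ _ _ _ (fun f g => ?_) _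
  rw [M_hcomp, M_ofEquiv, if_pos (Subsingleton.elim _ _), mul_one]
  rfl

theorem braiding_nat (x : LinPart k l) (y : LinPart k' l') :
    compL t _ _ _ (tensL _ _ _ _ x y) (permL finAddFlip) =
      compL t _ _ _ (permL finAddFlip) (tensL _ _ _ _ y x) := by
  induction x using Finsupp.induction_linear with
  | zero => simp
  | add x x' h h' => simp only [map_add, LinearMap.add_apply, h, h']
  | single p a =>
  induction y using Finsupp.induction_linear with
  | zero => simp
  | add x x' h h' => simp only [map_add, LinearMap.add_apply, h, h']
  | single q b =>
  rw [tensL_single, tensL_single, mul_comm]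
  refine compL_permL_eq t _ _ _ _ (fun f g => ?_) _
  rw [M_hcomp, M_hcomp, mul_comm]
  have h1 : ∀ i : Fin k', finAddFlip.symm (Fin.castAdd k i) = Fin.natAdd k i := fun i => by
    rw [Equiv.symm_apply_eq]; simp
  have h2 : ∀ i : Fin k, finAddFlip.symm (Fin.natAdd k' i) = Fin.castAdd k' i := fun i => by
    rw [Equiv.symm_apply_eq]; simp
  simp only [h1, h2, finAddFlip_apply_castAdd, finAddFlip_apply_natAdd]

theorem flip_flip : (finAddFlip (m := k) (n := l)).trans finAddFlip = Equiv.refl _ := by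
  apply Equiv.ext
  intro i
  refine Fin.addCases (fun i => ?_) (fun i => ?_) i <;> simp

set_option linter.unusedSimpArgs false in
theorem hexagon_fwd :
    (finCongr (add_assoc k l m)).trans
      ((finAddFlip (m := k) (n := l + m)).trans (finCongr (add_assoc l m k))) =
    (sumEquiv finAddFlip (Equiv.refl _)).trans
      ((finCongr (add_assoc l k m)).trans (sumEquiv (Equiv.refl _) finAddFlip)) := by
  have a1 : ∀ {a b c : ℕ} (i : Fin a), finCongr (add_assoc a b c)
      (Fin.castAdd c (Fin.castAdd b i)) = Fin.castAdd (b + c) i := fun i => rfl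
  have a2 : ∀ {a b c : ℕ} (i : Fin b), finCongr (add_assoc a b c)
      (Fin.castAdd c (Fin.natAdd a i)) = Fin.natAdd a (Fin.castAdd c i) := fun i => rfl
  have a3 : ∀ {a b c : ℕ} (i : Fin c), finCongr (add_assoc a b c)
      (Fin.natAdd (a + b) i) = Fin.natAdd a (Fin.natAdd b i) := fun i =>
    Fin.ext (add_assoc _ _ _)
  apply Equiv.ext
  intro i
  simp only [Equiv.trans_apply]
  refine Fin.addCases (fun i => Fin.addCases (fun i => ?_) (fun i => ?_) i) (fun i => ?_) i
  · simp only [a1, a2, a3, sumEquiv_castAdd, sumEquiv_natAdd, finAddFlip_apply_castAdd,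
      finAddFlip_apply_natAdd, Equiv.refl_apply]
  · simp only [a1, a2, a3, sumEquiv_castAdd, sumEquiv_natAdd, finAddFlip_apply_castAdd,
      finAddFlip_apply_natAdd, Equiv.refl_apply]
  · simp only [a1, a2, a3, sumEquiv_castAdd, sumEquiv_natAdd, finAddFlip_apply_castAdd,
      finAddFlip_apply_natAdd, Equiv.refl_apply]

set_option linter.unusedSimpArgs false in
theorem hexagon_rev :
    (finCongr (add_assoc k l m).symm).trans
      ((finAddFlip (m := k + l) (n := m)).trans (finCongr (add_assoc m k l).symm)) =
    (sumEquiv (Equiv.refl _) finAddFlip).trans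
      ((finCongr (add_assoc k m l).symm).trans (sumEquiv finAddFlip (Equiv.refl _))) := by
  have a1 : ∀ {a b c : ℕ} (i : Fin a), finCongr (add_assoc a b c).symm
      (Fin.castAdd (b + c) i) = (Fin.castAdd c (Fin.castAdd b i)) := fun i => rfl
  have a2 : ∀ {a b c : ℕ} (i : Fin b), finCongr (add_assoc a b c).symm
      (Fin.natAdd a (Fin.castAdd c i)) = (Fin.castAdd c (Fin.natAdd a i)) := fun i => rfl
  have a3 : ∀ {a b c : ℕ} (i : Fin c), finCongr (add_assoc a b c).symm
      (Fin.natAdd a (Fin.natAdd b i)) = (Fin.natAdd (a + b) i) := fun i =>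
    Fin.ext (add_assoc _ _ _).symm
  apply Equiv.ext
  intro i
  simp only [Equiv.trans_apply]
  refine Fin.addCases (fun i => ?_) (fun i => Fin.addCases (fun i => ?_) (fun i => ?_) i) i
  · simp only [a1, a2, a3, sumEquiv_castAdd, sumEquiv_natAdd, finAddFlip_apply_castAdd,
      finAddFlip_apply_natAdd, Equiv.refl_apply]
  · simp only [a1, a2, a3, sumEquiv_castAdd, sumEquiv_natAdd, finAddFlip_apply_castAdd,
      finAddFlip_apply_natAdd, Equiv.refl_apply]
  · simp only [a1, a2, a3, sumEquiv_castAdd, sumEquiv_natAdd, finAddFlip_apply_castAdd,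
      finAddFlip_apply_natAdd, Equiv.refl_apply]

instance : MonoidalCategory (RepZero t) := MonoidalCategory.ofTensorHom
  (id_tensorHom_id := by
    intro X Y
    exact (tensL_permL _ _).trans (congrArg _ sumEquiv_refl))
  (id_tensorHom := by intros; rfl)
  (tensorHom_id := by intros; rfl)
  (tensorHom_comp_tensorHom := by
    intro _ _ _ _ _ _ f₁ f₂ g₁ g₂
    exact tensL_compL t f₁ g₁ f₂ g₂)
  (associator_naturality := fun f₁ f₂ f₃ => associator_nat f₁ f₂ f₃)
  (leftUnitor_naturality := fun f => leftUnitor_nat f)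
  (rightUnitor_naturality := fun f => rightUnitor_nat f)
  (pentagon := by
    intro W X Y Z
    change compL t _ _ _ (tensL _ _ _ _ (permL _) (permL (finCongr rfl)))
      (compL t _ _ _ (permL _) (tensL _ _ _ _ (permL (finCongr rfl)) (permL _))) =
      compL t _ _ _ (permL _) (permL _)
    rw [tensL_permL, tensL_permL, permL_trans, permL_trans, permL_trans,
      sumEquiv_finCongr, sumEquiv_finCongr]
    rfl)
  (triangle := by
    intro X Y
    change compL t _ _ _ (permL _) (tensL _ _ _ _ (permL (finCongr rfl)) (permL _)) =
      tensL _ _ _ _ (permL _) (permL (finCongr rfl))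
    rw [tensL_permL, tensL_permL, permL_trans, sumEquiv_finCongr, sumEquiv_finCongr]
    rfl)

instance : SymmetricCategory (RepZero t) where
  braiding X Y := permIso (finAddFlip (m := X.n) (n := Y.n))
  braiding_naturality_right X _ _ f := braiding_nat (t := t) (permL (Equiv.refl (Fin X.n))) f
  braiding_naturality_left f Z := braiding_nat (t := t) f (permL (Equiv.refl (Fin Z.n)))
  hexagon_forward X Y Z := by
    change compL t _ _ _ (permL _) (compL t _ _ _ (permL _) (permL _)) =
      compL t _ _ _ (tensL _ _ _ _ (permL _) (permL (Equiv.refl _)))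
        (compL t _ _ _ (permL _) (tensL _ _ _ _ (permL (Equiv.refl _)) (permL _)))
    rw [tensL_permL, tensL_permL, permL_trans, permL_trans, permL_trans, permL_trans]
    exact congrArg permL hexagon_fwd
  hexagon_reverse X Y Z := by
    change compL t _ _ _ (permL _) (compL t _ _ _ (permL _) (permL _)) =
      compL t _ _ _ (tensL _ _ _ _ (permL (Equiv.refl _)) (permL _))
        (compL t _ _ _ (permL _) (tensL _ _ _ _ (permL _) (permL (Equiv.refl _))))
    rw [tensL_permL, tensL_permL, permL_trans, permL_trans, permL_trans, permL_trans]
    exact congrArg permL hexagon_rev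
  symmetry X Y := by
    change compL t _ _ _ (permL _) (permL _) = permL (Equiv.refl _)
    rw [permL_trans]
    exact congrArg permL flip_flip

instance : MonoidalPreadditive (RepZero t) where
  whiskerLeft_zero := by intros; exact map_zero (tensL _ _ _ _ _)
  zero_whiskerRight := by intros; exact LinearMap.congr_fun (map_zero (tensL _ _ _ _)) _
  whiskerLeft_add := by intros; exact map_add (tensL _ _ _ _ _) _ _
  add_whiskerRight := by intros; exact LinearMap.congr_fun (map_add (tensL _ _ _ _) _ _) _

instance : MonoidalLinear ℂ (RepZero t) where
  whiskerLeft_smul := by intros; exact map_smul (tensL _ _ _ _ _) _ _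
  smul_whiskerRight := by intros; exact LinearMap.congr_fun (map_smul (tensL _ _ _ _) _ _) _

end RepZero

end RepZero

/-! ### The symmetric monoidal structure on the additive envelope -/

namespace MatEnvelope

variable {C : Type u} [Category.{v} C] [Preadditive C]

open Classical in
/-- The matrix with entries `φ i` in the positions `(i, e i)` and zeros elsewhere. -/
def diag {M N : Mat_ C} (e : M.ι → N.ι) (φ : ∀ i, M.X i ⟶ N.X (e i)) : M ⟶ N :=
  fun i j => if h : e i = j then φ i ≫ eqToHom (congrArg N.X h) else 0

open Classical in
/-- The matrix with entries `φ i` in the positions `(e i, i)` and zeros elsewhere. -/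
def codiag {M N : Mat_ C} (e : M.ι → N.ι) (φ : ∀ i, N.X (e i) ⟶ M.X i) : N ⟶ M :=
  fun j i => if h : e i = j then eqToHom (congrArg N.X h.symm) ≫ φ i else 0

variable {M N K : Mat_ C}

theorem diag_self (e : M.ι → N.ι) (φ : ∀ i, M.X i ⟶ N.X (e i)) (i) :
    diag e φ i (e i) = φ i := by simp [diag]

theorem diag_ne (e : M.ι → N.ι) (φ : ∀ i, M.X i ⟶ N.X (e i)) (i j) (h : e i ≠ j) :
    diag e φ i j = 0 := by simp [diag, h]

theorem codiag_self (e : M.ι → N.ι) (φ : ∀ i, N.X (e i) ⟶ M.X i) (i) :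
    codiag e φ (e i) i = φ i := by simp [codiag]

theorem codiag_ne (e : M.ι → N.ι) (φ : ∀ i, N.X (e i) ⟶ M.X i) (i j) (h : e i ≠ j) :
    codiag e φ j i = 0 := by simp [codiag, h]

theorem diag_comp (e : M.ι → N.ι) (φ : ∀ i, M.X i ⟶ N.X (e i)) (f : N ⟶ K) (i k) :
    (diag e φ ≫ f) i k = φ i ≫ f (e i) k := by
  rw [Mat_.comp_apply, Finset.sum_eq_single (e i), diag_self]
  · intro j _ hj; rw [diag_ne _ _ _ _ hj.symm, zero_comp]
  · simp

theorem comp_diag (e : M.ι ≃ N.ι) (φ : ∀ i, M.X i ⟶ N.X (e i)) (f : K ⟶ M) (k i) :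
    (f ≫ diag e φ) k (e i) = f k i ≫ φ i := by
  rw [Mat_.comp_apply, Finset.sum_eq_single i, diag_self]
  · intro j _ hj; rw [diag_ne _ _ _ _ (fun h => hj (e.injective h)), comp_zero]
  · simp

theorem comp_codiag (e : M.ι → N.ι) (φ : ∀ i, N.X (e i) ⟶ M.X i) (f : K ⟶ N) (k i) :
    (f ≫ codiag e φ) k i = f k (e i) ≫ φ i := by
  rw [Mat_.comp_apply, Finset.sum_eq_single (e i), codiag_self]
  · intro j _ hj; rw [codiag_ne _ _ _ _ hj.symm, comp_zero]
  · simp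

theorem id_eq_diag : 𝟙 M = diag (N := M) id (fun i => 𝟙 (M.X i)) := by
  classical
  ext i j
  by_cases h : i = j
  · subst h; rw [Mat_.id_apply_self]; exact (diag_self (N := M) id (fun i => 𝟙 (M.X i)) i).symm
  · rw [Mat_.id_apply_of_ne _ _ _ h]
    exact (diag_ne (N := M) id (fun i => 𝟙 (M.X i)) i j h).symm

theorem diag_diag (e : M.ι → N.ι) (φ : ∀ i, M.X i ⟶ N.X (e i))
    (e' : N.ι → K.ι) (φ' : ∀ i, N.X i ⟶ K.X (e' i)) :
    diag e φ ≫ diag e' φ' = diag (N := K) (fun i => e' (e i)) (fun i => φ i ≫ φ' (e i)) := by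
  ext i k
  rw [diag_comp]
  by_cases h : e' (e i) = k
  · subst h; rw [diag_self]; exact (diag_self (N := K) (fun i => e' (e i)) (fun i => φ i ≫ φ' (e i)) i).symm
  · rw [diag_ne _ _ _ _ h, comp_zero]
    exact (diag_ne (N := K) (fun i => e' (e i)) (fun i => φ i ≫ φ' (e i)) i k h).symm

/-- A bijection of the indices with isomorphisms of the entries gives an isomorphism. -/
def diagIso (e : M.ι ≃ N.ι) (φ : ∀ i, M.X i ≅ N.X (e i)) : M ≅ N where
  hom := diag e fun i => (φ i).hom
  inv := codiag e fun i => (φ i).inv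
  hom_inv_id := by
    ext i j
    rw [comp_codiag]
    by_cases h : i = j
    · subst h; rw [diag_self, Mat_.id_apply_self, Iso.hom_inv_id]
    · rw [diag_ne _ _ _ _ (fun h' => h (e.injective h')), zero_comp, Mat_.id_apply_of_ne _ _ _ h]
  inv_hom_id := by
    ext i j
    obtain ⟨j, rfl⟩ := e.surjective j
    rw [comp_diag]
    by_cases h : i = e j
    · subst h; rw [codiag_self, Mat_.id_apply_self, Iso.inv_hom_id]
    · rw [codiag_ne _ _ _ _ (fun h' => h h'.symm), zero_comp, Mat_.id_apply_of_ne _ _ _ h]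

theorem diagIso_hom (e : M.ι ≃ N.ι) (φ : ∀ i, M.X i ≅ N.X (e i)) :
    (diagIso e φ).hom = diag e fun i => (φ i).hom := rfl

instance [Linear ℂ C] (M N : Mat_ C) : Module ℂ (M ⟶ N) :=
  inferInstanceAs (Module ℂ (∀ i j, M.X i ⟶ N.X j))

theorem smul_apply [Linear ℂ C] (r : ℂ) (f : M ⟶ N) (i j) : (r • f) i j = r • f i j := rfl

instance [Linear ℂ C] : Linear ℂ (Mat_ C) where
  smul_comp _ _ _ r f g := by
    ext i j
    simp only [Mat_.comp_apply, smul_apply, Linear.smul_comp, Finset.smul_sum]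
  comp_smul _ _ _ f r g := by
    ext i j
    simp only [Mat_.comp_apply, smul_apply, Linear.comp_smul, Finset.smul_sum]

variable [MonoidalCategory C]

/-- The tensor product of two tuples is the tuple of all tensor products of their entries. -/
def tensObj (M N : Mat_ C) : Mat_ C := ⟨M.ι × N.ι, fun p => M.X p.1 ⊗ N.X p.2⟩

/-- The tensor product of two matrices, as a Kronecker product. -/
def tensHom {M M' N N' : Mat_ C} (f : M ⟶ M') (g : N ⟶ N') : tensObj M N ⟶ tensObj M' N' :=
  fun p q => f p.1 q.1 ⊗ₘ g p.2 q.2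

instance : MonoidalCategoryStruct (Mat_ C) where
  tensorObj := tensObj
  tensorUnit := ⟨Unit, fun _ => 𝟙_ C⟩
  tensorHom := tensHom
  whiskerLeft M _ _ g := tensHom (𝟙 M) g
  whiskerRight f N := tensHom f (𝟙 N)
  associator M N K :=
    diagIso (M := tensObj (tensObj M N) K) (N := tensObj M (tensObj N K))
      (Equiv.prodAssoc M.ι N.ι K.ι) fun p => α_ (M.X p.1.1) (N.X p.1.2) (K.X p.2)
  leftUnitor M :=
    diagIso (M := tensObj ⟨Unit, fun _ => 𝟙_ C⟩ M) (N := M)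
      (Equiv.punitProd M.ι) fun p => λ_ (M.X p.2)
  rightUnitor M :=
    diagIso (M := tensObj M ⟨Unit, fun _ => 𝟙_ C⟩) (N := M)
      (Equiv.prodPUnit M.ι) fun p => ρ_ (M.X p.1)

variable [MonoidalPreadditive C]

theorem tensHom_diag {M M' N N' : Mat_ C} (e : M.ι → M'.ι) (φ : ∀ i, M.X i ⟶ M'.X (e i))
    (e' : N.ι → N'.ι) (φ' : ∀ i, N.X i ⟶ N'.X (e' i)) :
    tensHom (diag e φ) (diag e' φ') =
      diag (M := tensObj M N) (N := tensObj M' N') (fun p => (e p.1, e' p.2))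
        (fun p => φ p.1 ⊗ₘ φ' p.2) := by
  ext ⟨i, j⟩ ⟨k, l⟩
  change diag e φ i k ⊗ₘ diag e' φ' j l = _
  by_cases h : e i = k
  · by_cases h' : e' j = l
    · subst h h'
      rw [diag_self, diag_self]
      exact (diag_self (M := tensObj M N) (N := tensObj M' N') (fun p => (e p.1, e' p.2))
        (fun p => φ p.1 ⊗ₘ φ' p.2) (i, j)).symm
    · rw [diag_ne e' _ _ _ h', MonoidalPreadditive.tensor_zero]
      exact (diag_ne (M := tensObj M N) (N := tensObj M' N') (fun p => (e p.1, e' p.2))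
        (fun p => φ p.1 ⊗ₘ φ' p.2) (i, j) (k, l) fun h2 => h' (congrArg Prod.snd h2)).symm
  · rw [diag_ne e _ _ _ h, MonoidalPreadditive.zero_tensor]
    exact (diag_ne (M := tensObj M N) (N := tensObj M' N') (fun p => (e p.1, e' p.2))
      (fun p => φ p.1 ⊗ₘ φ' p.2) (i, j) (k, l) fun h2 => h (congrArg Prod.fst h2)).symm

theorem tensHom_id (M N : Mat_ C) : tensHom (𝟙 M) (𝟙 N) = 𝟙 (tensObj M N) := by
  rw [id_eq_diag, id_eq_diag, tensHom_diag, id_eq_diag]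
  congr 1
  funext p
  exact id_tensorHom_id _ _

theorem tensHom_comp {M₁ M₂ M₃ N₁ N₂ N₃ : Mat_ C} (f : M₁ ⟶ M₂) (f' : N₁ ⟶ N₂) (g : M₂ ⟶ M₃)
    (g' : N₂ ⟶ N₃) :
    tensHom f f' ≫ tensHom g g' = tensHom (f ≫ g) (f' ≫ g') := by
  ext ⟨i, i'⟩ ⟨k, k'⟩
  change ∑ j : M₂.ι × N₂.ι, (f i j.1 ⊗ₘ f' i' j.2) ≫ (g j.1 k ⊗ₘ g' j.2 k') =
    (f ≫ g) i k ⊗ₘ (f' ≫ g') i' k'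
  rw [Mat_.comp_apply, Mat_.comp_apply, sum_tensor, Fintype.sum_prod_type]
  refine Finset.sum_congr rfl fun j _ => ?_
  rw [tensor_sum]
  refine Finset.sum_congr rfl fun j' _ => ?_
  exact MonoidalCategory.tensorHom_comp_tensorHom _ _ _ _

instance : MonoidalCategory (Mat_ C) := MonoidalCategory.ofTensorHom
  (id_tensorHom_id := tensHom_id)
  (id_tensorHom := by intros; rfl)
  (tensorHom_id := by intros; rfl)
  (tensorHom_comp_tensorHom := tensHom_comp)
  (associator_naturality := by
    intro X₁ X₂ X₃ Y₁ Y₂ Y₃ f₁ f₂ f₃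
    ext p q
    refine (comp_diag (M := tensObj (tensObj Y₁ Y₂) Y₃) (N := tensObj Y₁ (tensObj Y₂ Y₃))
      (Equiv.prodAssoc Y₁.ι Y₂.ι Y₃.ι) _ _ p ((q.1, q.2.1), q.2.2)).trans ?_
    refine Eq.trans ?_ (diag_comp (M := tensObj (tensObj X₁ X₂) X₃)
      (N := tensObj X₁ (tensObj X₂ X₃)) _ _ _ p q).symm
    exact MonoidalCategory.associator_naturality _ _ _)
  (leftUnitor_naturality := by
    intro X Y f
    ext p q
    refine (comp_diag (M := tensObj ⟨Unit, fun _ => 𝟙_ C⟩ Y) (N := Y)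
      (Equiv.punitProd Y.ι) _ _ p ((), q)).trans ?_
    refine Eq.trans ?_ (diag_comp (M := tensObj ⟨Unit, fun _ => 𝟙_ C⟩ X) (N := X)
      _ _ _ p q).symm
    change ((𝟙 (⟨Unit, fun _ => 𝟙_ C⟩ : Mat_ C) : _ ⟶ _) () () ⊗ₘ f p.2 q) ≫ _ = _
    rw [Mat_.id_apply_self]
    have key : (𝟙 (𝟙_ C) ⊗ₘ f p.2 q) ≫ (λ_ (Y.X q)).hom = (λ_ (X.X p.2)).hom ≫ f p.2 q := by
      rw [MonoidalCategory.id_tensorHom, MonoidalCategory.leftUnitor_naturality]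
    exact key)
  (rightUnitor_naturality := by
    intro X Y f
    ext p q
    refine (comp_diag (M := tensObj Y ⟨Unit, fun _ => 𝟙_ C⟩) (N := Y)
      (Equiv.prodPUnit Y.ι) _ _ p (q, ())).trans ?_
    refine Eq.trans ?_ (diag_comp (M := tensObj X ⟨Unit, fun _ => 𝟙_ C⟩) (N := X)
      _ _ _ p q).symm
    change (f p.1 q ⊗ₘ (𝟙 (⟨Unit, fun _ => 𝟙_ C⟩ : Mat_ C) : _ ⟶ _) () ()) ≫ _ = _
    rw [Mat_.id_apply_self]
    have key : (f p.1 q ⊗ₘ 𝟙 (𝟙_ C)) ≫ (ρ_ (Y.X q)).hom = (ρ_ (X.X p.1)).hom ≫ f p.1 q := by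
      rw [MonoidalCategory.tensorHom_id, MonoidalCategory.rightUnitor_naturality]
    exact key)
  (pentagon := by
    intro W X Y Z
    change tensHom (diag _ _) (𝟙 Z) ≫ diag _ _ ≫ tensHom (𝟙 W) (diag _ _) = diag _ _ ≫ diag _ _
    rw [id_eq_diag, id_eq_diag, tensHom_diag, tensHom_diag]
    erw [diag_diag, diag_diag, diag_diag]
    refine congrArg (diag (M := tensObj (tensObj (tensObj W X) Y) Z)
      (N := tensObj W (tensObj X (tensObj Y Z))) _) ?_
    funext p
    have := MonoidalCategory.pentagon (W.X p.1.1.1) (X.X p.1.1.2) (Y.X p.1.2) (Z.X p.2)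
    simp only [← MonoidalCategory.id_tensorHom, ← MonoidalCategory.tensorHom_id] at this
    exact this)
  (triangle := by
    intro X Y
    change diag _ _ ≫ tensHom (𝟙 X) (diag _ _) = tensHom (diag _ _) (𝟙 Y)
    rw [id_eq_diag, id_eq_diag, tensHom_diag, tensHom_diag]
    erw [diag_diag]
    refine congrArg (diag (M := tensObj (tensObj X ⟨Unit, fun _ => 𝟙_ C⟩) Y)
      (N := tensObj X Y) _) ?_
    funext p
    have := MonoidalCategory.triangle (X.X p.1.1) (Y.X p.2)
    simp only [← MonoidalCategory.id_tensorHom, ← MonoidalCategory.tensorHom_id] at this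
    exact this)

theorem whiskerLeft_mat {M N K : Mat_ C} (f : N ⟶ K) : M ◁ f = tensHom (𝟙 M) f := rfl

theorem whiskerRight_mat {M N K : Mat_ C} (f : N ⟶ K) : f ▷ M = tensHom f (𝟙 M) := rfl

theorem tensHom_add_left {M M' N N' : Mat_ C} (f f' : M ⟶ M') (g : N ⟶ N') :
    tensHom (f + f') g = tensHom f g + tensHom f' g := by
  ext p q; exact MonoidalPreadditive.add_tensor _ _ _

theorem tensHom_add_right {M M' N N' : Mat_ C} (f : M ⟶ M') (g g' : N ⟶ N') :
    tensHom f (g + g') = tensHom f g + tensHom f g' := by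
  ext p q; exact MonoidalPreadditive.tensor_add _ _ _

theorem tensHom_zero_left {M M' N N' : Mat_ C} (g : N ⟶ N') :
    tensHom (0 : M ⟶ M') g = 0 := by
  ext p q; exact MonoidalPreadditive.zero_tensor _

theorem tensHom_zero_right {M M' N N' : Mat_ C} (f : M ⟶ M') :
    tensHom f (0 : N ⟶ N') = 0 := by
  ext p q; exact MonoidalPreadditive.tensor_zero _

instance : MonoidalPreadditive (Mat_ C) where
  whiskerLeft_zero := tensHom_zero_right _
  zero_whiskerRight := tensHom_zero_left _
  whiskerLeft_add _ _ := tensHom_add_right _ _ _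
  add_whiskerRight _ _ := tensHom_add_left _ _ _

theorem smul_tensorHom' [Linear ℂ C] [MonoidalLinear ℂ C] {W X Y Z : C} (r : ℂ) (f : W ⟶ X)
    (g : Y ⟶ Z) : (r • f) ⊗ₘ g = r • (f ⊗ₘ g) := by
  simp [MonoidalCategory.tensorHom_def]

theorem tensorHom_smul' [Linear ℂ C] [MonoidalLinear ℂ C] {W X Y Z : C} (r : ℂ) (f : W ⟶ X)
    (g : Y ⟶ Z) : f ⊗ₘ (r • g) = r • (f ⊗ₘ g) := by
  simp [MonoidalCategory.tensorHom_def]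

instance [Linear ℂ C] [MonoidalLinear ℂ C] : MonoidalLinear ℂ (Mat_ C) where
  whiskerLeft_smul M _ _ r f := by
    rw [whiskerLeft_mat, whiskerLeft_mat]
    ext p q; exact tensorHom_smul' _ _ _
  smul_whiskerRight r _ _ f M := by
    rw [whiskerRight_mat, whiskerRight_mat]
    ext p q; exact smul_tensorHom' _ _ _

variable [SymmetricCategory C]

/-- The symmetry, which permutes the entries of the tuples. -/
def matBraid (M N : Mat_ C) : M ⊗ N ≅ N ⊗ M :=
  diagIso (M := tensObj M N) (N := tensObj N M) (Equiv.prodComm M.ι N.ι)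
    fun p => β_ (M.X p.1) (N.X p.2)

theorem matBraid_nat {M M' N N' : Mat_ C} (f : M ⟶ M') (g : N ⟶ N') :
    (f ⊗ₘ g) ≫ (matBraid M' N').hom = (matBraid M N).hom ≫ (g ⊗ₘ f) := by
  ext p q
  refine (comp_diag (M := tensObj M' N') (N := tensObj N' M')
      (Equiv.prodComm M'.ι N'.ι) _ _ p (q.2, q.1)).trans ?_
  refine Eq.trans ?_ (diag_comp (M := tensObj M N) (N := tensObj N M) _ _ _ p q).symm
  exact BraidedCategory.braiding_naturality _ _

theorem matBraid_symm (M N : Mat_ C) :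
    (matBraid M N).hom ≫ (matBraid N M).hom = 𝟙 (M ⊗ N) := by
  refine (diag_diag _ _ _ _).trans ?_
  refine Eq.trans ?_ (id_eq_diag (M := tensObj M N)).symm
  refine congrArg (diag (M := tensObj M N) (N := tensObj M N) _) ?_
  funext p
  exact SymmetricCategory.symmetry _ _

theorem matBraid_hexagon (X Y Z : Mat_ C) :
    (α_ X Y Z).hom ≫ (matBraid X (Y ⊗ Z)).hom ≫ (α_ Y Z X).hom =
      (matBraid X Y).hom ▷ Z ≫ (α_ Y X Z).hom ≫ Y ◁ (matBraid X Z).hom := by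
  change diag _ _ ≫ diag _ _ ≫ diag _ _ =
    tensHom (diag _ _) (𝟙 Z) ≫ diag _ _ ≫ tensHom (𝟙 Y) (diag _ _)
  rw [id_eq_diag, id_eq_diag, tensHom_diag, tensHom_diag]
  erw [diag_diag, diag_diag, diag_diag, diag_diag]
  refine congrArg (diag (M := tensObj (tensObj X Y) Z) (N := tensObj Y (tensObj Z X)) _) ?_
  funext p
  have := BraidedCategory.hexagon_forward (X.X p.1.1) (Y.X p.1.2) (Z.X p.2)
  simp only [← MonoidalCategory.id_tensorHom, ← MonoidalCategory.tensorHom_id] at this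
  exact this

/-- A symmetric braiding satisfies the reverse hexagon identity if it satisfies the forward one. -/
theorem hexagon_reverse_of {D : Type*} [Category D] [MonoidalCategory D]
    (b : ∀ X Y : D, X ⊗ Y ≅ Y ⊗ X) (hs : ∀ X Y, (b X Y).hom ≫ (b Y X).hom = 𝟙 _)
    (hf : ∀ X Y Z, (α_ X Y Z).hom ≫ (b X (Y ⊗ Z)).hom ≫ (α_ Y Z X).hom =
      (b X Y).hom ▷ Z ≫ (α_ Y X Z).hom ≫ Y ◁ (b X Z).hom) (X Y Z : D) :
    (α_ X Y Z).inv ≫ (b (X ⊗ Y) Z).hom ≫ (α_ Z X Y).inv =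
      X ◁ (b Y Z).hom ≫ (α_ X Z Y).inv ≫ (b X Z).hom ▷ Y := by
  have hi : ∀ X Y, b X Y = (b Y X).symm := fun X Y => by
    apply Iso.ext
    rw [Iso.symm_hom, ← cancel_mono (b Y X).hom, hs, Iso.inv_hom_id]
  have key : (α_ Z X Y ≪≫ b Z (X ⊗ Y) ≪≫ α_ X Y Z) =
      (whiskerRightIso (b Z X) Y ≪≫ α_ X Z Y ≪≫ whiskerLeftIso X (b Z Y)) := by
    apply Iso.ext
    simpa using hf Z X Y
  have key2 := congrArg Iso.inv key
  rw [hi (X ⊗ Y) Z, hi Y Z, hi X Z]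
  simpa using key2

end MatEnvelope
namespace MatEnvelope

variable {C : Type u} [Category.{v} C] [Preadditive C] [MonoidalCategory C]
  [MonoidalPreadditive C] [SymmetricCategory C]

instance : SymmetricCategory (Mat_ C) where
  braiding := matBraid
  braiding_naturality_right X _ _ f := matBraid_nat (𝟙 X) f
  braiding_naturality_left f Z := matBraid_nat f (𝟙 Z)
  hexagon_forward := matBraid_hexagon
  hexagon_reverse := hexagon_reverse_of (D := Mat_ C) matBraid matBraid_symm matBraid_hexagon
  symmetry := matBraid_symm

end MatEnvelope

/-! ### The symmetric monoidal structure on the idempotent completion -/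

namespace KaroubiEnvelope

open Idempotents

variable {D : Type u} [Category.{v} D] [Preadditive D]

instance [Linear ℂ D] (P Q : Karoubi D) : SMul ℂ (P ⟶ Q) where
  smul r f := ⟨r • f.f, by simp⟩

theorem smul_f [Linear ℂ D] {P Q : Karoubi D} (r : ℂ) (f : P ⟶ Q) : (r • f).f = r • f.f := rfl

instance [Linear ℂ D] (P Q : Karoubi D) : Module ℂ (P ⟶ Q) where
  one_smul f := by ext; simp [smul_f]
  mul_smul r s f := by ext; simp [smul_f, mul_smul]
  smul_zero r := by ext; exact smul_zero r
  smul_add r f g := by ext; exact smul_add r f.f g.f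
  add_smul r s f := by ext; exact add_smul r s f.f
  zero_smul f := by ext; exact zero_smul ℂ f.f

instance [Linear ℂ D] : Linear ℂ (Karoubi D) where
  smul_comp _ _ _ r f g := by ext; simp [smul_f]
  comp_smul _ _ _ f r g := by ext; simp [smul_f]

variable [MonoidalCategory D]

/-- `(X, p) ⊗ (Y, q) = (X ⊗ Y, p ⊗ q)` -/
def tensObj (P Q : Karoubi D) : Karoubi D where
  X := P.X ⊗ Q.X
  p := P.p ⊗ₘ Q.p
  idem := by rw [tensorHom_comp_tensorHom, P.idem, Q.idem]

/-- The tensor product of morphisms, computed in the original category. -/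
def tensHom {P P' Q Q' : Karoubi D} (f : P ⟶ P') (g : Q ⟶ Q') : tensObj P Q ⟶ tensObj P' Q' where
  f := f.f ⊗ₘ g.f
  comm := by
    simp only [tensObj, MonoidalCategory.tensorHom_comp_tensorHom, f.comm, g.comm]

/-- A morphism of the underlying objects that commutes with the idempotents. -/
def homOf {P Q : Karoubi D} (e : P.X ⟶ Q.X) (h : P.p ≫ e = e ≫ Q.p) : P ⟶ Q where
  f := P.p ≫ e
  comm := by rw [Category.assoc, ← h, P.idem_assoc, P.idem_assoc]

theorem homOf_comp {P Q R : Karoubi D} (e : P.X ⟶ Q.X) (h : P.p ≫ e = e ≫ Q.p)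
    (e' : Q.X ⟶ R.X) (h' : Q.p ≫ e' = e' ≫ R.p) :
    homOf e h ≫ homOf e' h' =
      homOf (e ≫ e') (by rw [← Category.assoc, h, Category.assoc, h', Category.assoc]) := by
  apply Karoubi.hom_ext
  change (P.p ≫ e) ≫ (Q.p ≫ e') = P.p ≫ e ≫ e'
  rw [Category.assoc, ← Category.assoc e, ← h, Category.assoc, P.idem_assoc]

theorem homOf_id (P : Karoubi D) : homOf (𝟙 P.X) (by simp) = 𝟙 P := by
  apply Karoubi.hom_ext
  simp [homOf]

theorem comp_homOf {P Q R : Karoubi D} (f : P ⟶ Q) (e : Q.X ⟶ R.X) (h : Q.p ≫ e = e ≫ R.p) :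
    (f ≫ homOf e h).f = f.f ≫ e := by
  change f.f ≫ Q.p ≫ e = _
  rw [Karoubi.comp_p_assoc]

theorem homOf_comp' {P Q R : Karoubi D} (f : Q ⟶ R) (e : P.X ⟶ Q.X) (h : P.p ≫ e = e ≫ Q.p) :
    (homOf e h ≫ f).f = e ≫ f.f := by
  change (P.p ≫ e) ≫ f.f = _
  rw [h, Category.assoc, Karoubi.p_comp]

theorem tensHom_homOf {P P' Q Q' : Karoubi D} (e : P.X ⟶ P'.X) (h : P.p ≫ e = e ≫ P'.p)
    (e' : Q.X ⟶ Q'.X) (h' : Q.p ≫ e' = e' ≫ Q'.p) :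
    tensHom (homOf e h) (homOf e' h') =
      homOf (P := tensObj P Q) (Q := tensObj P' Q') (e ⊗ₘ e') (by
        simp only [tensObj, MonoidalCategory.tensorHom_comp_tensorHom, h, h']) := by
  apply Karoubi.hom_ext
  simp only [tensObj, tensHom, homOf, MonoidalCategory.tensorHom_comp_tensorHom]

/-- An isomorphism of the underlying objects that commutes with the idempotents. -/
def isoOf {P Q : Karoubi D} (e : P.X ≅ Q.X) (h : P.p ≫ e.hom = e.hom ≫ Q.p) : P ≅ Q where
  hom := homOf e.hom h
  inv := homOf e.inv (by rw [Iso.comp_inv_eq, Category.assoc, h, e.inv_hom_id_assoc])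
  hom_inv_id := by
    rw [homOf_comp, ← homOf_id]
    congr 1
    exact e.hom_inv_id
  inv_hom_id := by
    rw [homOf_comp, ← homOf_id]
    congr 1
    exact e.inv_hom_id

/-- The unit object of the idempotent completion. -/
def unitObj : Karoubi D := ⟨𝟙_ D, 𝟙 _, Category.id_comp _⟩

theorem assoc_comm (P Q R : Karoubi D) : (tensObj (tensObj P Q) R).p ≫ (α_ P.X Q.X R.X).hom =
    (α_ P.X Q.X R.X).hom ≫ (tensObj P (tensObj Q R)).p :=
  MonoidalCategory.associator_naturality _ _ _

theorem left_comm (P : Karoubi D) :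
    (tensObj unitObj P).p ≫ (λ_ P.X).hom = (λ_ P.X).hom ≫ P.p := by
  simp only [tensObj, unitObj, MonoidalCategory.id_tensorHom,
    MonoidalCategory.leftUnitor_naturality]

theorem right_comm (P : Karoubi D) :
    (tensObj P unitObj).p ≫ (ρ_ P.X).hom = (ρ_ P.X).hom ≫ P.p := by
  simp only [tensObj, unitObj, MonoidalCategory.tensorHom_id,
    MonoidalCategory.rightUnitor_naturality]

instance : MonoidalCategoryStruct (Karoubi D) where
  tensorObj := tensObj
  tensorUnit := unitObj
  tensorHom := tensHom
  whiskerLeft P _ _ g := tensHom (𝟙 P) g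
  whiskerRight f Q := tensHom f (𝟙 Q)
  associator P Q R :=
    isoOf (P := tensObj (tensObj P Q) R) (Q := tensObj P (tensObj Q R)) (α_ P.X Q.X R.X)
      (assoc_comm P Q R)
  leftUnitor P := isoOf (P := tensObj unitObj P) (Q := P) (λ_ P.X) (left_comm P)
  rightUnitor P := isoOf (P := tensObj P unitObj) (Q := P) (ρ_ P.X) (right_comm P)

theorem tensHom_f {P P' Q Q' : Karoubi D} (f : P ⟶ P') (g : Q ⟶ Q') :
    (tensHom f g).f = f.f ⊗ₘ g.f := rfl

theorem homOf_congr {P Q : Karoubi D} {e e' : P.X ⟶ Q.X} (h : P.p ≫ e = e ≫ Q.p)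
    (h' : P.p ≫ e' = e' ≫ Q.p) (w : e = e') : homOf e h = homOf e' h' := by subst w; rfl

instance : MonoidalCategory (Karoubi D) := MonoidalCategory.ofTensorHom
  (id_tensorHom_id := by intros; rfl)
  (id_tensorHom := by intros; rfl)
  (tensorHom_id := by intros; rfl)
  (tensorHom_comp_tensorHom := by
    intros
    apply Karoubi.hom_ext
    exact MonoidalCategory.tensorHom_comp_tensorHom _ _ _ _)
  (associator_naturality := by
    intro X₁ X₂ X₃ Y₁ Y₂ Y₃ f₁ f₂ f₃
    apply Karoubi.hom_ext
    refine (comp_homOf _ _ (assoc_comm _ _ _)).trans (Eq.trans ?_ (homOf_comp' _ _ (assoc_comm _ _ _)).symm)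
    exact MonoidalCategory.associator_naturality _ _ _)
  (leftUnitor_naturality := by
    intro X Y f
    apply Karoubi.hom_ext
    refine (comp_homOf _ _ (left_comm _)).trans (Eq.trans ?_ (homOf_comp' _ _ (left_comm _)).symm)
    change (𝟙 (𝟙_ D) ⊗ₘ f.f) ≫ _ = _
    rw [MonoidalCategory.id_tensorHom, MonoidalCategory.leftUnitor_naturality]
    rfl)
  (rightUnitor_naturality := by
    intro X Y f
    apply Karoubi.hom_ext
    refine (comp_homOf _ _ (right_comm _)).trans (Eq.trans ?_ (homOf_comp' _ _ (right_comm _)).symm)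
    change (f.f ⊗ₘ 𝟙 (𝟙_ D)) ≫ _ = _
    rw [MonoidalCategory.tensorHom_id, MonoidalCategory.rightUnitor_naturality]
    rfl)
  (pentagon := by
    intro W X Y Z
    change tensHom (homOf _ (assoc_comm W X Y)) (𝟙 Z) ≫ homOf _ (assoc_comm W (tensObj X Y) Z) ≫
      tensHom (𝟙 W) (homOf _ (assoc_comm X Y Z)) =
      homOf _ (assoc_comm (tensObj W X) Y Z) ≫ homOf _ (assoc_comm W X (tensObj Y Z))
    rw [← homOf_id, ← homOf_id]
    erw [tensHom_homOf, tensHom_homOf]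
    erw [homOf_comp, homOf_comp, homOf_comp]
    apply homOf_congr
    have := MonoidalCategory.pentagon W.X X.X Y.X Z.X
    simp only [← MonoidalCategory.id_tensorHom, ← MonoidalCategory.tensorHom_id] at this
    exact this)
  (triangle := by
    intro X Y
    change homOf _ (assoc_comm X unitObj Y) ≫ tensHom (𝟙 X) (homOf _ (left_comm Y)) =
      tensHom (homOf _ (right_comm X)) (𝟙 Y)
    rw [← homOf_id, ← homOf_id]
    erw [tensHom_homOf, tensHom_homOf]
    erw [homOf_comp]
    apply homOf_congr
    have := MonoidalCategory.triangle X.X Y.X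
    simp only [← MonoidalCategory.id_tensorHom, ← MonoidalCategory.tensorHom_id] at this
    exact this)

instance [MonoidalPreadditive D] : MonoidalPreadditive (Karoubi D) where
  whiskerLeft_zero := by intros; apply Karoubi.hom_ext; exact MonoidalPreadditive.tensor_zero _
  zero_whiskerRight := by intros; apply Karoubi.hom_ext; exact MonoidalPreadditive.zero_tensor _
  whiskerLeft_add _ _ := by apply Karoubi.hom_ext; exact MonoidalPreadditive.tensor_add _ _ _
  add_whiskerRight _ _ := by apply Karoubi.hom_ext; exact MonoidalPreadditive.add_tensor _ _ _

instance [MonoidalPreadditive D] [Linear ℂ D] [MonoidalLinear ℂ D] :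
    MonoidalLinear ℂ (Karoubi D) where
  whiskerLeft_smul _ _ _ r f := by
    apply Karoubi.hom_ext; exact MatEnvelope.tensorHom_smul' _ _ _
  smul_whiskerRight r _ _ f _ := by
    apply Karoubi.hom_ext; exact MatEnvelope.smul_tensorHom' _ _ _

variable [SymmetricCategory D]

theorem braid_comm (P Q : Karoubi D) :
    (tensObj P Q).p ≫ (β_ P.X Q.X).hom = (β_ P.X Q.X).hom ≫ (tensObj Q P).p :=
  BraidedCategory.braiding_naturality _ _

/-- The symmetry of the idempotent completion. -/
def karBraid (P Q : Karoubi D) : P ⊗ Q ≅ Q ⊗ P :=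
  isoOf (P := tensObj P Q) (Q := tensObj Q P) (β_ P.X Q.X) (braid_comm P Q)

theorem karBraid_nat {P P' Q Q' : Karoubi D} (f : P ⟶ P') (g : Q ⟶ Q') :
    (f ⊗ₘ g) ≫ (karBraid P' Q').hom = (karBraid P Q).hom ≫ (g ⊗ₘ f) := by
  apply Karoubi.hom_ext
  refine (comp_homOf _ _ (braid_comm _ _)).trans
    (Eq.trans ?_ (homOf_comp' _ _ (braid_comm _ _)).symm)
  exact BraidedCategory.braiding_naturality _ _

theorem karBraid_symm (P Q : Karoubi D) :
    (karBraid P Q).hom ≫ (karBraid Q P).hom = 𝟙 (P ⊗ Q) := by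
  refine (homOf_comp _ (braid_comm P Q) _ (braid_comm Q P)).trans ?_
  refine Eq.trans ?_ (homOf_id (tensObj P Q))
  apply homOf_congr
  exact SymmetricCategory.symmetry _ _

theorem karBraid_hexagon (X Y Z : Karoubi D) :
    (α_ X Y Z).hom ≫ (karBraid X (Y ⊗ Z)).hom ≫ (α_ Y Z X).hom =
      (karBraid X Y).hom ▷ Z ≫ (α_ Y X Z).hom ≫ Y ◁ (karBraid X Z).hom := by
  change homOf _ (assoc_comm X Y Z) ≫ homOf _ (braid_comm X (tensObj Y Z)) ≫
      homOf _ (assoc_comm Y Z X) =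
    tensHom (homOf _ (braid_comm X Y)) (𝟙 Z) ≫ homOf _ (assoc_comm Y X Z) ≫
      tensHom (𝟙 Y) (homOf _ (braid_comm X Z))
  rw [← homOf_id, ← homOf_id]
  erw [tensHom_homOf, tensHom_homOf]
  erw [homOf_comp, homOf_comp, homOf_comp, homOf_comp]
  apply homOf_congr
  have := BraidedCategory.hexagon_forward X.X Y.X Z.X
  simp only [← MonoidalCategory.id_tensorHom, ← MonoidalCategory.tensorHom_id] at this
  exact this

instance : SymmetricCategory (Karoubi D) where
  braiding := karBraid
  braiding_naturality_right X _ _ f := karBraid_nat (𝟙 X) f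
  braiding_naturality_left f Z := karBraid_nat f (𝟙 Z)
  hexagon_forward := karBraid_hexagon
  hexagon_reverse := MatEnvelope.hexagon_reverse_of (D := Karoubi D) karBraid karBraid_symm
    karBraid_hexagon
  symmetry := karBraid_symm

end KaroubiEnvelope

/-! ### The Deligne category -/

/-- The Deligne category `Rep(H_t)`: the Karoubian envelope (the idempotent completion of the
additive envelope) of the category of even partition diagrams with loop parameter `t`. -/
abbrev RepH (t : ℂ) : Type 1 := Idempotents.Karoubi (Mat_ (RepZero t))

/-- The full embedding of the category of even partition diagrams. -/
def embed (t : ℂ) : RepZero t ⥤ RepH t := Mat_.embedding (RepZero t) ⋙ Idempotents.toKaroubi _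

/-! ### Linear symmetric monoidal functors -/

section Functors

variable (D : Type*) [Category* D] [Preadditive D] [Linear ℂ D] [MonoidalCategory D]
  [SymmetricCategory D]
variable (C : Type*) [Category* C] [Preadditive C] [Linear ℂ C] [MonoidalCategory C]
  [SymmetricCategory C]

/-- A `ℂ`-linear (strong) symmetric monoidal functor. -/
structure LinSymFunctor where
  /-- the underlying functor -/
  functor : D ⥤ C
  [braided : functor.Braided]
  [additive : functor.Additive]
  [linear : functor.Linear ℂ]

attribute [instance] LinSymFunctor.braided LinSymFunctor.additive LinSymFunctor.linear

variable {D C}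

/-- A monoidal natural isomorphism between `ℂ`-linear symmetric monoidal functors. -/
@[ext] structure LinSymFunctor.Hom (F G : LinSymFunctor D C) where
  /-- the underlying natural isomorphism -/
  iso : F.functor ≅ G.functor
  monoidal : NatTrans.IsMonoidal iso.hom

attribute [instance] LinSymFunctor.Hom.monoidal

/-- The category of `ℂ`-linear symmetric monoidal functors and monoidal natural isomorphisms. -/
instance : Category (LinSymFunctor D C) where
  Hom := LinSymFunctor.Hom
  id F := ⟨Iso.refl _, inferInstanceAs (NatTrans.IsMonoidal (𝟙 F.functor))⟩
  comp τ σ := ⟨τ.iso ≪≫ σ.iso, inferInstanceAs (NatTrans.IsMonoidal (τ.iso.hom ≫ σ.iso.hom))⟩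
  id_comp _ := LinSymFunctor.Hom.ext (Iso.refl_trans _)
  comp_id _ := LinSymFunctor.Hom.ext (Iso.trans_refl _)
  assoc _ _ _ := LinSymFunctor.Hom.ext (Iso.trans_assoc _ _ _)

end Functors

/-! ### Rigid self-dual objects with neutralizer -/

section Objects

/-- An object `A` with morphisms `α : A ⊗ A ⟶ A ⊗ A`, `β : A ⊗ A ⟶ 𝟙` and `δ : 𝟙 ⟶ A ⊗ A`. -/
structure NeutData (C : Type*) [Category* C] [MonoidalCategory C] where
  /-- the object -/
  A : C
  /-- the neutralizer -/
  α : A ⊗ A ⟶ A ⊗ A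
  /-- the evaluation -/
  β : A ⊗ A ⟶ 𝟙_ C
  /-- the coevaluation -/
  δ : 𝟙_ C ⟶ A ⊗ A

variable {C : Type*} [Category* C] [MonoidalCategory C]

/-- An isomorphism of the objects that respects the structure morphisms. -/
@[ext] structure NeutData.Hom (X Y : NeutData C) where
  /-- the underlying isomorphism -/
  iso : X.A ≅ Y.A
  comm_α : X.α ≫ (iso.hom ⊗ₘ iso.hom) = (iso.hom ⊗ₘ iso.hom) ≫ Y.α
  comm_β : (iso.hom ⊗ₘ iso.hom) ≫ Y.β = X.β
  comm_δ : X.δ ≫ (iso.hom ⊗ₘ iso.hom) = Y.δ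

instance : Category (NeutData C) where
  Hom := NeutData.Hom
  id X := ⟨Iso.refl _, by simp, by simp, by simp⟩
  comp f g :=
    { iso := f.iso ≪≫ g.iso
      comm_α := by
        rw [Iso.trans_hom, ← tensorHom_comp_tensorHom, reassoc_of% f.comm_α, g.comm_α,
          Category.assoc]
      comm_β := by
        rw [Iso.trans_hom, ← tensorHom_comp_tensorHom, Category.assoc, g.comm_β, f.comm_β]
      comm_δ := by
        rw [Iso.trans_hom, ← tensorHom_comp_tensorHom, reassoc_of% f.comm_δ, g.comm_δ] }
  id_comp _ := NeutData.Hom.ext (Iso.refl_trans _)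
  comp_id _ := NeutData.Hom.ext (Iso.trans_refl _)
  assoc _ _ _ := NeutData.Hom.ext (Iso.trans_assoc _ _ _)

/-- The data `(A, α, β, δ)` is a `t`-dimensional rigid self-dual object with neutralizer.
The associators and unitors that are implicit in a strict category are inserted. -/
structure IsRigidNeut [Preadditive C] [Linear ℂ C] [SymmetricCategory C] (t : ℂ)
    (X : NeutData C) : Prop where
  /-- `A` is rigid and self-dual: `(id ⊗ β) ∘ (δ ⊗ id) = id`. -/
  zigzag_left : X.δ ▷ X.A ≫ (α_ _ _ _).hom ≫ X.A ◁ X.β = (λ_ X.A).hom ≫ (ρ_ X.A).inv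
  /-- `A` is rigid and self-dual: `(β ⊗ id) ∘ (id ⊗ δ) = id`. -/
  zigzag_right : X.A ◁ X.δ ≫ (α_ _ _ _).inv ≫ X.β ▷ X.A = (ρ_ X.A).hom ≫ (λ_ X.A).inv
  /-- `A` has dimension `t`. -/
  dim : X.δ ≫ X.β = t • 𝟙 (𝟙_ C)
  /-- the neutralizer is idempotent -/
  idem : X.α ≫ X.α = X.α
  /-- `(id ⊗ α) ∘ (α ⊗ id) = (α ⊗ id) ∘ (id ⊗ α)` -/
  exchange : X.α ▷ X.A ≫ (α_ _ _ _).hom ≫ X.A ◁ X.α ≫ (α_ _ _ _).inv =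
    (α_ _ _ _).hom ≫ X.A ◁ X.α ≫ (α_ _ _ _).inv ≫ X.α ▷ X.A
  /-- `α ∘ δ = δ` -/
  coev_neut : X.δ ≫ X.α = X.δ
  /-- `β ∘ α = β` -/
  neut_ev : X.α ≫ X.β = X.β
  /-- `(id ⊗ α) ∘ (δ ⊗ id) = (α ⊗ id) ∘ (id ⊗ δ)` -/
  coev_slide : (λ_ X.A).inv ≫ X.δ ▷ X.A ≫ (α_ _ _ _).hom ≫ X.A ◁ X.α =
    (ρ_ X.A).inv ≫ X.A ◁ X.δ ≫ (α_ _ _ _).inv ≫ X.α ▷ X.A ≫ (α_ _ _ _).hom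
  /-- `(β ⊗ id) ∘ (id ⊗ α) = (id ⊗ β) ∘ (α ⊗ id)` -/
  ev_slide : X.A ◁ X.α ≫ (α_ _ _ _).inv ≫ X.β ▷ X.A ≫ (λ_ X.A).hom =
    (α_ _ _ _).inv ≫ X.α ▷ X.A ≫ (α_ _ _ _).hom ≫ X.A ◁ X.β ≫ (ρ_ X.A).hom
  /-- `β ∘ γ = β` for the symmetry `γ` of `A ⊗ A` -/
  swap_ev : (β_ X.A X.A).hom ≫ X.β = X.β
  /-- `γ ∘ δ = δ` -/
  coev_swap : X.δ ≫ (β_ X.A X.A).hom = X.δ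
  /-- `α ∘ γ = α` -/
  swap_neut : (β_ X.A X.A).hom ≫ X.α = X.α
  /-- `γ ∘ α = α` -/
  neut_swap : X.α ≫ (β_ X.A X.A).hom = X.α

variable (C) in
/-- The groupoid of `t`-dimensional rigid self-dual objects with neutralizer in `C` and their
isomorphisms. -/
abbrev RigNeut [Preadditive C] [Linear ℂ C] [SymmetricCategory C] (t : ℂ) :=
  ObjectProperty.FullSubcategory (fun X : NeutData C => IsRigidNeut t X)

end Objects

/-! ### The generating object and its images -/

section Generator

open Functor.LaxMonoidal Functor.OplaxMonoidal

/-- The structure morphisms on the image of an object under a monoidal functor. -/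
def mapNeutData {D C : Type*} [Category* D] [MonoidalCategory D] [Category* C]
    [MonoidalCategory C] (F : D ⥤ C) [F.Monoidal] (X : NeutData D) : NeutData C where
  A := F.obj X.A
  α := μ F X.A X.A ≫ F.map X.α ≫ δ F X.A X.A
  β := μ F X.A X.A ≫ F.map X.β ≫ η F
  δ := ε F ≫ F.map X.δ ≫ δ F X.A X.A

/-- The object `[1]` of the category of even partition diagrams, with the four-legged block
`{1, 2, 1', 2'}`, the cap `{1, 2}` and the cup `{1', 2'}`. -/
def genZero (t : ℂ) : NeutData (RepZero t) where
  A := ⟨1⟩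
  α := RepZero.ofPart (EvenPartition.block 2 2 (by decide))
  β := RepZero.ofPart (EvenPartition.block 2 0 (by decide))
  δ := RepZero.ofPart (EvenPartition.block 0 2 (by decide))

/-- A morphism of the underlying objects, if the idempotents are identities. -/
def embedHom {D : Type*} [Category* D] {P Q : Idempotents.Karoubi D} (f : P.X ⟶ Q.X)
    (hP : P.p = 𝟙 _) (hQ : Q.p = 𝟙 _) : P ⟶ Q :=
  ⟨f, by rw [hP, hQ, Category.id_comp, Category.comp_id]⟩

/-- The image of the object `[1]` in `Rep(H_t)`, with its structure morphisms. -/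
def gen (t : ℂ) : NeutData (RepH t) where
  A := (embed t).obj ⟨1⟩
  α := embedHom (fun _ _ => (genZero t).α) (MatEnvelope.tensHom_id _ _)
    (MatEnvelope.tensHom_id _ _)
  β := embedHom (fun _ _ => (genZero t).β) (MatEnvelope.tensHom_id _ _) rfl
  δ := embedHom (fun _ _ => (genZero t).δ) rfl (MatEnvelope.tensHom_id _ _)

theorem δ_tensor {D C : Type*} [Category* D] [MonoidalCategory D] [Category* C]
    [MonoidalCategory C] {F G : D ⥤ C} [F.Monoidal] [G.Monoidal] (τ : F ⟶ G)
    [NatTrans.IsMonoidal τ] (X Y : D) :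
    δ F X Y ≫ (τ.app X ⊗ₘ τ.app Y) = τ.app (X ⊗ Y) ≫ δ G X Y := by
  rw [← cancel_epi (μ F X Y), Functor.Monoidal.μ_δ_assoc, NatTrans.IsMonoidal.tensor_assoc,
    Functor.Monoidal.μ_δ, Category.comp_id]

theorem unit_η {D C : Type*} [Category* D] [MonoidalCategory D] [Category* C]
    [MonoidalCategory C] {F G : D ⥤ C} [F.Monoidal] [G.Monoidal] (τ : F ⟶ G)
    [NatTrans.IsMonoidal τ] : τ.app (𝟙_ D) ≫ η G = η F := by
  rw [← cancel_epi (ε F), NatTrans.IsMonoidal.unit_assoc, Functor.Monoidal.ε_η,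
    Functor.Monoidal.ε_η]

/-- Evaluation of functors on an object with structure morphisms, `F ↦ F(X)` and `τ ↦ τ_X`. -/
def evalAt {D : Type*} [Category* D] [Preadditive D] [Linear ℂ D] [MonoidalCategory D]
    [SymmetricCategory D] (C : Type*) [Category* C] [Preadditive C] [Linear ℂ C]
    [MonoidalCategory C] [SymmetricCategory C] (X : NeutData D) :
    LinSymFunctor D C ⥤ NeutData C where
  obj F := mapNeutData F.functor X
  map {F G} τ :=
    { iso := τ.iso.app X.A
      comm_α := by
        have h := τ.iso.hom.naturality X.α
        simp only [mapNeutData, Iso.app_hom, Category.assoc]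
        rw [δ_tensor, reassoc_of% h, NatTrans.IsMonoidal.tensor_assoc]
      comm_β := by
        have h := τ.iso.hom.naturality X.β
        simp only [mapNeutData, Iso.app_hom]
        rw [← NatTrans.IsMonoidal.tensor_assoc, ← reassoc_of% h, unit_η]
      comm_δ := by
        have h := τ.iso.hom.naturality X.δ
        simp only [mapNeutData, Iso.app_hom, Category.assoc]
        rw [δ_tensor, reassoc_of% h, NatTrans.IsMonoidal.unit_assoc] }
  map_id _ := rfl
  map_comp _ _ := rfl

end Generator

end HypDeligne

end

/-! The equivalence is evaluation at the generating object, shown to be faithful, full and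
essentially surjective. Throughout, a partition is remembered by its incidence matrix on labellings
of the vertices by two colours. Stacking diagrams multiplies these matrices, with a factor `2` for
every loop, and `2 ^ a` times an incidence matrix determines both `a` and the partition. The
two-colour matrices therefore do the bookkeeping for every `t`: powers of `t` are recorded as powers
of `2`.

Essential surjectivity needs a functor on diagrams for every object `A` with neutralizer. The tensor
powers of `A`, indexed by finite sets, carry permutations and the morphisms `α`, `β`, `δ`. Each word
in these comes with an operator on functions on labellings (the relation `K`). The crucial statement
is `Rel.K_unique`: in the target category, words with equal operators are equal. Bending the
outgoing strands down by `β` is reversible by the zigzag relation (`Rel.cancel_evV`), so it is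
enough to compare words that end in the unit. These have a normal form: a power of `t`, times the
product of neutralizers that merges the blocks of an even partition, followed by evaluations along a
pairing of the points inside the blocks. A pairing exists because the blocks are even. Neutralizers
are commuting idempotents, and merging `i` with `j` and `j` with `k` merges all three
(`Rel.al_comm`, `Rel.al_trans`). Hence the product depends only on the partition, it absorbs
permutations inside the blocks, and the choice of pairing is irrelevant (`Rel.nf_unique`). Normal
forms are stable under all generators; the serious case is the coevaluation (`Rel.nf_cup`), which
either leaves a block with fewer points or closes a loop.

Conversely every even partition is the operator of some word (`K.exists_of_isEven`). Choosing such
words defines the functor on diagrams; its compatibility with composition, tensor products and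
permutations consists of instances of `Rel.K_unique`. It extends to the Karoubian envelope by
splitting matrices of idempotents (`Realization`).

The same words, read in the diagram category itself, show that permutations and the three blocks
generate all partitions (`IsTensorClosed.ofPart`). Faithfulness holds because an additive functor on
the envelope is determined by the objects `[n]`, and a monoidal transformation on `[n]` by its
component at `[1]`. For fullness, an isomorphism at `[1]` is extended to tensor powers; it is
natural for the generators, hence for all diagrams, and then extends to direct sums and summands.
That evaluation has rigid objects with neutralizer as values follows from a finite check for `[1]`,
transported along symmetric monoidal functors. -/

noncomputable section

set_option linter.unusedSectionVars false

namespace HypDeligne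

section

/-! ### Tensor powers of an object -/

section TensorPower

variable {C : Type u} [Category.{v} C] [MonoidalCategory C] [SymmetricCategory C]

/-- The tensor powers of an object. -/
@[reducible] def tpow (A : C) : ℕ → C
  | 0 => 𝟙_ C
  | n + 1 => tpow A n ⊗ A

variable (A : C)

/-- The symmetry of the last two factors. -/
def swapLast (X : C) : (X ⊗ A) ⊗ A ⟶ (X ⊗ A) ⊗ A :=
  (α_ X A A).hom ≫ X ◁ (β_ A A).hom ≫ (α_ X A A).inv

variable {A}

theorem swapLast_swapLast (X : C) : swapLast A X ≫ swapLast A X = 𝟙 _ := by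
  simp [swapLast, ← MonoidalCategory.whiskerLeft_comp_assoc]

theorem swapLast_naturality {X Y : C} (f : X ⟶ Y) :
    (f ▷ A) ▷ A ≫ swapLast A Y = swapLast A X ≫ (f ▷ A) ▷ A := by
  simp only [swapLast, associator_naturality_left_assoc, Category.assoc,
    ← whisker_exchange_assoc, associator_inv_naturality_left]

/-- The Yang–Baxter equation for three copies of `A`, whiskered by `X`; the remaining difference is
coherence. -/
theorem swapLast_braid (X : C) :
    swapLast A (X ⊗ A) ≫ swapLast A X ▷ A ≫ swapLast A (X ⊗ A) =
      swapLast A X ▷ A ≫ swapLast A (X ⊗ A) ≫ swapLast A X ▷ A := by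
  have h := BraidedCategory.yang_baxter' A A A
  dsimp only [swapLast] at h ⊢
  calc _ = (α_ (X ⊗ A) A A).hom ≫ (α_ X A (A ⊗ A)).hom ≫
      X ◁ ((α_ _ _ _).inv ≫ (𝟙 _ ⊗≫ (A ◁ (β_ A A).hom ⊗≫ (β_ A A).hom ▷ A ⊗≫ A ◁ (β_ A A).hom)
        ⊗≫ 𝟙 _)) ≫ (α_ X (A ⊗ A) A).inv ≫ (α_ X A A).inv ▷ A := by monoidal
    _ = _ := by rw [← h]; monoidal

/-- The insertion of the last factor at the position `j`. -/
def insertAt : (n : ℕ) → (j : Fin (n + 1)) → (tpow A n ⊗ A ⟶ tpow A (n + 1))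
  | 0, _ => 𝟙 _
  | n + 1, j => Fin.lastCases (motive := fun _ => tpow A (n + 1) ⊗ A ⟶ tpow A (n + 2)) (𝟙 _)
      (fun j => swapLast A (tpow A n) ≫ insertAt n j ▷ A) j

theorem insertAt_last (n : ℕ) : insertAt (A := A) n (Fin.last n) = 𝟙 _ := by
  cases n
  · rfl
  · exact Fin.lastCases_last

theorem insertAt_castSucc (n : ℕ) (j : Fin (n + 1)) :
    insertAt (A := A) (n + 1) j.castSucc = swapLast A (tpow A n) ≫ insertAt n j ▷ A :=
  Fin.lastCases_castSucc _

/-- The last two factors can be sent to the final positions `j` and `k` in either order; `j'` and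
`k'` are these positions as seen while the other factor is still missing. If one target is the last
position, an insertion is trivial. Otherwise one factor is peeled off and the Yang–Baxter equation
is applied. This one relation replaces a presentation of the symmetric groups. -/
theorem insertAt_insertAt (n : ℕ) (j k : Fin (n + 2)) (j' k' : Fin (n + 1))
    (hj : k.succAbove j' = j) (hk : j.succAbove k' = k) :
    swapLast A (tpow A n) ≫ insertAt n j' ▷ A ≫ insertAt (n + 1) k =
      insertAt n k' ▷ A ≫ insertAt (n + 1) j := by
  have hjk : j ≠ k := by rintro rfl; exact Fin.succAbove_ne _ _ hj
  induction n with
  | zero =>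
    induction k using Fin.lastCases with
    | last =>
      rw [Fin.succAbove_last_apply] at hj
      subst hj
      rw [Fin.succAbove_eq_last_iff (Fin.castSucc_lt_last _).ne] at hk
      subst hk
      simp only [insertAt_last, insertAt_castSucc, id_whiskerRight]
      rw [Category.comp_id, Category.id_comp]
    | cast k =>
      induction j using Fin.lastCases with
      | last =>
        rw [Fin.succAbove_last_apply] at hk
        rw [Fin.succAbove_eq_last_iff (Fin.castSucc_lt_last _).ne] at hj
        obtain rfl : k' = k := Fin.castSucc_injective _ hk
        subst hj
        simp only [insertAt_last, insertAt_castSucc, id_whiskerRight]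
        rw [Category.id_comp, Category.comp_id]
        rw [reassoc_of% (swapLast_swapLast (A := A))]
      | cast j => exact absurd (congrArg Fin.castSucc (Subsingleton.elim j k)) hjk
  | succ n ih =>
    induction k using Fin.lastCases with
    | last =>
      rw [Fin.succAbove_last_apply] at hj
      subst hj
      rw [Fin.succAbove_eq_last_iff (Fin.castSucc_lt_last _).ne] at hk
      subst hk
      simp only [insertAt_last, insertAt_castSucc, id_whiskerRight]
      rw [Category.comp_id, Category.id_comp]
    | cast k =>
      induction j using Fin.lastCases with
      | last =>
        rw [Fin.succAbove_last_apply] at hk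
        rw [Fin.succAbove_eq_last_iff (Fin.castSucc_lt_last _).ne] at hj
        obtain rfl : k' = k := Fin.castSucc_injective _ hk
        subst hj
        simp only [insertAt_last, insertAt_castSucc, id_whiskerRight]
        rw [Category.id_comp, Category.comp_id]
        rw [reassoc_of% (swapLast_swapLast (A := A))]
      | cast j => 
        induction j' using Fin.lastCases with
        | last => exact absurd hj.symm (by
            rw [Fin.succAbove_ne_last_last (Fin.castSucc_lt_last _).ne]
            exact (Fin.castSucc_lt_last _).ne)
        | cast j' =>
        induction k' using Fin.lastCases with
        | last => exact absurd hk.symm (by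
            rw [Fin.succAbove_ne_last_last (Fin.castSucc_lt_last _).ne]
            exact (Fin.castSucc_lt_last _).ne)
        | cast k' =>
          rw [Fin.castSucc_succAbove_castSucc] at hj hk
          have := ih j k j' k' (Fin.castSucc_injective _ hj) (Fin.castSucc_injective _ hk)
            (fun h => hjk (congrArg Fin.castSucc h))
          have h2 := congrArg (fun f => f ▷ A) this
          simp only [insertAt_castSucc, comp_whiskerRight, Category.assoc] at h2 ⊢
          rw [reassoc_of% (swapLast_naturality (A := A) (insertAt n j')),
            reassoc_of% (swapLast_braid (A := A)), h2,
            reassoc_of% (swapLast_naturality (A := A) (insertAt n k'))]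

/-- The bijection that is left if a point and its image are removed. -/
def removeAt {m n : ℕ} (e : Fin (m + 1) ≃ Fin (n + 1)) (i : Fin (m + 1)) : Fin m ≃ Fin n :=
  (finSuccAboveEquiv i).trans ((e.subtypeEquiv (p := fun x => x ≠ i) (q := fun x => x ≠ e i)
    (by simp)).trans (finSuccAboveEquiv (e i)).symm)

theorem removeAt_spec {m n : ℕ} (e : Fin (m + 1) ≃ Fin (n + 1)) (i : Fin (m + 1)) (k : Fin m) :
    (e i).succAbove (removeAt e i k) = e (i.succAbove k) := by
  have := congrArg Subtype.val ((finSuccAboveEquiv (e i)).apply_symm_apply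
    ((e.subtypeEquiv (p := fun x => x ≠ i) (q := fun x => x ≠ e i)
    (by simp)) (finSuccAboveEquiv i k)))
  exact this

theorem removeAt_unique {m n : ℕ} (e : Fin (m + 1) ≃ Fin (n + 1)) (i : Fin (m + 1))
    (e' : Fin m ≃ Fin n) (h : ∀ k, (e i).succAbove (e' k) = e (i.succAbove k)) :
    removeAt e i = e' := by
  ext k
  exact congrArg Fin.val (Fin.succAbove_right_injective ((removeAt_spec e i k).trans (h k).symm))

/-- The cosimplicial identity for skipping two points, in a form that does not ask which of them is
smaller. -/
theorem succAbove_comm {n : ℕ} {j k : Fin (n + 2)} {j' k' : Fin (n + 1)}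
    (hj : k.succAbove j' = j) (hk : j.succAbove k' = k) (x : Fin n) :
    j.succAbove (k'.succAbove x) = k.succAbove (j'.succAbove x) := by
  have hj2 := congrArg Fin.val hj
  have hk2 := congrArg Fin.val hk
  ext
  simp only [Fin.succAbove, Fin.lt_def, Fin.val_castSucc, apply_ite Fin.val, Fin.val_succ]
    at hj2 hk2 ⊢
  split_ifs at * <;> omega

theorem removeAt_removeAt {m n : ℕ} (e : Fin (m + 2) ≃ Fin (n + 2)) (i : Fin (m + 1)) :
    removeAt (removeAt e i.castSucc) (Fin.last m) = removeAt (removeAt e (Fin.last _)) i := by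
  refine removeAt_unique _ _ _ fun x => ?_
  have h0 : i.castSucc.succAbove (Fin.last m) = Fin.last (m + 1) :=
    Fin.succAbove_ne_last_last (Fin.castSucc_lt_last _).ne
  have h1 := removeAt_spec e i.castSucc (Fin.last m)
  have h2 := removeAt_spec e (Fin.last _) i
  rw [h0] at h1
  rw [Fin.succAbove_last] at h2
  apply Fin.succAbove_right_injective (p := e i.castSucc)
  rw [succAbove_comm h2 h1, removeAt_spec, removeAt_spec, removeAt_spec, Fin.succAbove_last,
    Fin.succAbove_last, Fin.castSucc_succAbove_castSucc]

/-- The action of bijections on tensor powers. -/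
def permPow : {m n : ℕ} → (e : Fin m ≃ Fin n) → (tpow A m ⟶ tpow A n)
  | 0, 0, _ => 𝟙 _
  | 0, _ + 1, e => (e.symm 0).elim0
  | _ + 1, 0, e => (e 0).elim0
  | m + 1, n + 1, e => permPow (removeAt e (Fin.last m)) ▷ A ≫ insertAt n (e (Fin.last m))

theorem permPow_succ {m n : ℕ} (e : Fin (m + 1) ≃ Fin (n + 1)) :
    permPow (A := A) e = permPow (removeAt e (Fin.last m)) ▷ A ≫ insertAt n (e (Fin.last m)) := by
  rw [permPow]

/-- The recursion that defines `permPow` singles out the last point; here it holds for an arbitrary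
point. Functoriality needs this, since a first bijection moves the last point anywhere before a
second one acts. -/
theorem insertAt_permPow {m n : ℕ} (e : Fin (m + 1) ≃ Fin (n + 1)) (i : Fin (m + 1)) :
    insertAt m i ≫ permPow (A := A) e = permPow (removeAt e i) ▷ A ≫ insertAt n (e i) := by
  induction m generalizing n with
  | zero =>
    obtain rfl : i = Fin.last 0 := Subsingleton.elim (α := Fin 1) _ _
    rw [insertAt_last, Category.id_comp, permPow_succ]
  | succ m ih =>
    induction i using Fin.lastCases with
    | last => rw [insertAt_last, Category.id_comp, permPow_succ]
    | cast i =>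
      obtain _ | n := n
      · exact absurd (e.injective (Subsingleton.elim (α := Fin 1) (e 0) (e 1))) (by simp)
      have h0 : i.castSucc.succAbove (Fin.last m) = Fin.last (m + 1) :=
        Fin.succAbove_ne_last_last (Fin.castSucc_lt_last _).ne
      have h1 := removeAt_spec e i.castSucc (Fin.last m)
      have h2 := removeAt_spec e (Fin.last _) i
      rw [h0] at h1
      rw [Fin.succAbove_last] at h2
      have h3 := congrArg (fun f => f ▷ A) (ih (removeAt e (Fin.last _)) i)
      simp only [comp_whiskerRight] at h3
      rw [permPow_succ e, permPow_succ (removeAt e i.castSucc), insertAt_castSucc, Category.assoc,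
        reassoc_of% h3, comp_whiskerRight, Category.assoc, ← insertAt_insertAt n _ _ _ _ h2 h1,
        removeAt_removeAt, reassoc_of% (swapLast_naturality (A := A))]

theorem removeAt_refl {m : ℕ} (i : Fin (m + 1)) : removeAt (Equiv.refl _) i = Equiv.refl _ :=
  removeAt_unique _ _ _ fun _ => rfl

theorem removeAt_trans {m n k : ℕ} (e : Fin (m + 1) ≃ Fin (n + 1)) (e' : Fin (n + 1) ≃ Fin (k + 1))
    (i : Fin (m + 1)) : removeAt (e.trans e') i = (removeAt e i).trans (removeAt e' (e i)) := by
  refine removeAt_unique _ _ _ fun j => ?_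
  simp only [Equiv.trans_apply, removeAt_spec]

theorem permPow_refl (m : ℕ) : permPow (A := A) (Equiv.refl (Fin m)) = 𝟙 _ := by
  induction m with
  | zero => rw [permPow]
  | succ m ih => rw [permPow_succ, removeAt_refl, ih, Equiv.refl_apply, insertAt_last]; simp

theorem permPow_trans {m n k : ℕ} (e : Fin m ≃ Fin n) (e' : Fin n ≃ Fin k) :
    permPow (A := A) (e.trans e') = permPow e ≫ permPow e' := by
  obtain rfl : m = n := by simpa using Fintype.card_congr e
  obtain rfl : m = k := by simpa using Fintype.card_congr e'
  induction m with
  | zero => simp [permPow]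
  | succ m ih =>
    rw [permPow_succ, removeAt_trans, ih, permPow_succ e, Category.assoc, insertAt_permPow]
    simp

end TensorPower

end

/-! ### Concatenation of tensor powers, its compatibility with permutations and with the symmetry.
-/

section

section TensorPower

variable {C : Type u} [Category.{v} C] [MonoidalCategory C] [SymmetricCategory C] (A : C)

open EvenPartition

/-- The concatenation of tensor powers. -/
def mulPow (m : ℕ) : (n : ℕ) → (tpow A m ⊗ tpow A n ≅ tpow A (m + n))
  | 0 => ρ_ _
  | n + 1 => (α_ _ _ _).symm ≪≫ whiskerRightIso (mulPow m n) A

variable {A}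

theorem mulPow_succ_hom (m n : ℕ) :
    (mulPow A m (n + 1)).hom = (α_ _ _ _).inv ≫ (mulPow A m n).hom ▷ A := by
  rw [mulPow]; rfl

theorem mulPow_zero_hom (m : ℕ) : (mulPow A m 0).hom = (ρ_ _).hom := by
  rw [mulPow]

theorem whiskerLeft_swapLast (X Y : C) :
    X ◁ swapLast A Y ≫ (α_ X (Y ⊗ A) A).inv ≫ (α_ X Y A).inv ▷ A =
      (α_ X (Y ⊗ A) A).inv ≫ (α_ X Y A).inv ▷ A ≫ swapLast A (X ⊗ Y) := by
  simp only [swapLast]; monoidal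

/-- An insertion into the right block moves the last factor only past factors of that block, so the
left block is a spectator. -/
theorem insertAt_mulPow (m n : ℕ) (j : Fin (n + 1)) :
    tpow A m ◁ insertAt n j ≫ (mulPow A m (n + 1)).hom =
      (α_ _ _ _).inv ≫ (mulPow A m n).hom ▷ A ≫ insertAt (m + n) (Fin.natAdd m j) := by
  induction n with
  | zero =>
    obtain rfl : j = Fin.last 0 := Subsingleton.elim (α := Fin 1) _ _
    rw [Fin.natAdd_last, insertAt_last, insertAt_last, mulPow_succ_hom]
    simp
  | succ n ih =>
    induction j using Fin.lastCases with
    | last =>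
      rw [Fin.natAdd_last, insertAt_last, insertAt_last, mulPow_succ_hom]
      simp
    | cast j =>
      have h1 : insertAt (A := A) (m + (n + 1)) (Fin.natAdd m j.castSucc) =
          swapLast A (tpow A (m + n)) ≫ insertAt (m + n) (Fin.natAdd m j) ▷ A :=
        insertAt_castSucc (A := A) (m + n) (Fin.natAdd m j)
      have h2 := congrArg (fun f => f ▷ A) (ih j)
      simp only [comp_whiskerRight] at h2
      rw [h1, insertAt_castSucc, mulPow_succ_hom]
      rw [MonoidalCategory.whiskerLeft_comp, Category.assoc]
      rw [MonoidalCategory.associator_inv_naturality_middle_assoc, h2]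
      rw [reassoc_of% (whiskerLeft_swapLast (A := A)), mulPow_succ_hom]
      rw [comp_whiskerRight, Category.assoc, reassoc_of% (swapLast_naturality (A := A))]

theorem sumEquiv_last {m n m' n' : ℕ} (e : Fin m ≃ Fin m') (e' : Fin (n + 1) ≃ Fin (n' + 1)) :
    sumEquiv e e' (Fin.last (m + n)) = Fin.natAdd m' (e' (Fin.last n)) := by
  rw [← Fin.natAdd_last]; exact sumEquiv_natAdd e e' (Fin.last n)

theorem natAdd_succAbove {m n : ℕ} (j : Fin (n + 1)) (i : Fin n) :
    (Fin.natAdd m j).succAbove (Fin.natAdd m i) = Fin.natAdd m (j.succAbove i) := by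
  ext
  simp only [Fin.succAbove, Fin.lt_def, Fin.val_castSucc, apply_ite Fin.val, Fin.val_succ,
    Fin.val_natAdd]
  split_ifs <;> omega

theorem natAdd_succAbove_castAdd {m n : ℕ} (j : Fin (n + 1)) (i : Fin m) :
    (Fin.natAdd m j).succAbove (Fin.castAdd n i) = Fin.castAdd (n + 1) i := by
  ext
  simp only [Fin.succAbove, Fin.lt_def, Fin.val_castSucc, apply_ite Fin.val, Fin.val_succ,
    Fin.val_natAdd, Fin.val_castAdd]
  split_ifs <;> omega

theorem removeAt_sumEquiv {m n m' n' : ℕ} (e : Fin m ≃ Fin m') (e' : Fin (n + 1) ≃ Fin (n' + 1)) :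
    removeAt (m := m + n) (n := m' + n')
        (sumEquiv e e' : Fin (m + (n + 1)) ≃ Fin (m' + (n' + 1))) (Fin.last (m + n)) =
      sumEquiv e (removeAt e' (Fin.last n)) := by
  refine removeAt_unique _ _ _ fun k => ?_
  rw [sumEquiv_last]
  refine Fin.addCases (fun i => ?_) (fun i => ?_) k
  · rw [sumEquiv_castAdd, natAdd_succAbove_castAdd, Fin.succAbove_last]
    exact (sumEquiv_castAdd e e' i).symm
  · rw [sumEquiv_natAdd, natAdd_succAbove, removeAt_spec, Fin.succAbove_last, Fin.succAbove_last]
    exact (sumEquiv_natAdd e e' i.castSucc).symm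

theorem sumEquiv_zero {m m' : ℕ} (e : Fin m ≃ Fin m') (e' : Fin 0 ≃ Fin 0) :
    sumEquiv e e' = (e : Fin (m + 0) ≃ Fin (m' + 0)) := by
  ext i
  exact congrArg Fin.val (sumEquiv_castAdd e e' i)

theorem mulPow_naturality {m n m' n' : ℕ} (e : Fin m ≃ Fin m') (e' : Fin n ≃ Fin n') :
    (permPow (A := A) e ⊗ₘ permPow e') ≫ (mulPow A m' n').hom =
      (mulPow A m n).hom ≫ permPow (sumEquiv e e') := by
  obtain rfl : n = n' := by simpa using Fintype.card_congr e'
  induction n with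
  | zero =>
    obtain rfl : e' = Equiv.refl _ := Subsingleton.elim _ _
    rw [permPow_refl, sumEquiv_zero, mulPow_zero_hom, mulPow_zero_hom]
    simp
  | succ n ih =>
    have h2 := congrArg (fun f => f ▷ A) (ih (removeAt e' (Fin.last n)))
    simp only [comp_whiskerRight] at h2
    have h3 := permPow_succ (A := A) (m := m + n) (n := m' + n)
      (sumEquiv e e' : Fin (m + (n + 1)) ≃ Fin (m' + (n + 1)))
    rw [removeAt_sumEquiv, sumEquiv_last] at h3
    refine Eq.trans ?_ (congrArg _ h3).symm
    rw [mulPow_succ_hom m n, Category.assoc, ← reassoc_of% h2, permPow_succ, MonoidalCategory.tensorHom_def,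
      MonoidalCategory.whiskerLeft_comp, Category.assoc, Category.assoc, insertAt_mulPow]
    simp [MonoidalCategory.tensorHom_def]

theorem permPow_finCongr_succ {m n : ℕ} (h : m = n) (h' : m + 1 = n + 1) :
    permPow (A := A) (finCongr h') = permPow (finCongr h) ▷ A := by
  subst h
  have : ∀ k (h : k = k), finCongr h = Equiv.refl _ := fun k h => rfl
  rw [this, this, permPow_refl, permPow_refl, id_whiskerRight]

theorem mulPow_assoc (a b c : ℕ) :
    (mulPow A a b).hom ▷ tpow A c ≫ (mulPow A (a + b) c).hom ≫ permPow (finCongr (add_assoc a b c)) =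
      (α_ _ _ _).hom ≫ tpow A a ◁ (mulPow A b c).hom ≫ (mulPow A a (b + c)).hom := by
  induction c with
  | zero =>
    have : finCongr (add_assoc a b 0) = Equiv.refl _ := rfl
    rw [this, permPow_refl, mulPow_zero_hom, mulPow_zero_hom]
    simp
  | succ c ih =>
    have h1 := permPow_finCongr_succ (A := A) (add_assoc a b c) (add_assoc a b (c + 1))
    have h2 := congrArg (fun f => f ▷ A) ih
    simp only [comp_whiskerRight] at h2
    refine (congrArg (fun f => _ ≫ _ ≫ f) h1).trans ?_
    have h3 := mulPow_succ_hom (A := A) a (b + c)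
    refine Eq.trans ?_ (congrArg (fun f => _ ≫ _ ≫ f) h3).symm
    rw [mulPow_succ_hom, mulPow_succ_hom, Category.assoc]
    rw [associator_inv_naturality_left_assoc, h2]
    simp

theorem mulPow_left (n : ℕ) :
    (mulPow A 0 n).hom ≫ permPow (finCongr (zero_add n)) = (λ_ _).hom := by
  induction n with
  | zero =>
    have : finCongr (zero_add 0) = Equiv.refl _ := rfl
    rw [this, permPow_refl, mulPow_zero_hom]
    simp [unitors_equal]
  | succ n ih =>
    have h1 := permPow_finCongr_succ (A := A) (zero_add n) (zero_add (n + 1))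
    have h2 := congrArg (fun f => f ▷ A) ih
    simp only [comp_whiskerRight] at h2
    refine (congrArg (fun f => _ ≫ f) h1).trans ?_
    rw [mulPow_succ_hom, Category.assoc, h2]
    simp

theorem permPow_comp_symm {m n : ℕ} (e : Fin m ≃ Fin n) :
    permPow (A := A) e ≫ permPow e.symm = 𝟙 _ := by
  rw [← permPow_trans, Equiv.self_trans_symm, permPow_refl]

theorem permPow_symm_comp {m n : ℕ} (e : Fin m ≃ Fin n) :
    permPow (A := A) e.symm ≫ permPow e = 𝟙 _ := by
  rw [← permPow_trans, Equiv.symm_trans_self, permPow_refl]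

instance {m n : ℕ} (e : Fin m ≃ Fin n) : IsIso (permPow (A := A) e) :=
  ⟨permPow e.symm, permPow_comp_symm e, permPow_symm_comp e⟩

variable (A) in
/-- The symmetry of the two tensor powers is given by the block transposition. -/
def BraidPow (m n : ℕ) : Prop :=
  (β_ (tpow A m) (tpow A n)).hom ≫ (mulPow A n m).hom = (mulPow A m n).hom ≫ permPow finAddFlip

theorem BraidPow.symm {m n : ℕ} (h : BraidPow A m n) : BraidPow A n m := by
  unfold BraidPow at *
  have h1 : finAddFlip (m := m) (n := n) = (finAddFlip (m := n) (n := m)).symm := by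
    ext; simp [finAddFlip]
  rw [← cancel_mono (permPow finAddFlip.symm), Category.assoc, Category.assoc, permPow_comp_symm,
    Category.comp_id, ← h1, ← h, SymmetricCategory.symmetry_assoc]

theorem braidPow_zero (m : ℕ) : BraidPow A m 0 := by
  have h := mulPow_left (A := A) m
  have h1 : finAddFlip (m := m) (n := 0) = (finCongr (zero_add m)).symm := by
    ext i
    refine Fin.addCases (fun i => ?_) (fun i => i.elim0) i
    rw [finAddFlip_apply_castAdd]
    simp
  rw [BraidPow, h1, mulPow_zero_hom, ← cancel_mono (permPow (finCongr (zero_add m))),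
    Category.assoc, Category.assoc, permPow_symm_comp, h]
  simp

/-- The hexagon identity of the category is matched with the hexagon identity for block
transpositions of finite sets. -/
theorem BraidPow.add {m n n' : ℕ} (h : BraidPow A m n) (h' : BraidPow A m n') :
    BraidPow A m (n + n') := by
  unfold BraidPow at *
  rw [← cancel_epi (tpow A m ◁ (mulPow A n n').hom), BraidedCategory.braiding_naturality_right_assoc,
    BraidedCategory.braiding_tensor_right_hom]
  rw [← cancel_mono (permPow (finCongr (add_assoc n n' m)))]
  simp only [Category.assoc]
  rw [mulPow_assoc, Iso.inv_hom_id_assoc, ← MonoidalCategory.whiskerLeft_comp_assoc, h',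
    MonoidalCategory.whiskerLeft_comp_assoc]
  have n1 := mulPow_naturality (A := A) (Equiv.refl (Fin n)) (finAddFlip (m := m) (n := n'))
  have n2 := mulPow_naturality (A := A) (finAddFlip (m := m) (n := n)) (Equiv.refl (Fin n'))
  rw [permPow_refl, id_tensorHom] at n1
  rw [permPow_refl, tensorHom_id] at n2
  rw [n1]
  have a1 := mulPow_assoc (A := A) n m n'
  have a2 := mulPow_assoc (A := A) m n n'
  rw [← reassoc_of% a1, ← comp_whiskerRight_assoc, h, comp_whiskerRight_assoc, reassoc_of% n2]
  rw [← cancel_epi (α_ _ _ _).hom, Iso.hom_inv_id_assoc]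
  rw [← reassoc_of% a2, ← permPow_trans, ← permPow_trans, ← permPow_trans, ← permPow_trans,
    RepZero.hexagon_fwd]

theorem removeAt_finAddFlip :
    removeAt (m := 1) (n := 1) (finAddFlip (m := 1) (n := 1)) (Fin.last 1) = Equiv.refl _ :=
  Subsingleton.elim _ _

/-- The base case: a transposition of two points acts by the symmetry of `A` with itself. The first
tensor power is `𝟙_ C ⊗ A`, which accounts for the unitors. -/
theorem braidPow_one : BraidPow A 1 1 := by
  have h1 : permPow (A := A) (finAddFlip (m := 1) (n := 1)) = swapLast A (𝟙_ C) := by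
    have h := permPow_succ (A := A) (m := 1) (n := 1) (finAddFlip (m := 1) (n := 1))
    rw [removeAt_finAddFlip, permPow_refl] at h
    have h3 := insertAt_castSucc (A := A) 0 0
    have h2 : (finAddFlip (m := 1) (n := 1)) (Fin.last 1) = Fin.castSucc 0 := by decide
    rw [h2, h3] at h
    have h4 : insertAt (A := A) 0 0 = 𝟙 _ := rfl
    rw [h4] at h
    simpa using h
  have h2 : swapLast A (𝟙_ C) = (λ_ A).hom ▷ A ≫ (β_ A A).hom ≫ (λ_ A).inv ▷ A := by
    simp [swapLast]
  have h3 : (mulPow A 1 1).hom = (𝟙_ C ⊗ A) ◁ (λ_ A).hom := by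
    rw [mulPow_succ_hom, mulPow_zero_hom]
    simp
  have h4 : (𝟙_ C ⊗ A) ◁ (λ_ A).hom ≫ (λ_ A).hom ▷ A ≫ (β_ A A).hom =
      (β_ (𝟙_ C ⊗ A) (𝟙_ C ⊗ A)).hom ≫ (𝟙_ C ⊗ A) ◁ (λ_ A).hom ≫ (λ_ A).hom ▷ A := by
    rw [← MonoidalCategory.tensorHom_def'_assoc, BraidedCategory.braiding_naturality,
      MonoidalCategory.tensorHom_def']
  rw [BraidPow, h1, h2, h3, reassoc_of% h4, ← comp_whiskerRight, Iso.hom_inv_id, id_whiskerRight,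
    Category.comp_id]

theorem braidPow (m n : ℕ) : BraidPow A m n := by
  have h1 : ∀ n, BraidPow A 1 n := fun n => by
    induction n with
    | zero => exact braidPow_zero 1
    | succ n ih => exact ih.add braidPow_one
  induction n with
  | zero => exact braidPow_zero m
  | succ n ih => exact ih.add (h1 m).symm

end TensorPower

/-- A symmetric monoidal functor from the category of the finite sets `Fin n` and their bijections:
objects `T n` on which the bijections act, with a compatible multiplication. -/
structure FinPow (C : Type u) [Category.{v} C] [MonoidalCategory C] [SymmetricCategory C] where
  T : ℕ → C
  S : ∀ {m n : ℕ}, (Fin m ≃ Fin n) → (T m ⟶ T n)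
  mul : ∀ m n : ℕ, T m ⊗ T n ≅ T (m + n)
  unit : 𝟙_ C ≅ T 0
  S_refl : ∀ m, S (Equiv.refl (Fin m)) = 𝟙 _
  S_trans : ∀ {m n k : ℕ} (e : Fin m ≃ Fin n) (e' : Fin n ≃ Fin k), S (e.trans e') = S e ≫ S e'
  mul_naturality : ∀ {m n m' n' : ℕ} (e : Fin m ≃ Fin m') (e' : Fin n ≃ Fin n'),
    (S e ⊗ₘ S e') ≫ (mul m' n').hom = (mul m n).hom ≫ S (EvenPartition.sumEquiv e e')
  mul_assoc : ∀ a b c : ℕ,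
    (mul a b).hom ▷ T c ≫ (mul (a + b) c).hom ≫ S (finCongr (add_assoc a b c)) =
      (α_ _ _ _).hom ≫ T a ◁ (mul b c).hom ≫ (mul a (b + c)).hom
  mul_left : ∀ n, unit.hom ▷ T n ≫ (mul 0 n).hom ≫ S (finCongr (zero_add n)) = (λ_ _).hom
  mul_right : ∀ n, T n ◁ unit.hom ≫ (mul n 0).hom ≫ S (finCongr (add_zero n)) = (ρ_ _).hom
  braid : ∀ m n, (β_ (T m) (T n)).hom ≫ (mul n m).hom = (mul m n).hom ≫ S finAddFlip

/-- The tensor powers of an object. -/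
def FinPow.ofObj {C : Type u} [Category.{v} C] [MonoidalCategory C] [SymmetricCategory C] (A : C) :
    FinPow C where
  T := tpow A
  S := permPow
  mul := mulPow A
  unit := Iso.refl _
  S_refl := permPow_refl
  S_trans := permPow_trans
  mul_naturality := mulPow_naturality
  mul_assoc := mulPow_assoc
  mul_left n := by simpa using mulPow_left n
  mul_right n := by
    have : finCongr (add_zero n) = Equiv.refl _ := rfl
    rw [this, permPow_refl, mulPow_zero_hom]
    simp
  braid := braidPow

/-- The objects `[n]` of the category of even partition diagrams. -/
def FinPow.repZero (t : ℂ) : FinPow (RepZero t) where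
  T n := ⟨n⟩
  S e := RepZero.permL e
  mul m n := Iso.refl _
  unit := Iso.refl _
  S_refl m := rfl
  S_trans e e' := (RepZero.permL_trans t e e').symm
  mul_naturality e e' := by
    refine (Category.comp_id _).trans (Eq.trans ?_ (Category.id_comp _).symm)
    exact RepZero.tensL_permL e e'
  mul_assoc a b c := by
    simp only [Iso.refl_hom, id_whiskerRight, Category.id_comp, MonoidalCategory.whiskerLeft_id]
    exact (Category.comp_id (obj := RepZero t) _).symm
  mul_left n := by
    simp only [Iso.refl_hom, id_whiskerRight, Category.id_comp]
    rfl
  mul_right n := by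
    simp only [Iso.refl_hom, Category.id_comp, MonoidalCategory.whiskerLeft_id]
    rfl
  braid m n := by
    refine (Category.comp_id _).trans (Eq.trans ?_ (Category.id_comp _).symm)
    rfl

end

/-! ### Tensor powers indexed by arbitrary finite sets. -/

section

namespace FinPow

open EvenPartition

variable {C : Type u} [Category.{v} C] [MonoidalCategory C] [SymmetricCategory C] (P : FinPow C)
variable {X Y Z X' Y' Z' : Type} [Finite X] [Finite Y] [Finite Z] [Finite X'] [Finite Y'] [Finite Z']

/-- The tensor power that is indexed by a finite set. -/
@[reducible] def V (X : Type) [Finite X] : C := P.T (Nat.card X)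

/-- The action of bijections of finite sets. -/
def perm (e : X ≃ Y) : P.V X ⟶ P.V Y :=
  P.S ((Finite.equivFin X).symm.trans (e.trans (Finite.equivFin Y)))

theorem perm_refl (X : Type) [Finite X] : P.perm (Equiv.refl X) = 𝟙 (P.V X) := by
  rw [perm, Equiv.refl_trans, Equiv.symm_trans_self, P.S_refl]

theorem perm_trans (e : X ≃ Y) (e' : Y ≃ Z) : P.perm (e.trans e') = P.perm e ≫ P.perm e' := by
  simp only [perm]
  refine Eq.trans ?_ (P.S_trans _ _)
  congr 1
  ext; simp

theorem perm_symm_comp (e : X ≃ Y) : P.perm e.symm ≫ P.perm e = 𝟙 _ := by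
  rw [← perm_trans, Equiv.symm_trans_self, perm_refl]

theorem perm_comp_symm (e : X ≃ Y) : P.perm e ≫ P.perm e.symm = 𝟙 _ := by
  rw [← perm_trans, Equiv.self_trans_symm, perm_refl]

/-- The action of a bijection as an isomorphism. -/
def permIso (e : X ≃ Y) : P.V X ≅ P.V Y := ⟨P.perm e, P.perm e.symm, P.perm_comp_symm e, P.perm_symm_comp e⟩

instance (e : X ≃ Y) : IsIso (P.perm e) := (P.permIso e).isIso_hom

/-- The bijection of the index sets that is part of the multiplication. -/
def sumFin (X Y : Type) [Finite X] [Finite Y] :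
    Fin (Nat.card X + Nat.card Y) ≃ Fin (Nat.card (X ⊕ Y)) :=
  finSumFinEquiv.symm.trans ((Equiv.sumCongr (Finite.equivFin X).symm (Finite.equivFin Y).symm).trans
    (Finite.equivFin (X ⊕ Y)))

/-- The action of a bijection between standard finite sets as an isomorphism. -/
def SIso {m n : ℕ} (e : Fin m ≃ Fin n) : P.T m ≅ P.T n where
  hom := P.S e
  inv := P.S e.symm
  hom_inv_id := by rw [← P.S_trans, Equiv.self_trans_symm, P.S_refl]
  inv_hom_id := by rw [← P.S_trans, Equiv.symm_trans_self, P.S_refl]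

/-- The multiplication of tensor powers. -/
def mulV (X Y : Type) [Finite X] [Finite Y] : P.V X ⊗ P.V Y ≅ P.V (X ⊕ Y) :=
  P.mul _ _ ≪≫ P.SIso (sumFin X Y)

theorem mulV_hom (X Y : Type) [Finite X] [Finite Y] :
    (P.mulV X Y).hom = (P.mul _ _).hom ≫ P.S (sumFin X Y) := rfl

theorem mulV_naturality (e : X ≃ X') (e' : Y ≃ Y') :
    (P.perm e ⊗ₘ P.perm e') ≫ (P.mulV X' Y').hom =
      (P.mulV X Y).hom ≫ P.perm (Equiv.sumCongr e e') := by
  have h := P.mul_naturality ((Finite.equivFin X).symm.trans (e.trans (Finite.equivFin X')))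
    ((Finite.equivFin Y).symm.trans (e'.trans (Finite.equivFin Y')))
  simp only [mulV_hom, Category.assoc, perm]
  rw [reassoc_of% h, ← P.S_trans, ← P.S_trans]
  congr 2
  apply Equiv.ext
  intro i
  refine Fin.addCases (fun i => ?_) (fun i => ?_) i <;> simp [sumFin, sumEquiv]

/-- After the naturality of the multiplication has moved all permutations to the end, only an
equality of bijections remains, and it can be checked on the three summands. From here on, coherence
of tensor powers is a statement about sums of sets. -/
theorem mulV_assoc (X Y Z : Type) [Finite X] [Finite Y] [Finite Z] :
    (P.mulV X Y).hom ▷ P.V Z ≫ (P.mulV (X ⊕ Y) Z).hom ≫ P.perm (Equiv.sumAssoc X Y Z) =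
      (α_ _ _ _).hom ≫ P.V X ◁ (P.mulV Y Z).hom ≫ (P.mulV X (Y ⊕ Z)).hom := by
  have n1 := P.mul_naturality (sumFin X Y) (Equiv.refl (Fin (Nat.card Z)))
  have n2 := P.mul_naturality (Equiv.refl (Fin (Nat.card X))) (sumFin Y Z)
  have a := P.mul_assoc (Nat.card X) (Nat.card Y) (Nat.card Z)
  rw [P.S_refl, tensorHom_id] at n1
  rw [P.S_refl, id_tensorHom] at n2
  have e : (sumEquiv (sumFin X Y) (Equiv.refl (Fin (Nat.card Z)))).trans
      ((sumFin (X ⊕ Y) Z).trans ((Finite.equivFin ((X ⊕ Y) ⊕ Z)).symm.trans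
        ((Equiv.sumAssoc X Y Z).trans (Finite.equivFin (X ⊕ Y ⊕ Z))))) =
      (finCongr (add_assoc _ _ _)).trans ((sumEquiv (Equiv.refl (Fin (Nat.card X))) (sumFin Y Z)).trans
        (sumFin X (Y ⊕ Z))) := by
    have a1 : ∀ {a b c : ℕ} (i : Fin a), finCongr (add_assoc a b c)
        (Fin.castAdd c (Fin.castAdd b i)) = Fin.castAdd (b + c) i := fun i => rfl
    have a2 : ∀ {a b c : ℕ} (i : Fin b), finCongr (add_assoc a b c)
        (Fin.castAdd c (Fin.natAdd a i)) = Fin.natAdd a (Fin.castAdd c i) := fun i => rfl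
    have a3 : ∀ {a b c : ℕ} (i : Fin c), finCongr (add_assoc a b c)
        (Fin.natAdd (a + b) i) = Fin.natAdd a (Fin.natAdd b i) := fun i =>
      Fin.ext (add_assoc _ _ _)
    apply Equiv.ext
    intro i
    simp only [Equiv.trans_apply]
    refine Fin.addCases (fun i => Fin.addCases (fun i => ?_) (fun i => ?_) i) (fun i => ?_) i
    · rw [a3, sumEquiv_natAdd, sumEquiv_natAdd]; simp [sumFin]
    · rw [a1, sumEquiv_castAdd, sumEquiv_castAdd]; simp [sumFin]
    · rw [a2, sumEquiv_castAdd, sumEquiv_natAdd]; simp [sumFin]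
  simp only [mulV_hom, comp_whiskerRight, MonoidalCategory.whiskerLeft_comp, Category.assoc, perm]
  rw [reassoc_of% n1, reassoc_of% n2, ← reassoc_of% a, ← P.S_trans, ← P.S_trans, ← P.S_trans,
    ← P.S_trans, e]

/-- The unit of the tensor powers. -/
def unitV : 𝟙_ C ≅ P.V Empty := P.unit ≪≫ P.SIso (finCongr (by simp))

theorem finAddFlip_eq (m n : ℕ) : finAddFlip (m := m) (n := n) =
    finSumFinEquiv.symm.trans ((Equiv.sumComm _ _).trans finSumFinEquiv) := rfl

theorem mulV_braid (X Y : Type) [Finite X] [Finite Y] :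
    (β_ (P.V X) (P.V Y)).hom ≫ (P.mulV Y X).hom =
      (P.mulV X Y).hom ≫ P.perm (Equiv.sumComm X Y) := by
  have h := P.braid (Nat.card X) (Nat.card Y)
  simp only [mulV_hom, Category.assoc, perm]
  rw [reassoc_of% h, ← P.S_trans, ← P.S_trans]
  congr 2
  apply Equiv.ext
  intro i
  refine Fin.addCases (fun i => ?_) (fun i => ?_) i <;> simp [sumFin, finAddFlip_eq]

theorem mulV_left (X : Type) [Finite X] :
    P.unitV.hom ▷ P.V X ≫ (P.mulV Empty X).hom ≫ P.perm (Equiv.emptySum Empty X) = (λ_ _).hom := by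
  have h := P.mul_left (Nat.card X)
  have n := P.mul_naturality (finCongr (by simp) : Fin 0 ≃ Fin (Nat.card Empty))
    (Equiv.refl (Fin (Nat.card X)))
  rw [P.S_refl, tensorHom_id] at n
  simp only [mulV_hom, Category.assoc, perm, unitV, SIso, Iso.trans_hom, comp_whiskerRight]
  rw [reassoc_of% n, ← P.S_trans, ← P.S_trans, ← h]
  congr 3
  apply Equiv.ext
  intro i
  refine Fin.addCases (fun i => i.elim0) (fun i => ?_) i
  rw [Equiv.trans_apply, sumEquiv_natAdd]
  simp only [sumFin, Equiv.trans_apply, Equiv.refl_apply, finSumFinEquiv_symm_apply_natAdd,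
    Equiv.sumCongr_apply, Sum.map_inr, Equiv.symm_apply_apply, Equiv.emptySum_apply_inr,
    Equiv.apply_symm_apply]
  ext; simp

theorem mulV_right (X : Type) [Finite X] :
    P.V X ◁ P.unitV.hom ≫ (P.mulV X Empty).hom ≫ P.perm (Equiv.sumEmpty X Empty) = (ρ_ _).hom := by
  have h := P.mul_right (Nat.card X)
  have n := P.mul_naturality (Equiv.refl (Fin (Nat.card X)))
    (finCongr (by simp) : Fin 0 ≃ Fin (Nat.card Empty))
  rw [P.S_refl, id_tensorHom] at n
  simp only [mulV_hom, Category.assoc, perm, unitV, SIso, Iso.trans_hom,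
    MonoidalCategory.whiskerLeft_comp]
  rw [reassoc_of% n, ← P.S_trans, ← P.S_trans, ← h]
  congr 3
  apply Equiv.ext
  intro i
  refine Fin.addCases (fun i => ?_) (fun i => i.elim0) i
  rw [Equiv.trans_apply, sumEquiv_castAdd]
  simp only [sumFin, Equiv.trans_apply, Equiv.refl_apply, finSumFinEquiv_symm_apply_castAdd,
    Equiv.sumCongr_apply, Sum.map_inl, Equiv.symm_apply_apply, Equiv.sumEmpty_apply_inl,
    Equiv.apply_symm_apply]
  ext; simp

/-- The tensor product of morphisms between tensor powers. -/
def tens (f : P.V X ⟶ P.V Y) (g : P.V X' ⟶ P.V Y') : P.V (X ⊕ X') ⟶ P.V (Y ⊕ Y') :=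
  (P.mulV X X').inv ≫ (f ⊗ₘ g) ≫ (P.mulV Y Y').hom

theorem tens_id : P.tens (𝟙 (P.V X)) (𝟙 (P.V Y)) = 𝟙 _ := by
  simp [tens]

theorem tens_comp (f : P.V X ⟶ P.V Y) (f' : P.V Y ⟶ P.V Z) (g : P.V X' ⟶ P.V Y')
    (g' : P.V Y' ⟶ P.V Z') :
    P.tens f g ≫ P.tens f' g' = P.tens (f ≫ f') (g ≫ g') := by
  simp only [tens, Category.assoc, Iso.hom_inv_id_assoc]
  rw [MonoidalCategory.tensorHom_comp_tensorHom_assoc]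

theorem tens_perm (e : X ≃ Y) (e' : X' ≃ Y') :
    P.tens (P.perm e) (P.perm e') = P.perm (Equiv.sumCongr e e') := by
  rw [tens, mulV_naturality, Iso.inv_hom_id_assoc]

theorem tens_assoc (f : P.V X ⟶ P.V X') (g : P.V Y ⟶ P.V Y') (h : P.V Z ⟶ P.V Z') :
    P.tens (P.tens f g) h ≫ P.perm (Equiv.sumAssoc X' Y' Z') =
      P.perm (Equiv.sumAssoc X Y Z) ≫ P.tens f (P.tens g h) := by
  have a1 := P.mulV_assoc X Y Z
  have a2 := P.mulV_assoc X' Y' Z'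
  rw [← cancel_epi (P.mulV (X ⊕ Y) Z).hom, ← cancel_epi ((P.mulV X Y).hom ▷ P.V Z)]
  simp only [tens, Category.assoc, Iso.hom_inv_id_assoc]
  rw [reassoc_of% a1, Iso.hom_inv_id_assoc]
  rw [← tensorHom_id, MonoidalCategory.tensorHom_comp_tensorHom_assoc, Iso.hom_inv_id_assoc,
    Category.id_comp]
  rw [← id_tensorHom, MonoidalCategory.tensorHom_comp_tensorHom_assoc, Iso.hom_inv_id_assoc,
    Category.id_comp]
  have e1 : (((f ⊗ₘ g) ≫ (P.mulV X' Y').hom) ⊗ₘ h) = ((f ⊗ₘ g) ⊗ₘ h) ≫ (P.mulV X' Y').hom ▷ _ := by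
    rw [← tensorHom_id, MonoidalCategory.tensorHom_comp_tensorHom, Category.comp_id]
  have e2 : (f ⊗ₘ ((g ⊗ₘ h) ≫ (P.mulV Y' Z').hom)) = (f ⊗ₘ (g ⊗ₘ h)) ≫ _ ◁ (P.mulV Y' Z').hom := by
    rw [← id_tensorHom, MonoidalCategory.tensorHom_comp_tensorHom, Category.comp_id]
  rw [e1, e2, Category.assoc, a2, Category.assoc, MonoidalCategory.associator_naturality_assoc]

theorem tens_comm (f : P.V X ⟶ P.V X') (g : P.V Y ⟶ P.V Y') :
    P.tens f g ≫ P.perm (Equiv.sumComm X' Y') = P.perm (Equiv.sumComm X Y) ≫ P.tens g f := by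
  rw [← cancel_epi (P.mulV X Y).hom]
  simp only [tens, Category.assoc, Iso.hom_inv_id_assoc]
  rw [← mulV_braid, ← reassoc_of% (P.mulV_braid X Y), Iso.hom_inv_id_assoc,
    BraidedCategory.braiding_naturality_assoc]

theorem tens_left (f : P.V X ⟶ P.V Y) :
    P.tens (𝟙 (P.V Empty)) f ≫ P.perm (Equiv.emptySum Empty Y) =
      P.perm (Equiv.emptySum Empty X) ≫ f := by
  rw [← cancel_epi (P.mulV Empty X).hom, ← cancel_epi (P.unitV.hom ▷ P.V X)]
  simp only [tens, Iso.hom_inv_id_assoc, Category.assoc, id_tensorHom]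
  rw [← whisker_exchange_assoc, P.mulV_left, reassoc_of% (P.mulV_left X), leftUnitor_naturality]

theorem tens_right (f : P.V X ⟶ P.V Y) :
    P.tens f (𝟙 (P.V Empty)) ≫ P.perm (Equiv.sumEmpty Y Empty) =
      P.perm (Equiv.sumEmpty X Empty) ≫ f := by
  rw [← cancel_epi (P.mulV X Empty).hom, ← cancel_epi (P.V X ◁ P.unitV.hom)]
  simp only [tens, Iso.hom_inv_id_assoc, Category.assoc, tensorHom_id]
  rw [whisker_exchange_assoc, P.mulV_right, reassoc_of% (P.mulV_right X), rightUnitor_naturality]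

section Linear

variable [Preadditive C] [Linear ℂ C] [MonoidalPreadditive C] [MonoidalLinear ℂ C]

theorem tens_smul (r : ℂ) (f : P.V X ⟶ P.V X') (g : P.V Y ⟶ P.V Y') :
    P.tens f (r • g) = r • P.tens f g := by
  simp only [tens, MatEnvelope.tensorHom_smul', Linear.smul_comp, Linear.comp_smul]

theorem smul_tens (r : ℂ) (f : P.V X ⟶ P.V X') (g : P.V Y ⟶ P.V Y') :
    P.tens (r • f) g = r • P.tens f g := by
  simp only [tens, MatEnvelope.smul_tensorHom', Linear.smul_comp, Linear.comp_smul]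

end Linear

end FinPow

end

/-! ### Endomorphisms that act on a chosen subset of the factors. -/

section

/-- A bijection between sums that fixes the left summand comes from the right summands. -/
theorem exists_sumCongr {Q S R : Type} (k : Q ⊕ S ≃ Q ⊕ R) (h : ∀ q, k (.inl q) = .inl q) :
    ∃ r : S ≃ R, k = Equiv.sumCongr (Equiv.refl Q) r := by
  have h1 : ∀ s, ∃ r, k (.inr s) = .inr r := fun s => by
    rcases hs : k (.inr s) with q | r
    · rw [← h] at hs; simpa using k.injective hs
    · exact ⟨r, rfl⟩
  choose f hf using h1
  refine ⟨Equiv.ofBijective f ⟨fun a b hab => ?_, fun r => ?_⟩, ?_⟩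
  · have := (hf a).trans ((congrArg Sum.inr hab).trans (hf b).symm)
    simpa using k.injective this
  · rcases hs : k.symm (.inr r) with q | s
    · rw [Equiv.symm_apply_eq, h] at hs; simp at hs
    · rw [Equiv.symm_apply_eq, hf] at hs; exact ⟨s, (Sum.inr_injective hs).symm⟩
  · ext x; rcases x with q | s
    · simp [h]
    · rw [hf]; rfl

/-- The splitting of a set into the range of an injection and its complement. -/
def splitEquiv {Q X : Type} (u : Q → X) (hu : Function.Injective u) :
    X ≃ Q ⊕ {x // x ∉ Set.range u} :=
  open Classical in (Equiv.sumCongr (Equiv.ofInjective u hu) (Equiv.refl _)).trans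
    (Equiv.sumCompl (fun x => x ∈ Set.range u)) |>.symm

theorem splitEquiv_symm_inl {Q X : Type} (u : Q → X) (hu : Function.Injective u) (q : Q) :
    (splitEquiv u hu).symm (.inl q) = u q := by
  simp [splitEquiv]

namespace FinPow

variable {C : Type u} [Category.{v} C] [MonoidalCategory C] [SymmetricCategory C] (P : FinPow C)
variable {X Y Z Q R S : Type} [Finite X] [Finite Y] [Finite Z] [Finite Q] [Finite R] [Finite S]

theorem perm_perm (e : X ≃ Y) (e' : Y ≃ Z) : P.perm e ≫ P.perm e' = P.perm (e.trans e') :=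
  (P.perm_trans e e').symm

theorem perm_perm_assoc (e : X ≃ Y) (e' : Y ≃ Z) {W : C} (f : P.V Z ⟶ W) :
    P.perm e ≫ P.perm e' ≫ f = P.perm (e.trans e') ≫ f := by
  rw [← perm_perm, Category.assoc]

theorem perm_congr {e e' : X ≃ Y} (h : ∀ x, e x = e' x) : P.perm e = P.perm e' :=
  congrArg _ (Equiv.ext h)

theorem perm_eq_id {e : X ≃ X} (h : ∀ x, e x = x) : P.perm e = 𝟙 _ :=
  (P.perm_congr (e' := Equiv.refl X) h).trans (P.perm_refl X)

theorem tens_id_perm (e : Y ≃ Z) :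
    P.tens (𝟙 (P.V X)) (P.perm e) = P.perm (Equiv.sumCongr (Equiv.refl X) e) := by
  rw [← perm_refl, tens_perm]

theorem tens_perm_id (e : Y ≃ Z) :
    P.tens (P.perm e) (𝟙 (P.V X)) = P.perm (Equiv.sumCongr e (Equiv.refl X)) := by
  rw [← perm_refl, tens_perm]

theorem tens_comp_assoc (f : P.V X ⟶ P.V Y) (f' : P.V Y ⟶ P.V Z) (g : P.V Q ⟶ P.V R)
    (g' : P.V R ⟶ P.V S) {W : C} (h : P.V (Z ⊕ S) ⟶ W) :
    P.tens f g ≫ P.tens f' g' ≫ h = P.tens (f ≫ f') (g ≫ g') ≫ h := by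
  rw [← tens_comp, Category.assoc]

theorem tens_assoc_symm (f : P.V X ⟶ P.V Y) (g : P.V Z ⟶ P.V Q) (h : P.V R ⟶ P.V S) :
    P.tens f (P.tens g h) ≫ P.perm (Equiv.sumAssoc _ _ _).symm =
      P.perm (Equiv.sumAssoc _ _ _).symm ≫ P.tens (P.tens f g) h := by
  have := P.tens_assoc f g h
  rw [← cancel_epi (P.perm (Equiv.sumAssoc _ _ _)), ← Category.assoc, ← this, Category.assoc,
    perm_comp_symm, Category.comp_id, ← Category.assoc, perm_comp_symm, Category.id_comp]

/-- The exchange of the first two summands. -/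
def leftComm (X Y Z : Type) : X ⊕ (Y ⊕ Z) ≃ Y ⊕ (X ⊕ Z) :=
  (Equiv.sumAssoc _ _ _).symm.trans
    ((Equiv.sumCongr (Equiv.sumComm _ _) (Equiv.refl _)).trans (Equiv.sumAssoc _ _ _))

theorem tens_leftComm (f : P.V X ⟶ P.V Y) (g : P.V Z ⟶ P.V Q) (h : P.V R ⟶ P.V S) :
    P.tens f (P.tens g h) ≫ P.perm (leftComm _ _ _) =
      P.perm (leftComm _ _ _) ≫ P.tens g (P.tens f h) := by
  have a1 := P.tens_assoc_symm f g h
  have a2 := P.tens_assoc g f h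
  have a3 := P.tens_comm f g
  rw [leftComm, leftComm, ← perm_perm, ← perm_perm, ← perm_perm, ← perm_perm, reassoc_of% a1,
    ← tens_perm_id, ← tens_perm_id, tens_comp_assoc, a3, Category.assoc, Category.assoc, ← a2,
    tens_comp_assoc, Category.comp_id, Category.id_comp]

/-- An endomorphism that acts on the factors in the image of an injection. -/
def actOn (u : Q → X) (hu : Function.Injective u) (f : P.V Q ⟶ P.V Q) : P.V X ⟶ P.V X :=
  P.perm (splitEquiv u hu) ≫ P.tens f (𝟙 _) ≫ P.perm (splitEquiv u hu).symm

/-- Two splittings with the same embedded copy of `Q` differ by a bijection of the complements, and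
that bijection slides past `f` tensored with an identity. So the chosen splitting may be replaced by
any convenient one. -/
theorem actOn_eq (u : Q → X) (hu : Function.Injective u) (f : P.V Q ⟶ P.V Q) (e : X ≃ Q ⊕ R)
    (h : ∀ q, e.symm (.inl q) = u q) :
    P.actOn u hu f = P.perm e ≫ P.tens f (𝟙 _) ≫ P.perm e.symm := by
  obtain ⟨r, hr⟩ := exists_sumCongr ((splitEquiv u hu).symm.trans e) (fun q => by
    rw [Equiv.trans_apply, splitEquiv_symm_inl, ← h, Equiv.apply_symm_apply])
  have h1 : P.perm e = P.perm (splitEquiv u hu) ≫ P.tens (𝟙 _) (P.perm r) := by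
    rw [tens_id_perm, ← hr, perm_perm]
    exact P.perm_congr fun x => by simp
  have h2 : P.perm e.symm = P.tens (𝟙 _) (P.perm r.symm) ≫ P.perm (splitEquiv u hu).symm := by
    rw [tens_id_perm, perm_perm]
    have := congrArg Equiv.symm hr
    refine P.perm_congr fun x => ?_
    have h3 : (Equiv.refl Q).sumCongr r.symm = ((Equiv.refl Q).sumCongr r).symm := by
      ext x; rcases x with x | x <;> rfl
    rw [h3, ← this]
    simp
  rw [h1, h2, actOn]
  simp only [Category.assoc]
  rw [← Category.assoc (P.tens f _), tens_comp, ← Category.assoc (P.tens _ (P.perm r)), tens_comp]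
  simp only [Category.id_comp, Category.comp_id, perm_comp_symm]

theorem actOn_comp (u : Q → X) (hu : Function.Injective u) (f g : P.V Q ⟶ P.V Q) :
    P.actOn u hu f ≫ P.actOn u hu g = P.actOn u hu (f ≫ g) := by
  simp only [actOn, Category.assoc]
  rw [← Category.assoc (P.perm (splitEquiv u hu).symm), perm_symm_comp, Category.id_comp,
    ← Category.assoc (P.tens f _), tens_comp, Category.comp_id]

theorem actOn_perm (u : Q → X) (hu : Function.Injective u) (f : P.V Q ⟶ P.V Q) (e : X ≃ Y) :
    P.actOn u hu f ≫ P.perm e =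
      P.perm e ≫ P.actOn (fun q => e (u q)) (e.injective.comp hu) f := by
  rw [P.actOn_eq (fun q => e (u q)) (e.injective.comp hu) f (e.symm.trans (splitEquiv u hu))
    (fun q => by simp [splitEquiv_symm_inl]), actOn]
  rw [perm_perm_assoc, Category.assoc, Category.assoc, perm_perm]
  congr 1
  exact P.perm_congr fun x => by simp

theorem actOn_actOn (u : Q → X) (hu : Function.Injective u) (w : X → Y) (hw : Function.Injective w)
    (f : P.V Q ⟶ P.V Q) :
    P.actOn w hw (P.actOn u hu f) = P.actOn (fun q => w (u q)) (hw.comp hu) f := by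
  rw [P.actOn_eq (fun q => w (u q)) (hw.comp hu) f ((splitEquiv w hw).trans
    ((Equiv.sumCongr (splitEquiv u hu) (Equiv.refl _)).trans (Equiv.sumAssoc _ _ _)))
    (fun q => by simp [splitEquiv_symm_inl]), actOn, actOn]
  have h := P.tens_assoc f (𝟙 (P.V {x // x ∉ Set.range u})) (𝟙 (P.V {x // x ∉ Set.range w}))
  rw [tens_id] at h
  rw [← perm_perm, ← perm_perm, Category.assoc, Category.assoc, ← reassoc_of% h,
    perm_perm, ← tens_perm_id]
  rw [← Category.id_comp (𝟙 (P.V {x // x ∉ Set.range w})), ← tens_comp, Category.id_comp,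
    ← Category.id_comp (𝟙 (P.V {x // x ∉ Set.range w})), ← tens_comp, Category.id_comp]
  simp only [Category.assoc]
  rw [tens_perm_id (e := (splitEquiv u hu).symm), perm_perm]
  congr 3
  exact P.perm_congr fun x => by
    simp only [Equiv.trans_apply, Equiv.symm_trans_apply, Equiv.symm_apply_apply]
    congr 1

/-- Disjoint supports can be split off simultaneously, and then the interchange law applies. -/
theorem actOn_comm (u : Q → X) (hu : Function.Injective u) (w : R → X) (hw : Function.Injective w)
    (huw : ∀ q r, u q ≠ w r) (f : P.V Q ⟶ P.V Q) (g : P.V R ⟶ P.V R) :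
    P.actOn u hu f ≫ P.actOn w hw g = P.actOn w hw g ≫ P.actOn u hu f := by
  have hs : Function.Injective (Sum.elim u w) := by
    rw [Sum.elim_injective]; exact ⟨hu, hw, huw⟩
  obtain ⟨T, _, e, he, he'⟩ : ∃ (T : Type) (_ : Finite T) (e : X ≃ Q ⊕ (R ⊕ T)),
      (∀ q, e.symm (.inl q) = u q) ∧ ∀ r, e.symm (.inr (.inl r)) = w r :=
    ⟨_, inferInstance, (splitEquiv (Sum.elim u w) hs).trans (Equiv.sumAssoc _ _ _),
      fun q => by simp [splitEquiv_symm_inl], fun q => by simp [splitEquiv_symm_inl]⟩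
  have h3 : P.actOn w hw g = P.perm e ≫ P.tens (𝟙 _) (P.tens g (𝟙 (P.V T))) ≫ P.perm e.symm := by
    have a1 := P.tens_leftComm (𝟙 (P.V Q)) g (𝟙 (P.V T))
    rw [tens_id] at a1
    rw [P.actOn_eq w hw g (e.trans (leftComm _ _ _)) (fun r => (he' r)), ← perm_perm,
      Category.assoc, ← reassoc_of% a1, perm_perm]
    congr 2
    exact P.perm_congr fun x => by simp
  rw [P.actOn_eq u hu f e he, h3]
  simp only [Category.assoc]
  rw [← Category.assoc (P.perm e.symm), perm_symm_comp, Category.id_comp,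
    ← Category.assoc (P.perm e.symm), perm_symm_comp, Category.id_comp,
    tens_comp_assoc, tens_comp_assoc]
  simp only [Category.id_comp, Category.comp_id]

end FinPow

end

/-! ### Structure morphisms on tensor powers and the neutralizer of two factors. -/

section

namespace FinPow

variable {C : Type u} [Category.{v} C] [MonoidalCategory C] [SymmetricCategory C]
variable {X Y Z Q R S : Type} [Finite X] [Finite Y] [Finite Z] [Finite Q] [Finite R] [Finite S]

/-- The structure morphisms of an object with neutralizer, on tensor powers. -/
structure NeutGen (P : FinPow C) where
  α : P.V (Unit ⊕ Unit) ⟶ P.V (Unit ⊕ Unit)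
  β : P.V (Unit ⊕ Unit) ⟶ P.V Empty
  δ : P.V Empty ⟶ P.V (Unit ⊕ Unit)

namespace NeutGen

variable {P : FinPow C} (G : P.NeutGen)

/-- The evaluation of the first two factors. -/
def cap (R : Type) [Finite R] : P.V ((Unit ⊕ Unit) ⊕ R) ⟶ P.V R :=
  P.tens G.β (𝟙 _) ≫ P.perm (Equiv.emptySum Empty R)

/-- The insertion of two factors by the coevaluation. -/
def cup (R : Type) [Finite R] : P.V R ⟶ P.V ((Unit ⊕ Unit) ⊕ R) :=
  P.perm (Equiv.emptySum Empty R).symm ≫ P.tens G.δ (𝟙 _)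

variable [Preadditive C] [Linear ℂ C]

/-- The relations of a rigid self-dual object with neutralizer, on tensor powers. -/
structure Rel (t : ℂ) : Prop where
  idem : G.α ≫ G.α = G.α
  swap_neut : P.perm (Equiv.sumComm Unit Unit) ≫ G.α = G.α
  neut_swap : G.α ≫ P.perm (Equiv.sumComm Unit Unit) = G.α
  exchange : (P.perm (Equiv.sumAssoc Unit Unit Unit).symm ≫ P.tens G.α (𝟙 (P.V Unit)) ≫
      P.perm (Equiv.sumAssoc Unit Unit Unit)) ≫ P.tens (𝟙 (P.V Unit)) G.α =
    P.tens (𝟙 (P.V Unit)) G.α ≫ P.perm (Equiv.sumAssoc Unit Unit Unit).symm ≫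
      P.tens G.α (𝟙 (P.V Unit)) ≫ P.perm (Equiv.sumAssoc Unit Unit Unit)
  neut_ev : G.α ≫ G.β = G.β
  coev_neut : G.δ ≫ G.α = G.δ
  swap_ev : P.perm (Equiv.sumComm Unit Unit) ≫ G.β = G.β
  dim : G.δ ≫ G.β = t • 𝟙 _
  zigzag : G.cup Unit ≫ P.perm (Equiv.sumAssoc Unit Unit Unit) ≫ P.tens (𝟙 (P.V Unit)) G.β ≫
    P.perm (Equiv.sumEmpty Unit Empty) = 𝟙 _
  trace : G.cup Unit ≫ P.perm (Equiv.sumAssoc Unit Unit Unit) ≫ P.tens (𝟙 (P.V Unit)) G.α ≫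
    P.perm (Equiv.sumAssoc Unit Unit Unit).symm ≫ G.cap Unit = 𝟙 _

end NeutGen

/-- The map from two points with the given values. -/
abbrev pairMap (i j : X) : Unit ⊕ Unit → X := Sum.elim (fun _ => i) (fun _ => j)

theorem pairMap_injective {i j : X} (h : i ≠ j) : Function.Injective (pairMap i j) := by
  rw [Sum.elim_injective]
  exact ⟨fun _ _ _ => rfl, fun _ _ _ => rfl, fun _ _ => h⟩

namespace NeutGen

variable {P : FinPow C} (G : P.NeutGen)

open Classical in
/-- The neutralizer of the factors `i` and `j`. -/
def al (i j : X) : P.V X ⟶ P.V X :=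
  -- With the identity as value for equal indices, the pairs absorbed by a morphism form a reflexive
  -- relation.
  if h : i = j then 𝟙 _ else P.actOn (pairMap i j) (pairMap_injective h) G.α

theorem al_self (i : X) : G.al i i = 𝟙 _ := by simp [al]

theorem al_of_ne {i j : X} (h : i ≠ j) :
    G.al i j = P.actOn (pairMap i j) (pairMap_injective h) G.α := by simp [al, h]

theorem actOn_congr {u w : Q → X} (hu : Function.Injective u) (h : u = w) (f : P.V Q ⟶ P.V Q) :
    P.actOn u hu f = P.actOn w (h ▸ hu) f := by subst h; rfl

theorem al_perm (i j : X) (e : X ≃ Y) : G.al i j ≫ P.perm e = P.perm e ≫ G.al (e i) (e j) := by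
  by_cases h : i = j
  · subst h; simp [al_self]
  · rw [al_of_ne _ h, al_of_ne _ (fun h' => h (e.injective h')), actOn_perm]
    congr 1
    apply actOn_congr
    funext q; rcases q with q | q <;> rfl

theorem al_inl_inl (R : Type) [Finite R] :
    G.al (X := (Unit ⊕ Unit) ⊕ R) (.inl (.inl ())) (.inl (.inr ())) = P.tens G.α (𝟙 _) := by
  rw [al_of_ne _ (by simp), P.actOn_eq _ _ G.α (Equiv.refl _) (by rintro (q | q) <;> rfl)]
  simp [perm_refl]

variable [Preadditive C] [Linear ℂ C] {G} {t : ℂ} (hG : G.Rel t)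
include hG

theorem Rel.al_idem (i j : X) : G.al i j ≫ G.al i j = G.al i j := by
  by_cases h : i = j
  · subst h; simp [al_self]
  · rw [al_of_ne _ h, actOn_comp, hG.idem]

end NeutGen
end FinPow

end

/-! ### Relations between the neutralizers of different pairs. -/

section

namespace FinPow

variable {C : Type u} [Category.{v} C] [MonoidalCategory C] [SymmetricCategory C]
variable (P : FinPow C)
variable {X Y Z Q R S : Type} [Finite X] [Finite Y] [Finite Z] [Finite Q] [Finite R] [Finite S]

/-- Two distinct points can be split off. -/
theorem exists_pair_split {i j : X} (h : i ≠ j) :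
    ∃ (T : Type) (_ : Finite T) (e : X ≃ (Unit ⊕ Unit) ⊕ T),
      e i = .inl (.inl ()) ∧ e j = .inl (.inr ()) := by
  refine ⟨_, inferInstance, splitEquiv _ (pairMap_injective h), ?_, ?_⟩ <;>
    rw [← Equiv.eq_symm_apply, splitEquiv_symm_inl] <;> rfl

theorem swap_inl (T : Type) [DecidableEq ((Unit ⊕ Unit) ⊕ T)] (x : (Unit ⊕ Unit) ⊕ T) :
    Equiv.swap (.inl (.inl ())) (.inl (.inr ())) x =
      Equiv.sumCongr (Equiv.sumComm Unit Unit) (Equiv.refl T) x := by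
  rcases x with (x | x) | x
  · exact Equiv.swap_apply_left _ _
  · exact Equiv.swap_apply_right _ _
  · exact Equiv.swap_apply_of_ne_of_ne (by simp) (by simp)

theorem tens_id_actOn (Q : Type) [Finite Q] (u : R → X) (hu : Function.Injective u)
    (f : P.V R ⟶ P.V R) : P.tens (𝟙 (P.V Q)) (P.actOn u hu f) =
      P.actOn (fun r => .inr (u r)) (Sum.inr_injective.comp hu) f := by
  have a1 := P.tens_leftComm (𝟙 (P.V Q)) f (𝟙 (P.V {x // x ∉ Set.range u}))
  rw [tens_id] at a1
  rw [P.actOn_eq (fun r => (.inr (u r) : Q ⊕ X)) (Sum.inr_injective.comp hu) f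
    ((Equiv.sumCongr (Equiv.refl Q) (splitEquiv u hu)).trans (leftComm _ _ _))
    (fun r => by simp [leftComm, splitEquiv_symm_inl]), actOn, ← perm_perm, Category.assoc,
    ← reassoc_of% a1, perm_perm, ← tens_id_perm]
  have h (f : P.V X ⟶ P.V (R ⊕ {x // x ∉ Set.range u})) (g : _ ⟶ P.V (R ⊕ {x // x ∉ Set.range u}))
      (k : _ ⟶ P.V X) : P.tens (𝟙 (P.V Q)) (f ≫ g ≫ k) =
      P.tens (𝟙 _) f ≫ P.tens (𝟙 _) g ≫ P.tens (𝟙 _) k := by simp [tens_comp]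
  rw [h, tens_id_perm (e := (splitEquiv u hu).symm)]
  congr 2
  exact P.perm_congr fun x => by rcases x with x | x <;> simp

theorem tens_actOn_id (Q : Type) [Finite Q] (u : R → X) (hu : Function.Injective u)
    (f : P.V R ⟶ P.V R) : P.tens (P.actOn u hu f) (𝟙 (P.V Q)) =
      P.actOn (fun r => .inl (u r)) (Sum.inl_injective.comp hu) f := by
  have h := P.tens_id_actOn Q u hu f
  have h2 := P.tens_comm (P.actOn u hu f) (𝟙 (P.V Q))
  rw [h, ← cancel_mono (P.perm (Equiv.sumComm Q X)), Category.assoc, Category.assoc,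
    P.actOn_perm _ _ _ (Equiv.sumComm Q X), perm_perm, ← Category.assoc (P.perm _), perm_perm,
    P.perm_eq_id (by simp), Category.comp_id, Category.id_comp] at h2
  exact h2

namespace NeutGen

variable {P : FinPow C} (G : P.NeutGen)

theorem al_eq_conj (i j : X) (e : X ≃ Y) :
    G.al i j = P.perm e ≫ G.al (e i) (e j) ≫ P.perm e.symm := by
  rw [← Category.assoc, ← al_perm, Category.assoc, P.perm_comp_symm, Category.comp_id]

theorem actOn_al (w : X → Y) (hw : Function.Injective w) (i j : X) (h : i ≠ j) :
    P.actOn w hw (G.al i j) = G.al (w i) (w j) := by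
  rw [al_of_ne _ h, al_of_ne _ (fun h' => h (hw h')), actOn_actOn]
  apply actOn_congr
  funext q; rcases q with q | q <;> rfl

theorem al_inr (i j : X) : G.al (X := Q ⊕ X) (.inr i) (.inr j) = P.tens (𝟙 _) (G.al i j) := by
  by_cases h : i = j
  · subst h; rw [al_self, al_self, tens_id]
  rw [al_of_ne _ h, al_of_ne _ (by simpa using h), tens_id_actOn]
  apply actOn_congr
  funext q; rcases q with q | q <;> rfl

theorem al_inl (i j : X) : G.al (X := X ⊕ Q) (.inl i) (.inl j) = P.tens (G.al i j) (𝟙 _) := by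
  by_cases h : i = j
  · subst h; rw [al_self, al_self, tens_id]
  rw [al_of_ne _ h, al_of_ne _ (by simpa using h), tens_actOn_id]
  apply actOn_congr
  funext q; rcases q with q | q <;> rfl

theorem al_pair : G.al (X := Unit ⊕ Unit) (.inl ()) (.inr ()) = G.α := by
  rw [al_of_ne _ (by simp), P.actOn_eq (R := Empty) _ _ G.α (Equiv.sumEmpty _ _).symm
    (by rintro (q | q) <;> rfl), Equiv.symm_symm, tens_right, perm_perm_assoc,
    P.perm_eq_id (by simp), Category.id_comp]

variable [Preadditive C] [Linear ℂ C] {G} {t : ℂ} (hG : G.Rel t)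
include hG

-- Conjugation by a splitting moves the two points to the front, where the claim is the relation
-- `neut_swap`.
open Classical in
theorem Rel.al_swap (i j : X) : G.al i j ≫ P.perm (Equiv.swap i j) = G.al i j := by
  by_cases h : i = j
  · subst h; rw [P.perm_eq_id (by simp), Category.comp_id]
  obtain ⟨T, _, e, hi, hj⟩ := exists_pair_split h
  rw [G.al_eq_conj i j e, hi, hj, al_inl_inl, Category.assoc, Category.assoc]
  have h1 : P.perm e.symm ≫ P.perm (Equiv.swap i j) =
      P.tens (P.perm (Equiv.sumComm Unit Unit)) (𝟙 _) ≫ P.perm e.symm := by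
    rw [tens_perm_id, perm_perm, perm_perm]
    refine P.perm_congr fun x => ?_
    rw [Equiv.trans_apply, Equiv.trans_apply, ← swap_inl, ← hi, ← hj, Equiv.eq_symm_apply]
    exact (Equiv.symm_trans_swap_trans i j e ▸ rfl :
      (e.symm.trans ((Equiv.swap i j).trans e)) x = Equiv.swap (e i) (e j) x)
  rw [h1, ← Category.assoc (P.tens _ _), tens_comp, hG.neut_swap, Category.comp_id]

open Classical in
theorem Rel.swap_al (i j : X) : P.perm (Equiv.swap i j) ≫ G.al i j = G.al i j := by
  by_cases h : i = j
  · subst h; rw [P.perm_eq_id (by simp), Category.id_comp]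
  obtain ⟨T, _, e, hi, hj⟩ := exists_pair_split h
  rw [G.al_eq_conj i j e, hi, hj, al_inl_inl]
  have h1 : P.perm (Equiv.swap i j) ≫ P.perm e =
      P.perm e ≫ P.tens (P.perm (Equiv.sumComm Unit Unit)) (𝟙 _) := by
    rw [tens_perm_id, perm_perm, perm_perm]
    refine P.perm_congr fun x => ?_
    rw [Equiv.trans_apply, Equiv.trans_apply, ← swap_inl, ← hi, ← hj]
    conv_lhs => rw [← e.symm_apply_apply x]
    exact (Equiv.symm_trans_swap_trans i j e ▸ rfl :
      (e.symm.trans ((Equiv.swap i j).trans e)) (e x) = Equiv.swap (e i) (e j) (e x))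
  rw [reassoc_of% h1, ← Category.assoc (P.tens _ _), tens_comp, hG.swap_neut, Category.comp_id]

/-- Conjugation by the transposition of `i` and `j` exchanges the two sides, and both sides absorb
this transposition. -/
theorem Rel.al_symm (i j : X) : G.al i j = G.al j i := by
  classical
  have h := G.al_perm i j (Equiv.swap i j)
  rw [hG.al_swap, Equiv.swap_apply_left, Equiv.swap_apply_right] at h
  rw [h, Equiv.swap_comm, hG.swap_al]

theorem Rel.al_exchange : G.al (X := Unit ⊕ (Unit ⊕ Unit)) (.inl ()) (.inr (.inl ())) ≫
    G.al (X := Unit ⊕ (Unit ⊕ Unit)) (.inr (.inl ())) (.inr (.inr ())) =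
    G.al (X := Unit ⊕ (Unit ⊕ Unit)) (.inr (.inl ())) (.inr (.inr ())) ≫
    G.al (X := Unit ⊕ (Unit ⊕ Unit)) (.inl ()) (.inr (.inl ())) := by
  have h1 := G.al_inr (Q := Unit) (X := Unit ⊕ Unit) (.inl ()) (.inr ())
  rw [al_pair] at h1
  have h2 : G.al (X := Unit ⊕ (Unit ⊕ Unit)) (.inl ()) (.inr (.inl ())) =
      P.perm (Equiv.sumAssoc Unit Unit Unit).symm ≫ P.tens G.α (𝟙 (P.V Unit)) ≫
      P.perm (Equiv.sumAssoc Unit Unit Unit) := by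
    have := G.al_inl (Q := Unit) (X := Unit ⊕ Unit) (.inl ()) (.inr ())
    rw [al_pair] at this
    rw [← this, G.al_eq_conj _ _ (Equiv.sumAssoc Unit Unit Unit).symm]
    rfl
  rw [h1, h2, hG.exchange]

/-- The exchange relation on three points, carried to `X` by the injection with values `i`, `j`,
`k`. -/
theorem Rel.al_comm_chain {i j k : X} (hij : i ≠ j) (hjk : j ≠ k) (hik : i ≠ k) :
    G.al i j ≫ G.al j k = G.al j k ≫ G.al i j := by
  let w : Unit ⊕ (Unit ⊕ Unit) → X := Sum.elim (fun _ => i) (pairMap j k)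
  have hw : Function.Injective w := by
    rw [Sum.elim_injective]
    refine ⟨fun _ _ _ => rfl, pairMap_injective hjk, ?_⟩
    rintro _ (_ | _) <;> assumption
  have h1 := G.actOn_al w hw (.inl ()) (.inr (.inl ())) (by simp)
  have h2 := G.actOn_al w hw (.inr (.inl ())) (.inr (.inr ())) (by simp)
  have := congrArg (P.actOn w hw) hG.al_exchange
  rw [← P.actOn_comp, ← P.actOn_comp, h1, h2] at this
  exact this

/-- Disjoint pairs commute by the interchange law. Pairs with one common point are brought into
chain position by the symmetry of neutralizers. The other cases are degenerate. -/
theorem Rel.al_comm (i j k l : X) : G.al i j ≫ G.al k l = G.al k l ≫ G.al i j := by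
  by_cases hij : i = j
  · subst hij; simp [al_self]
  by_cases hkl : k = l
  · subst hkl; simp [al_self]
  by_cases hik : i = k
  · subst hik
    by_cases hjl : j = l
    · subst hjl; rfl
    · rw [hG.al_symm i j, hG.al_comm_chain (Ne.symm hij) hkl hjl]
  by_cases hil : i = l
  · subst hil
    by_cases hjk : j = k
    · subst hjk; rw [hG.al_symm i j]
    · rw [hG.al_symm i j, hG.al_symm k i, hG.al_comm_chain (Ne.symm hij) hik hjk]
  by_cases hjk : j = k
  · subst hjk; exact hG.al_comm_chain hij hkl hil
  by_cases hjl : j = l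
  · subst hjl; rw [hG.al_symm k j]; exact hG.al_comm_chain hij (Ne.symm hkl) hik
  rw [al_of_ne _ hij, al_of_ne _ hkl]
  apply P.actOn_comm
  rintro (_ | _) (_ | _) <;> assumption

/-- The neutralizer of `i` and `j` absorbs their transposition, and this transposition conjugates
the neutralizers of `i, k` and `j, k` into each other. This makes merging a transitive operation. -/
theorem Rel.al_trans (i j k : X) : G.al i j ≫ G.al j k = G.al i j ≫ G.al i k := by
  classical
  by_cases hik : i = k
  · subst hik; rw [al_self, Category.comp_id, hG.al_symm j i, hG.al_idem]
  by_cases hjk : j = k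
  · subst hjk; rw [al_self, Category.comp_id, hG.al_idem]
  have h := G.al_perm i k (Equiv.swap i j)
  rw [Equiv.swap_apply_left, Equiv.swap_apply_of_ne_of_ne (Ne.symm hik) (Ne.symm hjk)] at h
  have h2 := congrArg (fun x => G.al i j ≫ x) h
  rw [← Category.assoc, hG.al_comm i j i k, Category.assoc, hG.al_swap, ← Category.assoc,
    hG.al_swap] at h2
  rw [← h2, hG.al_comm]

end NeutGen
end FinPow

end

/-! ### The idempotent that merges the blocks of an equivalence relation. -/

section

namespace FinPow

variable {C : Type u} [Category.{v} C] [MonoidalCategory C] [SymmetricCategory C]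
variable {X Y Z Q R S : Type} [Finite X] [Finite Y] [Finite Z] [Finite Q] [Finite R] [Finite S]

namespace NeutGen

variable {P : FinPow C} (G : P.NeutGen)

/-- The products of neutralizers of pairs of equivalent factors. -/
inductive Merge (p : Setoid X) : (P.V X ⟶ P.V X) → Prop
  | id : Merge p (𝟙 _)
  | cons {i j : X} (h : p i j) {F} (hF : Merge p F) : Merge p (G.al i j ≫ F)

variable {G}

theorem Merge.mono {p q : Setoid X} (h : p ≤ q) {F} (hF : G.Merge p F) : G.Merge q F := by
  induction hF with
  | id => exact .id
  | cons hij _ ih => exact .cons (h hij) ih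

theorem Merge.comp {p : Setoid X} {F F'} (hF : G.Merge p F) (hF' : G.Merge p F') :
    G.Merge p (F ≫ F') := by
  induction hF with
  | id => simpa using hF'
  | cons h _ ih => rw [Category.assoc]; exact .cons h ih

theorem Merge.al {p : Setoid X} {i j : X} (h : p i j) : G.Merge p (G.al i j) := by
  simpa using Merge.cons h (Merge.id (G := G))

theorem Merge.absorb {p : Setoid X} {F} (hF : G.Merge p F) {W : C} {K : P.V X ⟶ W}
    (h : ∀ i j, p i j → G.al i j ≫ K = K) : F ≫ K = K := by
  induction hF with
  | id => simp
  | cons hij _ ih => rw [Category.assoc, ih, h _ _ hij]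

theorem Merge.perm {p : Setoid X} {F} (hF : G.Merge p F) (e : X ≃ Y) :
    G.Merge (p.comap e.symm) (P.perm e.symm ≫ F ≫ P.perm e) := by
  induction hF with
  | id => rw [Category.id_comp, P.perm_symm_comp]; exact .id
  | @cons i j h F _ ih =>
    have h1 : P.perm e.symm ≫ (G.al i j ≫ F) ≫ P.perm e =
        G.al (e i) (e j) ≫ P.perm e.symm ≫ F ≫ P.perm e := by
      rw [Category.assoc, G.al_eq_conj i j e]
      simp only [Category.assoc]
      rw [← Category.assoc (P.perm e.symm), P.perm_symm_comp, Category.id_comp]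
    rw [h1]
    refine .cons ?_ ih
    simpa [Setoid.comap_rel] using h

theorem Merge.tens {p : Setoid X} {F} (hF : G.Merge p F) (Q : Type) [Finite Q] :
    G.Merge (p.map (Sum.inr : X → Q ⊕ X)) (P.tens (𝟙 (P.V Q)) F) := by
  induction hF with
  | id => rw [P.tens_id]; exact .id
  | @cons i j h F _ ih =>
    have : P.tens (𝟙 (P.V Q)) (G.al i j ≫ F) =
        G.al (.inr i) (.inr j) ≫ P.tens (𝟙 (P.V Q)) F := by
      rw [al_inr, P.tens_comp, Category.comp_id]
    rw [this]
    exact .cons (Relation.EqvGen.rel _ _ ⟨i, j, h, rfl, rfl⟩) ih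

/-- A product of neutralizers that absorbs the neutralizers of all pairs of equivalent factors. -/
structure IsE (p : Setoid X) (F : P.V X ⟶ P.V X) : Prop where
  merge : G.Merge p F
  absorb : ∀ i j, p i j → G.al i j ≫ F = F

/-- The equivalence relation generated by one pair. -/
def pairRel (i j : X) : Setoid X := Relation.EqvGen.setoid fun a b => a = i ∧ b = j

theorem pairRel_rel (i j : X) : pairRel i j i j := Relation.EqvGen.rel _ _ ⟨rfl, rfl⟩

theorem pairRel_le_iff {i j : X} {s : Setoid X} : pairRel i j ≤ s ↔ s i j :=
  ⟨fun h => h (pairRel_rel i j), fun h => Setoid.eqvGen_le (by rintro _ _ ⟨rfl, rfl⟩; exact h)⟩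

variable [Preadditive C] [Linear ℂ C] {t : ℂ} (hG : G.Rel t)
include hG

theorem Rel.merge_al_comm {p : Setoid X} {F} (hF : G.Merge p F) (k l : X) :
    F ≫ G.al k l = G.al k l ≫ F := by
  induction hF with
  | id => simp
  | cons _ _ ih => rw [Category.assoc, ih, ← Category.assoc, hG.al_comm, Category.assoc]

theorem Rel.merge_comm {p q : Setoid X} {F F'} (hF : G.Merge p F) (hF' : G.Merge q F') :
    F ≫ F' = F' ≫ F := by
  induction hF' with
  | id => simp
  | cons _ _ ih =>
    rw [← Category.assoc, hG.merge_al_comm hF, Category.assoc, ih, Category.assoc]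

/-- The two products commute and each absorbs the other. Hence the merging idempotent depends only
on the equivalence relation. -/
theorem Rel.isE_unique {p : Setoid X} {F F'} (hF : G.IsE p F) (hF' : G.IsE p F') : F = F' := by
  rw [← hF'.merge.absorb hF.absorb, hG.merge_comm hF'.merge hF.merge, hF.merge.absorb hF'.absorb]

/-- The pairs of factors whose neutralizer is absorbed by a morphism. -/
def Rel.stab {W : C} (K : P.V X ⟶ W) : Setoid X where
  r i j := G.al i j ≫ K = K
  iseqv :=
    { refl i := by rw [al_self, Category.id_comp]
      symm {i j} h := by rwa [hG.al_symm]
      trans {i j k} h1 h2 := by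
        -- The neutralizer of `i` and `j` is inserted in front of `K`; in its presence that of `i,
        -- k` may be traded for that of `j, k`, which `K` absorbs.
        have h3 := hG.al_trans i j k
        have h4 : G.al i k ≫ K = G.al i k ≫ G.al i j ≫ K := by rw [h1]
        rw [h4, ← Category.assoc, hG.al_comm, ← h3, Category.assoc, h2, h1] }

/-- Since `Rel.stab` is an equivalence relation, absorption has to be checked only for pairs that
generate `p`. -/
theorem Rel.isE_of_le {p : Setoid X} {F} (h1 : G.Merge p F) (h2 : p ≤ hG.stab F) : G.IsE p F :=
  ⟨h1, fun _ _ h => h2 h⟩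

theorem Rel.isE_sup {p q : Setoid X} {F F'} (hF : G.IsE p F) (hF' : G.IsE q F') :
    G.IsE (p ⊔ q) (F ≫ F') := by
  refine hG.isE_of_le ((hF.merge.mono le_sup_left).comp (hF'.merge.mono le_sup_right))
    (sup_le (fun i j h => ?_) fun i j h => ?_)
  · change G.al i j ≫ F ≫ F' = _
    rw [← Category.assoc, hF.absorb _ _ h]
  · change G.al i j ≫ F ≫ F' = _
    rw [hG.merge_comm hF.merge hF'.merge, ← Category.assoc, hF'.absorb _ _ h]

theorem Rel.isE_pair (i j : X) : G.IsE (pairRel i j) (G.al i j) :=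
  hG.isE_of_le (.al (pairRel_rel i j)) (pairRel_le_iff.2 (hG.al_idem i j))

/-- By finiteness one can multiply the neutralizers of all related pairs; each of them is absorbed
because they commute and are idempotent. -/
theorem Rel.exists_isE (p : Setoid X) : ∃ F, G.IsE p F := by
  classical
  have := Fintype.ofFinite X
  have key : ∀ s : Finset (X × X), ∃ F, G.Merge p F ∧
      ∀ i j, p i j → (i, j) ∈ s → G.al i j ≫ F = F := by
    intro s
    induction s using Finset.induction_on with
    | empty => exact ⟨_, .id, by simp⟩
    | insert a s _ ih =>
      obtain ⟨F, h1, h2⟩ := ih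
      by_cases ha : p a.1 a.2
      · refine ⟨_, .cons ha h1, fun i j hij hm => ?_⟩
        rcases Finset.mem_insert.1 hm with rfl | hm
        · rw [← Category.assoc, hG.al_idem]
        · rw [← Category.assoc, hG.al_comm, Category.assoc, h2 i j hij hm]
      · refine ⟨F, h1, fun i j hij hm => ?_⟩
        rcases Finset.mem_insert.1 hm with rfl | hm
        · exact absurd hij ha
        · exact h2 i j hij hm
  obtain ⟨F, h1, h2⟩ := key Finset.univ
  exact ⟨F, h1, fun i j h => h2 i j h (Finset.mem_univ _)⟩

theorem IsE.perm {p : Setoid X} {F} (hF : G.IsE p F) (e : X ≃ Y) :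
    G.IsE (p.comap e.symm) (P.perm e.symm ≫ F ≫ P.perm e) := by
  refine ⟨hF.merge.perm e, fun i j h => ?_⟩
  rw [← Category.assoc, G.al_perm, Category.assoc, ← Category.assoc (G.al _ _),
    hF.absorb _ _ h]

theorem Rel.isE_tens {p : Setoid X} {F} (hF : G.IsE p F) (Q : Type) [Finite Q] :
    G.IsE (p.map (Sum.inr : X → Q ⊕ X)) (P.tens (𝟙 (P.V Q)) F) := by
  refine hG.isE_of_le (hF.merge.tens Q) ((map_le_iff _ _ _).2 fun i j h => ?_)
  change G.al _ _ ≫ _ = _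
  rw [al_inr, P.tens_comp, Category.comp_id, hF.absorb _ _ h]

/-- A permutation that preserves every block is a product of transpositions of related points, and
each of these is absorbed by the corresponding neutralizer. This is why the choice of a pairing
inside the blocks will not matter. -/
theorem Rel.isE_comp_perm {p : Setoid X} {F} (hF : G.IsE p F) (σ : X ≃ X)
    (hσ : ∀ x, p x (σ x)) : F ≫ P.perm σ = F := by
  classical
  have := Fintype.ofFinite X
  induction h : (Equiv.Perm.support σ).card using Nat.strong_induction_on generalizing σ with
  | _ n ih =>
  by_cases h1 : ∃ x, σ x ≠ x
  · obtain ⟨x, hx⟩ := h1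
    have h2 := Equiv.Perm.card_support_swap_mul hx
    -- Following `σ` by this transposition makes `x` a fixed point, so the support shrinks, and the
    -- result still preserves the blocks.
    have h3 : F ≫ P.perm (Equiv.swap x (σ x) * σ : Equiv.Perm X) = F := by
      refine ih _ (h ▸ h2) _ (fun y => ?_) rfl
      rw [Equiv.Perm.mul_apply]
      rcases eq_or_ne (σ y) x with h4 | h4
      · rw [h4, Equiv.swap_apply_left]
        exact p.trans' (h4 ▸ hσ y) (hσ x)
      rcases eq_or_ne (σ y) (σ x) with h5 | h5
      · rw [h5, Equiv.swap_apply_right]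
        rw [σ.injective h5]
      · rw [Equiv.swap_apply_of_ne_of_ne h4 h5]
        exact hσ y
    have h4 : P.perm σ = P.perm (Equiv.swap x (σ x) * σ : Equiv.Perm X) ≫
        P.perm (Equiv.swap x (σ x)) := by
      rw [P.perm_perm]
      exact P.perm_congr fun y => by simp [Equiv.Perm.mul_apply]
    rw [h4, ← Category.assoc, h3]
    have h5 : F = F ≫ G.al x (σ x) := by
      rw [hG.merge_al_comm hF.merge, hF.absorb _ _ (hσ x)]
    rw [h5, Category.assoc, hG.al_swap]
  · push Not at h1
    rw [P.perm_eq_id h1, Category.comp_id]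

end NeutGen
end FinPow

end

/-! ### Caps, cups and the evaluation of two copies of a finite set. -/

section

/-- A bijection between a nonempty initial segment and a shorter one with one more point. -/
def finU (n : ℕ) : Fin (n + 1) ≃ Unit ⊕ Fin n :=
  (finSuccEquiv n).trans ((Equiv.optionEquivSumPUnit _).trans (Equiv.sumComm _ _))

namespace FinPow

variable {C : Type u} [Category.{v} C] [MonoidalCategory C] [SymmetricCategory C]
variable {X Y Z Q R S T : Type} [Finite X] [Finite Y] [Finite Z] [Finite Q] [Finite R] [Finite S]
  [Finite T]

namespace NeutGen

variable {P : FinPow C} (G : P.NeutGen)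

theorem tens_cap (f : P.V X ⟶ P.V Y) : P.tens (𝟙 _) f ≫ G.cap Y = G.cap X ≫ f := by
  rw [cap, cap, ← Category.assoc, P.tens_comp, Category.id_comp, Category.assoc, ← P.tens_left,
    ← Category.assoc, P.tens_comp, Category.comp_id, Category.id_comp, Category.comp_id]

theorem cup_tens (f : P.V X ⟶ P.V Y) : G.cup X ≫ P.tens (𝟙 _) f = f ≫ G.cup Y := by
  have h : P.perm (Equiv.emptySum Empty X).symm ≫ P.tens (𝟙 (P.V Empty)) f =
      f ≫ P.perm (Equiv.emptySum Empty Y).symm := by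
    rw [← cancel_mono (P.perm (Equiv.emptySum Empty Y)), Category.assoc, P.tens_left,
      ← Category.assoc, P.perm_symm_comp, Category.assoc, P.perm_symm_comp, Category.id_comp,
      Category.comp_id]
  rw [cup, cup, ← reassoc_of% h, Category.assoc, P.tens_comp, P.tens_comp, Category.comp_id,
    Category.comp_id, Category.id_comp, Category.id_comp]

theorem cap_perm (e : X ≃ Y) : P.perm (Equiv.sumCongr (Equiv.refl _) e) ≫ G.cap Y =
    G.cap X ≫ P.perm e := by
  rw [← P.tens_id_perm, tens_cap]

theorem cup_perm (e : X ≃ Y) : G.cup X ≫ P.perm (Equiv.sumCongr (Equiv.refl _) e) =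
    P.perm e ≫ G.cup Y := by
  rw [← P.tens_id_perm, cup_tens]

theorem cap_tens (X Y : Type) [Finite X] [Finite Y] : P.tens (G.cap X) (𝟙 (P.V Y)) =
    P.perm (Equiv.sumAssoc _ _ _) ≫ G.cap (X ⊕ Y) := by
  have h := P.tens_assoc G.β (𝟙 (P.V X)) (𝟙 (P.V Y))
  rw [P.tens_id] at h
  have h2 : P.tens (P.perm (Equiv.emptySum Empty X)) (𝟙 (P.V Y)) =
      P.perm (Equiv.sumAssoc Empty X Y) ≫ P.perm (Equiv.emptySum Empty (X ⊕ Y)) := by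
    rw [P.tens_perm_id, P.perm_perm]
    exact P.perm_congr fun x => by rcases x with (x | x) | x <;> first | exact x.elim | simp
  have h3 : P.tens (G.cap X) (𝟙 (P.V Y)) = P.tens (P.tens G.β (𝟙 (P.V X))) (𝟙 (P.V Y)) ≫
      P.tens (P.perm (Equiv.emptySum Empty X)) (𝟙 (P.V Y)) := by
    rw [P.tens_comp, cap, Category.comp_id]
  rw [h3, h2, reassoc_of% h, cap]

theorem cup_tens_id (X Y : Type) [Finite X] [Finite Y] : P.tens (G.cup X) (𝟙 (P.V Y)) =
    G.cup (X ⊕ Y) ≫ P.perm (Equiv.sumAssoc _ _ _).symm := by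
  have h := P.tens_assoc_symm G.δ (𝟙 (P.V X)) (𝟙 (P.V Y))
  rw [P.tens_id] at h
  have h2 : P.tens (P.perm (Equiv.emptySum Empty X).symm) (𝟙 (P.V Y)) =
      P.perm (Equiv.emptySum Empty (X ⊕ Y)).symm ≫ P.perm (Equiv.sumAssoc Empty X Y).symm := by
    rw [P.tens_perm_id, P.perm_perm]
    exact P.perm_congr fun x => by rcases x with x | x <;> simp
  have h3 : P.tens (G.cup X) (𝟙 (P.V Y)) =
      P.tens (P.perm (Equiv.emptySum Empty X).symm) (𝟙 (P.V Y)) ≫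
       P.tens (P.tens G.δ (𝟙 (P.V X))) (𝟙 (P.V Y)) := by
    rw [P.tens_comp, cup, Category.comp_id]
  rw [h3, h2, cup, Category.assoc, Category.assoc, ← h]

/-- Two evaluations side by side can be performed in either order, because both end in the empty
power. -/
theorem cap_cap (R : Type) [Finite R] : P.perm (leftComm _ _ _) ≫ G.cap ((Unit ⊕ Unit) ⊕ R) ≫ G.cap R =
    G.cap ((Unit ⊕ Unit) ⊕ R) ≫ G.cap R := by
  have h1 : G.cap ((Unit ⊕ Unit) ⊕ R) ≫ G.cap R = P.tens G.β (P.tens G.β (𝟙 (P.V R))) ≫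
      P.perm (Equiv.sumCongr (Equiv.refl _) (Equiv.emptySum Empty R)) ≫
      P.perm (Equiv.emptySum Empty R) := by
    rw [← tens_cap, ← P.tens_id_perm, ← Category.assoc (P.tens G.β _), P.tens_comp,
      Category.comp_id, cap, ← Category.assoc, P.tens_comp, Category.id_comp, Category.comp_id]
  rw [h1, ← Category.assoc, ← P.tens_leftComm, Category.assoc]
  congr 1
  rw [P.perm_perm, P.perm_perm]
  exact P.perm_congr fun x => by rcases x with x | x | x <;> first | exact x.elim | simp [leftComm]

/-- The evaluation of a sum of two copies of an initial segment. -/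
def evF : ∀ n : ℕ, P.V (Fin n ⊕ Fin n) ⟶ P.V Empty
  | 0 => P.perm (Equiv.equivOfIsEmpty _ _)
  | n + 1 => P.perm (Equiv.sumCongr (finU n) (finU n)) ≫
      P.perm (Equiv.sumSumSumComm Unit (Fin n) Unit (Fin n)) ≫ G.cap (Fin n ⊕ Fin n) ≫ evF n

/-- The evaluation of a sum of two copies. -/
def evV (T : Type) [Finite T] : P.V (T ⊕ T) ⟶ P.V Empty :=
  P.perm (Equiv.sumCongr (Finite.equivFin T) (Finite.equivFin T)) ≫ G.evF (Nat.card T)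

/-- The inductive step for invariance under simultaneous permutation of both copies. Transpositions
generate; those that fix the first point are covered by `ih`, and every other one is conjugate, by
such permutations, to the exchange of the first two pairs. -/
theorem evF_perm_sum (n : ℕ) (ih : ∀ σ : Equiv.Perm (Fin n),
      P.perm (Equiv.sumCongr σ σ) ≫ G.evF n = G.evF n) (σ : Equiv.Perm (Unit ⊕ Fin n)) :
    P.perm (Equiv.sumCongr σ σ) ≫
      P.perm (Equiv.sumSumSumComm Unit (Fin n) Unit (Fin n)) ≫ G.cap (Fin n ⊕ Fin n) ≫ G.evF n =
      P.perm (Equiv.sumSumSumComm Unit (Fin n) Unit (Fin n)) ≫ G.cap (Fin n ⊕ Fin n) ≫ G.evF n := by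
  classical
  set E := P.perm (Equiv.sumSumSumComm Unit (Fin n) Unit (Fin n)) ≫
    G.cap (Fin n ⊕ Fin n) ≫ G.evF n with hE
  have hmul : ∀ σ τ : Equiv.Perm (Unit ⊕ Fin n), P.perm (Equiv.sumCongr (σ * τ) (σ * τ)) =
      P.perm (Equiv.sumCongr τ τ) ≫ P.perm (Equiv.sumCongr σ σ) := by
    intro σ τ
    rw [P.perm_perm]
    exact P.perm_congr fun x => by rcases x with x | x <;> rfl
  have hr : ∀ τ : Equiv.Perm (Fin n),
      P.perm (Equiv.sumCongr (Equiv.sumCongr (Equiv.refl Unit) τ)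
        (Equiv.sumCongr (Equiv.refl Unit) τ)) ≫ E = E := by
    intro τ
    rw [hE, P.perm_perm_assoc]
    conv_rhs => rw [← ih τ, ← Category.assoc (G.cap _), ← G.cap_perm, Category.assoc,
      P.perm_perm_assoc]
    congr 1
    exact P.perm_congr fun x => by rcases x with (x | x) | (x | x) <;> simp
  have hs : ∀ y : Fin n, P.perm (Equiv.sumCongr (Equiv.swap (.inl ()) (.inr y))
      (Equiv.swap (.inl ()) (.inr y))) ≫ E = E := by
    intro y
    rcases n with _ | m
    · exact y.elim0
    -- The exchange of the first two pairs is `cap_cap`, once two evaluations have been unfolded.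
    have h0 : P.perm (Equiv.sumCongr (Equiv.swap (.inl ()) (.inr ((finU m).symm (.inl ()))))
        (Equiv.swap (.inl ()) (.inr ((finU m).symm (.inl ()))))) ≫ E = E := by
      have hE2 : E = P.perm ((Equiv.sumSumSumComm Unit (Fin (m + 1)) Unit (Fin (m + 1))).trans
          (Equiv.sumCongr (Equiv.refl _) ((Equiv.sumCongr (finU m) (finU m)).trans
          (Equiv.sumSumSumComm Unit (Fin m) Unit (Fin m))))) ≫
          G.cap ((Unit ⊕ Unit) ⊕ (Fin m ⊕ Fin m)) ≫ G.cap (Fin m ⊕ Fin m) ≫ G.evF m := by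
        rw [hE, ← P.perm_perm, Category.assoc, reassoc_of% G.cap_perm, evF, ← P.perm_perm_assoc]
      have h1 : P.perm (Equiv.sumCongr (Equiv.swap (.inl ()) (.inr ((finU m).symm (.inl ()))))
          (Equiv.swap (.inl ()) (.inr ((finU m).symm (.inl ()))))) ≫
          P.perm ((Equiv.sumSumSumComm Unit (Fin (m + 1)) Unit (Fin (m + 1))).trans
          (Equiv.sumCongr (Equiv.refl _) ((Equiv.sumCongr (finU m) (finU m)).trans
          (Equiv.sumSumSumComm Unit (Fin m) Unit (Fin m))))) =
          P.perm ((Equiv.sumSumSumComm Unit (Fin (m + 1)) Unit (Fin (m + 1))).trans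
          (Equiv.sumCongr (Equiv.refl _) ((Equiv.sumCongr (finU m) (finU m)).trans
          (Equiv.sumSumSumComm Unit (Fin m) Unit (Fin m))))) ≫ P.perm (leftComm _ _ _) := by
        rw [P.perm_perm, P.perm_perm]
        refine P.perm_congr fun x => ?_
        rcases x with (x | x) | (x | x)
        · simp [leftComm]
        · obtain ⟨x, rfl⟩ := (finU m).symm.surjective x
          rcases x with x | x
          · simp [leftComm]
          · rw [Equiv.trans_apply, Equiv.sumCongr_apply, Sum.map_inl,
              Equiv.swap_apply_of_ne_of_ne (by simp) (by simp)]
            simp [leftComm]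
        · simp [leftComm]
        · obtain ⟨x, rfl⟩ := (finU m).symm.surjective x
          rcases x with x | x
          · simp [leftComm]
          · rw [Equiv.trans_apply, Equiv.sumCongr_apply, Sum.map_inr,
              Equiv.swap_apply_of_ne_of_ne (by simp) (by simp)]
            simp [leftComm]
      rw [hE2, reassoc_of% h1, reassoc_of% G.cap_cap]
    have h1 := hr (Equiv.swap y ((finU m).symm (.inl ())))
    -- The transposition of the first point with `y` is a conjugate of the one in `h0` by a
    -- transposition in the tail.
    have h2 : P.perm (Equiv.sumCongr (Equiv.swap (.inl ()) (.inr y))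
        (Equiv.swap (.inl ()) (.inr y))) =
        P.perm (Equiv.sumCongr (Equiv.sumCongr (Equiv.refl Unit)
          (Equiv.swap y ((finU m).symm (.inl ())))) (Equiv.sumCongr (Equiv.refl Unit)
          (Equiv.swap y ((finU m).symm (.inl ()))))) ≫
        P.perm (Equiv.sumCongr (Equiv.swap (.inl ()) (.inr ((finU m).symm (.inl ()))))
          (Equiv.swap (.inl ()) (.inr ((finU m).symm (.inl ()))))) ≫
        P.perm (Equiv.sumCongr (Equiv.sumCongr (Equiv.refl Unit)
          (Equiv.swap y ((finU m).symm (.inl ())))) (Equiv.sumCongr (Equiv.refl Unit)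
          (Equiv.swap y ((finU m).symm (.inl ()))))) := by
      set τ := Equiv.sumCongr (Equiv.refl Unit) (Equiv.swap y ((finU m).symm (.inl ())))
      have h3 : Equiv.swap (.inl ()) (.inr y) =
          (τ.trans (Equiv.swap (.inl ()) (.inr ((finU m).symm (.inl ()))))).trans τ := by
        have h4 := Equiv.symm_trans_swap_trans (.inl ()) (.inr ((finU m).symm (.inl ()))) τ
        have h5 : τ.symm = τ := by
          ext x; rcases x with x | x <;> simp [τ]
        rw [h5] at h4
        rw [h4, show τ (.inl ()) = .inl () from rfl, show τ (.inr ((finU m).symm (.inl ()))) = .inr y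
          from congrArg Sum.inr (Equiv.swap_apply_right _ _)]
      rw [h3, P.perm_perm, P.perm_perm]
      exact P.perm_congr fun x => by rcases x with x | x <;> rfl
    rw [h2, Category.assoc, Category.assoc, h1, h0, h1]
  induction σ using Equiv.Perm.swap_induction_on with
  | one => rw [P.perm_eq_id, Category.id_comp]; rintro (x | x) <;> rfl
  | swap_mul σ x y hxy h =>
    rw [hmul, Category.assoc]
    refine Eq.trans (congrArg _ ?_) h
    rcases x with x | x <;> rcases y with y | y
    · exact absurd rfl hxy
    · exact hs y
    · rw [Equiv.swap_comm]; exact hs x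
    · have h1 : Equiv.swap (Sum.inr x) (Sum.inr y) =
          Equiv.sumCongr (Equiv.refl Unit) (Equiv.swap x y) := by
        ext z
        rcases z with z | z
        · rw [Equiv.swap_apply_of_ne_of_ne (by simp) (by simp)]; rfl
        · simp only [Equiv.sumCongr_apply, Sum.map_inr, Equiv.swap_apply_def, Sum.inr.injEq]
          split_ifs <;> rfl
      rw [h1]
      exact hr (Equiv.swap x y)

theorem evF_perm (n : ℕ) (σ : Equiv.Perm (Fin n)) :
    P.perm (Equiv.sumCongr σ σ) ≫ G.evF n = G.evF n := by
  induction n with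
  | zero => rw [P.perm_eq_id (fun x => by rcases x with x | x <;> exact x.elim0), Category.id_comp]
  | succ n ih =>
    have h := G.evF_perm_sum n ih (((finU n).symm.trans σ).trans (finU n))
    rw [evF]
    conv_rhs => rw [← h]
    simp only [P.perm_perm_assoc]
    congr 1
    exact P.perm_congr fun x => by rcases x with x | x <;> simp

/-- The enumeration in the definition is irrelevant, as two enumerations differ by a simultaneous
permutation of both copies. -/
theorem evV_perm (e : S ≃ T) : P.perm (Equiv.sumCongr e e) ≫ G.evV T = G.evV S := by
  have key : ∀ {n : ℕ} (f : S ≃ Fin n), P.perm (Equiv.sumCongr f f) ≫ G.evF n = G.evV S := by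
    intro n f
    obtain rfl : Nat.card S = n := by simpa using Nat.card_congr f
    rw [evV]
    conv_lhs => rw [← G.evF_perm _ (f.symm.trans (Finite.equivFin S)), P.perm_perm_assoc]
    congr 1
    exact P.perm_congr fun x => by rcases x with x | x <;> simp
  rw [← key (e.trans (Finite.equivFin T)), evV, P.perm_perm_assoc]
  congr 1
  exact P.perm_congr fun x => by rcases x with x | x <;> simp

theorem evV_fin (n : ℕ) : G.evV (Fin n) = G.evF n := by
  have key : ∀ {m : ℕ} (f : Fin n ≃ Fin m), P.perm (Equiv.sumCongr f f) ≫ G.evF m = G.evF n := by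
    intro m f
    obtain rfl : n = m := by simpa using Nat.card_congr f
    exact G.evF_perm _ _
  exact key _

theorem evV_empty : G.evV Empty = P.perm (Equiv.sumEmpty Empty Empty) := by
  rw [← G.evV_perm (Equiv.equivOfIsEmpty Empty (Fin 0)), evV_fin, evF, P.perm_perm]
  exact P.perm_congr fun x => by rcases x with x | x <;> exact x.elim

theorem evV_unit (T : Type) [Finite T] : G.evV (Unit ⊕ T) =
    P.perm (Equiv.sumSumSumComm Unit T Unit T) ≫ G.cap (T ⊕ T) ≫ G.evV T := by
  rw [← G.evV_perm ((Equiv.sumCongr (Equiv.refl Unit) (Finite.equivFin T)).trans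
    (finU (Nat.card T)).symm), evV_fin, evF, ← G.evV_perm (Finite.equivFin T), evV_fin,
    ← reassoc_of% G.cap_perm, P.perm_perm_assoc, P.perm_perm_assoc, P.perm_perm_assoc]
  congr 1
  exact P.perm_congr fun x => by rcases x with (x | x) | (x | x) <;> simp

end NeutGen
end FinPow

end

/-! ### Pairings of even partitions and the normal form of morphisms to the unit. -/

section

section Pairings

variable {X Y T T' : Type} [Finite X] [Finite Y] [Finite T] [Finite T']

open Classical in
/-- The indicator function of the labellings that are constant on the blocks. -/
def ind (p : Setoid X) (f : X → Bool) : ℕ := if p ≤ Setoid.ker f then 1 else 0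

theorem ind_eq_one {p : Setoid X} {f : X → Bool} (h : p ≤ Setoid.ker f) : ind p f = 1 := if_pos h

theorem ind_eq_zero {p : Setoid X} {f : X → Bool} (h : ¬ p ≤ Setoid.ker f) : ind p f = 0 := if_neg h

theorem ind_congr {p : Setoid X} {q : Setoid Y} {f : X → Bool} {g : Y → Bool}
    (h : p ≤ Setoid.ker f ↔ q ≤ Setoid.ker g) : ind p f = ind q g := by
  unfold ind
  by_cases h1 : q ≤ Setoid.ker g
  · rw [if_pos h1, if_pos (h.2 h1)]
  · rw [if_neg h1, if_neg (fun h2 => h1 (h.1 h2))]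

theorem ind_eq_ite {p : Setoid X} {q : Setoid Y} {f : X → Bool} {g : Y → Bool} {A : Prop}
    [Decidable A] (h : p ≤ Setoid.ker f ↔ A ∧ q ≤ Setoid.ker g) :
    ind p f = if A then ind q g else 0 := by
  split_ifs with hA
  · exact ind_congr (h.trans (and_iff_right hA))
  · exact ind_eq_zero fun h1 => hA (h.1 h1).1

theorem ind_const (p : Setoid X) (b : Bool) : ind p (fun _ => b) = 1 :=
  ind_eq_one fun _ _ _ => rfl

/-- A constant labelling is compatible with every partition, so it reveals the exponent. The
compatible labellings then recover the equivalence relation. -/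
theorem eq_of_ind {p q : Setoid X} {a b : ℕ} (h : ∀ f, 2 ^ a * ind p f = 2 ^ b * ind q f) :
    a = b ∧ p = q := by
  have h0 := h fun _ => true
  simp only [ind_const, mul_one] at h0
  obtain rfl : a = b := Nat.pow_right_injective le_rfl h0
  have h1 : ∀ f, ind p f = ind q f := fun f => mul_left_cancel₀ (by positivity) (h f)
  refine ⟨rfl, le_antisymm (setoid_le_of_ker _ _ fun f hf => ?_)
    (setoid_le_of_ker _ _ fun f hf => ?_)⟩
  · by_contra h3
    simpa [ind_eq_one hf, ind_eq_zero h3] using h1 f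
  · by_contra h3
    simpa [ind_eq_one hf, ind_eq_zero h3] using h1 f

/-- A pairing of the points within the blocks. -/
def IsPairing (p : Setoid X) (e : X ≃ T ⊕ T) : Prop := ∀ s, p (e.symm (.inl s)) (e.symm (.inr s))

/-- The points of a block correspond to two copies of the pairs in it. -/
def pairingFiber {p : Setoid X} {e : X ≃ T ⊕ T} (he : IsPairing p e) (q : Quotient p) :
    {x : X // Quotient.mk p x = q} ≃
      {s : T // Quotient.mk p (e.symm (.inl s)) = q} ⊕ {s : T // Quotient.mk p (e.symm (.inl s)) = q} :=
  (e.subtypeEquiv (q := fun z => Quotient.mk p (e.symm z) = q) (fun x => by simp)).trans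
    (Equiv.subtypeSum.trans (Equiv.sumCongr (Equiv.refl _)
      (Equiv.subtypeEquivRight fun s => by rw [Quotient.sound (he s)])))

/-- In either pairing the number of pairs in a block is half the size of the block, so the pairs can
be matched block by block. -/
theorem IsPairing.exists_equiv {p : Setoid X} {e : X ≃ T ⊕ T} {e' : X ≃ T' ⊕ T'}
    (he : IsPairing p e) (he' : IsPairing p e') :
    ∃ θ : T ≃ T', ∀ s, p (e.symm (.inl s)) (e'.symm (.inl (θ s))) := by
  have h : ∀ q : Quotient p, Nonempty ({s : T // Quotient.mk p (e.symm (.inl s)) = q} ≃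
      {s : T' // Quotient.mk p (e'.symm (.inl s)) = q}) := by
    intro q
    have h1 := Nat.card_congr ((pairingFiber he q).symm.trans (pairingFiber he' q))
    rw [Nat.card_sum, Nat.card_sum] at h1
    exact Finite.card_eq.1 (by omega)
  refine ⟨Equiv.ofFiberEquiv (f := fun s => Quotient.mk p (e.symm (.inl s)))
    (g := fun s => Quotient.mk p (e'.symm (.inl s))) (fun q => (h q).some), fun s => ?_⟩
  exact Quotient.exact (Equiv.ofFiberEquiv_map (f := fun s => Quotient.mk p (e.symm (.inl s)))
    (g := fun s => Quotient.mk p (e'.symm (.inl s))) (fun q => (h q).some) s).symm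

/-- Each block of even size is cut into two halves of equal size. This is where evenness of the
partitions enters. -/
theorem IsEven.exists_pairing {p : Setoid X} (hp : IsEven p) :
    ∃ (T : Type) (_ : Finite T) (e : X ≃ T ⊕ T), IsPairing p e := by
  have h : ∀ q : Quotient p, ∃ k : ℕ, Nonempty ({x : X // Quotient.mk p x = q} ≃ Fin k ⊕ Fin k) := by
    intro q
    induction q using Quotient.inductionOn with
    | _ v =>
    obtain ⟨k, hk⟩ := hp v
    refine ⟨k, Finite.card_eq.1 ?_⟩
    rw [Nat.card_sum, Nat.card_fin, ← hk, ← Nat.card_coe_set_eq]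
    exact Nat.card_congr (Equiv.subtypeEquivRight fun w =>
      ⟨fun h => p.symm' (Quotient.exact h), fun h => Quotient.sound (p.symm' h)⟩)
  choose k hk using h
  let E := fun q => (hk q).some
  refine ⟨Σ q, Fin (k q), inferInstance, (Equiv.sigmaFiberEquiv (Quotient.mk p)).symm.trans
    ((Equiv.sigmaCongrRight E).trans (Equiv.sigmaSumDistrib _ _)), ?_⟩
  rintro ⟨q, i⟩
  have h1 := ((E q).symm (.inl i)).2
  have h2 := ((E q).symm (.inr i)).2
  exact Quotient.exact (h1.trans h2.symm)

theorem cnt_comp_equiv (e : X ≃ Y) (f : Y → Bool) : cnt (fun x => f (e x)) = cnt f := by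
  simp only [cnt, ← Nat.card_coe_set_eq, Set.coe_ofPred]
  exact Nat.card_congr (e.subtypeEquiv fun _ => Iff.rfl)

theorem cnt_sum_elim (f : X → Bool) (g : Y → Bool) : cnt (Sum.elim f g) = cnt f + cnt g :=
  cnt_sum _

theorem isEven_iff_cnt (p : Setoid X) :
    IsEven p ↔ ∀ f : X → Bool, p ≤ Setoid.ker f → Even (cnt f) := isEven_iff p

theorem IsPairing.isEven {p : Setoid X} {e : X ≃ T ⊕ T} (he : IsPairing p e) : IsEven p := by
  rw [isEven_iff_cnt]
  intro f hf
  rw [← cnt_comp_equiv e.symm f]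
  have : (fun x => f (e.symm x)) = Sum.elim (fun s => f (e.symm (.inl s)))
      (fun s => f (e.symm (.inl s))) := by
    funext x
    rcases x with x | x
    · rfl
    · exact (hf (he x)).symm
  rw [this, cnt_sum_elim]
  exact ⟨_, rfl⟩

theorem cnt_const_pair (b : Bool) : Even (cnt (fun _ : Unit ⊕ Unit => b)) := by
  have := cnt_sum_elim (fun _ : Unit => b) (fun _ : Unit => b)
  have h : Sum.elim (fun _ : Unit => b) (fun _ : Unit => b) = fun _ => b := by
    funext x; rcases x with x | x <;> rfl
  rw [h] at this
  rw [this]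
  exact ⟨_, rfl⟩

/-- A compatible labelling of the remaining points extends to the two deleted ones. Being related,
these have equal colours, so the parity of the number of coloured points does not change. -/
theorem isEven_comap_inr {p : Setoid ((Unit ⊕ Unit) ⊕ X)} (hp : IsEven p)
    (h : p (.inl (.inl ())) (.inl (.inr ()))) : IsEven (p.comap Sum.inr) := by
  rw [isEven_iff_cnt] at *
  intro f hf
  -- The colour `b` is copied from a remaining point in the block of the two points; if there is
  -- none, any colour will do.
  have key : ∃ b, p ≤ Setoid.ker (Sum.elim (fun _ => b) f) := by
    by_cases h1 : ∃ r, p (.inl (.inl ())) (.inr r)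
    · obtain ⟨r, hr⟩ := h1
      have h2 : ∀ x, p (.inl x) (.inr r) := by
        rintro (x | x)
        · exact hr
        · exact p.trans' (p.symm' h) hr
      refine ⟨f r, ?_⟩
      rintro (x | x) (y | y) hxy
      · rfl
      · exact hf (show p _ _ from p.trans' (p.symm' (h2 x)) hxy)
      · exact hf (show p _ _ from p.trans' hxy (h2 y))
      · exact hf hxy
    · have h2 : ∀ x r, ¬ p (.inl x) (.inr r) := by
        push Not at h1
        rintro (x | x) r h3
        · exact h1 r h3
        · exact h1 r (p.trans' h h3)
      refine ⟨false, ?_⟩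
      rintro (x | x) (y | y) hxy
      · rfl
      · exact absurd hxy (h2 _ _)
      · exact absurd (p.symm' hxy) (h2 _ _)
      · exact hf hxy
  obtain ⟨b, hb⟩ := key
  have h3 := hp _ hb
  rw [cnt_sum_elim, Nat.even_add] at h3
  exact h3.1 (cnt_const_pair b)

/-- First case for a block that contains the two leading points: it also contains some `r`, and the
partition arises from the remaining one by attaching the pair to `r`. The form of the right-hand
side matches a cap preceded by one neutralizer. -/
theorem le_ker_iff_of_rel {p : Setoid ((Unit ⊕ Unit) ⊕ X)} {r : X}
    (h : p (.inl (.inl ())) (.inl (.inr ()))) (hr : p (.inl (.inr ())) (.inr r))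
    {f : (Unit ⊕ Unit) ⊕ X → Bool} : p ≤ Setoid.ker f ↔
      f (.inl (.inr ())) = f (.inr r) ∧ f (.inl (.inl ())) = f (.inl (.inr ())) ∧
        p.comap Sum.inr ≤ Setoid.ker (fun r => f (.inr r)) := by
  refine ⟨fun hf => ⟨hf hr, hf h, fun x y hxy => hf hxy⟩, ?_⟩
  rintro ⟨h1, h2, h3⟩
  have h4 : ∀ x, p (.inl x) (.inr r) := by
    rintro (x | x)
    · exact p.trans' h hr
    · exact hr
  have h5 : ∀ x, f (.inl x) = f (.inr r) := by
    rintro (x | x)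
    · exact h2.trans h1
    · exact h1
  rintro (x | x) (y | y) hxy
  · exact (h5 x).trans (h5 y).symm
  · exact (h5 x).trans (h3 (show p _ _ from p.trans' (p.symm' (h4 x)) hxy))
  · exact (h3 (show p _ _ from p.trans' hxy (h4 y))).trans (h5 y).symm
  · exact h3 hxy

/-- Second case: the pair is a block by itself, which matches a cap alone. -/
theorem le_ker_iff_of_not_rel {p : Setoid ((Unit ⊕ Unit) ⊕ X)}
    (h : p (.inl (.inl ())) (.inl (.inr ()))) (hr : ∀ r, ¬ p (.inl (.inr ())) (.inr r))
    {f : (Unit ⊕ Unit) ⊕ X → Bool} : p ≤ Setoid.ker f ↔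
      f (.inl (.inl ())) = f (.inl (.inr ())) ∧
        p.comap Sum.inr ≤ Setoid.ker (fun r => f (.inr r)) := by
  refine ⟨fun hf => ⟨hf h, fun x y hxy => hf hxy⟩, ?_⟩
  rintro ⟨h2, h3⟩
  have h4 : ∀ x r, ¬ p (.inl x) (.inr r) := by
    rintro (x | x) r h5
    · exact hr r (p.trans' (p.symm' h) h5)
    · exact hr r h5
  have h5 : ∀ x, f (.inl x) = f (.inl (.inr ())) := by
    rintro (x | x)
    · exact h2
    · rfl
  rintro (x | x) (y | y) hxy
  · exact (h5 x).trans (h5 y).symm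
  · exact absurd hxy (h4 _ _)
  · exact absurd (p.symm' hxy) (h4 _ _)
  · exact h3 hxy

end Pairings

namespace FinPow

variable {C : Type u} [Category.{v} C] [MonoidalCategory C] [SymmetricCategory C]
variable {X Y Z Q R S T : Type} [Finite X] [Finite Y] [Finite Z] [Finite Q] [Finite R] [Finite S]
  [Finite T]

namespace NeutGen

variable {P : FinPow C} (G : P.NeutGen) [Preadditive C] [Linear ℂ C] [MonoidalPreadditive C]
  [MonoidalLinear ℂ C] {t : ℂ}

/-- The morphism `φ` and the matrix `m` come from the same even partition, with the same number
of loops. -/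
def NF (t : ℂ) (φ : P.V X ⟶ P.V Empty) (m : (X → Bool) → ℕ) : Prop :=
  ∃ (p : Setoid X) (a : ℕ) (F : P.V X ⟶ P.V X) (T : Type) (_ : Finite T) (e : X ≃ T ⊕ T),
    G.IsE p F ∧ IsPairing p e ∧ φ = t ^ a • (F ≫ P.perm e ≫ G.evV T) ∧
    ∀ f, m f = 2 ^ a * ind p f

variable {G}

theorem NF.smul {φ : P.V X ⟶ P.V Empty} {m} (h : G.NF t φ m) :
    G.NF t (t • φ) (fun f => 2 * m f) := by
  obtain ⟨p, a, F, T, hT, e, hF, he, rfl, hm⟩ := h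
  refine ⟨p, a + 1, F, T, hT, e, hF, he, ?_, fun f => ?_⟩
  · rw [smul_smul, pow_succ']
  · simp only [hm]; rw [pow_succ']; ring

theorem NF.of_eq {φ : P.V X ⟶ P.V Empty} {m m'} (h : G.NF t φ m) (hm : ∀ f, m' f = m f) :
    G.NF t φ m' := by
  obtain rfl : m' = m := funext hm
  exact h

theorem NF.smul_pow {φ : P.V X ⟶ P.V Empty} {m} (h : G.NF t φ m) (a : ℕ) :
    G.NF t (t ^ a • φ) (fun f => 2 ^ a * m f) := by
  induction a with
  | zero => simpa using h
  | succ a ih =>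
    have := ih.smul
    rw [smul_smul, ← pow_succ'] at this
    refine this.of_eq fun f => ?_
    rw [pow_succ']; ring

theorem NF.one : G.NF t (𝟙 (P.V Empty)) (fun _ => 1) := by
  refine ⟨⊥, 0, 𝟙 _, Empty, inferInstance, (Equiv.sumEmpty Empty Empty).symm,
    ⟨.id, fun i => i.elim⟩, fun s => s.elim, ?_, fun f => ?_⟩
  · rw [evV_empty, P.perm_perm, P.perm_eq_id (by simp)]; simp
  · rw [ind_eq_one]
    · rfl
    · exact fun i => i.elim

variable (hG : G.Rel t)
include hG

theorem Rel.nf_perm {φ : P.V X ⟶ P.V Empty} {m} (h : G.NF t φ m) (e : Y ≃ X) :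
    G.NF t (P.perm e ≫ φ) (fun f => m (fun x => f (e.symm x))) := by
  obtain ⟨p, a, F, T, hT, e', hF, he, rfl, hm⟩ := h
  refine ⟨_, a, _, T, hT, e.trans e', hF.perm hG e.symm, fun s => ?_, ?_, fun f => ?_⟩
  · simpa [Setoid.comap_rel] using he s
  · rw [Linear.comp_smul, ← P.perm_perm]
    simp only [Category.assoc, Equiv.symm_symm]
    rw [← Category.assoc (P.perm e.symm), P.perm_symm_comp, Category.id_comp]
  · simp only [hm]
    congr 1
    apply ind_congr
    constructor
    · intro h x y hxy
      simpa using h hxy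
    · intro h x y hxy
      exact h (show p _ _ by simpa using hxy)

/-- The matrix determines the exponent and the partition, the partition determines the merging
idempotent, and a change of pairing is absorbed. Normal forms can thus be compared through their
matrices alone. -/
theorem Rel.nf_unique {φ φ' : P.V X ⟶ P.V Empty} {m} (h : G.NF t φ m) (h' : G.NF t φ' m) :
    φ = φ' := by
  obtain ⟨p, a, F, T, hT, e, hF, he, rfl, hm⟩ := h
  obtain ⟨p', a', F', T', hT', e', hF', he', rfl, hm'⟩ := h'
  obtain ⟨rfl, rfl⟩ := eq_of_ind fun f => (hm f).symm.trans (hm' f)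
  obtain rfl := hG.isE_unique hF hF'
  obtain ⟨θ, hθ⟩ := he.exists_equiv he'
  rw [← G.evV_perm θ, P.perm_perm_assoc]
  -- After the relabelling of pairs by `θ`, which the evaluation absorbs, the two pairings differ by
  -- a permutation of `X` that preserves the blocks.
  have h1 : P.perm (e.trans (Equiv.sumCongr θ θ)) =
      P.perm ((e.trans (Equiv.sumCongr θ θ)).trans e'.symm) ≫ P.perm e' := by
    rw [P.perm_perm]
    exact P.perm_congr fun x => by simp
  rw [h1, Category.assoc, ← Category.assoc F, hG.isE_comp_perm hF]
  intro x
  obtain ⟨x, rfl⟩ := e.symm.surjective x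
  rcases x with s | s
  · simpa using hθ s
  · refine p.trans' (p.symm' (he s)) (p.trans' (hθ s) ?_)
    simpa using he' (θ s)

theorem Rel.nf_al {φ : P.V X ⟶ P.V Empty} {m} (h : G.NF t φ m) (i j : X) :
    G.NF t (G.al i j ≫ φ) (fun f => if f i = f j then m f else 0) := by
  obtain ⟨p, a, F, T, hT, e, hF, he, rfl, hm⟩ := h
  refine ⟨_, a, _, T, hT, e, hG.isE_sup (hG.isE_pair i j) hF, fun s => ?_, ?_, fun f => ?_⟩
  · exact le_sup_right (a := pairRel i j) (he s)
  · rw [Linear.comp_smul, Category.assoc]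
  · have h : pairRel i j ⊔ p ≤ Setoid.ker f ↔ f i = f j ∧ p ≤ Setoid.ker f := by
      rw [sup_le_iff, pairRel_le_iff]; rfl
    simp only [hm, ind_eq_ite h, mul_ite, mul_zero]

theorem Rel.al_cap (R : Type) [Finite R] :
    G.al (.inl (.inl ())) (.inl (.inr ())) ≫ G.cap R = G.cap R := by
  rw [al_inl_inl, cap, ← Category.assoc, P.tens_comp, hG.neut_ev, Category.comp_id]

theorem Rel.cup_al (R : Type) [Finite R] :
    G.cup R ≫ G.al (.inl (.inl ())) (.inl (.inr ())) = G.cup R := by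
  rw [al_inl_inl, cup, Category.assoc, P.tens_comp, hG.coev_neut, Category.comp_id]

theorem Rel.cup_cap (R : Type) [Finite R] : G.cup R ≫ G.cap R = t • 𝟙 _ := by
  rw [cup, cap, Category.assoc, ← Category.assoc (P.tens _ _), P.tens_comp, hG.dim, P.smul_tens,
    Category.comp_id, P.tens_id, Linear.smul_comp, Linear.comp_smul, Category.id_comp,
    P.perm_symm_comp]

/-- This is the relation `trace` with `R` as spectators. A pair that is created, merged with an
existing strand and closed again leaves no trace. -/
theorem Rel.cup_al_cap_unit (R : Type) [Finite R] :
    G.cup (Unit ⊕ R) ≫ G.al (.inl (.inr ())) (.inr (.inl ())) ≫ G.cap (Unit ⊕ R) = 𝟙 _ := by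
  have h1 : G.al (X := (Unit ⊕ Unit) ⊕ Unit) (.inl (.inr ())) (.inr ()) =
      P.perm (Equiv.sumAssoc Unit Unit Unit) ≫ P.tens (𝟙 (P.V Unit)) G.α ≫
        P.perm (Equiv.sumAssoc Unit Unit Unit).symm := by
    rw [G.al_eq_conj _ _ (Equiv.sumAssoc Unit Unit Unit), ← G.al_pair, ← G.al_inr]
    rfl
  have h2 : G.al (X := (Unit ⊕ Unit) ⊕ (Unit ⊕ R)) (.inl (.inr ())) (.inr (.inl ())) =
      P.perm (Equiv.sumAssoc _ _ _).symm ≫ P.tens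
        (G.al (X := (Unit ⊕ Unit) ⊕ Unit) (.inl (.inr ())) (.inr ())) (𝟙 (P.V R)) ≫
        P.perm (Equiv.sumAssoc _ _ _) := by
    rw [G.al_eq_conj _ _ (Equiv.sumAssoc (Unit ⊕ Unit) Unit R).symm, ← G.al_inl]
    rfl
  have h3 := hG.trace
  rw [← reassoc_of% h1] at h3
  rw [h2, Category.assoc, Category.assoc, ← G.cap_tens, ← reassoc_of% G.cup_tens_id,
    P.tens_comp, P.tens_comp, Category.id_comp, Category.id_comp, h1]
  simp only [Category.assoc]
  rw [hG.trace, P.tens_id]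

theorem Rel.cup_al_cap (r : R) :
    G.cup R ≫ G.al (.inl (.inr ())) (.inr r) ≫ G.cap R = 𝟙 _ := by
  classical
  let u : Unit → R := fun _ => r
  have hu : Function.Injective u := fun _ _ _ => rfl
  have hr : (splitEquiv u hu) r = .inl () := by
    rw [← Equiv.eq_symm_apply, splitEquiv_symm_inl]
  have h1 := hG.cup_al_cap_unit {x // x ∉ Set.range u}
  have h2 := congrArg (fun f => P.perm (splitEquiv u hu) ≫ f ≫ P.perm (splitEquiv u hu).symm) h1
  simp only [Category.assoc] at h2
  rw [← G.cap_perm, ← reassoc_of% G.cup_perm, ← Category.assoc (G.al _ _), G.al_perm,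
    Category.assoc, P.perm_perm_assoc, P.perm_eq_id (by rintro (x | x) <;> simp),
    Category.id_comp, Category.id_comp, P.perm_comp_symm] at h2
  simp only [Equiv.sumCongr_apply, Sum.map_inl, Sum.map_inr, Equiv.refl_apply, ← hr,
    Equiv.symm_apply_apply] at h2
  exact h2

/-- The two capped points form a new block, and they are also the one additional pair of the
pairing. The new neutralizer may be added because `β` absorbs it. -/
theorem Rel.nf_cap {φ : P.V R ⟶ P.V Empty} {m} (h : G.NF t φ m) :
    G.NF t (G.cap R ≫ φ) (fun f => if f (.inl (.inl ())) = f (.inl (.inr ())) then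
      m (fun r => f (.inr r)) else 0) := by
  obtain ⟨p, a, F, T, hT, e, hF, he, rfl, hm⟩ := h
  refine ⟨_, a, _, Unit ⊕ T, inferInstance, (Equiv.sumCongr (Equiv.refl _) e).trans
    (Equiv.sumSumSumComm Unit T Unit T).symm,
    hG.isE_sup (hG.isE_pair (.inl (.inl ())) (.inl (.inr ()))) (hG.isE_tens hF (Unit ⊕ Unit)),
    ?_, ?_, fun f => ?_⟩
  · rintro (s | s)
    · exact le_sup_left (a := pairRel (X := (Unit ⊕ Unit) ⊕ R) (.inl (.inl ())) (.inl (.inr ()))) (pairRel_rel _ _)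
    · exact le_sup_right (a := pairRel (X := (Unit ⊕ Unit) ⊕ R) (.inl (.inl ())) (.inl (.inr ())))
        (Relation.EqvGen.rel _ _ ⟨_, _, he s, rfl, rfl⟩)
  · have h1 : P.perm (Equiv.sumSumSumComm Unit T Unit T).symm ≫ G.evV (Unit ⊕ T) =
        G.cap (T ⊕ T) ≫ G.evV T := by
      rw [evV_unit, P.perm_perm_assoc, P.perm_eq_id (by simp), Category.id_comp]
    rw [Linear.comp_smul, ← P.perm_perm]
    simp only [Category.assoc]
    rw [h1, reassoc_of% G.cap_perm, reassoc_of% G.tens_cap, reassoc_of% hG.al_cap]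
  · have h : pairRel (X := (Unit ⊕ Unit) ⊕ R) (.inl (.inl ())) (.inl (.inr ())) ⊔ p.map Sum.inr ≤ Setoid.ker f ↔
        f (.inl (.inl ())) = f (.inl (.inr ())) ∧ p ≤ Setoid.ker (fun r => f (.inr r)) := by
      rw [sup_le_iff, pairRel_le_iff, map_le_iff]; rfl
    simp only [hm, ind_eq_ite h, mul_ite, mul_zero]

theorem Rel.exists_nf {p : Setoid X} (hp : IsEven p) : ∃ φ, G.NF t φ (ind p) := by
  obtain ⟨T, _, e, he⟩ := hp.exists_pairing
  obtain ⟨F, hF⟩ := hG.exists_isE p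
  exact ⟨_, p, 0, F, T, inferInstance, e, hF, he, rfl, by simp⟩

/-- The decisive closure property. The two joined points can be assumed to lie in one block. If that
block has other points, the pair is detached from it by `Rel.cup_al_cap` and the exponent is
unchanged; if not, the pair closes to a loop, which contributes `t` on one side and `2` on the
other. -/
theorem Rel.nf_cup {φ : P.V ((Unit ⊕ Unit) ⊕ R) ⟶ P.V Empty} {m} (h : G.NF t φ m) :
    G.NF t (G.cup R ≫ φ) (fun f => ∑ b : Bool, m (Sum.elim (fun _ => b) f)) := by
  -- The cup absorbs the neutralizer of its two legs, so `φ` may be replaced by its composite with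
  -- this neutralizer, in which the legs are merged.
  have key := hG.nf_al h (.inl (.inl ())) (.inl (.inr ()))
  rw [← hG.cup_al, Category.assoc]
  suffices H : ∀ {ψ n}, G.NF t ψ n → G.al (.inl (.inl ())) (.inl (.inr ())) ≫ ψ = ψ →
      (∀ f, n f ≠ 0 → f (.inl (.inl ())) = f (.inl (.inr ()))) →
      G.NF t (G.cup R ≫ ψ) (fun f => ∑ b : Bool, n (Sum.elim (fun _ => b) f)) by
    have := H key (by rw [← Category.assoc, hG.al_idem]) (fun f hf => by
      by_contra h; simp [h] at hf)
    refine this.of_eq fun f => ?_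
    simp
  rintro ψ n h1 - h3
  obtain ⟨p, a, F, T, hT, e, hF, he, h4, hm⟩ := id h1
  -- The matrix is nonzero on every compatible labelling and vanishes when the two legs have
  -- different colours, so the legs are related.
  have hp : p (.inl (.inl ())) (.inl (.inr ())) := by
    refine pairRel_le_iff.1 (setoid_le_of_ker _ _ fun f hf => pairRel_le_iff.2 (h3 f ?_))
    rw [hm, ind_eq_one hf]
    positivity
  obtain ⟨χ, hχ⟩ := hG.exists_nf (isEven_comap_inr he.isEven hp)
  have hc := hG.nf_cap hχ
  by_cases h5 : ∃ r, p (.inl (.inr ())) (.inr r)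
  · obtain ⟨r, hr⟩ := h5
    have hn : ∀ f, n f = 2 ^ a * (if f (.inl (.inr ())) = f (.inr r) then
        if f (.inl (.inl ())) = f (.inl (.inr ())) then
          ind (p.comap Sum.inr) (fun r => f (.inr r)) else 0 else 0) := by
      intro f
      rw [hm]
      congr 1
      rw [ind_eq_ite ((le_ker_iff_of_rel hp hr).trans and_assoc.symm)]
      split_ifs <;> simp_all
    -- Uniqueness of normal forms rewrites `ψ` as neutralizer, cap and a state on the remaining
    -- points; the cup then cancels the first two.
    have h7 : ψ = _ := hG.nf_unique h1
      (((hG.nf_al hc (.inl (.inr ())) (.inr r)).smul_pow a).of_eq hn)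
    rw [h7, Linear.comp_smul, ← Category.assoc (G.al _ _), ← Category.assoc (G.cup R),
      hG.cup_al_cap, Category.id_comp]
    refine (hχ.smul_pow a).of_eq fun f => ?_
    simp only [hn, Sum.elim_inl, Sum.elim_inr, Fintype.sum_bool]
    cases f r <;> simp
  · push Not at h5
    have hn : ∀ f, n f = 2 ^ a * (if f (.inl (.inl ())) = f (.inl (.inr ())) then
          ind (p.comap Sum.inr) (fun r => f (.inr r)) else 0) := by
      intro f
      rw [hm]
      congr 1
      exact ind_eq_ite (le_ker_iff_of_not_rel hp h5)
    -- Here `ψ` starts with a cap, and cup followed by cap is the dimension. The sum over the two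
    -- colours gives the corresponding factor `2`.
    have h7 : ψ = _ := hG.nf_unique h1 ((hc.smul_pow a).of_eq hn)
    rw [h7, Linear.comp_smul, ← Category.assoc (G.cup R), hG.cup_cap, Linear.smul_comp,
      Category.id_comp, smul_smul, ← pow_succ]
    refine (hχ.smul_pow (a + 1)).of_eq fun f => ?_
    simp only [hn, Sum.elim_inl, Sum.elim_inr, Fintype.sum_bool, if_true]
    ring

end NeutGen
end FinPow

end

/-! ### Words in the structure morphisms, and their determination by operators on labellings. -/

section

namespace FinPow

variable {C : Type u} [Category.{v} C] [MonoidalCategory C] [SymmetricCategory C]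

/-- The isomorphism that moves a factor out of the second summand to the front. -/
def rotEquiv (X Y : Type) : X ⊕ (Unit ⊕ Y) ≃ (Unit ⊕ X) ⊕ Y :=
  (Equiv.sumAssoc X Unit Y).symm.trans (Equiv.sumCongr (Equiv.sumComm X Unit) (Equiv.refl Y))

theorem tens_rot (P : FinPow C) {X Y R : Type} [Finite X] [Finite Y] [Finite R]
    (f : P.V X ⟶ P.V Y) : P.tens f (𝟙 (P.V (Unit ⊕ R))) ≫ P.perm (rotEquiv Y R) =
      P.perm (rotEquiv X R) ≫ P.tens (P.tens (𝟙 (P.V Unit)) f) (𝟙 (P.V R)) := by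
  have h := P.tens_assoc_symm f (𝟙 (P.V Unit)) (𝟙 (P.V R))
  rw [P.tens_id] at h
  rw [rotEquiv, ← P.perm_perm, reassoc_of% h, ← P.tens_perm_id, P.tens_comp, P.tens_comm,
    Category.comp_id, rotEquiv, ← P.perm_perm, Category.assoc, ← P.tens_perm_id, P.tens_comp,
    Category.comp_id]

namespace NeutGen

variable {P : FinPow C} (G : P.NeutGen) [Preadditive C] [Linear ℂ C] (t : ℂ)

/-- The relation between morphisms generated by the structure morphisms and operators on functions
on labellings. -/
inductive K : ∀ {X Y : Type} [Finite X] [Finite Y], (P.V X ⟶ P.V Y) →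
    (((Y → Bool) → ℕ) → (X → Bool) → ℕ) → Prop
  | perm {X Y : Type} [Finite X] [Finite Y] (e : X ≃ Y) :
      K (P.perm e) (fun n f => n (fun y => f (e.symm y)))
  | comp {X Y Z : Type} [Finite X] [Finite Y] [Finite Z] {f : P.V X ⟶ P.V Y} {g : P.V Y ⟶ P.V Z}
      {M N} (hf : K f M) (hg : K g N) : K (f ≫ g) (fun n => M (N n))
  | whisker {X Y : Type} [Finite X] [Finite Y] (R : Type) [Finite R] {f : P.V X ⟶ P.V Y} {M}
      (hf : K f M) : K (P.tens f (𝟙 (P.V R)))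
        (fun n h => M (fun g => n (Sum.elim g (fun r => h (.inr r)))) (fun x => h (.inl x)))
  | smul {X Y : Type} [Finite X] [Finite Y] {f : P.V X ⟶ P.V Y} {M} (hf : K f M) :
      K (t • f) (fun n h => 2 * M n h)
  | neut : K G.α (fun n f => if f (.inl ()) = f (.inr ()) then n f else 0)
  | ev : K G.β (fun n f => if f (.inl ()) = f (.inr ()) then n Empty.elim else 0)
  | coev : K G.δ (fun n _ => ∑ b : Bool, n (fun _ => b))

variable {G t} [MonoidalPreadditive C] [MonoidalLinear ℂ C] (hG : G.Rel t)
include hG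

variable {X Y Z Q R S T : Type} [Finite X] [Finite Y] [Finite Z] [Finite Q] [Finite R] [Finite S]
  [Finite T]

/-- Normal forms are closed under precomposition with each generator, and `M` is the matching
operation on matrices. The spectators `R` are carried along so that whiskering is covered by the
induction. -/
theorem Rel.nf_of_K {f : P.V X ⟶ P.V Y} {M} (hf : G.K t f M) (R : Type) [Finite R]
    {φ : P.V (Y ⊕ R) ⟶ P.V Empty} {n} (hφ : G.NF t φ n) :
    G.NF t (P.tens f (𝟙 (P.V R)) ≫ φ)
      (fun h => M (fun g => n (Sum.elim g (fun r => h (.inr r)))) (fun x => h (.inl x))) := by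
  induction hf generalizing R with
  | perm e =>
    rw [P.tens_perm_id]
    refine (hG.nf_perm hφ _).of_eq fun f => ?_
    beta_reduce
    congr 1
    funext x; rcases x with x | x <;> rfl
  | @comp X Y Z _ _ _ f g M N _ _ ih1 ih2 =>
    have := ih1 R (ih2 R hφ)
    rw [← Category.assoc, P.tens_comp, Category.comp_id] at this
    exact this
  | @whisker X Y _ _ S _ f M _ ih =>
    have h := P.tens_assoc f (𝟙 (P.V S)) (𝟙 (P.V R))
    rw [P.tens_id] at h
    have h1 := hG.nf_perm (ih (S ⊕ R) (hG.nf_perm hφ (Equiv.sumAssoc _ _ _).symm))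
      (Equiv.sumAssoc X S R)
    rw [← reassoc_of% h, P.perm_perm_assoc, P.perm_eq_id (by simp), Category.id_comp] at h1
    refine h1.of_eq fun f => ?_
    beta_reduce
    congr 1
    funext g
    congr 1
    funext x; rcases x with (x | x) | x <;> rfl
  | smul _ ih =>
    rw [P.smul_tens, Linear.smul_comp]
    exact (ih R hφ).smul
  | neut =>
    rw [← al_inl_inl]
    refine (hG.nf_al hφ _ _).of_eq fun f => ?_
    beta_reduce
    congr 2
    funext x; rcases x with x | x <;> rfl
  | ev =>
    have h := hG.nf_cap (hG.nf_perm hφ (Equiv.emptySum Empty R).symm)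
    rw [cap, Category.assoc, P.perm_perm_assoc, P.perm_eq_id (by simp), Category.id_comp] at h
    refine h.of_eq fun f => ?_
    beta_reduce
    congr 2
    funext x; rcases x with x | x
    · exact x.elim
    · rfl
  | coev =>
    have h := hG.nf_perm (hG.nf_cup hφ) (Equiv.emptySum Empty R)
    rw [cup, Category.assoc, P.perm_perm_assoc, P.perm_eq_id (by simp), Category.id_comp] at h
    exact h

theorem Rel.exists_nf_evV (T : Type) [Finite T] : ∃ n, G.NF t (G.evV T) n := by
  have key : ∀ k : ℕ, ∃ n, G.NF t (G.evV (Fin k)) n := by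
    intro k
    induction k with
    | zero =>
      obtain h := hG.nf_perm (NF.one (G := G) (t := t)) (Equiv.equivOfIsEmpty (Fin 0 ⊕ Fin 0) Empty)
      rw [Category.comp_id] at h
      rw [evV_fin]
      exact ⟨_, h⟩
    | succ k ih =>
      obtain ⟨n, hn⟩ := ih
      rw [evV_fin] at hn ⊢
      exact ⟨_, hG.nf_perm (hG.nf_perm (hG.nf_cap hn) _) _⟩
  obtain ⟨n, hn⟩ := key (Nat.card T)
  rw [← G.evV_perm (Finite.equivFin T)]
  exact ⟨_, hG.nf_perm hn _⟩

theorem Rel.zigzag_tens (Y : Type) [Finite Y] : G.cup (Unit ⊕ Y) ≫ P.perm (Equiv.sumAssoc _ _ _) ≫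
    P.tens (𝟙 (P.V Unit)) (P.perm (Equiv.sumAssoc _ _ _).symm ≫ G.cap Y) = 𝟙 _ := by
  have h := P.tens_assoc_symm (𝟙 (P.V Unit)) G.β (𝟙 (P.V Y))
  have h0 : P.perm (Equiv.sumAssoc Unit (Unit ⊕ Unit) Y) ≫
      P.tens (𝟙 (P.V Unit)) (P.tens G.β (𝟙 (P.V Y))) =
      P.tens (P.tens (𝟙 (P.V Unit)) G.β) (𝟙 (P.V Y)) ≫ P.perm (Equiv.sumAssoc Unit Empty Y) := by
    rw [← P.tens_assoc]
  have h1 : P.tens (𝟙 (P.V Unit)) (P.perm (Equiv.sumAssoc Unit Unit Y).symm ≫ G.cap Y) =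
      P.tens (𝟙 (P.V Unit)) (P.perm (Equiv.sumAssoc Unit Unit Y).symm) ≫
      P.tens (𝟙 (P.V Unit)) (P.tens G.β (𝟙 (P.V Y))) ≫
      P.tens (𝟙 (P.V Unit)) (P.perm (Equiv.emptySum Empty Y)) := by
    rw [P.tens_comp, P.tens_comp, cap, Category.comp_id, Category.comp_id]
  have h2 : G.cup (Unit ⊕ Y) = P.tens (G.cup Unit) (𝟙 (P.V Y)) ≫ P.perm (Equiv.sumAssoc _ _ _) := by
    rw [cup_tens_id, Category.assoc, P.perm_symm_comp, Category.comp_id]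
  have h3 : P.perm (Equiv.sumAssoc (Unit ⊕ Unit) Unit Y) ≫
      P.perm (Equiv.sumAssoc Unit Unit (Unit ⊕ Y)) ≫
      P.tens (𝟙 (P.V Unit)) (P.perm (Equiv.sumAssoc Unit Unit Y).symm) =
      P.tens (P.perm (Equiv.sumAssoc Unit Unit Unit)) (𝟙 (P.V Y)) ≫
      P.perm (Equiv.sumAssoc Unit (Unit ⊕ Unit) Y) := by
    rw [P.tens_id_perm, P.tens_perm_id, P.perm_perm, P.perm_perm, P.perm_perm]
    exact P.perm_congr fun x => by rcases x with ((x | x) | x) | x <;> simp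
  have h4 : P.perm (Equiv.sumAssoc Unit Empty Y) ≫
      P.tens (𝟙 (P.V Unit)) (P.perm (Equiv.emptySum Empty Y)) =
      P.tens (P.perm (Equiv.sumEmpty Unit Empty)) (𝟙 (P.V Y)) := by
    rw [P.tens_id_perm, P.tens_perm_id, P.perm_perm]
    exact P.perm_congr fun x => by rcases x with (x | x) | x <;> first | exact x.elim | simp
  rw [h1, h2, Category.assoc, reassoc_of% h3, reassoc_of% h0, h4, P.tens_comp, P.tens_comp,
    P.tens_comp, Category.comp_id, Category.comp_id, Category.comp_id, hG.zigzag, P.tens_id]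

/-- The bending of one outgoing strand. -/
def bend (f : P.V X ⟶ P.V (Unit ⊕ Y)) : P.V (Unit ⊕ X) ⟶ P.V Y :=
  P.tens (𝟙 (P.V Unit)) f ≫ P.perm (Equiv.sumAssoc _ _ _).symm ≫ G.cap Y

/-- The zigzag relation straightens the bent strand, so bending loses no information. -/
theorem Rel.unbend_bend (f : P.V X ⟶ P.V (Unit ⊕ Y)) : G.cup X ≫ P.perm (Equiv.sumAssoc _ _ _) ≫
    P.tens (𝟙 (P.V Unit)) (G.bend f) = f := by
  have h := P.tens_assoc (𝟙 (P.V Unit)) (𝟙 (P.V Unit)) f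
  have h1 : P.tens (𝟙 (P.V Unit)) (G.bend f) = P.tens (𝟙 (P.V Unit)) (P.tens (𝟙 (P.V Unit)) f) ≫
      P.tens (𝟙 (P.V Unit)) (P.perm (Equiv.sumAssoc _ _ _).symm ≫ G.cap Y) := by
    rw [P.tens_comp, Category.comp_id, bend]
  rw [h1, ← reassoc_of% h, P.tens_id, reassoc_of% G.cup_tens, hG.zigzag_tens, Category.comp_id]

theorem Rel.swap_cap (R : Type) [Finite R] :
    P.perm (Equiv.sumCongr (Equiv.sumComm Unit Unit) (Equiv.refl R)) ≫ G.cap R = G.cap R := by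
  rw [cap, ← P.tens_perm_id, ← Category.assoc, P.tens_comp, hG.swap_ev, Category.comp_id]

/-- To evaluate the first outgoing strand against its copy is to bend that strand; the other strands
are then evaluated as before. -/
theorem Rel.tens_evV_unit (f : P.V X ⟶ P.V (Unit ⊕ Y)) :
    P.tens f (𝟙 (P.V (Unit ⊕ Y))) ≫ G.evV (Unit ⊕ Y) =
      P.perm (rotEquiv X Y) ≫ P.tens (G.bend f) (𝟙 (P.V Y)) ≫ G.evV Y := by
  have h1 : P.tens (G.bend f) (𝟙 (P.V Y)) = P.tens (P.tens (𝟙 (P.V Unit)) f) (𝟙 (P.V Y)) ≫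
      P.tens (P.perm (Equiv.sumAssoc _ _ _).symm) (𝟙 (P.V Y)) ≫ P.tens (G.cap Y) (𝟙 (P.V Y)) := by
    rw [P.tens_comp, P.tens_comp, bend, Category.comp_id, Category.comp_id]
  rw [h1, Category.assoc, ← reassoc_of% P.tens_rot, evV_unit, cap_tens, P.tens_perm_id]
  -- The bent strand reaches the cap as its second leg, while the evaluation has it as the first
  -- leg; the symmetry of `β` repairs this.
  conv_lhs => rw [← hG.swap_cap]
  simp only [Category.assoc, P.perm_perm_assoc]
  congr 2
  exact P.perm_congr fun x => by rcases x with (x | x) | (x | x) <;> simp [rotEquiv]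

theorem cancel_transport {f f' : P.V X ⟶ P.V Y} (e : Y ≃ Z)
    (h : P.tens f (𝟙 (P.V Y)) ≫ G.evV Y = P.tens f' (𝟙 (P.V Y)) ≫ G.evV Y) :
    P.tens (f ≫ P.perm e) (𝟙 (P.V Z)) ≫ G.evV Z = P.tens (f' ≫ P.perm e) (𝟙 (P.V Z)) ≫ G.evV Z := by
  have key : ∀ f : P.V X ⟶ P.V Y, P.tens (f ≫ P.perm e) (𝟙 (P.V Z)) ≫ G.evV Z =
      P.tens (𝟙 (P.V X)) (P.perm e.symm) ≫ P.tens f (𝟙 (P.V Y)) ≫ G.evV Y := by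
    intro f
    rw [← G.evV_perm e, ← P.tens_perm, ← Category.assoc (P.tens f _), P.tens_comp,
      ← Category.assoc, P.tens_comp, Category.id_comp, Category.id_comp, P.perm_symm_comp]
  rw [key, key, h]

/-- The evaluation of `Y` against its copy is nondegenerate: it bends the outgoing strands one at a
time, and each bending can be undone. -/
theorem Rel.cancel_evV {f f' : P.V X ⟶ P.V Y}
    (h : P.tens f (𝟙 (P.V Y)) ≫ G.evV Y = P.tens f' (𝟙 (P.V Y)) ≫ G.evV Y) : f = f' := by
  have key : ∀ (k : ℕ) {X : Type} [Finite X] {Y : Type} [Finite Y] (f f' : P.V X ⟶ P.V Y)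
      (_ : Y ≃ Fin k), P.tens f (𝟙 (P.V Y)) ≫ G.evV Y = P.tens f' (𝟙 (P.V Y)) ≫ G.evV Y →
      f = f' := by
    intro k
    induction k with
    | zero =>
      intro X _ Y _ f f' e h
      have h1 := cancel_transport hG (e.trans (Equiv.equivOfIsEmpty (Fin 0) Empty)) h
      rw [evV_empty, P.tens_right, P.tens_right, cancel_epi, cancel_mono] at h1
      exact h1
    | succ k ih =>
      intro X _ Y _ f f' e h
      have h1 := cancel_transport hG (e.trans (finU k)) h
      rw [hG.tens_evV_unit, hG.tens_evV_unit, cancel_epi] at h1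
      have h2 := ih _ _ (Equiv.refl _) h1
      rw [← cancel_mono (P.perm (e.trans (finU k))), ← hG.unbend_bend (f ≫ _), h2,
        hG.unbend_bend]
  exact key _ f f' (Finite.equivFin Y) h

/-- With all outgoing strands bent down, both words become normal forms with the same matrix. Every
identity between words in the target category is derived from this. -/
theorem Rel.K_unique {f f' : P.V X ⟶ P.V Y} {M} (h : G.K t f M) (h' : G.K t f' M) : f = f' := by
  obtain ⟨n, hn⟩ := hG.exists_nf_evV Y
  exact hG.cancel_evV (hG.nf_unique (hG.nf_of_K h Y hn) (hG.nf_of_K h' Y hn))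

end NeutGen
end FinPow

end

/-! ### Every even partition is the operator of a word. -/

section

/-- The operator on functions on labellings given by the incidence matrix of a partition. -/
def matOp {X Y : Type} (p : Setoid (X ⊕ Y)) (n : (Y → Bool) → ℕ) (f : X → Bool) : ℕ :=
  ∑ᶠ h : Y → Bool, mat p f h * n h

theorem mat_eq_ind {X Y : Type} [Finite X] [Finite Y] (p : Setoid (X ⊕ Y)) (f : X → Bool)
    (g : Y → Bool) : mat p f g = ind p (Sum.elim f g) := rfl

theorem ind_comap {X Y : Type} [Finite X] [Finite Y] (p : Setoid Y) (e : X ≃ Y)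
    {f : X → Bool} {g : Y → Bool} (h : ∀ x, f x = g (e x)) : ind (p.comap e) f = ind p g := by
  apply ind_congr
  obtain rfl : f = g ∘ e := funext h
  constructor
  · intro h x y hxy
    obtain ⟨x, rfl⟩ := e.surjective x
    obtain ⟨y, rfl⟩ := e.surjective y
    exact h hxy
  · intro h x y hxy
    exact h hxy

theorem isEven_comap_equiv {X Y : Type} [Finite X] [Finite Y] {p : Setoid X} (hp : IsEven p)
    (e : Y ≃ X) : IsEven (p.comap e) := by
  intro v
  have h1 := hp (e v)
  have h2 : Nat.card {w // p (e v) (e w)} = Nat.card {w // p (e v) w} :=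
    Nat.card_congr (e.subtypeEquiv fun _ => Iff.rfl)
  rw [← Nat.card_coe_set_eq] at h1 ⊢
  exact h2 ▸ h1

namespace FinPow

variable {C : Type u} [Category.{v} C] [MonoidalCategory C] [SymmetricCategory C]

namespace NeutGen

variable {P : FinPow C} {G : P.NeutGen} [Preadditive C] [Linear ℂ C] {t : ℂ}
variable {X Y Z Q R S T : Type} [Finite X] [Finite Y] [Finite Z] [Finite Q] [Finite R] [Finite S]
  [Finite T]

theorem K.of_eq {f : P.V X ⟶ P.V Y} {M M'} (h : G.K t f M) (hM : ∀ n x, M' n x = M n x) :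
    G.K t f M' := by
  obtain rfl : M' = M := funext fun n => funext fun x => hM n x
  exact h

theorem K.whiskerLeft {f : P.V X ⟶ P.V Y} {M} (hf : G.K t f M) (R : Type) [Finite R] :
    G.K t (P.tens (𝟙 (P.V R)) f)
      (fun n h => M (fun g => n (Sum.elim (fun r => h (.inl r)) g)) (fun x => h (.inr x))) := by
  have h1 := ((K.perm (G := G) (t := t) (Equiv.sumComm R X)).comp (hf.whisker R)).comp
    (K.perm (Equiv.sumComm Y R))
  rw [Category.assoc, P.tens_comm, P.perm_perm_assoc, P.perm_eq_id (by simp),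
    Category.id_comp] at h1
  refine h1.of_eq fun n f => ?_
  beta_reduce
  congr 1
  funext g
  congr 1
  funext x; rcases x with x | x <;> rfl

theorem K.id : G.K t (𝟙 (P.V X)) (fun n => n) := by
  rw [← P.perm_refl]
  exact K.perm _

theorem K.cup (X : Type) [Finite X] : G.K t (G.cup X)
    (fun n h => ∑ b : Bool, n (Sum.elim (fun _ => b) h)) :=
  (K.perm (Equiv.emptySum Empty X).symm).comp (K.coev.whisker X)

theorem K.cap (X : Type) [Finite X] : G.K t (G.cap X)
    (fun n h => if h (.inl (.inl ())) = h (.inl (.inr ())) then n (fun x => h (.inr x)) else 0) :=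
  (K.ev.whisker X).comp (K.perm (Equiv.emptySum Empty X))

theorem K.al (i j : X) : G.K t (G.al i j) (fun n f => if f i = f j then n f else 0) := by
  by_cases h : i = j
  · subst h
    rw [al_self]
    simpa using K.id
  obtain ⟨T, _, e, hi, hj⟩ := exists_pair_split h
  rw [G.al_eq_conj i j e, hi, hj, al_inl_inl]
  refine ((K.perm e).comp ((K.neut.whisker T).comp (K.perm e.symm))).of_eq fun n f => ?_
  beta_reduce
  rw [← hi, ← hj, e.symm_apply_apply, e.symm_apply_apply]
  congr 2
  funext x
  obtain ⟨x, rfl⟩ := e.symm.surjective x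
  rcases x with x | x <;> simp

/-- The neutralizers of all related pairs are composed; each multiplies the operator by the
indicator that two colours agree. -/
theorem K.exists_merge (p : Setoid X) :
    ∃ F : P.V X ⟶ P.V X, G.K t F (fun n f => ind p f * n f) := by
  classical
  have := Fintype.ofFinite X
  have key : ∀ s : Finset (X × X), ∃ F : P.V X ⟶ P.V X, G.K t F (fun n f =>
      (if ∀ i j, p i j → (i, j) ∈ s → f i = f j then 1 else 0) * n f) := by
    intro s
    induction s using Finset.induction_on with
    | empty => exact ⟨_, K.id.of_eq (by simp)⟩
    | insert a s _ ih =>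
      obtain ⟨F, h1⟩ := ih
      by_cases ha : p a.1 a.2
      · refine ⟨_, ((K.al a.1 a.2).comp h1).of_eq fun n f => ?_⟩
        have : (∀ i j, p i j → (i, j) ∈ insert a s → f i = f j) ↔
            f a.1 = f a.2 ∧ ∀ i j, p i j → (i, j) ∈ s → f i = f j := by
          constructor
          · exact fun h => ⟨h _ _ ha (Finset.mem_insert_self _ _),
              fun i j hij hm => h i j hij (Finset.mem_insert_of_mem hm)⟩
          · rintro ⟨h2, h3⟩ i j hij hm
            rcases Finset.mem_insert.1 hm with rfl | hm
            · exact h2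
            · exact h3 i j hij hm
        simp only [this, ite_and, ite_mul, one_mul, zero_mul]
      · refine ⟨F, h1.of_eq fun n f => ?_⟩
        congr 2
        apply propext
        constructor
        · exact fun h i j hij hm => h i j hij (Finset.mem_insert_of_mem hm)
        · rintro h3 i j hij hm
          rcases Finset.mem_insert.1 hm with rfl | hm
          · exact absurd hij ha
          · exact h3 i j hij hm
  obtain ⟨F, h1⟩ := key Finset.univ
  refine ⟨F, h1.of_eq fun n f => ?_⟩
  congr 1
  by_cases h : p ≤ Setoid.ker f
  · rw [ind_eq_one h, if_pos]
    exact fun i j hij _ => h hij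
  · rw [ind_eq_zero h, if_neg]
    exact fun h2 => h fun i j hij => h2 i j hij (Finset.mem_univ _)

open Classical in
theorem K.evV (T : Type) [Finite T] : G.K t (G.evV T) (fun n f =>
    if ∀ s, f (.inl s) = f (.inr s) then n Empty.elim else 0) := by
  have key : ∀ k : ℕ, G.K t (G.evV (Fin k)) (fun n f =>
      if ∀ s, f (.inl s) = f (.inr s) then n Empty.elim else 0) := by
    intro k
    induction k with
    | zero =>
      rw [evV_fin]
      refine (K.perm (Equiv.equivOfIsEmpty (Fin 0 ⊕ Fin 0) Empty)).of_eq fun n f => ?_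
      rw [if_pos fun s => s.elim0]
      congr 1
      funext x; exact x.elim
    | succ k ih =>
      rw [evV_fin] at ih ⊢
      refine ((K.perm _).comp ((K.perm _).comp ((K.cap _).comp ih))).of_eq fun n f => ?_
      have : (∀ s, f (.inl s) = f (.inr s)) ↔
          f (.inl ((finU k).symm (.inl ()))) = f (.inr ((finU k).symm (.inl ()))) ∧
          ∀ s, f (.inl ((finU k).symm (.inr s))) = f (.inr ((finU k).symm (.inr s))) := by
        constructor
        · exact fun h => ⟨h _, fun s => h _⟩
        · rintro ⟨h1, h2⟩ s
          obtain ⟨s, rfl⟩ := (finU k).symm.surjective s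
          rcases s with s | s
          · exact h1
          · exact h2 s
      simp only [this, ite_and]
      rfl
  rw [← G.evV_perm (Finite.equivFin T)]
  refine ((K.perm _).comp (key _)).of_eq fun n f => ?_
  have : (∀ s, f (.inl s) = f (.inr s)) ↔ ∀ s, f (.inl ((Finite.equivFin T).symm s)) =
      f (.inr ((Finite.equivFin T).symm s)) :=
    ⟨fun h s => h _, fun h s => by simpa using h (Finite.equivFin T s)⟩
  simp only [this]
  rfl

/-- The blocks are merged and then evaluated along a pairing. The pairing tests only equalities of
colours that the merging has already imposed. -/
theorem K.exists_state {p : Setoid X} (hp : IsEven p) :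
    ∃ φ : P.V X ⟶ P.V Empty, G.K t φ (fun n f => ind p f * n Empty.elim) := by
  obtain ⟨T, _, e, he⟩ := hp.exists_pairing
  obtain ⟨F, hF⟩ := K.exists_merge (G := G) (t := t) p
  refine ⟨_, (hF.comp ((K.perm e).comp (K.evV T))).of_eq fun n f => ?_⟩
  beta_reduce
  by_cases h : p ≤ Setoid.ker f
  · rw [if_pos]
    exact fun s => h (he s)
  · rw [ind_eq_zero h, zero_mul, zero_mul]

/-- Induction on the number of outgoing points. One of them is turned into an incoming point, which
does not affect evenness, and a cup turns it back. -/
theorem K.exists_of_isEven {p : Setoid (X ⊕ Y)} (hp : IsEven p) :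
    ∃ f : P.V X ⟶ P.V Y, G.K t f (matOp p) := by
  have key : ∀ (k : ℕ) {X : Type} [Finite X] {Y : Type} [Finite Y] (_ : Y ≃ Fin k)
      {p : Setoid (X ⊕ Y)} (_ : IsEven p), ∃ f : P.V X ⟶ P.V Y, G.K t f (matOp p) := by
    intro k
    induction k with
    | zero =>
      intro X _ Y _ e p hp
      let e' : Y ≃ Empty := e.trans (Equiv.equivOfIsEmpty _ _)
      have := e'.isEmpty
      obtain ⟨φ, hφ⟩ := K.exists_state (G := G) (t := t)
        (isEven_comap_equiv hp (Equiv.sumEmpty X Y).symm)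
      refine ⟨_, (hφ.comp (K.perm e'.symm)).of_eq fun n f => ?_⟩
      rw [matOp, finsum_unique]
      congr 1
      · rw [mat_eq_ind]
        symm
        exact ind_comap _ _ fun x => rfl
      · congr 1
        exact Subsingleton.elim _ _
    | succ k ih =>
      intro X _ Y _ e p hp
      let e' : Y ≃ Unit ⊕ Fin k := e.trans (finU k)
      -- Pulling back along `E` moves the first outgoing point to the incoming side.
      let E : (Unit ⊕ X) ⊕ Fin k ≃ X ⊕ Y := (rotEquiv X (Fin k)).symm.trans
        (Equiv.sumCongr (Equiv.refl X) e'.symm)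
      obtain ⟨f', hf'⟩ := ih (Equiv.refl _) (isEven_comap_equiv hp E)
      refine ⟨_, ((K.cup X).comp ((K.perm (Equiv.sumAssoc _ _ _)).comp
        ((hf'.whiskerLeft Unit).comp (K.perm e'.symm)))).of_eq fun n f => ?_⟩
      -- A labelling of `Y` consists of the colour of the bent strand, over which the cup sums, and
      -- a labelling of the other points.
      let F : Bool × (Fin k → Bool) ≃ (Y → Bool) :=
        { toFun := fun x y => Sum.elim (fun _ => x.1) x.2 (e' y)
          invFun := fun h => (h (e'.symm (.inl ())), fun i => h (e'.symm (.inr i)))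
          left_inv := fun x => by simp
          right_inv := fun h => by
            funext y
            obtain ⟨y, rfl⟩ := e'.symm.surjective y
            rcases y with y | y <;> simp }
      have := Fintype.ofFinite (Y → Bool)
      simp only [matOp, finsum_eq_sum_of_fintype]
      rw [← Equiv.sum_comp F, Fintype.sum_prod_type]
      refine Finset.sum_congr rfl fun b _ => Finset.sum_congr rfl fun g _ => ?_
      congr 1
      · symm
        refine ind_comap _ _ ?_
        rintro ((x | x) | x) <;> simp [E, rotEquiv, F]
  exact key _ (Finite.equivFin Y) hp

end NeutGen
end FinPow

end

/-! ### Words evaluated in the category of even partition diagrams. -/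

section

namespace RepZero

open EvenPartition

variable {t : ℂ} {k l m k' l' : ℕ}

/-- A multiple of a partition by a power of the loop parameter, with the corresponding operator. -/
def IsModel (t : ℂ) (x : LinPart k l) (M : ((Fin l → Bool) → ℕ) → (Fin k → Bool) → ℕ) : Prop :=
  ∃ (p : EvenPartition k l) (a : ℕ), x = .single p (t ^ a) ∧
    ∀ n f, M n f = 2 ^ a * ∑ g, p.M f g * n g

theorem IsModel.of_eq {x : LinPart k l} {M M'} (h : IsModel t x M) (hM : ∀ n f, M' n f = M n f) :
    IsModel t x M' := by
  obtain rfl : M' = M := funext fun n => funext fun x => hM n x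
  exact h

theorem IsModel.comp {x : LinPart k l} {y : LinPart l m} {M N} (hx : IsModel t x M)
    (hy : IsModel t y N) : IsModel t (compL t _ _ _ x y) (fun n => M (N n)) := by
  obtain ⟨p, a, rfl, hM⟩ := hx
  obtain ⟨q, b, rfl, hN⟩ := hy
  refine ⟨vcomp p q, a + b + loops p q, ?_, fun n f => ?_⟩
  · rw [compL_single, pow_add, pow_add]
  · have h1 : ∀ h, 2 ^ loops p q * ((vcomp p q).M f h * n h) =
        ∑ g, p.M f g * (q.M g h * n h) := by
      intro h
      rw [← mul_assoc, ← sum_M, Finset.sum_mul]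
      simp only [mul_assoc]
    rw [pow_add, mul_assoc, Finset.mul_sum]
    simp only [h1]
    rw [Finset.sum_comm, hM, pow_add, mul_assoc]
    congr 1
    rw [Finset.mul_sum]
    refine Finset.sum_congr rfl fun g _ => ?_
    rw [hN, Finset.mul_sum, Finset.mul_sum, Finset.mul_sum]
    refine Finset.sum_congr rfl fun h _ => ?_
    ring

theorem IsModel.perm (e : Fin k ≃ Fin l) :
    IsModel t (permL e) (fun n f => n (fun i => f (e.symm i))) := by
  refine ⟨ofEquiv e, 0, by rw [pow_zero]; rfl, fun n f => ?_⟩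
  simp [M_ofEquiv']

theorem IsModel.smul {x : LinPart k l} {M} (hx : IsModel t x M) :
    IsModel t (t • x) (fun n f => 2 * M n f) := by
  obtain ⟨p, a, rfl, hM⟩ := hx
  refine ⟨p, a + 1, ?_, fun n f => ?_⟩
  · rw [Finsupp.smul_single, smul_eq_mul, pow_succ']
  · beta_reduce
    rw [hM, pow_succ', mul_assoc]

theorem IsModel.tens {x : LinPart k l} {M} (hx : IsModel t x M) (r : ℕ) :
    IsModel t (tensL _ _ _ _ x (permL (Equiv.refl (Fin r))))
      (fun n h => M (fun g => n (Fin.append g (fun i => h (Fin.natAdd k i))))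
        (fun i => h (Fin.castAdd r i))) := by
  obtain ⟨p, a, rfl, hM⟩ := hx
  refine ⟨hcomp p (ofEquiv (Equiv.refl _)), a, ?_, fun n f => ?_⟩
  · rw [permL, tensL_single, mul_one]
  · beta_reduce
    rw [hM, sum_fin]
    congr 1
    refine Finset.sum_congr rfl fun g _ => ?_
    rw [Finset.sum_eq_single (fun i => f (Fin.natAdd k i))]
    · simp [M_hcomp, M_ofEquiv']
    · intro h _ hh
      simp [M_hcomp, M_ofEquiv', hh]
    · simp

/-- The compatible labellings of a single block are the constant ones. With no vertices at all, the
sum would count the empty labelling twice, hence the condition `h0`. -/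
theorem block_M (hkl : Even (k + l)) (h0 : 0 < k + l) (f : Fin k → Bool) (g : Fin l → Bool) :
    (block k l hkl).M f g = ∑ b : Bool, (if f = fun _ => b then 1 else 0) *
      (if g = fun _ => b then 1 else 0) := by
  have hx : ∃ x : Fin k ⊕ Fin l, True := by
    by_cases hk : 0 < k
    · exact ⟨.inl ⟨0, hk⟩, trivial⟩
    · exact ⟨.inr ⟨0, by omega⟩, trivial⟩
  obtain ⟨x, -⟩ := hx
  have key : ∀ b, (f = (fun _ => b) ∧ g = fun _ => b) ↔ ∀ y, Sum.elim f g y = b := by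
    intro b
    constructor
    · rintro ⟨rfl, rfl⟩ (y | y) <;> rfl
    · intro h
      exact ⟨funext fun y => h (.inl y), funext fun y => h (.inr y)⟩
  have hc : Compat (block k l hkl).rel f g ↔ ∀ y, Sum.elim f g y = Sum.elim f g x := by
    constructor
    · intro h y
      exact h (show (⊤ : Setoid _) y x from trivial)
    · intro h y z _
      exact (h y).trans (h z).symm
  have h2 : ∀ b, ((if f = fun _ => b then 1 else 0) * (if g = fun _ => b then 1 else 0) : ℕ) =
      if ∀ y, Sum.elim f g y = b then 1 else 0 := by
    intro b
    by_cases h : ∀ y, Sum.elim f g y = b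
    · rw [if_pos h, if_pos ((key b).2 h).1, if_pos ((key b).2 h).2]
    · rw [if_neg h]
      by_cases h1 : f = fun _ => b
      · rw [if_neg fun h2 => h ((key b).1 ⟨h1, h2⟩), mul_zero]
      · rw [if_neg h1, zero_mul]
  simp only [h2]
  rw [Finset.sum_eq_single (Sum.elim f g x)]
  · unfold M mat
    by_cases h : Compat (block k l hkl).rel f g
    · rw [if_pos h, if_pos (hc.1 h)]
    · rw [if_neg h, if_neg (fun h' => h (hc.2 h'))]
  · intro b _ hb
    rw [if_neg fun h => hb (h x).symm]
  · simp

theorem IsModel.block (hkl : Even (k + l)) (h0 : 0 < k + l) :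
    IsModel t (.single (block k l hkl) 1)
      (fun n f => ∑ b : Bool, (if f = fun _ => b then 1 else 0) * n (fun _ => b)) := by
  refine ⟨_, 0, by rw [pow_zero], fun n f => ?_⟩
  simp only [block_M hkl h0, Finset.sum_mul, pow_zero, one_mul]
  rw [Finset.sum_comm]
  refine Finset.sum_congr rfl fun b _ => ?_
  rw [Finset.sum_eq_single (fun _ => b)]
  · simp
  · intro g _ hg
    simp [hg]
  · simp

end RepZero

open FinPow RepZero EvenPartition

theorem even_card_pair : Even (Nat.card (Unit ⊕ Unit)) := by simp

/-- The generating blocks of the category of even partition diagrams. -/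
def genV (t : ℂ) : (FinPow.repZero t).NeutGen where
  α := ofPart (t := t) (block (Nat.card (Unit ⊕ Unit)) (Nat.card (Unit ⊕ Unit))
    (even_card_pair.add even_card_pair))
  β := ofPart (t := t) (block (Nat.card (Unit ⊕ Unit)) (Nat.card Empty)
    (even_card_pair.add (by simp)))
  δ := ofPart (t := t) (block (Nat.card Empty) (Nat.card (Unit ⊕ Unit))
    (Even.add (by simp) even_card_pair))

variable {t : ℂ} {X Y Z : Type} [Finite X] [Finite Y] [Finite Z]

/-- The operator on functions on labellings of the standard sets. -/
def conjOp (M : ((Y → Bool) → ℕ) → (X → Bool) → ℕ) (n : (Fin (Nat.card Y) → Bool) → ℕ)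
    (f : Fin (Nat.card X) → Bool) : ℕ :=
  M (fun h => n (fun i => h ((Finite.equivFin Y).symm i))) (fun x => f (Finite.equivFin X x))

theorem repZero_tens (R : Type) [Finite R]
    (f : (FinPow.repZero t).V X ⟶ (FinPow.repZero t).V Y) :
    (FinPow.repZero t).tens f (𝟙 ((FinPow.repZero t).V R)) =
      compL t _ _ _ (permL (sumFin X R).symm) (compL t _ _ _
        (tensL _ _ _ _ f (permL (Equiv.refl (Fin (Nat.card R))))) (permL (sumFin Y R))) := by
  have h : (FinPow.repZero t).tens f (𝟙 ((FinPow.repZero t).V R)) =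
      ((FinPow.repZero t).SIso (sumFin X R)).inv ≫ ((FinPow.repZero t).mul _ _).inv ≫
      (f ⊗ₘ 𝟙 ((FinPow.repZero t).V R)) ≫ ((FinPow.repZero t).mul _ _).hom ≫
      ((FinPow.repZero t).SIso (sumFin Y R)).hom := by
    simp only [FinPow.tens, mulV, Iso.trans_hom, Iso.trans_inv, Category.assoc]
  rw [h]
  exact congrArg (compL t _ _ _ (permL (sumFin X R).symm)) ((permL_refl_compL t _).trans
    (congrArg (compL t _ _ _ _) (permL_refl_compL t (permL (sumFin Y R)))))

theorem eq_const_iff (f : Fin (Nat.card (Unit ⊕ Unit)) → Bool) (b : Bool) :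
    (f = fun _ => b) ↔ f (Finite.equivFin _ (.inl ())) = b ∧ f (Finite.equivFin _ (.inr ())) = b := by
  constructor
  · rintro rfl; exact ⟨rfl, rfl⟩
  · rintro ⟨h1, h2⟩
    funext i
    obtain ⟨i, rfl⟩ := (Finite.equivFin (Unit ⊕ Unit)).surjective i
    rcases i with i | i
    · exact h1
    · exact h2

theorem ite_const_eq (f : Fin (Nat.card (Unit ⊕ Unit)) → Bool) (n : Bool → ℕ) :
    (∑ b : Bool, (if f = fun _ => b then 1 else 0) * n b) =
      if f (Finite.equivFin _ (.inl ())) = f (Finite.equivFin _ (.inr ())) then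
        n (f (Finite.equivFin _ (.inl ()))) else 0 := by
  simp only [eq_const_iff]
  rw [Finset.sum_eq_single (f (Finite.equivFin _ (.inl ())))]
  · simp [eq_comm]
  · intro b _ hb
    rw [if_neg fun h => hb h.1.symm, zero_mul]
  · simp

theorem isModel_neut (h : Even (Nat.card (Unit ⊕ Unit) + Nat.card (Unit ⊕ Unit))) :
    IsModel t (.single (block _ _ h) 1) (conjOp (X := Unit ⊕ Unit) (Y := Unit ⊕ Unit)
      (fun n f => if f (.inl ()) = f (.inr ()) then n f else 0)) := by
  refine (IsModel.block _ (by simp)).of_eq fun n f => ?_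
  rw [ite_const_eq f (fun b => n fun _ => b), conjOp]
  split_ifs with h
  · rw [← (eq_const_iff f _).2 ⟨rfl, h.symm⟩]
    simp
  · rfl

theorem isModel_ev (h : Even (Nat.card (Unit ⊕ Unit) + Nat.card Empty)) :
    IsModel t (.single (block _ _ h) 1) (conjOp (X := Unit ⊕ Unit) (Y := Empty)
      (fun n f => if f (.inl ()) = f (.inr ()) then n Empty.elim else 0)) := by
  refine (IsModel.block _ (by simp)).of_eq fun n f => ?_
  rw [ite_const_eq f (fun b => n fun _ => b), conjOp]
  congr 2
  beta_reduce
  congr 1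
  funext x
  exact ((Finite.equivFin Empty).symm x).elim

theorem isModel_coev (h : Even (Nat.card Empty + Nat.card (Unit ⊕ Unit))) :
    IsModel t (.single (block _ _ h) 1) (conjOp (X := Empty) (Y := Unit ⊕ Unit)
      (fun n _ => ∑ b : Bool, n (fun _ => b))) := by
  refine (IsModel.block _ (by simp)).of_eq fun n f => ?_
  simp only [conjOp]
  refine Finset.sum_congr rfl fun b _ => ?_
  rw [if_pos, one_mul]
  funext x
  exact ((Finite.equivFin Empty).symm x).elim

theorem isModel_whisker {x : LinPart (Nat.card X) (Nat.card Y)}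
    {M : ((Y → Bool) → ℕ) → (X → Bool) → ℕ} (hx : IsModel t x (conjOp M)) (R : Type) [Finite R] :
    IsModel t (compL t _ _ _ (permL (sumFin X R).symm) (compL t _ _ _
        (tensL _ _ _ _ x (permL (Equiv.refl (Fin (Nat.card R))))) (permL (sumFin Y R))))
      (conjOp (X := X ⊕ R) (Y := Y ⊕ R)
        (fun n h => M (fun g => n (Sum.elim g (fun r => h (.inr r)))) (fun x => h (.inl x)))) := by
  refine ((IsModel.perm _).comp ((hx.tens _).comp (IsModel.perm _))).of_eq fun n f => ?_
  simp only [conjOp]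
  congr 1
  · funext g
    congr 1
    funext i
    obtain ⟨i, rfl⟩ := (Finite.equivFin (Y ⊕ R)).surjective i
    rcases i with i | i <;> simp [sumFin]
  · funext i
    simp [sumFin]

/-- In the diagram category a word is a power of `t` times one partition, and its operator is the
same power of `2` times the incidence matrix. So the operator tells which diagram a word computes.
-/
theorem isModel_of_K {f : (FinPow.repZero t).V X ⟶ (FinPow.repZero t).V Y} {M}
    (h : (genV t).K t f M) : IsModel t (k := Nat.card X) (l := Nat.card Y) f (conjOp M) := by
  induction h with
  | perm e => exact IsModel.perm _
  | comp _ _ ih1 ih2 =>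
    refine (ih1.comp ih2).of_eq fun n f => ?_
    simp [conjOp]
  | whisker R _ ih =>
    rw [repZero_tens]
    exact isModel_whisker ih R
  | smul _ ih => exact ih.smul
  | neut => exact isModel_neut _
  | ev => exact isModel_ev _
  | coev => exact isModel_coev _

end

/-! ### Generation of all even partitions by permutations and the three blocks. -/

section

open FinPow RepZero EvenPartition

variable {t : ℂ} {k l m : ℕ}

/-- The incidence operator on labellings of standard sets determines the morphism. -/
theorem RepZero.IsModel.eq_single {x : LinPart k l} {p : EvenPartition k l}
    (h : IsModel t x (matOp p.rel)) : x = .single p 1 := by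
  classical
  obtain ⟨q, a, rfl, hM⟩ := h
  have key : ∀ f g, 2 ^ 0 * p.M f g = 2 ^ a * q.M f g := by
    intro f g
    have h1 := hM (fun h => if h = g then 1 else 0) f
    simp only [matOp, finsum_eq_sum_of_fintype, mul_ite, mul_one, mul_zero,
      Finset.sum_ite_eq', Finset.mem_univ, if_true] at h1
    rw [pow_zero, one_mul]
    exact h1
  obtain ⟨rfl, rfl⟩ := eq_of_M key
  simp

/-- Properties of morphisms that are stable under the tensor operations and hold for the
generators. -/
structure IsTensorClosed (W : MorphismProperty (RepZero t)) : Prop where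
  id : ∀ X, W (𝟙 X)
  comp : ∀ {X Y Z : RepZero t} (f : X ⟶ Y) (g : Y ⟶ Z), W f → W g → W (f ≫ g)
  tens : ∀ {X Y X' Y' : RepZero t} (f : X ⟶ Y) (g : X' ⟶ Y'), W f → W g → W (f ⊗ₘ g)
  smul : ∀ {X Y : RepZero t} (f : X ⟶ Y), W f → W (t • f)
  braid : W (β_ (genZero t).A (genZero t).A).hom
  neut : W (genZero t).α
  ev : W (genZero t).β
  coev : W (genZero t).δ

namespace IsTensorClosed

variable {W : MorphismProperty (RepZero t)} (hW : IsTensorClosed W)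
include hW

/-- Adjacent transpositions generate the symmetric group. The last one is the symmetry of `[1]` with
identities on its left; the others come from fewer strands by adding one on the right. -/
theorem perm_self (n : ℕ) (σ : Equiv.Perm (Fin n)) :
    W (X := ⟨n⟩) (Y := ⟨n⟩) (permL σ) := by
  induction n with
  | zero =>
    rw [show σ = Equiv.refl _ from Subsingleton.elim _ _]
    exact hW.id _
  | succ n ih =>
    have hσ : σ ∈ Submonoid.closure (Set.range fun i : Fin n => Equiv.swap i.castSucc i.succ) := by
      rw [Equiv.Perm.mclosure_swap_castSucc_succ]; trivial
    induction hσ using Submonoid.closure_induction with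
    | one => exact hW.id _
    | mul x y _ _ hx hy =>
      have h := hW.comp _ _ hy hx
      have h2 : permL (x * y) = compL t _ _ _ (permL y) (permL x) := by
        rw [permL_trans]; rfl
      rw [h2]
      exact h
    | mem x hx =>
      obtain ⟨i, rfl⟩ := hx
      rcases n with _ | n
      · exact i.elim0
      · refine Fin.lastCases ?_ (fun i => ?_) i
        · have h := hW.tens _ _ (hW.id ⟨n⟩) hW.braid
          have h2 : permL (Equiv.swap (Fin.last n).castSucc (Fin.last n).succ) =
              tensL _ _ _ _ (permL (Equiv.refl (Fin n))) (permL (finAddFlip (m := 1) (n := 1))) := by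
            rw [tensL_permL]
            congr 1
            ext j
            refine Fin.addCases (m := n) (n := 2) (fun j => ?_) (fun j => ?_) j
            · rw [sumEquiv_castAdd, Equiv.swap_apply_of_ne_of_ne]
              · rfl
              · intro h; have := congrArg Fin.val h; simp at this; omega
              · intro h; have := congrArg Fin.val h; simp at this; omega
            · rw [sumEquiv_natAdd]
              fin_cases j
              · exact congrArg Fin.val (Equiv.swap_apply_left _ _)
              · exact congrArg Fin.val (Equiv.swap_apply_right _ _)
          rw [h2]
          exact h
        · have h := hW.tens _ _ (ih (Equiv.swap i.castSucc i.succ)) (hW.id ⟨1⟩)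
          have h2 : permL (Equiv.swap i.castSucc.castSucc i.castSucc.succ) =
              tensL _ _ _ _ (permL (Equiv.swap i.castSucc i.succ)) (permL (Equiv.refl (Fin 1))) := by
            rw [tensL_permL]
            congr 1
            ext j
            refine Fin.addCases (m := n + 1) (n := 1) (fun j => ?_) (fun j => ?_) j
            · rw [sumEquiv_castAdd]
              simp only [Equiv.swap_apply_def, Fin.ext_iff]
              split_ifs <;> simp_all
            · rw [sumEquiv_natAdd, Equiv.swap_apply_of_ne_of_ne]
              · rfl
              · intro h; have := congrArg Fin.val h; simp at this; omega
              · intro h; have := congrArg Fin.val h; simp at this; omega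
          rw [h2]
          exact h

theorem perm (e : Fin k ≃ Fin l) : W (X := ⟨k⟩) (Y := ⟨l⟩) (permL e) := by
  obtain rfl : k = l := by simpa using Nat.card_congr e
  exact hW.perm_self k e

theorem neut_of_eq (hk : k = 2) (hl : l = 2) (h : Even (k + l)) :
    W (X := ⟨k⟩) (Y := ⟨l⟩) (ofPart (t := t) (X := ⟨k⟩) (Y := ⟨l⟩) (block k l h)) := by
  subst hk hl
  exact hW.neut

theorem ev_of_eq (hk : k = 2) (hl : l = 0) (h : Even (k + l)) :
    W (X := ⟨k⟩) (Y := ⟨l⟩) (ofPart (t := t) (X := ⟨k⟩) (Y := ⟨l⟩) (block k l h)) := by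
  subst hk hl
  exact hW.ev

theorem coev_of_eq (hk : k = 0) (hl : l = 2) (h : Even (k + l)) :
    W (X := ⟨k⟩) (Y := ⟨l⟩) (ofPart (t := t) (X := ⟨k⟩) (Y := ⟨l⟩) (block k l h)) := by
  subst hk hl
  exact hW.coev

theorem of_K {X Y : Type} [Finite X] [Finite Y]
    {f : (FinPow.repZero t).V X ⟶ (FinPow.repZero t).V Y} {M}
    (h : (genV t).K t f M) : W f := by
  induction h with
  | perm e => exact hW.perm _
  | comp _ _ ih1 ih2 => exact hW.comp _ _ ih1 ih2
  | whisker R _ ih =>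
    rw [repZero_tens]
    exact hW.comp _ _ (hW.perm _) (hW.comp _ _ (hW.tens _ _ ih (hW.id ⟨Nat.card R⟩)) (hW.perm _))
  | smul _ ih => exact hW.smul _ ih
  | neut => exact hW.neut_of_eq (by simp) (by simp) _
  | ev => exact hW.ev_of_eq (by simp) (by simp) _
  | coev => exact hW.coev_of_eq (by simp) (by simp) _

/-- The incidence matrix of `p` is the operator of a word. Its value in the diagram category, moved
to standard sets, is `p` itself: the operator carries no factor `2`, so there is no factor `t`
either. -/
theorem ofPart (p : EvenPartition k l) :
    W (X := ⟨k⟩) (Y := ⟨l⟩) (RepZero.ofPart (t := t) (X := ⟨k⟩) (Y := ⟨l⟩) p) := by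
  obtain ⟨f, hf⟩ := NeutGen.K.exists_of_isEven (G := genV t) (t := t) p.even
  have h1 := hW.of_K hf
  have h2 := (IsModel.perm (Finite.equivFin (Fin k))).comp
    ((isModel_of_K hf).comp (IsModel.perm (Finite.equivFin (Fin l)).symm))
  have h3 := (h2.of_eq (M' := matOp p.rel) fun n g => by simp [conjOp]).eq_single
  have h4 := hW.comp (X := ⟨k⟩) (Z := ⟨l⟩) _ _ (hW.perm (Finite.equivFin (Fin k)))
    (hW.comp _ _ h1 (hW.perm (Finite.equivFin (Fin l)).symm))
  have h5 : RepZero.ofPart (t := t) (X := ⟨k⟩) (Y := ⟨l⟩) p = _ := h3.symm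
  rw [h5]
  exact h4

end IsTensorClosed

end

/-! ### From an object with neutralizer to structure morphisms on tensor powers. -/

section

namespace FinPow

variable {C : Type u} [Category.{v} C] [MonoidalCategory C] [SymmetricCategory C] (P : FinPow C)
variable {X Y Z X' Y' : Type} [Finite X] [Finite Y] [Finite Z] [Finite X'] [Finite Y']
variable {A B D A' B' : C}

/-- The product of two morphisms to tensor powers. -/
def pairV (a : A ⟶ P.V X) (b : B ⟶ P.V Y) : A ⊗ B ⟶ P.V (X ⊕ Y) := (a ⊗ₘ b) ≫ (P.mulV X Y).hom

instance (a : A ⟶ P.V X) (b : B ⟶ P.V Y) [IsIso a] [IsIso b] : IsIso (P.pairV a b) := by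
  unfold pairV; infer_instance

theorem pairV_tens {a : A ⟶ P.V X} {b : B ⟶ P.V Y} {a' : A' ⟶ P.V X'} {b' : B' ⟶ P.V Y'}
    {f : P.V X ⟶ P.V X'} {g : P.V Y ⟶ P.V Y'} {f₀ : A ⟶ A'} {g₀ : B ⟶ B'}
    (hf : a ≫ f = f₀ ≫ a') (hg : b ≫ g = g₀ ≫ b') :
    P.pairV a b ≫ P.tens f g = (f₀ ⊗ₘ g₀) ≫ P.pairV a' b' := by
  simp only [pairV, tens, Category.assoc, Iso.hom_inv_id_assoc]
  rw [MonoidalCategory.tensorHom_comp_tensorHom_assoc, hf, hg,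
    MonoidalCategory.tensorHom_comp_tensorHom_assoc]

theorem pairV_tens_id {a : A ⟶ P.V X} {b : B ⟶ P.V Y} {a' : A' ⟶ P.V X'}
    {f : P.V X ⟶ P.V X'} {f₀ : A ⟶ A'} (hf : a ≫ f = f₀ ≫ a') :
    P.pairV a b ≫ P.tens f (𝟙 _) = f₀ ▷ B ≫ P.pairV a' b := by
  rw [← tensorHom_id]
  exact P.pairV_tens hf ((Category.comp_id _).trans (Category.id_comp _).symm)

theorem pairV_id_tens {a : A ⟶ P.V X} {b : B ⟶ P.V Y} {b' : B' ⟶ P.V Y'}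
    {g : P.V Y ⟶ P.V Y'} {g₀ : B ⟶ B'} (hg : b ≫ g = g₀ ≫ b') :
    P.pairV a b ≫ P.tens (𝟙 _) g = A ◁ g₀ ≫ P.pairV a b' := by
  rw [← id_tensorHom]
  exact P.pairV_tens ((Category.comp_id _).trans (Category.id_comp _).symm) hg

/-- The products `pairV` of comparison morphisms translate associators, symmetries and unitors into
bijections of index sets, and this lets the axioms be carried over one by one. -/
theorem pairV_assoc (a : A ⟶ P.V X) (b : B ⟶ P.V Y) (c : D ⟶ P.V Z) :
    P.pairV (P.pairV a b) c ≫ P.perm (Equiv.sumAssoc X Y Z) =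
      (α_ A B D).hom ≫ P.pairV a (P.pairV b c) := by
  have h := P.mulV_assoc X Y Z
  have e1 : (((a ⊗ₘ b) ≫ (P.mulV X Y).hom) ⊗ₘ c) = ((a ⊗ₘ b) ⊗ₘ c) ≫ (P.mulV X Y).hom ▷ _ := by
    rw [← tensorHom_id, MonoidalCategory.tensorHom_comp_tensorHom, Category.comp_id]
  have e2 : (a ⊗ₘ ((b ⊗ₘ c) ≫ (P.mulV Y Z).hom)) = (a ⊗ₘ (b ⊗ₘ c)) ≫ _ ◁ (P.mulV Y Z).hom := by
    rw [← id_tensorHom, MonoidalCategory.tensorHom_comp_tensorHom, Category.comp_id]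
  simp only [pairV, e1, e2, Category.assoc]
  rw [h, MonoidalCategory.associator_naturality_assoc]

theorem pairV_assoc_symm (a : A ⟶ P.V X) (b : B ⟶ P.V Y) (c : D ⟶ P.V Z) :
    P.pairV a (P.pairV b c) ≫ P.perm (Equiv.sumAssoc X Y Z).symm =
      (α_ A B D).inv ≫ P.pairV (P.pairV a b) c := by
  rw [← cancel_epi (α_ A B D).hom, Iso.hom_inv_id_assoc, ← reassoc_of% (P.pairV_assoc a b c),
    P.perm_comp_symm, Category.comp_id]

theorem pairV_comm (a : A ⟶ P.V X) (b : B ⟶ P.V Y) :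
    P.pairV a b ≫ P.perm (Equiv.sumComm X Y) = (β_ A B).hom ≫ P.pairV b a := by
  simp only [pairV, Category.assoc]
  rw [← P.mulV_braid, BraidedCategory.braiding_naturality_assoc]

theorem pairV_left (a : A ⟶ P.V X) :
    P.pairV P.unitV.hom a ≫ P.perm (Equiv.emptySum Empty X) = (λ_ A).hom ≫ a := by
  rw [pairV, Category.assoc, MonoidalCategory.tensorHom_def', Category.assoc, P.mulV_left,
    leftUnitor_naturality]

theorem pairV_left_symm (a : A ⟶ P.V X) :
    a ≫ P.perm (Equiv.emptySum Empty X).symm = (λ_ A).inv ≫ P.pairV P.unitV.hom a := by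
  rw [← cancel_epi (λ_ A).hom, Iso.hom_inv_id_assoc, ← reassoc_of% (P.pairV_left a),
    P.perm_comp_symm, Category.comp_id]

theorem pairV_right (a : A ⟶ P.V X) :
    P.pairV a P.unitV.hom ≫ P.perm (Equiv.sumEmpty X Empty) = (ρ_ A).hom ≫ a := by
  rw [pairV, Category.assoc, MonoidalCategory.tensorHom_def, Category.assoc, P.mulV_right,
    rightUnitor_naturality]

namespace NeutGen

/-- The structure morphisms on tensor powers that correspond to those of an object. -/
def ofNeut (N : NeutData C) (u : N.A ≅ P.V Unit) : P.NeutGen where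
  α := inv (P.pairV u.hom u.hom) ≫ N.α ≫ P.pairV u.hom u.hom
  β := inv (P.pairV u.hom u.hom) ≫ N.β ≫ P.unitV.hom
  δ := P.unitV.inv ≫ N.δ ≫ P.pairV u.hom u.hom

variable {P} (N : NeutData C) (u : N.A ≅ P.V Unit)

theorem pairV_α : P.pairV u.hom u.hom ≫ (ofNeut P N u).α = N.α ≫ P.pairV u.hom u.hom :=
  IsIso.hom_inv_id_assoc _ _

theorem pairV_β : P.pairV u.hom u.hom ≫ (ofNeut P N u).β = N.β ≫ P.unitV.hom :=
  IsIso.hom_inv_id_assoc _ _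

theorem unitV_δ : P.unitV.hom ≫ (ofNeut P N u).δ = N.δ ≫ P.pairV u.hom u.hom :=
  Iso.hom_inv_id_assoc _ _

theorem pairV_cup : u.hom ≫ (ofNeut P N u).cup Unit =
    (λ_ _).inv ≫ N.δ ▷ N.A ≫ P.pairV (P.pairV u.hom u.hom) u.hom := by
  rw [cup, reassoc_of% P.pairV_left_symm, P.pairV_tens_id (unitV_δ N u)]

theorem pairV_cap : P.pairV (P.pairV u.hom u.hom) u.hom ≫ (ofNeut P N u).cap Unit =
    N.β ▷ N.A ≫ (λ_ _).hom ≫ u.hom := by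
  rw [cap, reassoc_of% (P.pairV_tens_id (pairV_β N u)), P.pairV_left]

variable {N} [Preadditive C] [Linear ℂ C]

/-- The slide relation for the coevaluation moves the neutralizer to the other side, where `β`
absorbs it; what remains is the zigzag `zigzag_right`. In `NeutGen.Rel` this consequence stands in
for the slide relations and the second zigzag. -/
theorem _root_.HypDeligne.IsRigidNeut.trace {t : ℂ} (hN : IsRigidNeut t N) :
    (λ_ N.A).inv ≫ N.δ ▷ N.A ≫ (α_ _ _ _).hom ≫ N.A ◁ N.α ≫ (α_ _ _ _).inv ≫ N.β ▷ N.A ≫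
      (λ_ N.A).hom = 𝟙 _ := by
  have h := hN.coev_slide
  rw [reassoc_of% h, Iso.hom_inv_id_assoc, ← comp_whiskerRight_assoc, hN.neut_ev,
    reassoc_of% hN.zigzag_right]
  simp

/-- Each relation is precomposed with an invertible product of copies of `u`, or with the unit
isomorphism, and then pushed through to the matching axiom for `N`. -/
theorem _root_.HypDeligne.IsRigidNeut.rel {t : ℂ} (hN : IsRigidNeut t N) (u : N.A ≅ P.V Unit) :
    (ofNeut P N u).Rel t := by
  have ha := pairV_α N u
  have hb := pairV_β N u
  have hd := unitV_δ N u
  have hs := P.pairV_comm u.hom u.hom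
  constructor
  · rw [← cancel_epi (P.pairV u.hom u.hom), reassoc_of% ha, ha, reassoc_of% hN.idem]
  · rw [← cancel_epi (P.pairV u.hom u.hom), reassoc_of% hs, ha, reassoc_of% hN.swap_neut]
  · rw [← cancel_epi (P.pairV u.hom u.hom), reassoc_of% ha, hs, ha, reassoc_of% hN.neut_swap]
  · rw [← cancel_epi (P.pairV u.hom (P.pairV u.hom u.hom))]
    simp only [Category.assoc]
    rw [reassoc_of% P.pairV_assoc_symm, reassoc_of% (P.pairV_tens_id ha), reassoc_of% P.pairV_assoc,
      P.pairV_id_tens ha, reassoc_of% (P.pairV_id_tens ha), reassoc_of% P.pairV_assoc_symm,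
      reassoc_of% (P.pairV_tens_id ha), P.pairV_assoc]
    have h := hN.exchange
    rw [← cancel_mono (α_ _ _ _).hom] at h
    simp only [Category.assoc, Iso.inv_hom_id, Category.comp_id] at h
    rw [← cancel_epi (α_ _ _ _).hom, Iso.hom_inv_id_assoc, reassoc_of% h]
  · rw [← cancel_epi (P.pairV u.hom u.hom), reassoc_of% ha, hb, reassoc_of% hN.neut_ev]
  · rw [← cancel_epi P.unitV.hom, reassoc_of% hd, ha, hd, reassoc_of% hN.coev_neut]
  · rw [← cancel_epi (P.pairV u.hom u.hom), reassoc_of% hs, hb, reassoc_of% hN.swap_ev]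
  · rw [← cancel_epi P.unitV.hom, reassoc_of% hd, hb, reassoc_of% hN.dim]
    simp
  · rw [← cancel_epi u.hom, reassoc_of% (pairV_cup N u), reassoc_of% P.pairV_assoc,
      reassoc_of% (P.pairV_id_tens hb), P.pairV_right, reassoc_of% hN.zigzag_left]
    simp
  · rw [← cancel_epi u.hom, reassoc_of% (pairV_cup N u), reassoc_of% P.pairV_assoc,
      reassoc_of% (P.pairV_id_tens ha), reassoc_of% P.pairV_assoc_symm, pairV_cap,
      reassoc_of% hN.trace]
    simp

end NeutGen

/-- The object is its first tensor power. -/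
def unitIso (A : C) : A ≅ (ofObj A).V Unit :=
  (λ_ A).symm ≪≫ (ofObj A).SIso (finCongr (by simp) : Fin 1 ≃ Fin (Nat.card Unit))

end FinPow

end

/-! ### The symmetric monoidal functor on diagrams given by an object with neutralizer. -/

section

open RepZero EvenPartition

namespace FinPow

variable {C : Type u} [Category.{v} C] [MonoidalCategory C] [SymmetricCategory C]

section Mul

variable (P : FinPow C)

/-- The multiplication of the tensor powers on standard sets. -/
def mulFin (m n : ℕ) : P.V (Fin m) ⊗ P.V (Fin n) ≅ P.V (Fin (m + n)) :=
  P.mulV _ _ ≪≫ P.permIso (finSumFinEquiv (m := m) (n := n))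

theorem mulFin_hom (m n : ℕ) :
    (P.mulFin m n).hom = (P.mulV (Fin m) (Fin n)).hom ≫ P.perm finSumFinEquiv := rfl

theorem mulFin_naturality {m n m' n' : ℕ} (f : P.V (Fin m) ⟶ P.V (Fin m'))
    (g : P.V (Fin n) ⟶ P.V (Fin n')) :
    (f ⊗ₘ g) ≫ (P.mulFin m' n').hom = (P.mulFin m n).hom ≫ P.perm finSumFinEquiv.symm ≫
      P.tens f g ≫ P.perm finSumFinEquiv := by
  simp only [mulFin_hom, tens, Category.assoc]
  rw [reassoc_of% (P.perm_comp_symm (finSumFinEquiv (m := m) (n := n))), Iso.hom_inv_id_assoc]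

theorem mulFin_assoc (a b c : ℕ) :
    (P.mulFin a b).hom ▷ P.V (Fin c) ≫ (P.mulFin (a + b) c).hom ≫
      P.perm (finCongr (add_assoc a b c)) =
    (α_ _ _ _).hom ≫ P.V (Fin a) ◁ (P.mulFin b c).hom ≫ (P.mulFin a (b + c)).hom := by
  have h := P.mulV_assoc (Fin a) (Fin b) (Fin c)
  have n1 := P.mulV_naturality (finSumFinEquiv (m := a) (n := b)) (Equiv.refl (Fin c))
  have n2 := P.mulV_naturality (Equiv.refl (Fin a)) (finSumFinEquiv (m := b) (n := c))
  rw [P.perm_refl, tensorHom_id] at n1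
  rw [P.perm_refl, id_tensorHom] at n2
  simp only [mulFin_hom, comp_whiskerRight, MonoidalCategory.whiskerLeft_comp, Category.assoc]
  rw [reassoc_of% n1, reassoc_of% n2, ← reassoc_of% h, P.perm_perm, P.perm_perm, P.perm_perm, P.perm_perm]
  congr 2
  refine P.perm_congr fun x => ?_
  rcases x with (x | x) | x
  · ext; simp
  · ext; simp
  · ext; simp [add_assoc]

/-- The unit of the tensor powers on standard sets. -/
def unitFin : 𝟙_ C ≅ P.V (Fin 0) := P.unitV ≪≫ P.permIso (Equiv.equivOfIsEmpty _ _)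

theorem unitFin_hom : P.unitFin.hom = P.unitV.hom ≫ P.perm (Equiv.equivOfIsEmpty _ _) := rfl

theorem mulFin_left (n : ℕ) : P.unitFin.hom ▷ P.V (Fin n) ≫ (P.mulFin 0 n).hom ≫
    P.perm (finCongr (zero_add n)) = (λ_ _).hom := by
  have n1 := P.mulV_naturality (Equiv.equivOfIsEmpty Empty (Fin 0)) (Equiv.refl (Fin n))
  rw [P.perm_refl, tensorHom_id] at n1
  rw [unitFin_hom, mulFin_hom, comp_whiskerRight, Category.assoc, Category.assoc, reassoc_of% n1,
    P.perm_perm, P.perm_perm, ← P.mulV_left]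
  congr 2
  refine P.perm_congr fun x => ?_
  rcases x with x | x
  · exact x.elim
  · ext; simp

theorem mulFin_right (n : ℕ) : P.V (Fin n) ◁ P.unitFin.hom ≫ (P.mulFin n 0).hom ≫
    P.perm (finCongr (add_zero n)) = (ρ_ _).hom := by
  have n1 := P.mulV_naturality (Equiv.refl (Fin n)) (Equiv.equivOfIsEmpty Empty (Fin 0))
  rw [P.perm_refl, id_tensorHom] at n1
  rw [unitFin_hom, mulFin_hom, MonoidalCategory.whiskerLeft_comp, Category.assoc, Category.assoc,
    reassoc_of% n1, P.perm_perm, P.perm_perm, ← P.mulV_right]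
  congr 2
  refine P.perm_congr fun x => ?_
  rcases x with x | x
  · ext; exact congrArg Fin.val (finSumFinEquiv_apply_left (n := 0) x)
  · exact x.elim

theorem mulFin_braid (m n : ℕ) : (P.mulFin m n).hom ≫ P.perm finAddFlip =
    (β_ _ _).hom ≫ (P.mulFin n m).hom := by
  rw [mulFin_hom, mulFin_hom, reassoc_of% P.mulV_braid, Category.assoc, P.perm_perm, P.perm_perm]
  congr 1
  exact P.perm_congr fun x => by rcases x with x | x <;> simp

end Mul

namespace NeutGen

variable {P : FinPow C} {G : P.NeutGen} [Preadditive C] [Linear ℂ C] [MonoidalPreadditive C]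
  [MonoidalLinear ℂ C] {t : ℂ} {k l m k' l' m' : ℕ}

theorem K.tens {X Y X' Y' : Type} [Finite X] [Finite Y] [Finite X'] [Finite Y']
    {f : P.V X ⟶ P.V Y} {g : P.V X' ⟶ P.V Y'} {M N} (hf : G.K t f M) (hg : G.K t g N) :
    G.K t (P.tens f g) (fun n h => M (fun a => N (fun b => n (Sum.elim a b))
      (fun x => h (.inr x))) (fun x => h (.inl x))) := by
  have h := (hf.whisker X').comp (hg.whiskerLeft Y)
  rw [P.tens_comp, Category.comp_id, Category.id_comp] at h
  exact h

theorem matOp_eq_sum (p : EvenPartition k l) (n : (Fin l → Bool) → ℕ) (f : Fin k → Bool) :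
    matOp p.rel n f = ∑ g, p.M f g * n g := finsum_eq_sum_of_fintype _

theorem matOp_matOp (p : EvenPartition k l) (q : EvenPartition l m) (n : (Fin m → Bool) → ℕ)
    (f : Fin k → Bool) :
    matOp p.rel (matOp q.rel n) f = 2 ^ loops p q * matOp (vcomp p q).rel n f := by
  simp only [matOp_eq_sum, Finset.mul_sum]
  rw [Finset.sum_comm]
  refine Finset.sum_congr rfl fun g _ => ?_
  rw [← _root_.mul_assoc, ← sum_M, Finset.sum_mul]
  simp only [_root_.mul_assoc]

theorem matOp_ofEquiv (e : Fin k ≃ Fin l) (n : (Fin l → Bool) → ℕ) (f : Fin k → Bool) :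
    matOp (ofEquiv e).rel n f = n (fun y => f (e.symm y)) := by
  simp [matOp_eq_sum, M_ofEquiv']

theorem matOp_hcomp (p : EvenPartition k l) (q : EvenPartition k' l')
    (n : (Fin (l + l') → Bool) → ℕ) (f : Fin (k + k') → Bool) :
    matOp (hcomp p q).rel n f = matOp p.rel (fun a => matOp q.rel (fun b => n (Fin.append a b))
      (fun i => f (Fin.natAdd k i))) (fun i => f (Fin.castAdd k' i)) := by
  simp only [matOp_eq_sum, Finset.mul_sum]
  rw [sum_fin]
  refine Finset.sum_congr rfl fun a _ => Finset.sum_congr rfl fun b _ => ?_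
  rw [M_hcomp, _root_.mul_assoc]
  simp only [Fin.append_left, Fin.append_right]

theorem K.pow_smul {X Y : Type} [Finite X] [Finite Y] {f : P.V X ⟶ P.V Y} {M} (hf : G.K t f M)
    (a : ℕ) : G.K t (t ^ a • f) (fun n h => 2 ^ a * M n h) := by
  induction a with
  | zero => simpa using hf
  | succ a ih =>
    rw [pow_succ', mul_smul]
    exact ih.smul.of_eq fun n h => by rw [pow_succ', _root_.mul_assoc]

variable (G t) in
/-- The morphism of tensor powers given by an even partition. -/
def mapPart (p : EvenPartition k l) : P.V (Fin k) ⟶ P.V (Fin l) :=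
  (K.exists_of_isEven (G := G) (t := t) p.even).choose

theorem K_mapPart (p : EvenPartition k l) : G.K t (G.mapPart t p) (matOp p.rel) :=
  (K.exists_of_isEven (G := G) (t := t) p.even).choose_spec

variable (G t) in
/-- The linear extension of the assignment of morphisms to even partitions. -/
def mapLin (k l : ℕ) : LinPart k l →ₗ[ℂ] (P.V (Fin k) ⟶ P.V (Fin l)) :=
  Finsupp.linearCombination ℂ (G.mapPart t)

theorem mapLin_single (p : EvenPartition k l) (a : ℂ) :
    G.mapLin t k l (.single p a) = a • G.mapPart t p := by
  rw [mapLin, Finsupp.linearCombination_single]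

variable (hG : G.Rel t)
include hG

/-- Both sides are words. Their operators agree by the matrix form of stacking, in which each loop
contributes `2` where the scalar contributes `t`. -/
theorem Rel.mapPart_comp (p : EvenPartition k l) (q : EvenPartition l m) :
    G.mapPart t p ≫ G.mapPart t q = t ^ loops p q • G.mapPart t (vcomp p q) :=
  hG.K_unique (((K_mapPart p).comp (K_mapPart q)).of_eq fun n f => (matOp_matOp p q n f).symm)
    ((K_mapPart _).pow_smul _)

theorem Rel.mapPart_ofEquiv (e : Fin k ≃ Fin l) : G.mapPart t (ofEquiv e) = P.perm e :=
  hG.K_unique (K_mapPart _) ((K.perm e).of_eq fun n f => matOp_ofEquiv e n f)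

/-- Again two words with the same operator: horizontal concatenation has the Kronecker product of
the incidence matrices. -/
theorem Rel.mapPart_hcomp (p : EvenPartition k l) (q : EvenPartition k' l') :
    G.mapPart t (hcomp p q) = P.perm finSumFinEquiv.symm ≫
      P.tens (G.mapPart t p) (G.mapPart t q) ≫ P.perm finSumFinEquiv := by
  refine hG.K_unique (K_mapPart _) (((K.perm _).comp (((K_mapPart p).tens (K_mapPart q)).comp
    (K.perm _))).of_eq fun n f => ?_)
  rw [matOp_hcomp]
  beta_reduce
  congr 1
  funext a
  congr 1
  funext b
  congr 1
  funext i
  refine Fin.addCases (fun i => ?_) (fun i => ?_) i <;> simp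

theorem Rel.mapLin_permL (e : Fin k ≃ Fin l) : G.mapLin t k l (permL e) = P.perm e := by
  rw [permL, mapLin_single, one_smul, hG.mapPart_ofEquiv]

theorem Rel.mapLin_compL (x : LinPart k l) (y : LinPart l m) :
    G.mapLin t _ _ (compL t _ _ _ x y) = G.mapLin t _ _ x ≫ G.mapLin t _ _ y := by
  induction x using Finsupp.induction_linear with
  | zero => simp
  | add x x' h h' => simp [h, h']
  | single p a =>
  induction y using Finsupp.induction_linear with
  | zero => simp
  | add x x' h h' => simp [h, h']
  | single q b =>
  rw [compL_single, mapLin_single, mapLin_single, mapLin_single, Linear.smul_comp,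
    Linear.comp_smul, hG.mapPart_comp, smul_smul, smul_smul]

theorem Rel.mapLin_tensL (x : LinPart k l) (y : LinPart k' l') :
    G.mapLin t _ _ (tensL _ _ _ _ x y) = P.perm finSumFinEquiv.symm ≫
      P.tens (G.mapLin t _ _ x) (G.mapLin t _ _ y) ≫ P.perm finSumFinEquiv := by
  induction x using Finsupp.induction_linear with
  | zero => simp [tens, MonoidalPreadditive.zero_tensor]
  | add x x' h h' => simp [h, h', tens, MonoidalPreadditive.add_tensor]
  | single p a =>
  induction y using Finsupp.induction_linear with
  | zero => simp [tens, MonoidalPreadditive.tensor_zero]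
  | add x x' h h' => simp [h, h', tens, MonoidalPreadditive.tensor_add]
  | single q b =>
  rw [tensL_single, mapLin_single, mapLin_single, mapLin_single, P.smul_tens, P.tens_smul,
    hG.mapPart_hcomp, smul_smul, Linear.smul_comp, Linear.comp_smul]

theorem Rel.mulFin_mapLin (x : LinPart k l) (y : LinPart k' l') :
    (G.mapLin t _ _ x ⊗ₘ G.mapLin t _ _ y) ≫ (P.mulFin l l').hom =
      (P.mulFin k k').hom ≫ G.mapLin t _ _ (tensL _ _ _ _ x y) := by
  rw [P.mulFin_naturality, hG.mapLin_tensL]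

/-- The functor on even partition diagrams given by the structure morphisms. -/
def Rel.functor : RepZero t ⥤ C where
  obj X := P.V (Fin X.n)
  map f := G.mapLin t _ _ f
  map_id _ := (hG.mapLin_permL _).trans (P.perm_refl _)
  map_comp f g := hG.mapLin_compL f g

instance : hG.functor.Additive where
  map_add := map_add (G.mapLin t _ _) _ _

instance : hG.functor.Linear ℂ where
  map_smul _ _ := map_smul (G.mapLin t _ _) _ _

/-- The monoidal structure of the functor on even partition diagrams. -/
def Rel.coreMonoidal : hG.functor.CoreMonoidal where
  εIso := P.unitFin
  μIso X Y := P.mulFin X.n Y.n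
  μIso_hom_natural_left {X Y} f Z := by
    have h := hG.mulFin_mapLin f (permL (Equiv.refl (Fin Z.n)))
    rw [hG.mapLin_permL, P.perm_refl, tensorHom_id] at h
    exact h
  μIso_hom_natural_right {X Y} Z f := by
    have h := hG.mulFin_mapLin (permL (Equiv.refl (Fin Z.n))) f
    rw [hG.mapLin_permL, P.perm_refl, id_tensorHom] at h
    exact h
  associativity X Y Z := by
    have h : hG.functor.map (α_ X Y Z).hom = P.perm (finCongr (add_assoc X.n Y.n Z.n)) :=
      hG.mapLin_permL _
    rw [h]
    exact P.mulFin_assoc X.n Y.n Z.n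
  left_unitality X := by
    have h : hG.functor.map (λ_ X).hom = P.perm (finCongr (zero_add X.n)) := hG.mapLin_permL _
    rw [h]
    exact (P.mulFin_left X.n).symm
  right_unitality X := by
    have h : hG.functor.map (ρ_ X).hom = P.perm (finCongr (add_zero X.n)) := hG.mapLin_permL _
    rw [h]
    exact (P.mulFin_right X.n).symm

instance : hG.functor.Braided where
  __ := hG.coreMonoidal.toMonoidal
  braided X Y := by
    have h : hG.functor.map (β_ X Y).hom = P.perm finAddFlip := hG.mapLin_permL _
    rw [h]
    exact P.mulFin_braid X.n Y.n

end NeutGen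
end FinPow

end

/-! ### The constructed functor sends the generating object back to the given one. -/

section

open RepZero EvenPartition

section

open Functor.LaxMonoidal Functor.OplaxMonoidal

variable {D C : Type*} [Category* D] [MonoidalCategory D] [Category* C] [MonoidalCategory C]
  (F : D ⥤ C) [F.Monoidal] (X : NeutData D)

variable {F X}

/-- An isomorphism from an object with structure morphisms to the image of another one. -/
def homMap {N : NeutData C} (w : N.A ≅ F.obj X.A) (q : N.A ⊗ N.A ⟶ F.obj (X.A ⊗ X.A))
    (hq : (w.hom ⊗ₘ w.hom) ≫ μ F X.A X.A = q) (hα : N.α ≫ q = q ≫ F.map X.α)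
    (hβ : q ≫ F.map X.β = N.β ≫ ε F) (hδ : N.δ ≫ q = ε F ≫ F.map X.δ) : N ⟶ mapNeutData F X where
  iso := w
  comm_α := by
    have h : N.α ≫ (w.hom ⊗ₘ w.hom) = (w.hom ⊗ₘ w.hom) ≫ μ F X.A X.A ≫ F.map X.α ≫ δ F X.A X.A := by
      rw [← cancel_mono (μ F X.A X.A), Category.assoc, hq, hα, ← hq]
      simp
    exact h
  comm_β := by
    have h : (w.hom ⊗ₘ w.hom) ≫ μ F X.A X.A ≫ F.map X.β ≫ η F = N.β := by
      rw [reassoc_of% hq, reassoc_of% hβ]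
      simp
    exact h
  comm_δ := by
    have h : N.δ ≫ (w.hom ⊗ₘ w.hom) = ε F ≫ F.map X.δ ≫ δ F X.A X.A := by
      rw [← cancel_mono (μ F X.A X.A), Category.assoc, hq, hδ]
      simp
    exact h

end

namespace FinPow

variable {C : Type u} [Category.{v} C] [MonoidalCategory C] [SymmetricCategory C]

namespace NeutGen

variable {P : FinPow C} {G : P.NeutGen} [Preadditive C] [Linear ℂ C] [MonoidalPreadditive C]
  [MonoidalLinear ℂ C] {t : ℂ}

theorem matOp_block {k l : ℕ} (h : Even (k + l)) (h0 : 0 < k + l) (n : (Fin l → Bool) → ℕ)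
    (f : Fin k → Bool) : matOp (block k l h).rel n f =
      ∑ b : Bool, (if f = fun _ => b then 1 else 0) * n (fun _ => b) := by
  simp only [matOp_eq_sum, block_M h h0, Finset.sum_mul]
  rw [Finset.sum_comm]
  refine Finset.sum_congr rfl fun b _ => ?_
  rw [Finset.sum_eq_single (fun _ => b)]
  · simp
  · intro g _ hg
    simp [hg]
  · simp

theorem sum_ite_const (f : Fin 2 → Bool) (n : (Fin 2 → Bool) → ℕ) :
    (∑ b : Bool, (if f = fun _ => b then 1 else 0) * n (fun _ => b)) =
      if f 0 = f 1 then n f else 0 := by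
  have key : ∀ b, (f = fun _ => b) ↔ f 0 = b ∧ f 1 = b := by
    intro b
    constructor
    · rintro rfl; exact ⟨rfl, rfl⟩
    · rintro ⟨h0, h1⟩
      funext i
      fin_cases i
      · exact h0
      · exact h1
  rw [Finset.sum_eq_single (f 0)]
  · by_cases h : f 0 = f 1
    · have h2 := (key (f 0)).2 ⟨rfl, h.symm⟩
      rw [if_pos h2, if_pos h, one_mul, ← h2]
    · rw [if_neg (fun h2 => h ((key _).1 h2).2.symm), if_neg h, zero_mul]
  · intro b _ hb
    rw [if_neg fun h => hb ((key b).1 h).1.symm, zero_mul]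
  · simp

/-- The bijection between the two standard two-element sets. -/
def pairFin : Unit ⊕ Unit ≃ Fin (1 + 1) :=
  (Equiv.sumCongr finOneEquiv.symm finOneEquiv.symm).trans finSumFinEquiv

variable (hG : G.Rel t)
include hG

/-- The word chosen for the block need not be `α`, but it has the same operator up to relabelling,
so the two agree. The evaluation and the coevaluation are treated in the same way. -/
theorem Rel.mapPart_neut : P.perm pairFin ≫ G.mapPart t (block 2 2 (by decide)) =
    G.α ≫ P.perm pairFin := by
  refine hG.K_unique ((K.perm _).comp (K_mapPart _)) ((K.neut.comp (K.perm _)).of_eq fun n f => ?_)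
  rw [matOp_block _ (by decide), sum_ite_const]
  rfl

theorem Rel.mapPart_ev : P.perm pairFin ≫ G.mapPart t (block 2 0 (by decide)) =
    G.β ≫ P.perm (Equiv.equivOfIsEmpty _ _) := by
  refine hG.K_unique ((K.perm _).comp (K_mapPart _)) ((K.ev.comp (K.perm _)).of_eq fun n f => ?_)
  rw [matOp_block _ (by decide)]
  refine Eq.trans (Finset.sum_congr rfl fun b _ => ?_) (sum_ite_const
    (fun i => f (pairFin.symm i)) fun _ => n fun y => ((Equiv.equivOfIsEmpty Empty _).symm y).elim)
  congr 2
  exact Subsingleton.elim _ _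

theorem Rel.mapPart_coev : P.perm (Equiv.equivOfIsEmpty _ _) ≫
    G.mapPart t (block 0 2 (by decide)) = G.δ ≫ P.perm pairFin := by
  refine hG.K_unique ((K.perm _).comp (K_mapPart _))
    ((K.coev.comp (K.perm _)).of_eq fun n f => ?_)
  rw [matOp_block _ (by decide)]
  refine Finset.sum_congr rfl fun b _ => ?_
  rw [if_pos (Subsingleton.elim _ _), one_mul]

theorem Rel.functor_map_ofPart {X Y : RepZero t} (p : EvenPartition X.n Y.n) :
    hG.functor.map (ofPart p) = G.mapPart t p := by
  exact (mapLin_single p 1).trans (one_smul _ _)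

end NeutGen

open NeutGen Functor.LaxMonoidal Functor.OplaxMonoidal

variable {P : FinPow C} [Preadditive C] [Linear ℂ C] [MonoidalPreadditive C]
  [MonoidalLinear ℂ C] {t : ℂ} {N : NeutData C}

theorem pairV_pairFin (u : N.A ≅ P.V Unit) :
    ((u.hom ≫ P.perm finOneEquiv.symm) ⊗ₘ (u.hom ≫ P.perm finOneEquiv.symm)) ≫
      (P.mulFin 1 1).hom = P.pairV u.hom u.hom ≫ P.perm pairFin := by
  rw [← MonoidalCategory.tensorHom_comp_tensorHom, mulFin_hom, Category.assoc,
    reassoc_of% P.mulV_naturality, P.perm_perm, pairV, Category.assoc]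
  rfl

/-- The functor given by an object with neutralizer sends the generating object to it. -/
def evalIso (hN : IsRigidNeut t N) (u : N.A ≅ P.V Unit) :
    N ⟶ mapNeutData (hN.rel u).functor (genZero t) := by
  refine homMap (u ≪≫ P.permIso finOneEquiv.symm) (P.pairV u.hom u.hom ≫ P.perm pairFin)
    (pairV_pairFin u) ?_ ?_ ?_
  · have h1 : (hN.rel u).functor.map (genZero t).α = _ := (hN.rel u).functor_map_ofPart _
    rw [h1]
    refine ((reassoc_of% (pairV_α N u)) _).symm.trans ?_
    exact (congrArg _ (hN.rel u).mapPart_neut.symm).trans (Category.assoc _ _ _).symm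
  · have h1 : (hN.rel u).functor.map (genZero t).β = _ := (hN.rel u).functor_map_ofPart _
    rw [h1]
    refine (Category.assoc _ _ _).trans ((congrArg _ (hN.rel u).mapPart_ev).trans ?_)
    exact (reassoc_of% (pairV_β N u)) _
  · have h1 : (hN.rel u).functor.map (genZero t).δ = _ := (hN.rel u).functor_map_ofPart _
    rw [h1]
    refine ((reassoc_of% (unitV_δ N u)) _).symm.trans ?_
    exact (congrArg _ (hN.rel u).mapPart_coev.symm).trans (Category.assoc _ _ _).symm

end FinPow

end

/-! ### Realizing objects of the Karoubian envelope as summands of biproducts. -/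

section

open Idempotents

universe v₁ u₁

variable {D : Type u₁} [Category.{v₁} D] [Preadditive D] {C : Type u} [Category.{v} C]
  [Preadditive C]

/-- A realization of an object of the Karoubian envelope in the target category of a functor on the
original category: a direct summand of the direct sum of the images of the entries. -/
structure Realization (F : D ⥤ C) (P : Karoubi (Mat_ D)) where
  Z : C
  ι : ∀ k, F.obj (P.X.X k) ⟶ Z
  π : ∀ k, Z ⟶ F.obj (P.X.X k)
  ι_π : ∀ k l, ι k ≫ π l = F.map (P.p k l)
  total : ∑ k, π k ≫ ι k = 𝟙 Z

/-- The image of the idempotent matrix under the additive functor is an idempotent of the biproduct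
of the images of the entries, and its splitting gives the realization. -/
theorem nonempty_realization [HasFiniteBiproducts C] [IsIdempotentComplete C] (F : D ⥤ C)
    [F.Additive] (P : Karoubi (Mat_ D)) : Nonempty (Realization F P) := by
  have h : (biproduct.matrix fun k l => F.map (P.p k l)) ≫
      (biproduct.matrix fun k l => F.map (P.p k l)) =
      biproduct.matrix fun k l => F.map (P.p k l) := by
    ext l k
    have h := congrArg (fun f : P.X ⟶ P.X => F.map (f k l)) P.idem
    simp only [Mat_.comp_apply, Functor.map_sum, Functor.map_comp] at h
    simpa [biproduct.lift_desc] using h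
  obtain ⟨Z, i, e, hie, hei⟩ := IsIdempotentComplete.idempotents_split _ _ h
  refine ⟨⟨Z, fun k => biproduct.ι (fun k => F.obj (P.X.X k)) k ≫ e,
    fun k => i ≫ biproduct.π (fun k => F.obj (P.X.X k)) k, fun k l => ?_, ?_⟩⟩
  · rw [Category.assoc, reassoc_of% hei]
    simp
  · simp only [Category.assoc]
    rw [← Preadditive.comp_sum]
    simp only [← Category.assoc (biproduct.π _ _)]
    rw [← Preadditive.sum_comp, biproduct.total, Category.id_comp, hie]

namespace Realization

variable {F G H : D ⥤ C} {P Q S : Karoubi (Mat_ D)}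

theorem hom_ext (R : Realization F P) {W : C} {f g : R.Z ⟶ W} (h : ∀ k, R.ι k ≫ f = R.ι k ≫ g) :
    f = g := by
  rw [← Category.id_comp f, ← Category.id_comp g, ← R.total, Preadditive.sum_comp,
    Preadditive.sum_comp]
  refine Finset.sum_congr rfl fun k _ => ?_
  rw [Category.assoc, Category.assoc, h]

theorem sum_map_ι (R : Realization F P) (k : P.X.ι) :
    ∑ l, F.map (P.p k l) ≫ R.ι l = R.ι k := by
  simp only [← R.ι_π, Category.assoc]
  rw [← Preadditive.comp_sum, R.total, Category.comp_id]

/-- The morphism of realizations given by a natural transformation and a morphism. -/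
def hom (R : Realization F P) (τ : F ⟶ G) (f : P ⟶ Q) (S : Realization G Q) : R.Z ⟶ S.Z :=
  ∑ k, R.π k ≫ ∑ l, F.map (f.f k l) ≫ τ.app _ ≫ S.ι l

/-- The sum over the projections disappears because `f` absorbs the idempotent of `P`. Since the
inclusions are jointly epimorphic, this determines `hom`. -/
theorem ι_hom [F.Additive] (R : Realization F P) (τ : F ⟶ G) (f : P ⟶ Q) (S : Realization G Q)
    (k : P.X.ι) : R.ι k ≫ R.hom τ f S = ∑ l, F.map (f.f k l) ≫ τ.app _ ≫ S.ι l := by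
  have h : ∀ l, F.map (f.f k l) = ∑ m, F.map (P.p k m) ≫ F.map (f.f m l) := by
    intro l
    have h := congrArg (fun f : P.X ⟶ Q.X => F.map (f k l)) (Karoubi.p_comp f)
    simp only [Mat_.comp_apply, Functor.map_sum, Functor.map_comp] at h
    exact h.symm
  rw [hom, Preadditive.comp_sum]
  simp only [← Category.assoc, R.ι_π, h, Preadditive.sum_comp, Preadditive.comp_sum]
  exact Finset.sum_comm

/-- The realizations are arbitrary and the functor may vary, so that one computation serves the
functoriality of the extension as well as the naturality and invertibility of extended isomorphisms.
-/
theorem hom_comp [F.Additive] [G.Additive] (R : Realization F P) (τ : F ⟶ G) (f : P ⟶ Q)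
    (S : Realization G Q) {K : Karoubi (Mat_ D)} (σ : G ⟶ H) (g : Q ⟶ K) (T : Realization H K) :
    R.hom τ f S ≫ S.hom σ g T = R.hom (τ ≫ σ) (f ≫ g) T := by
  refine R.hom_ext fun k => ?_
  rw [← Category.assoc, ι_hom, ι_hom, Preadditive.sum_comp]
  simp only [Category.assoc, ι_hom, Preadditive.comp_sum]
  have h : ∀ l, F.map ((f ≫ g).f k l) = ∑ m, F.map (f.f k m) ≫ F.map (g.f m l) := by
    intro l
    rw [Karoubi.comp_f, Mat_.comp_apply, Functor.map_sum]
    simp only [Functor.map_comp]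
  simp only [h, Preadditive.sum_comp, NatTrans.comp_app, Category.assoc]
  rw [Finset.sum_comm]
  refine Finset.sum_congr rfl fun l _ => Finset.sum_congr rfl fun m _ => ?_
  simp only [NatTrans.naturality_assoc]

theorem hom_id [F.Additive] (R : Realization F P) : R.hom (𝟙 F) (𝟙 P) R = 𝟙 R.Z := by
  refine R.hom_ext fun k => ?_
  rw [ι_hom, Category.comp_id, ← R.sum_map_ι k]
  refine Finset.sum_congr rfl fun l _ => ?_
  rw [NatTrans.id_app, Category.id_comp]
  rfl

theorem hom_add [F.Additive] (R : Realization F P) (τ : F ⟶ G) (f g : P ⟶ Q)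
    (S : Realization G Q) : R.hom τ (f + g) S = R.hom τ f S + R.hom τ g S := by
  refine R.hom_ext fun k => ?_
  rw [Preadditive.comp_add, ι_hom, ι_hom, ι_hom, ← Finset.sum_add_distrib]
  refine Finset.sum_congr rfl fun l _ => ?_
  rw [← Preadditive.add_comp, ← F.map_add]
  rfl

theorem hom_smul [Linear ℂ D] [Linear ℂ C] [F.Additive] [F.Linear ℂ] (R : Realization F P)
    (τ : F ⟶ G) (r : ℂ) (f : P ⟶ Q)
    (S : Realization G Q) : R.hom τ (r • f) S = r • R.hom τ f S := by
  refine R.hom_ext fun k => ?_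
  rw [Linear.comp_smul, ι_hom, ι_hom, Finset.smul_sum]
  refine Finset.sum_congr rfl fun l _ => ?_
  rw [← Linear.smul_comp, ← F.map_smul]
  rfl

/-- A morphism whose matrix has one entry in each row, if it is composed with the idempotents. -/
theorem ι_hom_homOf [F.Additive] (R : Realization F P) (τ : F ⟶ G) (S : Realization G Q)
    (e : P.X.ι → Q.X.ι) (φ : ∀ i, P.X.X i ⟶ Q.X.X (e i))
    (h : P.p ≫ MatEnvelope.diag e φ = MatEnvelope.diag e φ ≫ Q.p) (k : P.X.ι) :
    R.ι k ≫ R.hom τ (KaroubiEnvelope.homOf (MatEnvelope.diag e φ) h) S =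
      F.map (φ k) ≫ τ.app _ ≫ S.ι (e k) := by
  have h2 : ∀ l, (KaroubiEnvelope.homOf (MatEnvelope.diag e φ) h).f k l = φ k ≫ Q.p (e k) l :=
    fun l => (congrArg (fun f : P.X ⟶ Q.X => f k l) h).trans (MatEnvelope.diag_comp _ _ _ _ _)
  rw [ι_hom, ← S.sum_map_ι, Preadditive.comp_sum, Preadditive.comp_sum]
  refine Finset.sum_congr rfl fun l _ => ?_
  rw [h2, F.map_comp, Category.assoc, NatTrans.naturality_assoc]

end Realization

end

/-! ### Tensor products of realizations. -/

section

open Idempotents Functor.LaxMonoidal Functor.OplaxMonoidal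

universe v₁ u₁

variable {D : Type u₁} [Category.{v₁} D] [Preadditive D] [MonoidalCategory D]
  [MonoidalPreadditive D] {C : Type u} [Category.{v} C] [Preadditive C] [MonoidalCategory C]
  [MonoidalPreadditive C]

namespace Realization

variable {F G : D ⥤ C} {P Q S P' Q' S' : Karoubi (Mat_ D)}

theorem tensor_total (R : Realization F P) (S : Realization F Q) :
    ∑ k, ∑ l, (R.π k ⊗ₘ S.π l) ≫ (R.ι k ⊗ₘ S.ι l) = 𝟙 (R.Z ⊗ S.Z) := by
  simp only [MonoidalCategory.tensorHom_comp_tensorHom]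
  simp only [← tensor_sum, ← sum_tensor, R.total, S.total, id_tensorHom_id]

theorem tensor_hom_ext (R : Realization F P) (S : Realization F Q) {W : C}
    {f g : R.Z ⊗ S.Z ⟶ W} (h : ∀ k l, (R.ι k ⊗ₘ S.ι l) ≫ f = (R.ι k ⊗ₘ S.ι l) ≫ g) : f = g := by
  rw [← Category.id_comp f, ← Category.id_comp g, ← tensor_total]
  simp only [Preadditive.sum_comp, Category.assoc, h]

/-- The components of a realization of a tensor product. -/
def ι₂ (T : Realization F (P ⊗ Q)) (k : P.X.ι) (l : Q.X.ι) :
    F.obj (P.X.X k ⊗ Q.X.X l) ⟶ T.Z := T.ι (k, l)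

/-- The components of a realization of a tensor product. -/
def π₂ (T : Realization F (P ⊗ Q)) (k : P.X.ι) (l : Q.X.ι) :
    T.Z ⟶ F.obj (P.X.X k ⊗ Q.X.X l) := T.π (k, l)

theorem ι₂_π₂ (T : Realization F (P ⊗ Q)) (k m : P.X.ι) (l n : Q.X.ι) :
    T.ι₂ k l ≫ T.π₂ m n = F.map (P.p k m ⊗ₘ Q.p l n) := T.ι_π (k, l) (m, n)

theorem hom_ext₂ (T : Realization F (P ⊗ Q)) {W : C} {f g : T.Z ⟶ W}
    (h : ∀ k l, T.ι₂ k l ≫ f = T.ι₂ k l ≫ g) : f = g :=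
  T.hom_ext fun x => h x.1 x.2

theorem ι₂_hom [F.Additive] (T : Realization F (P ⊗ Q)) (τ : F ⟶ G) (f : P ⟶ P') (g : Q ⟶ Q')
    (T' : Realization G (P' ⊗ Q')) (k : P.X.ι) (l : Q.X.ι) : T.ι₂ k l ≫ T.hom τ (f ⊗ₘ g) T' =
      ∑ m, ∑ n, F.map (f.f k m ⊗ₘ g.f l n) ≫ τ.app _ ≫ T'.ι₂ m n := by
  refine (ι_hom _ _ _ _ _).trans ?_
  exact Fintype.sum_prod_type (fun x : P'.X.ι × Q'.X.ι =>
    F.map (f.f k x.1 ⊗ₘ g.f l x.2) ≫ τ.app _ ≫ T'.ι₂ x.1 x.2)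

theorem sum_map_ι₂ (T : Realization F (P ⊗ Q)) (k : P.X.ι) (l : Q.X.ι) :
    ∑ m, ∑ n, F.map (P.p k m ⊗ₘ Q.p l n) ≫ T.ι₂ m n = T.ι₂ k l := by
  refine Eq.trans ?_ (T.sum_map_ι (k, l))
  exact (Fintype.sum_prod_type (fun x : P.X.ι × Q.X.ι =>
    F.map (P.p k x.1 ⊗ₘ Q.p l x.2) ≫ T.ι₂ x.1 x.2)).symm

/-- The components of a realization of a tensor product of three objects. -/
def ιL {K : Karoubi (Mat_ D)} (T : Realization F ((P ⊗ Q) ⊗ K)) (k : P.X.ι) (l : Q.X.ι)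
    (m : K.X.ι) : F.obj ((P.X.X k ⊗ Q.X.X l) ⊗ K.X.X m) ⟶ T.Z := T.ι ((k, l), m)

/-- The components of a realization of a tensor product of three objects. -/
def ιR {K : Karoubi (Mat_ D)} (T : Realization F (P ⊗ (Q ⊗ K))) (k : P.X.ι) (l : Q.X.ι)
    (m : K.X.ι) : F.obj (P.X.X k ⊗ (Q.X.X l ⊗ K.X.X m)) ⟶ T.Z := T.ι (k, (l, m))

/-- The components of a realization of a tensor product with the unit. -/
def ιl (T : Realization F (𝟙_ (Karoubi (Mat_ D)) ⊗ P)) (k : P.X.ι) :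
    F.obj (𝟙_ D ⊗ P.X.X k) ⟶ T.Z := T.ι ((), k)

/-- The components of a realization of a tensor product with the unit. -/
def ιr (T : Realization F (P ⊗ 𝟙_ (Karoubi (Mat_ D)))) (k : P.X.ι) :
    F.obj (P.X.X k ⊗ 𝟙_ D) ⟶ T.Z := T.ι (k, ())

theorem tensor_hom_ext₃ {K : Karoubi (Mat_ D)} (R : Realization F P) (S : Realization F Q)
    (T : Realization F K) {W : C} {f g : (R.Z ⊗ S.Z) ⊗ T.Z ⟶ W}
    (h : ∀ k l m, ((R.ι k ⊗ₘ S.ι l) ⊗ₘ T.ι m) ≫ f = ((R.ι k ⊗ₘ S.ι l) ⊗ₘ T.ι m) ≫ g) : f = g := by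
  have h1 : ∑ k, ∑ l, ∑ m, ((R.π k ⊗ₘ S.π l) ⊗ₘ T.π m) ≫ ((R.ι k ⊗ₘ S.ι l) ⊗ₘ T.ι m) = 𝟙 _ := by
    simp only [MonoidalCategory.tensorHom_comp_tensorHom]
    simp only [← tensor_sum, ← sum_tensor, R.total, S.total, T.total, id_tensorHom_id]
  rw [← Category.id_comp f, ← Category.id_comp g, ← h1]
  simp only [Preadditive.sum_comp, Category.assoc, h]

variable [F.Monoidal] [G.Monoidal]

/-- The multiplication of realizations. -/
def mul (R : Realization F P) (S : Realization F Q) (T : Realization F (P ⊗ Q)) :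
    R.Z ⊗ S.Z ⟶ T.Z :=
  ∑ k, ∑ l, (R.π k ⊗ₘ S.π l) ≫ μ F _ _ ≫ T.ι₂ k l

/-- Tensor products of inclusions are jointly epimorphic, so this formula characterizes the
multiplication. The coherence laws are checked on entries through it. -/
theorem tensor_ι_mul (R : Realization F P) (S : Realization F Q) (T : Realization F (P ⊗ Q))
    (k : P.X.ι) (l : Q.X.ι) : (R.ι k ⊗ₘ S.ι l) ≫ R.mul S T = μ F _ _ ≫ T.ι₂ k l := by
  rw [mul, ← T.sum_map_ι₂ k l]
  simp only [Preadditive.comp_sum]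
  refine Finset.sum_congr rfl fun m _ => Finset.sum_congr rfl fun n _ => ?_
  rw [MonoidalCategory.tensorHom_comp_tensorHom_assoc, R.ι_π, S.ι_π, μ_natural_assoc]

/-- The inverse of the multiplication of realizations. -/
def comul (R : Realization F P) (S : Realization F Q) (T : Realization F (P ⊗ Q)) :
    T.Z ⟶ R.Z ⊗ S.Z :=
  ∑ k, ∑ l, T.π₂ k l ≫ δ F _ _ ≫ (R.ι k ⊗ₘ S.ι l)

theorem ι₂_comul (R : Realization F P) (S : Realization F Q) (T : Realization F (P ⊗ Q))
    (k : P.X.ι) (l : Q.X.ι) : T.ι₂ k l ≫ R.comul S T = δ F _ _ ≫ (R.ι k ⊗ₘ S.ι l) := by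
  rw [comul]
  conv_rhs => rw [← R.sum_map_ι k, ← S.sum_map_ι l]
  simp only [Preadditive.comp_sum, tensor_sum, sum_tensor]
  conv_rhs => rw [Finset.sum_comm]
  refine Finset.sum_congr rfl fun m _ => Finset.sum_congr rfl fun n _ => ?_
  rw [← Category.assoc, ι₂_π₂, ← δ_natural_assoc, MonoidalCategory.tensorHom_comp_tensorHom]

/-- The multiplication of realizations as an isomorphism. -/
def mulIso (R : Realization F P) (S : Realization F Q) (T : Realization F (P ⊗ Q)) :
    R.Z ⊗ S.Z ≅ T.Z where
  hom := R.mul S T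
  inv := R.comul S T
  hom_inv_id := R.tensor_hom_ext S fun k l => by
    rw [← Category.assoc, tensor_ι_mul, Category.assoc, ι₂_comul]
    simp
  inv_hom_id := T.hom_ext₂ fun k l => by
    rw [← Category.assoc, ι₂_comul, Category.assoc, tensor_ι_mul]
    simp

/-- Used in two ways: with `τ` an identity it is naturality of the tensor comparison of the extended
functor; with identities for `f` and `g` it says that an extended transformation is monoidal. -/
theorem mul_naturality [F.Additive] [G.Additive] (R : Realization F P) (S : Realization F Q)
    (T : Realization F (P ⊗ Q)) (τ : F ⟶ G) [NatTrans.IsMonoidal τ] (R' : Realization G P')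
    (S' : Realization G Q') (T' : Realization G (P' ⊗ Q')) (f : P ⟶ P') (g : Q ⟶ Q') :
    (R.hom τ f R' ⊗ₘ S.hom τ g S') ≫ R'.mul S' T' = R.mul S T ≫ T.hom τ (f ⊗ₘ g) T' := by
  refine R.tensor_hom_ext S fun k l => ?_
  rw [MonoidalCategory.tensorHom_comp_tensorHom_assoc, ι_hom, ι_hom, ← Category.assoc,
    tensor_ι_mul, Category.assoc, ι₂_hom]
  simp only [Preadditive.comp_sum, Preadditive.sum_comp, tensor_sum, sum_tensor]
  rw [Finset.sum_comm]
  refine Finset.sum_congr rfl fun m _ => Finset.sum_congr rfl fun n _ => ?_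
  rw [← MonoidalCategory.tensorHom_comp_tensorHom_assoc, ← μ_natural_assoc,
    ← MonoidalCategory.tensorHom_comp_tensorHom_assoc, tensor_ι_mul, NatTrans.IsMonoidal.tensor_assoc]

/-- The component of a realization of the unit. -/
def ι₀ (T : Realization F (𝟙_ (Karoubi (Mat_ D)))) : F.obj (𝟙_ D) ⟶ T.Z := T.ι ()

/-- The component of a realization of the unit. -/
def π₀ (T : Realization F (𝟙_ (Karoubi (Mat_ D)))) : T.Z ⟶ F.obj (𝟙_ D) := T.π ()

theorem ι₀_π₀ (T : Realization F (𝟙_ (Karoubi (Mat_ D)))) : T.ι₀ ≫ T.π₀ = 𝟙 _ :=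
  (T.ι_π () ()).trans ((congrArg F.map (Mat_.id_apply_self (M := 𝟙_ (Mat_ D)) ())).trans
    (F.map_id _))

theorem π₀_ι₀ (T : Realization F (𝟙_ (Karoubi (Mat_ D)))) : T.π₀ ≫ T.ι₀ = 𝟙 _ :=
  (Fintype.sum_unique (ι := Unit) fun k => T.π k ≫ T.ι k).symm.trans T.total

/-- The unit of realizations. -/
def unitIso (T : Realization F (𝟙_ (Karoubi (Mat_ D)))) : 𝟙_ C ≅ T.Z where
  hom := ε F ≫ T.ι₀
  inv := T.π₀ ≫ η F
  hom_inv_id := by rw [Category.assoc, reassoc_of% T.ι₀_π₀, Functor.Monoidal.ε_η]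
  inv_hom_id := by rw [Category.assoc, Functor.Monoidal.η_ε_assoc, T.π₀_ι₀]

theorem unit_naturality [F.Additive] (T : Realization F (𝟙_ (Karoubi (Mat_ D)))) (τ : F ⟶ G)
    [NatTrans.IsMonoidal τ] (T' : Realization G (𝟙_ (Karoubi (Mat_ D)))) :
    T.unitIso.hom ≫ T.hom τ (𝟙 _) T' = T'.unitIso.hom := by
  have h : T.ι₀ ≫ T.hom τ (𝟙 _) T' = τ.app _ ≫ T'.ι₀ := by
    refine (ι_hom T τ (𝟙 _) T' ()).trans ((Fintype.sum_unique (ι := Unit) fun k =>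
      F.map (Karoubi.Hom.f (𝟙 (𝟙_ (Karoubi (Mat_ D)))) () k) ≫ τ.app (𝟙_ D) ≫ T'.ι k).trans ?_)
    refine (congrArg (fun f : 𝟙_ D ⟶ 𝟙_ D => F.map f ≫ τ.app (𝟙_ D) ≫ T'.ι₀)
      (Mat_.id_apply_self (M := 𝟙_ (Mat_ D)) ())).trans ?_
    exact (congrArg (· ≫ _) (F.map_id (𝟙_ D))).trans (Category.id_comp _)
  simp only [unitIso, Category.assoc]
  rw [h, NatTrans.IsMonoidal.unit_assoc]

variable [F.Additive] {K : Karoubi (Mat_ D)}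

theorem ιL_assoc (U : Realization F ((P ⊗ Q) ⊗ K)) (V : Realization F (P ⊗ (Q ⊗ K))) (k : P.X.ι)
    (l : Q.X.ι) (m : K.X.ι) :
    U.ιL k l m ≫ U.hom (𝟙 F) (α_ P Q K).hom V = F.map (α_ _ _ _).hom ≫ V.ιR k l m :=
  (ι_hom_homOf U (𝟙 F) V (Equiv.prodAssoc P.X.ι Q.X.ι K.X.ι)
    (fun p : (P.X.ι × Q.X.ι) × K.X.ι => (α_ (P.X.X p.1.1) (Q.X.X p.1.2) (K.X.X p.2)).hom)
    (KaroubiEnvelope.assoc_comm P Q K) ((k, l), m)).trans (congrArg _ (Category.id_comp _))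

theorem ιl_hom (R : Realization F P) (U : Realization F (𝟙_ (Karoubi (Mat_ D)) ⊗ P)) (k : P.X.ι) :
    U.ιl k ≫ U.hom (𝟙 F) (λ_ P).hom R = F.map (λ_ (P.X.X k)).hom ≫ R.ι k :=
  (ι_hom_homOf U (𝟙 F) R (Equiv.punitProd P.X.ι) (fun p => (λ_ (P.X.X p.2)).hom)
    (KaroubiEnvelope.left_comm P) ((), k)).trans (congrArg _ (Category.id_comp _))

theorem ιr_hom (R : Realization F P) (U : Realization F (P ⊗ 𝟙_ (Karoubi (Mat_ D)))) (k : P.X.ι) :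
    U.ιr k ≫ U.hom (𝟙 F) (ρ_ P).hom R = F.map (ρ_ (P.X.X k)).hom ≫ R.ι k :=
  (ι_hom_homOf U (𝟙 F) R (Equiv.prodPUnit P.X.ι) (fun p => (ρ_ (P.X.X p.1)).hom)
    (KaroubiEnvelope.right_comm P) (k, ())).trans (congrArg _ (Category.id_comp _))

theorem ι₂_braid [SymmetricCategory D] (U : Realization F (P ⊗ Q)) (V : Realization F (Q ⊗ P))
    (k : P.X.ι) (l : Q.X.ι) :
    U.ι₂ k l ≫ U.hom (𝟙 F) (β_ P Q).hom V = F.map (β_ (P.X.X k) (Q.X.X l)).hom ≫ V.ι₂ l k :=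
  (ι_hom_homOf U (𝟙 F) V (Equiv.prodComm P.X.ι Q.X.ι)
    (fun p : P.X.ι × Q.X.ι => (β_ (P.X.X p.1) (Q.X.X p.2)).hom)
    (KaroubiEnvelope.braid_comm P Q) (k, l)).trans (congrArg _ (Category.id_comp _))

/-- On each triple of entries this is the associativity of the monoidal functor `F`. -/
theorem mul_assoc (R : Realization F P) (S : Realization F Q) (T : Realization F K)
    (RS : Realization F (P ⊗ Q)) (ST : Realization F (Q ⊗ K)) (U : Realization F ((P ⊗ Q) ⊗ K))
    (V : Realization F (P ⊗ (Q ⊗ K))) :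
    R.mul S RS ▷ T.Z ≫ RS.mul T U ≫ U.hom (𝟙 F) (α_ P Q K).hom V =
      (α_ R.Z S.Z T.Z).hom ≫ R.Z ◁ S.mul T ST ≫ R.mul ST V := by
  have e1 : ∀ k l m, ((R.ι k ⊗ₘ S.ι l) ⊗ₘ T.ι m) ≫ R.mul S RS ▷ T.Z ≫ RS.mul T U =
      μ F _ _ ▷ _ ≫ μ F _ _ ≫ U.ιL k l m := fun k l m => by
    have h : (RS.ι₂ k l ⊗ₘ T.ι m) ≫ RS.mul T U = μ F _ _ ≫ U.ιL k l m :=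
      tensor_ι_mul RS T U (k, l) m
    rw [← tensorHom_id, MonoidalCategory.tensorHom_comp_tensorHom_assoc, tensor_ι_mul,
      Category.comp_id, ← h, ← tensorHom_id, MonoidalCategory.tensorHom_comp_tensorHom_assoc,
      Category.id_comp]
  have e2 : ∀ k l m, (R.ι k ⊗ₘ (S.ι l ⊗ₘ T.ι m)) ≫ R.Z ◁ S.mul T ST ≫ R.mul ST V =
      _ ◁ μ F _ _ ≫ μ F _ _ ≫ V.ιR k l m := fun k l m => by
    have h : (R.ι k ⊗ₘ ST.ι₂ l m) ≫ R.mul ST V = μ F _ _ ≫ V.ιR k l m :=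
      tensor_ι_mul R ST V k (l, m)
    rw [← id_tensorHom, MonoidalCategory.tensorHom_comp_tensorHom_assoc, tensor_ι_mul,
      Category.comp_id, ← h, ← id_tensorHom, MonoidalCategory.tensorHom_comp_tensorHom_assoc,
      Category.id_comp]
  refine tensor_hom_ext₃ R S T fun k l m => ?_
  rw [reassoc_of% e1, ιL_assoc, MonoidalCategory.associator_naturality_assoc, e2,
    Functor.LaxMonoidal.associativity_assoc]

theorem mul_left (R : Realization F P) (T : Realization F (𝟙_ (Karoubi (Mat_ D))))
    (U : Realization F (𝟙_ (Karoubi (Mat_ D)) ⊗ P)) :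
    T.unitIso.hom ▷ R.Z ≫ T.mul R U ≫ U.hom (𝟙 F) (λ_ P).hom R = (λ_ R.Z).hom := by
  rw [← cancel_epi (λ_ R.Z).inv, Iso.inv_hom_id]
  refine R.hom_ext fun k => ?_
  have h1 : (T.ι₀ ⊗ₘ R.ι k) ≫ T.mul R U = μ F (𝟙_ D) (P.X.X k) ≫ U.ιl k :=
    tensor_ι_mul T R U () k
  have h3 : R.ι k ≫ (λ_ R.Z).inv ≫ T.unitIso.hom ▷ R.Z = (λ_ _).inv ≫ ε F ▷ _ ≫
      (T.ι₀ ⊗ₘ R.ι k) := by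
    simp only [unitIso, MonoidalCategory.tensorHom_def, comp_whiskerRight]
    rw [MonoidalCategory.leftUnitor_inv_naturality_assoc, MonoidalCategory.whisker_exchange_assoc,
      MonoidalCategory.whisker_exchange]
  rw [reassoc_of% h3, reassoc_of% h1, ιl_hom]
  have h4 := Functor.LaxMonoidal.left_unitality F (P.X.X k)
  rw [← reassoc_of% h4]
  simp

theorem mul_right (R : Realization F P) (T : Realization F (𝟙_ (Karoubi (Mat_ D))))
    (U : Realization F (P ⊗ 𝟙_ (Karoubi (Mat_ D)))) :
    R.Z ◁ T.unitIso.hom ≫ R.mul T U ≫ U.hom (𝟙 F) (ρ_ P).hom R = (ρ_ R.Z).hom := by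
  rw [← cancel_epi (ρ_ R.Z).inv, Iso.inv_hom_id]
  refine R.hom_ext fun k => ?_
  have h1 : (R.ι k ⊗ₘ T.ι₀) ≫ R.mul T U = μ F (P.X.X k) (𝟙_ D) ≫ U.ιr k :=
    tensor_ι_mul R T U k ()
  have h3 : R.ι k ≫ (ρ_ R.Z).inv ≫ R.Z ◁ T.unitIso.hom = (ρ_ _).inv ≫ _ ◁ ε F ≫
      (R.ι k ⊗ₘ T.ι₀) := by
    simp only [unitIso, MonoidalCategory.tensorHom_def, MonoidalCategory.whiskerLeft_comp]
    rw [MonoidalCategory.rightUnitor_inv_naturality_assoc, MonoidalCategory.whisker_exchange_assoc]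
  rw [reassoc_of% h3, reassoc_of% h1, ιr_hom]
  have h4 := Functor.LaxMonoidal.right_unitality F (P.X.X k)
  rw [← reassoc_of% h4]
  simp

theorem mul_braid [SymmetricCategory D] [SymmetricCategory C] (hF : ∀ X Y : D,
      μ F X Y ≫ F.map (β_ X Y).hom = (β_ (F.obj X) (F.obj Y)).hom ≫ μ F Y X)
    (R : Realization F P) (S : Realization F Q)
    (U : Realization F (P ⊗ Q)) (V : Realization F (Q ⊗ P)) :
    R.mul S U ≫ U.hom (𝟙 F) (β_ P Q).hom V = (β_ R.Z S.Z).hom ≫ S.mul R V := by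
  refine R.tensor_hom_ext S fun k l => ?_
  rw [← Category.assoc, tensor_ι_mul, Category.assoc, ι₂_braid, reassoc_of% hF,
    BraidedCategory.braiding_naturality_assoc, tensor_ι_mul]

end Realization

end

/-! ### The monoidal embedding of a category into its Karoubian envelope. -/

section

open Idempotents Functor.LaxMonoidal Functor.OplaxMonoidal

universe v₁ u₁

section Embedding

variable {D : Type u₁} [Category.{v₁} D] [Preadditive D]

theorem mat_comp_single {M N K : Mat_ D} (a : N.ι) (ha : ∀ b, b = a) (f : M ⟶ N) (g : N ⟶ K)
    (i k) : (f ≫ g) i k = f i a ≫ g a k := by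
  rw [Mat_.comp_apply, Finset.sum_eq_single a]
  · exact fun b _ hb => absurd (ha b) hb
  · exact fun h => absurd (Finset.mem_univ _) h

theorem karoubi_comp_single {P Q R : Karoubi (Mat_ D)} (a : Q.X.ι) (ha : ∀ b, b = a) (f : P ⟶ Q)
    (g : Q ⟶ R) (i k) : (f ≫ g).f i k = f.f i a ≫ g.f a k :=
  mat_comp_single a ha f.f g.f i k

theorem karoubi_mat_ext {P Q : Karoubi (Mat_ D)} {f g : P ⟶ Q} (h : ∀ i j, f.f i j = g.f i j) :
    f = g := by
  apply Karoubi.hom_ext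
  ext i j
  exact h i j

variable (D) in
/-- The full embedding into the Karoubian envelope. -/
abbrev emb : D ⥤ Karoubi (Mat_ D) := Mat_.embedding D ⋙ toKaroubi _

/-- A morphism from a tuple with one entry. -/
def embDesc {X : D} {P : Karoubi (Mat_ D)} (f : ∀ j, X ⟶ P.X.X j)
    (h : ∀ j, ∑ i, f i ≫ P.p i j = f j) : (emb D).obj X ⟶ P :=
  ⟨fun _ j => f j, by
    ext i j
    refine (congrArg (fun f : ((emb D).obj X).X ⟶ P.X => f i j) (Category.id_comp _)).trans ?_
    exact (Mat_.comp_apply _ _ _ _).trans (h j)⟩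

/-- A morphism to a tuple with one entry. -/
def embLift {X : D} {P : Karoubi (Mat_ D)} (f : ∀ i, P.X.X i ⟶ X)
    (h : ∀ i, ∑ j, P.p i j ≫ f j = f i) : P ⟶ (emb D).obj X :=
  ⟨fun i _ => f i, by
    ext i j
    refine (congrArg (fun f : P.X ⟶ ((emb D).obj X).X => (P.p ≫ f) i j) (Category.comp_id _)).trans ?_
    exact (Mat_.comp_apply _ _ _ _).trans (h i)⟩

theorem sum_p_p (P : Karoubi (Mat_ D)) (i j : P.X.ι) : ∑ k, P.p i k ≫ P.p k j = P.p i j :=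
  (Mat_.comp_apply _ _ _ _).symm.trans (congrArg (fun f : P.X ⟶ P.X => f i j) P.idem)

/-- The inclusion of an entry of a tuple, composed with the idempotent. -/
def inc (P : Karoubi (Mat_ D)) (k : P.X.ι) : (emb D).obj (P.X.X k) ⟶ P :=
  embDesc (fun j => P.p k j) fun _ => sum_p_p P _ _

/-- The projection to an entry of a tuple, composed with the idempotent. -/
def prj (P : Karoubi (Mat_ D)) (k : P.X.ι) : P ⟶ (emb D).obj (P.X.X k) :=
  embLift (fun i => P.p i k) fun _ => sum_p_p P _ _

theorem inc_prj (P : Karoubi (Mat_ D)) (k l : P.X.ι) : inc P k ≫ prj P l = (emb D).map (P.p k l) :=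
  karoubi_mat_ext fun _ _ => (Mat_.comp_apply _ _ _ _).trans (sum_p_p P k l)

theorem sum_f {P Q : Karoubi (Mat_ D)} {ι : Type} (s : Finset ι) (f : ι → (P ⟶ Q)) (i j) :
    (∑ k ∈ s, f k).f i j = ∑ k ∈ s, (f k).f i j := by
  classical
  induction s using Finset.induction_on with
  | empty => rfl
  | insert a s ha ih => rw [Finset.sum_insert ha, Finset.sum_insert ha, ← ih]; rfl

theorem prj_inc (P : Karoubi (Mat_ D)) : ∑ k, prj P k ≫ inc P k = 𝟙 P := by
  refine karoubi_mat_ext fun i j => ?_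
  rw [sum_f]
  refine Eq.trans (Finset.sum_congr rfl fun k _ => ?_) (sum_p_p P i j)
  exact karoubi_comp_single () (fun _ => rfl) (prj P k) (inc P k) i j

/-- A morphism of the envelope absorbs both idempotents, so both sides have the entries of `f`
itself. Every morphism is thereby expressed through embedded ones. -/
theorem inc_comp {P Q : Karoubi (Mat_ D)} (f : P ⟶ Q) (k : P.X.ι) :
    inc P k ≫ f = ∑ l, (emb D).map (f.f k l) ≫ inc Q l := by
  refine karoubi_mat_ext fun i j => ?_
  rw [sum_f]
  have h1 := congrArg (fun f : P.X ⟶ Q.X => f k j) (Karoubi.p_comp f)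
  have h2 := congrArg (fun f : P.X ⟶ Q.X => f k j) (Karoubi.comp_p f)
  refine h1.trans (h2.symm.trans ((Mat_.comp_apply _ _ _ _).trans
    (Finset.sum_congr rfl fun l _ => ?_)))
  exact (karoubi_comp_single () (fun _ => rfl) ((emb D).map (f.f k l)) (inc Q l) i j).symm

variable {C : Type u} [Category.{v} C] [Preadditive C]

/-- The value of an additive functor on the Karoubian envelope is a realization of its
restriction. -/
def Realization.ofFunctor (H : Karoubi (Mat_ D) ⥤ C) [H.Additive] (P : Karoubi (Mat_ D)) :
    Realization (emb D ⋙ H) P where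
  Z := H.obj P
  ι k := H.map (inc P k)
  π k := H.map (prj P k)
  ι_π k l := by rw [← H.map_comp, inc_prj]; rfl
  total := by
    simp only [← H.map_comp, ← H.map_sum]
    rw [prj_inc, H.map_id]

/-- An additive functor on the envelope is recovered from its restriction, so statements about
realizations apply to functors that were not built as extensions. -/
theorem Realization.ofFunctor_hom (H : Karoubi (Mat_ D) ⥤ C) [H.Additive] {P Q : Karoubi (Mat_ D)}
    (f : P ⟶ Q) : (ofFunctor H P).hom (𝟙 _) f (ofFunctor H Q) = H.map f := by
  refine (ofFunctor H P).hom_ext fun k => ?_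
  rw [ι_hom]
  have h := congrArg H.map (inc_comp f k)
  rw [H.map_comp, H.map_sum] at h
  refine Eq.trans ?_ h.symm
  refine Finset.sum_congr rfl fun l _ => ?_
  rw [H.map_comp, NatTrans.id_app]
  exact congrArg _ (Category.id_comp _)

end Embedding

section Monoidal

variable {D : Type u₁} [Category.{v₁} D] [Preadditive D] [MonoidalCategory D]
  [MonoidalPreadditive D]

theorem emb_id_f (X : D) (i j) : (𝟙 ((emb D).obj X) : (emb D).obj X ⟶ (emb D).obj X).f i j = 𝟙 X :=
  Mat_.id_apply_self ((Mat_.embedding D).obj X) ()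

theorem emb_tensor_id_f (X Y : D) (i j) : (𝟙 ((emb D).obj X ⊗ (emb D).obj Y) :
    (emb D).obj X ⊗ (emb D).obj Y ⟶ (emb D).obj X ⊗ (emb D).obj Y).f i j = 𝟙 (X ⊗ Y) :=
  (congrArg₂ (· ⊗ₘ ·) (Mat_.id_apply_self ((Mat_.embedding D).obj X) ())
    (Mat_.id_apply_self ((Mat_.embedding D).obj Y) ())).trans (id_tensorHom_id _ _)

/-- The embedding into the Karoubian envelope respects tensor products. -/
def embMul (X Y : D) : (emb D).obj X ⊗ (emb D).obj Y ≅ (emb D).obj (X ⊗ Y) where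
  hom := embedHom (fun _ _ => 𝟙 (X ⊗ Y)) (MatEnvelope.tensHom_id _ _) rfl
  inv := embedHom (fun _ _ => 𝟙 (X ⊗ Y)) rfl (MatEnvelope.tensHom_id _ _)
  hom_inv_id := karoubi_mat_ext fun i j => (karoubi_comp_single () (fun _ => rfl) _ _ i j).trans
    ((Category.comp_id _).trans (emb_tensor_id_f X Y i j).symm)
  inv_hom_id := karoubi_mat_ext fun i j => (karoubi_comp_single ((), ()) (fun _ => rfl) _ _ i j).trans
    ((Category.comp_id _).trans (emb_id_f _ i j).symm)

theorem homOf_f_eq {P Q : Karoubi (Mat_ D)} (e : P.X ⟶ Q.X) (h : P.p ≫ e = e ≫ Q.p)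
    (hP : P.p = 𝟙 _) : (KaroubiEnvelope.homOf e h).f = e :=
  (congrArg (· ≫ e) hP).trans (Category.id_comp _)

/-- The monoidal structure of the embedding into the Karoubian envelope. -/
def embCore : (emb D).CoreMonoidal where
  εIso := Iso.refl _
  μIso := embMul
  μIso_hom_natural_left {X Y} f Z := karoubi_mat_ext fun i j => by
    refine (karoubi_comp_single ((), ()) (fun _ => rfl) _ _ i j).trans ?_
    refine Eq.trans ?_ (karoubi_comp_single () (fun _ => rfl) _ _ i j).symm
    refine (Category.comp_id _).trans (Eq.trans ?_ (Category.id_comp _).symm)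
    exact (congrArg (f ⊗ₘ ·) (emb_id_f Z () ())).trans (tensorHom_id _ _)
  μIso_hom_natural_right {X Y} Z f := karoubi_mat_ext fun i j => by
    refine (karoubi_comp_single ((), ()) (fun _ => rfl) _ _ i j).trans ?_
    refine Eq.trans ?_ (karoubi_comp_single () (fun _ => rfl) _ _ i j).symm
    refine (Category.comp_id _).trans (Eq.trans ?_ (Category.id_comp _).symm)
    exact (congrArg (· ⊗ₘ f) (emb_id_f Z () ())).trans (id_tensorHom _ _)
  associativity X Y Z := karoubi_mat_ext fun i j => by
    refine (karoubi_comp_single ((), ()) (fun _ => rfl) _ _ i j).trans ?_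
    refine (congrArg₂ (· ≫ ·) (congrArg (_ ⊗ₘ ·) (emb_id_f Z () ()))
      (karoubi_comp_single () (fun _ => rfl) _ _ _ _)).trans ?_
    have h := (congrArg (fun f : (((emb D).obj X ⊗ (emb D).obj Y) ⊗ (emb D).obj Z).X ⟶
      ((emb D).obj (X ⊗ Y ⊗ Z)).X => f i j) (KaroubiEnvelope.homOf_comp'
        ((emb D).obj X ◁ (embMul Y Z).hom ≫ (embMul X (Y ⊗ Z)).hom) _
        (KaroubiEnvelope.assoc_comm ((emb D).obj X) ((emb D).obj Y) ((emb D).obj Z))))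
    refine Eq.trans ?_ h.symm
    refine Eq.trans ?_ (MatEnvelope.diag_comp
      (M := (((emb D).obj X ⊗ (emb D).obj Y) ⊗ (emb D).obj Z).X)
      (N := ((emb D).obj X ⊗ ((emb D).obj Y ⊗ (emb D).obj Z)).X)
      (Equiv.prodAssoc Unit Unit Unit) (fun _ => (α_ X Y Z).hom) _ i j).symm
    refine Eq.trans ?_ (congrArg (fun g : X ⊗ (Y ⊗ Z) ⟶ X ⊗ (Y ⊗ Z) => (α_ X Y Z).hom ≫ g)
      (karoubi_comp_single ((), ()) (fun _ => rfl) _ _ _ _)).symm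
    refine Eq.trans ?_ (congrArg (fun g : X ⟶ X => (α_ X Y Z).hom ≫ (g ⊗ₘ 𝟙 (Y ⊗ Z)) ≫ 𝟙 (X ⊗ (Y ⊗ Z)))
      (emb_id_f X () ())).symm
    have key : (𝟙 (X ⊗ Y) ⊗ₘ 𝟙 Z) ≫ 𝟙 _ ≫ (α_ X Y Z).hom =
      (α_ X Y Z).hom ≫ (𝟙 X ⊗ₘ 𝟙 (Y ⊗ Z)) ≫ 𝟙 _ := by simp
    exact key
  left_unitality X := karoubi_mat_ext fun i j => by
    refine (congrArg (fun f : (𝟙_ (Karoubi (Mat_ D)) ⊗ (emb D).obj X).X ⟶ ((emb D).obj X).X => f i j)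
      (homOf_f_eq _ (KaroubiEnvelope.left_comm ((emb D).obj X)) (MatEnvelope.tensHom_id _ _))).trans ?_
    refine (MatEnvelope.diag_self (M := (𝟙_ (Karoubi (Mat_ D)) ⊗ (emb D).obj X).X)
      (N := ((emb D).obj X).X) (Equiv.punitProd Unit) (fun _ => (λ_ X).hom) i).trans ?_
    refine Eq.trans ?_ (karoubi_comp_single ((), ()) (fun _ => rfl) _ _ i j).symm
    refine Eq.trans ?_ (congrArg₂ (· ≫ ·) (congrArg₂ (· ⊗ₘ ·) (emb_id_f (𝟙_ D) () ())
      (emb_id_f X () ())) (karoubi_comp_single () (fun _ => rfl) _ _ _ _)).symm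
    have key : (λ_ X).hom = (𝟙 (𝟙_ D) ⊗ₘ 𝟙 X) ≫ 𝟙 _ ≫ (λ_ X).hom := by simp
    exact key
  right_unitality X := karoubi_mat_ext fun i j => by
    refine (congrArg (fun f : ((emb D).obj X ⊗ 𝟙_ (Karoubi (Mat_ D))).X ⟶ ((emb D).obj X).X => f i j)
      (homOf_f_eq _ (KaroubiEnvelope.right_comm ((emb D).obj X)) (MatEnvelope.tensHom_id _ _))).trans ?_
    refine (MatEnvelope.diag_self (M := ((emb D).obj X ⊗ 𝟙_ (Karoubi (Mat_ D))).X)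
      (N := ((emb D).obj X).X) (Equiv.prodPUnit Unit) (fun _ => (ρ_ X).hom) i).trans ?_
    refine Eq.trans ?_ (karoubi_comp_single ((), ()) (fun _ => rfl) _ _ i j).symm
    refine Eq.trans ?_ (congrArg₂ (· ≫ ·) (congrArg₂ (· ⊗ₘ ·) (emb_id_f X () ())
      (emb_id_f (𝟙_ D) () ())) (karoubi_comp_single () (fun _ => rfl) _ _ _ _)).symm
    have key : (ρ_ X).hom = (𝟙 X ⊗ₘ 𝟙 (𝟙_ D)) ≫ 𝟙 _ ≫ (ρ_ X).hom := by simp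
    exact key

instance [SymmetricCategory D] : (emb D).Braided where
  __ := (embCore (D := D)).toMonoidal
  braided X Y := karoubi_mat_ext fun i j => by
    refine (karoubi_comp_single () (fun _ => rfl) _ _ i j).trans ?_
    refine (Category.id_comp _).trans ?_
    have h := (congrArg (fun f : ((emb D).obj X ⊗ (emb D).obj Y).X ⟶
      ((emb D).obj (Y ⊗ X)).X => f i j) (KaroubiEnvelope.homOf_comp'
        (embMul Y X).hom _ (KaroubiEnvelope.braid_comm ((emb D).obj X) ((emb D).obj Y))))
    refine Eq.trans ?_ h.symm
    refine Eq.trans ?_ (MatEnvelope.diag_comp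
      (M := ((emb D).obj X ⊗ (emb D).obj Y).X) (N := ((emb D).obj Y ⊗ (emb D).obj X).X)
      (Equiv.prodComm Unit Unit) (fun _ => (β_ X Y).hom) _ i j).symm
    exact (Category.comp_id _).symm

instance : (emb D).Additive where
  map_add := rfl

instance [Linear ℂ D] : (emb D).Linear ℂ where
  map_smul _ _ := rfl

/-- The inclusion of an entry of a tensor product, composed with the idempotent. -/
def inc₂ (P Q : Karoubi (Mat_ D)) (k : P.X.ι) (l : Q.X.ι) :
    (emb D).obj (P.X.X k ⊗ Q.X.X l) ⟶ P ⊗ Q := inc (P ⊗ Q) (k, l)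

theorem inc_tensor [SymmetricCategory D] (P Q : Karoubi (Mat_ D)) (k : P.X.ι) (l : Q.X.ι) :
    inc P k ⊗ₘ inc Q l = μ (emb D) _ _ ≫ inc₂ P Q k l :=
  karoubi_mat_ext fun i j => ((karoubi_comp_single () (fun _ => rfl) _ _ i j).trans
    (Category.id_comp _)).symm

variable {C : Type u} [Category.{v} C] [Preadditive C] [MonoidalCategory C]
  [MonoidalPreadditive C]

/-- The inclusions are compatible with tensor products, so naturality of `μ` gives the formula that
characterizes the multiplication of realizations. -/
theorem Realization.ofFunctor_mul [SymmetricCategory D] (H : Karoubi (Mat_ D) ⥤ C) [H.Additive]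
    [H.Monoidal] (P Q : Karoubi (Mat_ D)) :
    (ofFunctor H P).mul (ofFunctor H Q) (ofFunctor H (P ⊗ Q)) = μ H P Q := by
  refine tensor_hom_ext _ _ fun k l => ?_
  rw [tensor_ι_mul]
  refine Eq.trans ?_ (μ_natural H (inc P k) (inc Q l)).symm
  rw [inc_tensor, H.map_comp]
  exact Category.assoc _ _ _

theorem Realization.ofFunctor_unit [SymmetricCategory D] (H : Karoubi (Mat_ D) ⥤ C) [H.Additive]
    [H.Monoidal] : (ofFunctor H (𝟙_ _)).unitIso.hom = ε H := by
  have h : inc (𝟙_ (Karoubi (Mat_ D))) () = 𝟙 (𝟙_ (Karoubi (Mat_ D))) := rfl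
  refine (Category.assoc _ _ _).trans ?_
  refine (congrArg (ε H ≫ ·) ((H.map_comp _ _).symm.trans ?_)).trans (Category.comp_id _)
  refine (congrArg H.map (?_ : _ = 𝟙 (𝟙_ (Karoubi (Mat_ D))))).trans (H.map_id _)
  exact (congrArg (ε (emb D) ≫ ·) h).trans (Category.comp_id _)

end Monoidal

end

/-! ### Extension of symmetric monoidal functors to the Karoubian envelope. -/

section

open Idempotents Functor.LaxMonoidal Functor.OplaxMonoidal

universe v₁ u₁

variable {D : Type u₁} [Category.{v₁} D] [Preadditive D] [MonoidalCategory D]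
  [MonoidalPreadditive D] [SymmetricCategory D]
  {C : Type u} [Category.{v} C] [Preadditive C] [MonoidalCategory C]
  [MonoidalPreadditive C] [SymmetricCategory C]

section Extension

variable [HasFiniteBiproducts C] [IsIdempotentComplete C] (F : D ⥤ C) [F.Additive]

/-- A chosen realization. -/
def realize (P : Karoubi (Mat_ D)) : Realization F P := (nonempty_realization F P).some

/-- The extension of an additive functor to the Karoubian envelope. -/
def extend : Karoubi (Mat_ D) ⥤ C where
  obj P := (realize F P).Z
  map f := (realize F _).hom (𝟙 F) f (realize F _)
  map_id P := (realize F P).hom_id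
  map_comp f g := by rw [Realization.hom_comp, Category.comp_id]

instance : (extend F).Additive where
  map_add := Realization.hom_add _ _ _ _ _

instance [Linear ℂ D] [Linear ℂ C] [F.Linear ℂ] : (extend F).Linear ℂ where
  map_smul _ _ := Realization.hom_smul _ _ _ _ _

/-- The monoidal structure of the extension to the Karoubian envelope. -/
def extendCore [F.Monoidal] : (extend F).CoreMonoidal where
  εIso := (realize F _).unitIso
  μIso P Q := (realize F P).mulIso (realize F Q) (realize F _)
  μIso_hom_natural_left {P _} f S := by
    have h := (realize F P).mul_naturality (realize F S) (realize F _) (𝟙 F) (realize F _)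
      (realize F S) (realize F _) f (𝟙 S)
    rw [Realization.hom_id, tensorHom_id, tensorHom_id] at h
    exact h
  μIso_hom_natural_right {P Q} S f := by
    have h := (realize F S).mul_naturality (realize F P) (realize F _) (𝟙 F) (realize F S)
      (realize F Q) (realize F _) (𝟙 S) f
    rw [Realization.hom_id, id_tensorHom, id_tensorHom] at h
    exact h
  associativity P Q S := (realize F P).mul_assoc _ _ _ _ _ _
  left_unitality P := ((realize F P).mul_left _ _).symm
  right_unitality P := ((realize F P).mul_right _ _).symm

instance [F.Braided] : (extend F).Braided where
  __ := (extendCore F).toMonoidal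
  braided P _ := (realize F P).mul_braid (Functor.LaxBraided.braided (F := F)) _ _ _

end Extension

/-- The image of an object with structure morphisms in the Karoubian envelope. -/
def embNeut (X : NeutData D) : NeutData (Karoubi (Mat_ D)) where
  A := (emb D).obj X.A
  α := embedHom (fun _ _ => X.α) (MatEnvelope.tensHom_id _ _) (MatEnvelope.tensHom_id _ _)
  β := embedHom (fun _ _ => X.β) (MatEnvelope.tensHom_id _ _) rfl
  δ := embedHom (fun _ _ => X.δ) rfl (MatEnvelope.tensHom_id _ _)

theorem gen_eq (t : ℂ) : gen t = embNeut (genZero t) := rfl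

/-- All comparison morphisms of the embedding have one entry, an identity, so transport along them
changes nothing. This links the explicit generator with images under monoidal functors. -/
theorem embNeut_eq (X : NeutData D) : embNeut X = mapNeutData (emb D) X := by
  have h1 : (embNeut X).α = (mapNeutData (emb D) X).α := karoubi_mat_ext fun i j => by
    refine Eq.trans ?_ (karoubi_comp_single () (fun _ => rfl) _ _ i j).symm
    refine Eq.trans ?_ (congrArg (fun g : X.A ⊗ X.A ⟶ X.A ⊗ X.A => 𝟙 (X.A ⊗ X.A) ≫ g)
      (karoubi_comp_single () (fun _ => rfl) ((emb D).map X.α) (δ (emb D) X.A X.A) () j)).symm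
    exact ((Category.id_comp _).trans (Category.comp_id _)).symm
  have h2 : (embNeut X).β = (mapNeutData (emb D) X).β := karoubi_mat_ext fun i j => by
    refine Eq.trans ?_ (karoubi_comp_single () (fun _ => rfl) _ _ i j).symm
    refine Eq.trans ?_ (congrArg (fun g : X.A ⊗ X.A ⟶ 𝟙_ D => 𝟙 (X.A ⊗ X.A) ≫ g)
      (karoubi_comp_single () (fun _ => rfl) ((emb D).map X.β) (η (emb D)) () j)).symm
    refine ((Category.id_comp _).trans ?_).symm
    exact (congrArg (X.β ≫ ·) (emb_id_f (𝟙_ D) () ())).trans (Category.comp_id _)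
  have h3 : (embNeut X).δ = (mapNeutData (emb D) X).δ := karoubi_mat_ext fun i j => by
    refine Eq.trans ?_ (karoubi_comp_single () (fun _ => rfl) _ _ i j).symm
    refine Eq.trans ?_ (congrArg (fun g : 𝟙_ D ⟶ X.A ⊗ X.A => (ε (emb D)).f () () ≫ g)
      (karoubi_comp_single () (fun _ => rfl) ((emb D).map X.δ) (δ (emb D) X.A X.A) () j)).symm
    refine Eq.trans ?_ (congrArg (· ≫ X.δ ≫ 𝟙 _) (emb_id_f (𝟙_ D) () ())).symm
    exact ((Category.id_comp _).trans (Category.comp_id _)).symm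
  change NeutData.mk _ _ _ _ = NeutData.mk _ _ _ _
  congr 1

section Single

namespace Realization

variable {F G : D ⥤ C} [F.Additive]

theorem ι_hom_single {P Q : Karoubi (Mat_ D)} (a : Q.X.ι) (ha : ∀ b, b = a) (R : Realization F P)
    (τ : F ⟶ G) (f : P ⟶ Q) (S : Realization G Q) (k : P.X.ι) :
    R.ι k ≫ R.hom τ f S = F.map (f.f k a) ≫ τ.app _ ≫ S.ι a := by
  rw [ι_hom, Finset.sum_eq_single a]
  · exact fun b _ hb => absurd (ha b) hb
  · exact fun h => absurd (Finset.mem_univ _) h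

/-- The realization of an object of the original category. -/
def embIso {X : D} (R : Realization F ((emb D).obj X)) : F.obj X ≅ R.Z where
  hom := R.ι ()
  inv := R.π ()
  hom_inv_id := (R.ι_π () ()).trans ((congrArg F.map (emb_id_f X () ())).trans (F.map_id _))
  inv_hom_id := (Fintype.sum_unique (ι := Unit) fun k => R.π k ≫ R.ι k).symm.trans R.total

end Realization

/-- The common shape of the three compatibility conditions in `extendEval`: an inverse comparison
cancels, and the rest is one commuting square. -/
theorem conj_comp {E : Type*} [Category* E] {M M' N N' Z Z' : E} {m : M ⟶ N} {a : N ⟶ N'}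
    {d : N' ⟶ M'} {m' : M' ⟶ N'} {i : N ⟶ Z} {i' : N' ⟶ Z'} {a' : Z ⟶ Z'} (h : d ≫ m' = 𝟙 _)
    (h' : i ≫ a' = a ≫ i') : (m ≫ a ≫ d) ≫ m' ≫ i' = (m ≫ i) ≫ a' := by
  simp only [Category.assoc, h', reassoc_of% h]

variable [HasFiniteBiproducts C] [IsIdempotentComplete C] (F : D ⥤ C) [F.Additive] [F.Braided]

/-- The extension of a functor has the same value on an object of the original category. -/
def extendEval (X : NeutData D) : mapNeutData F X ⟶ mapNeutData (extend F) (embNeut X) :=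
  homMap (N := mapNeutData F X) (F := extend F) (X := embNeut X) (realize F _).embIso
    (μ F X.A X.A ≫ (realize F ((emb D).obj X.A ⊗ (emb D).obj X.A)).ι₂ () ())
    (Realization.tensor_ι_mul _ _ _ _ _)
    (conj_comp (Functor.Monoidal.δ_μ F X.A X.A)
      ((Realization.ι_hom_single ((), ()) (fun _ => rfl) _ _ _ _ _).trans
        (congrArg (F.map X.α ≫ ·) (Category.id_comp _))))
    (conj_comp (m := μ F X.A X.A) (Functor.Monoidal.η_ε F)
      ((Realization.ι_hom_single (show (𝟙_ (Karoubi (Mat_ D))).X.ι from ()) (fun _ => rfl)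
        (realize F ((emb D).obj X.A ⊗ (emb D).obj X.A))
        (𝟙 F) (embNeut X).β (realize F (𝟙_ _)) ((), ())).trans
        (congrArg (F.map X.β ≫ ·) (Category.id_comp (realize F (𝟙_ _)).ι₀)))).symm
    (conj_comp (Functor.Monoidal.δ_μ F X.A X.A)
      ((Realization.ι_hom_single ((), ()) (fun _ => rfl) _ _ _ _ _).trans
        (congrArg (F.map X.δ ≫ ·) (Category.id_comp _))))

end Single

end

/-! ### Extension and uniqueness of natural transformations on the Karoubian envelope. -/

section

section Extension

open Idempotents Functor.LaxMonoidal Functor.OplaxMonoidal Realization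

universe v₁ u₁

variable {D : Type u₁} [Category.{v₁} D] [Preadditive D] [MonoidalCategory D]
  [MonoidalPreadditive D] [SymmetricCategory D]
  {C : Type u} [Category.{v} C] [Preadditive C] [MonoidalCategory C]
  [MonoidalPreadditive C] [SymmetricCategory C] {H H' : Karoubi (Mat_ D) ⥤ C} [H.Additive] [H'.Additive]

/-- Natural transformations of additive functors on the Karoubian envelope are determined by
their restriction to the original category. -/
theorem natTrans_ext {κ κ' : H ⟶ H'}
    (h : ∀ X, κ.app ((emb D).obj X) = κ'.app ((emb D).obj X)) : κ = κ' := by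
  ext P
  refine (ofFunctor H P).hom_ext fun k => ?_
  exact (κ.naturality (inc P k)).trans ((congrArg (· ≫ _) (h _)).trans
    (κ'.naturality (inc P k)).symm)

/-- The isomorphism of realizations given by a natural isomorphism. -/
def Realization.iso {F G : D ⥤ C} [F.Additive] [G.Additive] {P : Karoubi (Mat_ D)}
    (R : Realization F P) (τ : F ≅ G) (S : Realization G P) : R.Z ≅ S.Z where
  hom := R.hom τ.hom (𝟙 P) S
  inv := S.hom τ.inv (𝟙 P) R
  hom_inv_id := by rw [Realization.hom_comp, τ.hom_inv_id, Category.comp_id, hom_id]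
  inv_hom_id := by rw [Realization.hom_comp, τ.inv_hom_id, Category.comp_id, hom_id]

/-- The extension of a natural isomorphism to the Karoubian envelope. -/
def extendIso (τ : emb D ⋙ H ≅ emb D ⋙ H') : H ≅ H' :=
  NatIso.ofComponents (fun P => (ofFunctor H P).iso τ (ofFunctor H' P))
    (fun {P Q} f => by
      rw [← ofFunctor_hom H f, ← ofFunctor_hom H' f]
      refine (Realization.hom_comp _ _ _ _ _ _ _).trans (Eq.trans ?_ (Realization.hom_comp _ _ _ _ _ _ _).symm)
      simp only [Category.id_comp, Category.comp_id])

theorem extendIso_app (τ : emb D ⋙ H ≅ emb D ⋙ H') (X : D) :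
    (extendIso τ).hom.app ((emb D).obj X) = τ.hom.app X := by
  have h : ∀ (G : Karoubi (Mat_ D) ⥤ C) [G.Additive],
      (ofFunctor G ((emb D).obj X)).ι () = 𝟙 (G.obj ((emb D).obj X)) :=
    fun G _ => G.map_id ((emb D).obj X)
  have h1 := ι_hom_single (P := (emb D).obj X) (Q := (emb D).obj X) () (fun _ => rfl)
    (ofFunctor H _) τ.hom (𝟙 _) (ofFunctor H' _) ()
  rw [h H, h H'] at h1
  refine (Category.id_comp _).symm.trans (h1.trans ?_)
  refine (congrArg (fun f : X ⟶ X => (emb D ⋙ H).map f ≫ τ.hom.app X ≫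
    𝟙 (H'.obj ((emb D).obj X))) (emb_id_f X () ())).trans ?_
  refine (congrArg (· ≫ τ.hom.app X ≫ 𝟙 (H'.obj ((emb D).obj X))) ((emb D ⋙ H).map_id X)).trans ?_
  exact (Category.id_comp _).trans (Category.comp_id _)

/-- The naturality of units and multiplications of realizations, applied to the realizations given
by the values of `H` and `H'`. -/
instance [H.Monoidal] [H'.Monoidal] (τ : emb D ⋙ H ≅ emb D ⋙ H')
    [NatTrans.IsMonoidal τ.hom] : NatTrans.IsMonoidal (extendIso τ).hom where
  unit := by
    have h := unit_naturality (ofFunctor H (𝟙_ _)) τ.hom (ofFunctor H' (𝟙_ _))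
    rwa [ofFunctor_unit, ofFunctor_unit] at h
  tensor P Q := by
    have h := mul_naturality (ofFunctor H P) (ofFunctor H Q) (ofFunctor H (P ⊗ Q)) τ.hom
      (ofFunctor H' P) (ofFunctor H' Q) (ofFunctor H' (P ⊗ Q)) (𝟙 P) (𝟙 Q)
    rw [ofFunctor_mul, ofFunctor_mul, id_tensorHom_id] at h
    exact h.symm

end Extension

end

/-! ### The axioms for the generating object, by comparison of operators. -/

section

section GenZero

open RepZero EvenPartition

variable {t : ℂ} {k l k' l' : ℕ}

theorem RepZero.IsModel.tensHom {x : LinPart k l} {y : LinPart k' l'} {M N} (hx : IsModel t x M)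
    (hy : IsModel t y N) : IsModel t (tensL _ _ _ _ x y)
      (fun n h => M (fun g => N (fun g' => n (Fin.append g g')) (fun i => h (Fin.natAdd k i)))
        (fun i => h (Fin.castAdd k' i))) := by
  obtain ⟨p, a, rfl, hM⟩ := hx
  obtain ⟨q, b, rfl, hN⟩ := hy
  refine ⟨hcomp p q, a + b, ?_, fun n f => ?_⟩
  · rw [tensL_single, pow_add]
  · beta_reduce
    rw [hM, sum_fin, pow_add, mul_assoc]
    congr 1
    rw [Finset.mul_sum]
    refine Finset.sum_congr rfl fun g _ => ?_
    rw [hN, Finset.mul_sum, Finset.mul_sum, Finset.mul_sum]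
    refine Finset.sum_congr rfl fun g' _ => ?_
    rw [M_hcomp]
    simp only [Fin.append_left, Fin.append_right]
    ring

/-- Indicator functions of single labellings read off the matrix entries, and these determine the
partition and the exponent. The criterion is a finite computation that does not involve `t`. -/
theorem RepZero.IsModel.unique {x y : LinPart k l} {M N} (hx : IsModel t x M) (hy : IsModel t y N)
    (h : ∀ f g, M (fun h => if h = g then 1 else 0) f = N (fun h => if h = g then 1 else 0) f) :
    x = y := by
  obtain ⟨p, a, rfl, hM⟩ := hx
  obtain ⟨q, b, rfl, hN⟩ := hy
  have key : ∀ f g, 2 ^ a * p.M f g = 2 ^ b * q.M f g := by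
    intro f g
    have h1 := h f g
    rw [hM, hN] at h1
    simpa using h1
  obtain ⟨rfl, rfl⟩ := eq_of_M key
  rfl

theorem isModel_genZero_α : IsModel t (k := 2) (l := 2) (genZero t).α
    (fun n f => if f 0 = f 1 then n f else 0) := by
  refine (IsModel.block _ (by decide)).of_eq fun n f => ?_
  exact (FinPow.NeutGen.sum_ite_const f n).symm

theorem isModel_genZero_β : IsModel t (k := 2) (l := 0) (genZero t).β
    (fun n f => if f 0 = f 1 then n Fin.elim0 else 0) := by
  refine (IsModel.block _ (by decide)).of_eq fun n f => ?_
  refine (FinPow.NeutGen.sum_ite_const f fun _ => n Fin.elim0).symm.trans ?_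
  refine Finset.sum_congr rfl fun b _ => ?_
  congr 2
  exact Subsingleton.elim _ _

theorem isModel_genZero_δ : IsModel t (k := 0) (l := 2) (genZero t).δ
    (fun n _ => n (fun _ => false) + n (fun _ => true)) := by
  refine (IsModel.block _ (by decide)).of_eq fun n f => ?_
  rw [Fintype.sum_bool, if_pos (Subsingleton.elim _ _), if_pos (Subsingleton.elim _ _), one_mul,
    one_mul, add_comm]

theorem isModel_id (t : ℂ) (n : ℕ) : IsModel t (permL (Equiv.refl (Fin n))) (fun n f => n f) :=
  IsModel.perm _

theorem isModel_cast (t : ℂ) {m n : ℕ} (h : m = n) : IsModel t (permL (finCongr h))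
    (fun n f => n fun i => f (Fin.cast h.symm i)) :=
  IsModel.perm _

theorem isModel_flip (t : ℂ) : IsModel t (permL (finAddFlip (m := 1) (n := 1)))
    (fun n f => n fun i => f ((finAddFlip (m := 1) (n := 1)).symm i)) :=
  IsModel.perm _

/-- The generating object is a rigid self-dual object with neutralizer. -/
theorem isRigidNeut_genZero (t : ℂ) : IsRigidNeut t (genZero t) := by
  have a := isModel_genZero_α (t := t)
  have b := isModel_genZero_β (t := t)
  have d := isModel_genZero_δ (t := t)
  have i := isModel_id t 1
  have m := isModel_cast t (show 2 + 1 = 1 + 2 by decide)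
  have m' := isModel_cast t (show 1 + 2 = 2 + 1 by decide)
  have l := isModel_cast t (show 0 + 1 = 1 by decide)
  have l' := isModel_cast t (show 1 = 0 + 1 by decide)
  have r := isModel_cast t (show 1 + 0 = 1 by decide)
  have r' := isModel_cast t (show 1 = 1 + 0 by decide)
  have s := isModel_flip t
  -- Both sides of every axiom are built from the models above, and `decide` compares their
  -- operators on all labellings.
  exact
    { zigzag_left :=
        (((d.tensHom i).comp (m.comp (i.tensHom b))).unique (l.comp r') (by decide) :)
      zigzag_right :=
        (((i.tensHom d).comp (m'.comp (b.tensHom i))).unique (r.comp l') (by decide) :)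
      dim := ((d.comp b).unique (isModel_id t 0).smul (by decide) :)
      idem := ((a.comp a).unique a (by decide) :)
      exchange := (((a.tensHom i).comp (m.comp ((i.tensHom a).comp m'))).unique
        (m.comp ((i.tensHom a).comp (m'.comp (a.tensHom i)))) (by decide) :)
      coev_neut := ((d.comp a).unique d (by decide) :)
      neut_ev := ((a.comp b).unique b (by decide) :)
      coev_slide := ((l'.comp ((d.tensHom i).comp (m.comp (i.tensHom a)))).unique
        (r'.comp ((i.tensHom d).comp (m'.comp ((a.tensHom i).comp m)))) (by decide) :)
      ev_slide := (((i.tensHom a).comp (m'.comp ((b.tensHom i).comp l))).unique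
        (m'.comp ((a.tensHom i).comp (m.comp ((i.tensHom b).comp r)))) (by decide) :)
      swap_ev := ((s.comp b).unique b (by decide) :)
      coev_swap := ((d.comp s).unique d (by decide) :)
      swap_neut := ((s.comp a).unique a (by decide) :)
      neut_swap := ((a.comp s).unique a (by decide) :) }

end GenZero

end

/-! ### Preservation of the axioms by symmetric monoidal functors. -/

section

section Square

open Functor.LaxMonoidal Functor.OplaxMonoidal

variable {D : Type*} [Category* D] [MonoidalCategory D] {C : Type u} [Category.{v} C]
  [MonoidalCategory C] (F : D ⥤ C)

/-- The morphism `g` is the image of the morphism `f`, up to the given comparisons of the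
objects. -/
def IsImage {X Y : D} {M N : C} (m : M ⟶ F.obj X) (n : N ⟶ F.obj Y) (g : X ⟶ Y) (f : M ⟶ N) :
    Prop := f ≫ n = m ≫ F.map g

namespace IsImage

variable {F} {X Y Z : D} {M N K : C} {m : M ⟶ F.obj X} {n : N ⟶ F.obj Y} {k : K ⟶ F.obj Z}
  {g g' : X ⟶ Y} {f f' : M ⟶ N}

theorem comp (h : IsImage F m n g f) {g₁ : Y ⟶ Z} {f₁ : N ⟶ K} (h₁ : IsImage F n k g₁ f₁) :
    IsImage F m k (g ≫ g₁) (f ≫ f₁) := by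
  unfold IsImage at *
  rw [Category.assoc, h₁, reassoc_of% h, F.map_comp]

theorem id : IsImage F m m (𝟙 X) (𝟙 M) := by
  unfold IsImage
  rw [F.map_id, Category.comp_id, Category.id_comp]

theorem smul [Preadditive D] [Linear ℂ D] [Preadditive C] [Linear ℂ C] [F.Additive] [F.Linear ℂ]
    (h : IsImage F m n g f) (t : ℂ) : IsImage F m n (t • g) (t • f) := by
  unfold IsImage at *
  rw [F.map_smul, Linear.smul_comp, Linear.comp_smul, h]

theorem inv {g : X ≅ Y} {f : M ≅ N} (h : IsImage F m n g.hom f.hom) :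
    IsImage F n m g.inv f.inv := by
  unfold IsImage at *
  rw [Iso.inv_comp_eq, reassoc_of% h, ← F.map_comp, g.hom_inv_id, F.map_id, Category.comp_id]

/-- Once both sides of an axiom are recognized as images of the sides upstairs, the equation
descends. In the application the comparisons are invertible. -/
theorem eq [Mono n] (h : IsImage F m n g f) (h' : IsImage F m n g' f') (e : g = g') : f = f' := by
  unfold IsImage at *
  rw [← cancel_mono n, h, h', e]

variable [F.Monoidal]

theorem whiskerRight (h : IsImage F m n g f) (k : K ⟶ F.obj Z) :
    IsImage F ((m ⊗ₘ k) ≫ μ F X Z) ((n ⊗ₘ k) ≫ μ F Y Z) (g ▷ Z) (f ▷ K) := by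
  unfold IsImage at *
  rw [← MonoidalCategory.tensorHom_id, MonoidalCategory.tensorHom_comp_tensorHom_assoc, h,
    Category.assoc, ← μ_natural_left, ← MonoidalCategory.tensorHom_id,
    MonoidalCategory.tensorHom_comp_tensorHom_assoc, Category.id_comp, Category.comp_id]

theorem whiskerLeft (h : IsImage F m n g f) (k : K ⟶ F.obj Z) :
    IsImage F ((k ⊗ₘ m) ≫ μ F Z X) ((k ⊗ₘ n) ≫ μ F Z Y) (Z ◁ g) (K ◁ f) := by
  unfold IsImage at *
  rw [← MonoidalCategory.id_tensorHom, MonoidalCategory.tensorHom_comp_tensorHom_assoc, h,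
    Category.assoc, ← μ_natural_right, ← MonoidalCategory.id_tensorHom,
    MonoidalCategory.tensorHom_comp_tensorHom_assoc, Category.id_comp, Category.comp_id]

theorem associator (m : M ⟶ F.obj X) (n : N ⟶ F.obj Y) (k : K ⟶ F.obj Z) :
    IsImage F ((((m ⊗ₘ n) ≫ μ F X Y) ⊗ₘ k) ≫ μ F _ Z) ((m ⊗ₘ ((n ⊗ₘ k) ≫ μ F Y Z)) ≫ μ F X _)
      (α_ X Y Z).hom (α_ M N K).hom := by
  unfold IsImage
  have h1 : ((m ⊗ₘ n) ≫ μ F X Y) ⊗ₘ k = ((m ⊗ₘ n) ⊗ₘ k) ≫ μ F X Y ▷ F.obj Z := by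
    rw [← MonoidalCategory.tensorHom_id, MonoidalCategory.tensorHom_comp_tensorHom, Category.comp_id]
  have h2 : m ⊗ₘ ((n ⊗ₘ k) ≫ μ F Y Z) = (m ⊗ₘ (n ⊗ₘ k)) ≫ F.obj X ◁ μ F Y Z := by
    rw [← MonoidalCategory.id_tensorHom, MonoidalCategory.tensorHom_comp_tensorHom, Category.comp_id]
  rw [h1, h2, Category.assoc, Category.assoc, ← associator_naturality_assoc, Category.assoc,
    Functor.LaxMonoidal.associativity]

theorem leftUnitor (m : M ⟶ F.obj X) :
    IsImage F ((ε F ⊗ₘ m) ≫ μ F _ X) m (λ_ X).hom (λ_ M).hom := by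
  unfold IsImage
  have h1 : ε F ⊗ₘ m = (𝟙 _ ⊗ₘ m) ≫ ε F ▷ F.obj X := by
    rw [← MonoidalCategory.tensorHom_id, MonoidalCategory.tensorHom_comp_tensorHom, Category.comp_id,
      Category.id_comp]
  rw [h1, Category.assoc, Category.assoc, ← Functor.LaxMonoidal.left_unitality,
    MonoidalCategory.id_tensorHom, leftUnitor_naturality]

theorem rightUnitor (m : M ⟶ F.obj X) :
    IsImage F ((m ⊗ₘ ε F) ≫ μ F X _) m (ρ_ X).hom (ρ_ M).hom := by
  unfold IsImage
  have h1 : m ⊗ₘ ε F = (m ⊗ₘ 𝟙 _) ≫ F.obj X ◁ ε F := by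
    rw [← MonoidalCategory.id_tensorHom, MonoidalCategory.tensorHom_comp_tensorHom, Category.comp_id,
      Category.id_comp]
  rw [h1, Category.assoc, Category.assoc, ← Functor.LaxMonoidal.right_unitality,
    MonoidalCategory.tensorHom_id, rightUnitor_naturality]

end IsImage

theorem IsImage.braiding [SymmetricCategory D] [SymmetricCategory C] {F : D ⥤ C} [F.Braided]
    {X Y : D} {M N : C} (m : M ⟶ F.obj X) (n : N ⟶ F.obj Y) :
    IsImage F ((m ⊗ₘ n) ≫ μ F X Y) ((n ⊗ₘ m) ≫ μ F Y X) (β_ X Y).hom (β_ M N).hom := by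
  unfold IsImage
  rw [Category.assoc, Functor.LaxBraided.braided, BraidedCategory.braiding_naturality_assoc]

end Square

section MapRigid

open Functor.LaxMonoidal Functor.OplaxMonoidal IsImage

variable {D : Type*} [Category* D] [Preadditive D] [Linear ℂ D] [MonoidalCategory D]
  [SymmetricCategory D] {C : Type u} [Category.{v} C] [Preadditive C] [Linear ℂ C]
  [MonoidalCategory C] [SymmetricCategory C]

/-- Linear symmetric monoidal functors preserve rigid self-dual objects with neutralizer. -/
theorem IsRigidNeut.map {t : ℂ} {X : NeutData D} (hX : IsRigidNeut t X) (F : D ⥤ C) [F.Braided]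
    [F.Additive] [F.Linear ℂ] : IsRigidNeut t (mapNeutData F X) := by
  let i : F.obj X.A ⟶ F.obj X.A := 𝟙 _
  have a : IsImage F ((i ⊗ₘ i) ≫ μ F X.A X.A) ((i ⊗ₘ i) ≫ μ F X.A X.A) X.α
      (mapNeutData F X).α := by
    simp [IsImage, mapNeutData, i]
  have b : IsImage F ((i ⊗ₘ i) ≫ μ F X.A X.A) (ε F) X.β (mapNeutData F X).β := by
    simp [IsImage, mapNeutData, i]
  have d : IsImage F (ε F) ((i ⊗ₘ i) ≫ μ F X.A X.A) X.δ (mapNeutData F X).δ := by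
    simp [IsImage, mapNeutData, i]
  have s := associator i i i
  have l := leftUnitor (F := F) i
  have r := rightUnitor (F := F) i
  have c := braiding (F := F) i i
  have : IsIso i := inferInstanceAs (IsIso (𝟙 _))
  exact
    { zigzag_left := ((d.whiskerRight i).comp (s.comp (b.whiskerLeft i))).eq (l.comp r.inv)
        hX.zigzag_left
      zigzag_right := ((d.whiskerLeft i).comp (s.inv.comp (b.whiskerRight i))).eq (r.comp l.inv)
        hX.zigzag_right
      dim := (d.comp b).eq (IsImage.id.smul t) hX.dim
      idem := (a.comp a).eq a hX.idem
      exchange := ((a.whiskerRight i).comp (s.comp ((a.whiskerLeft i).comp s.inv))).eq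
        (s.comp ((a.whiskerLeft i).comp (s.inv.comp (a.whiskerRight i)))) hX.exchange
      coev_neut := (d.comp a).eq d hX.coev_neut
      neut_ev := (a.comp b).eq b hX.neut_ev
      coev_slide := (l.inv.comp ((d.whiskerRight i).comp (s.comp (a.whiskerLeft i)))).eq
        (r.inv.comp ((d.whiskerLeft i).comp (s.inv.comp ((a.whiskerRight i).comp s))))
        hX.coev_slide
      ev_slide := ((a.whiskerLeft i).comp (s.inv.comp ((b.whiskerRight i).comp l))).eq
        (s.inv.comp ((a.whiskerRight i).comp (s.comp ((b.whiskerLeft i).comp r)))) hX.ev_slide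
      swap_ev := (c.comp b).eq b hX.swap_ev
      coev_swap := (d.comp c).eq d hX.coev_swap
      swap_neut := (c.comp a).eq a hX.swap_neut
      neut_swap := (a.comp c).eq a hX.neut_swap }

end MapRigid

end

/-! ### Extension of an isomorphism from degree one to all tensor powers. -/

section

section Graded

/-- A sequence of objects with multiplications that are compatible with units and associators. -/
structure Graded (C : Type u) [Category.{v} C] [MonoidalCategory C] where
  Z : ℕ → C
  e : 𝟙_ C ≅ Z 0
  m : ∀ a b, Z a ⊗ Z b ≅ Z (a + b)
  unit_right : ∀ a, Z a ◁ e.hom ≫ (m a 0).hom = (ρ_ (Z a)).hom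
  unit_left : e.hom ▷ Z 1 ≫ (m 0 1).hom = (λ_ (Z 1)).hom
  assoc : ∀ a b, Z a ◁ (m b 1).hom ≫ (m a (b + 1)).hom =
    (α_ (Z a) (Z b) (Z 1)).inv ≫ (m a b).hom ▷ Z 1 ≫ (m (a + b) 1).hom

namespace Graded

variable {C : Type u} [Category.{v} C] [MonoidalCategory C] {Z Z' : Graded C}

/-- The extension of an isomorphism in degree one. -/
def extend (f : Z.Z 1 ≅ Z'.Z 1) : ∀ n, Z.Z n ≅ Z'.Z n
  | 0 => Z.e.symm ≪≫ Z'.e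
  | n + 1 => (Z.m n 1).symm ≪≫ (extend f n ⊗ᵢ f) ≪≫ Z'.m n 1

variable (f : Z.Z 1 ≅ Z'.Z 1)

theorem e_extend : Z.e.hom ≫ (extend f 0).hom = Z'.e.hom := by simp [extend]

theorem m_extend_one (n : ℕ) : (Z.m n 1).hom ≫ (extend f (n + 1)).hom =
    ((extend f n).hom ⊗ₘ f.hom) ≫ (Z'.m n 1).hom := by
  simp [extend]

theorem extend_one : (extend f 1).hom = f.hom := by
  have h : IsIso (Z.e.hom ▷ Z.Z 1 ≫ (Z.m 0 1).hom) := inferInstance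
  refine (cancel_epi (Z.e.hom ▷ Z.Z 1 ≫ (Z.m 0 1).hom)).1 ?_
  rw [Category.assoc, m_extend_one, Z.unit_left, ← MonoidalCategory.tensorHom_id,
    MonoidalCategory.tensorHom_comp_tensorHom_assoc, e_extend, Category.id_comp,
    ← leftUnitor_naturality, ← Z'.unit_left, MonoidalCategory.tensorHom_def', Category.assoc]

/-- Induction on `b`. The extension is defined by adding factors of degree one on the right, and
associativity with a last factor of degree one passes from `b` to `b + 1`. -/
theorem m_extend (a b : ℕ) : (Z.m a b).hom ≫ (extend f (a + b)).hom =
    ((extend f a).hom ⊗ₘ (extend f b).hom) ≫ (Z'.m a b).hom := by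
  induction b with
  | zero =>
    rw [← cancel_epi (Z.Z a ◁ Z.e.hom), reassoc_of% Z.unit_right a,
      ← MonoidalCategory.id_tensorHom, MonoidalCategory.tensorHom_comp_tensorHom_assoc, e_extend,
      Category.id_comp, MonoidalCategory.tensorHom_def, Category.assoc, Z'.unit_right]
    exact (rightUnitor_naturality _).symm
  | succ b ih =>
    rw [← cancel_epi (Z.Z a ◁ (Z.m b 1).hom), reassoc_of% Z.assoc a b]
    refine (congrArg (fun g => (α_ (Z.Z a) (Z.Z b) (Z.Z 1)).inv ≫ (Z.m a b).hom ▷ Z.Z 1 ≫ g)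
      (m_extend_one f (a + b))).trans ?_
    rw [← MonoidalCategory.id_tensorHom, MonoidalCategory.tensorHom_comp_tensorHom_assoc,
      m_extend_one, ← MonoidalCategory.tensorHom_id,
      MonoidalCategory.tensorHom_comp_tensorHom_assoc, ih, Category.id_comp, Category.id_comp]
    have h1 : ((extend f a).hom ⊗ₘ (extend f b).hom) ≫ (Z'.m a b).hom ⊗ₘ f.hom =
        (((extend f a).hom ⊗ₘ (extend f b).hom) ⊗ₘ f.hom) ≫ (Z'.m a b).hom ▷ Z'.Z 1 := by
      rw [← MonoidalCategory.tensorHom_id, MonoidalCategory.tensorHom_comp_tensorHom,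
        Category.comp_id]
    have h2 : (extend f a).hom ⊗ₘ (((extend f b).hom ⊗ₘ f.hom) ≫ (Z'.m b 1).hom) =
        ((extend f a).hom ⊗ₘ ((extend f b).hom ⊗ₘ f.hom)) ≫ Z'.Z a ◁ (Z'.m b 1).hom := by
      rw [← MonoidalCategory.id_tensorHom, MonoidalCategory.tensorHom_comp_tensorHom,
        Category.comp_id]
    rw [h1, h2, Category.assoc, Category.assoc, Z'.assoc, ← associator_inv_naturality_assoc]

end Graded

open Functor.LaxMonoidal Functor.OplaxMonoidal

variable {C : Type u} [Category.{v} C] [MonoidalCategory C] {t : ℂ}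

/-- The values of a monoidal functor on the category of even partition diagrams. -/
def gradedOf (F : RepZero t ⥤ C) [F.Monoidal] : Graded C where
  Z n := F.obj ⟨n⟩
  e := Functor.Monoidal.εIso F
  m a b := Functor.Monoidal.μIso F ⟨a⟩ ⟨b⟩
  unit_right a := by
    have h : F.map (ρ_ (⟨a⟩ : RepZero t)).hom = 𝟙 (F.obj ⟨a⟩) := F.map_id _
    have h1 := Functor.LaxMonoidal.right_unitality F ⟨a⟩
    rw [h] at h1
    exact ((congrArg (F.obj ⟨a⟩ ◁ ε F ≫ ·) (Category.comp_id (μ F ⟨a⟩ ⟨0⟩))).symm.trans h1.symm)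
  unit_left := by
    -- `0 + 1` reduces to `1`, so this unitor is an identity. For a variable `n` the sum `0 + n`
    -- does not reduce, and degree one is all that is needed.
    have h : F.map (λ_ (⟨1⟩ : RepZero t)).hom = 𝟙 (F.obj ⟨1⟩) := F.map_id _
    have h1 := Functor.LaxMonoidal.left_unitality F ⟨1⟩
    rw [h] at h1
    exact ((congrArg (ε F ▷ F.obj ⟨1⟩ ≫ ·) (Category.comp_id (μ F ⟨0⟩ ⟨1⟩))).symm.trans h1.symm)
  assoc a b := by
    have h : F.map (α_ (⟨a⟩ : RepZero t) ⟨b⟩ ⟨1⟩).hom = 𝟙 (F.obj ⟨a + b + 1⟩) := F.map_id _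
    have h1 := Functor.LaxMonoidal.associativity F ⟨a⟩ ⟨b⟩ ⟨1⟩
    rw [h] at h1
    refine (Iso.eq_inv_comp _).2 (h1.symm.trans ?_)
    exact congrArg (μ F ⟨a⟩ ⟨b⟩ ▷ F.obj ⟨1⟩ ≫ ·) (Category.comp_id (μ F ⟨a + b⟩ ⟨1⟩))

end Graded

end

/-! ### Isomorphisms between monoidal functors on diagrams, from the generating object. -/

section

section Full

open Functor.LaxMonoidal Functor.OplaxMonoidal

variable {C : Type u} [Category.{v} C] [MonoidalCategory C] [SymmetricCategory C] [Preadditive C]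
  [Linear ℂ C] {t : ℂ} {F F' : RepZero t ⥤ C} [F.Braided] [F'.Braided] [F.Additive] [F'.Additive]
  [F.Linear ℂ] [F'.Linear ℂ]

section Naturality

variable {τ : ∀ X, F.obj X ≅ F'.obj X}

/-- The morphisms for which a family of isomorphisms is natural. -/
def naturalOn (τ : ∀ X, F.obj X ≅ F'.obj X) : MorphismProperty (RepZero t) :=
  fun X Y g => F.map g ≫ (τ Y).hom = (τ X).hom ≫ F'.map g

/-- Compatibility with `μ` gives closure under tensor products and, as both functors are braided,
the symmetry. For the three blocks, naturality is the compatibility of `f` with the structure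
morphisms, after the comparisons `μ`, `δ`, `ε`, `η` are cancelled. -/
theorem isTensorClosed_naturalOn (hτ : ∀ X Y, μ F X Y ≫ (τ (X ⊗ Y)).hom =
      ((τ X).hom ⊗ₘ (τ Y).hom) ≫ μ F' X Y) (hε : ε F ≫ (τ (𝟙_ _)).hom = ε F')
    (f : mapNeutData F (genZero t) ⟶ mapNeutData F' (genZero t))
    (hf : (τ (genZero t).A).hom = f.iso.hom) : IsTensorClosed (naturalOn τ) where
  id X := by unfold naturalOn; rw [F.map_id, F'.map_id, Category.id_comp, Category.comp_id]
  comp f g hf hg := by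
    unfold naturalOn at *
    rw [F.map_comp, F'.map_comp, Category.assoc, hg, reassoc_of% hf]
  tens f g hf hg := by
    unfold naturalOn at *
    rw [← cancel_epi (μ F _ _), ← μ_natural_assoc, hτ, reassoc_of% hτ, ← μ_natural,
      MonoidalCategory.tensorHom_comp_tensorHom_assoc, hf, hg,
      MonoidalCategory.tensorHom_comp_tensorHom_assoc]
  smul f hf := by
    unfold naturalOn at *
    rw [F.map_smul, F'.map_smul, Linear.smul_comp, Linear.comp_smul, hf]
  braid := by
    unfold naturalOn
    rw [← cancel_epi (μ F _ _), Functor.LaxBraided.braided_assoc, hτ, reassoc_of% hτ,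
      Functor.LaxBraided.braided, BraidedCategory.braiding_naturality_assoc]
  neut := by
    have h := f.comm_α
    rw [← hf] at h
    have h1 : (μ F _ _ ≫ F.map (genZero t).α ≫ δ F _ _) ≫ ((τ (genZero t).A).hom ⊗ₘ
      (τ (genZero t).A).hom) = ((τ (genZero t).A).hom ⊗ₘ (τ (genZero t).A).hom) ≫
      μ F' _ _ ≫ F'.map (genZero t).α ≫ δ F' _ _ := h
    unfold naturalOn
    rw [← cancel_epi (μ F _ _), ← cancel_mono (δ F' _ _), reassoc_of% hτ, Category.assoc,
      Category.assoc, Category.assoc, Category.assoc, ← h1, Category.assoc, Category.assoc]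
    congr 2
    rw [← cancel_epi (μ F _ _), reassoc_of% hτ, Functor.Monoidal.μ_δ, Functor.Monoidal.μ_δ_assoc,
      Category.comp_id]
  ev := by
    have h := f.comm_β
    rw [← hf] at h
    have h1 : ((τ (genZero t).A).hom ⊗ₘ (τ (genZero t).A).hom) ≫ μ F' _ _ ≫
      F'.map (genZero t).β ≫ η F' = μ F _ _ ≫ F.map (genZero t).β ≫ η F := h
    unfold naturalOn
    rw [← cancel_epi (μ F _ _), ← cancel_mono (η F'), reassoc_of% hτ, Category.assoc,
      Category.assoc, Category.assoc, Category.assoc, h1]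
    congr 2
    rw [← cancel_epi (ε F), reassoc_of% hε, Functor.Monoidal.ε_η, Functor.Monoidal.ε_η]
  coev := by
    have h := f.comm_δ
    rw [← hf] at h
    have h1 : (ε F ≫ F.map (genZero t).δ ≫ δ F _ _) ≫ ((τ (genZero t).A).hom ⊗ₘ
      (τ (genZero t).A).hom) = ε F' ≫ F'.map (genZero t).δ ≫ δ F' _ _ := h
    unfold naturalOn
    rw [← cancel_epi (ε F), ← cancel_mono (δ F' _ _), reassoc_of% hε, Category.assoc,
      Category.assoc, Category.assoc, ← h1, Category.assoc, Category.assoc]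
    congr 2
    rw [← cancel_epi (μ F _ _), reassoc_of% hτ, Functor.Monoidal.μ_δ, Functor.Monoidal.μ_δ_assoc,
      Category.comp_id]

theorem naturalOn_of_ofPart (h : ∀ {k l : ℕ} (p : EvenPartition k l),
      naturalOn τ (RepZero.ofPart (t := t) (X := ⟨k⟩) (Y := ⟨l⟩) p))
    {X Y : RepZero t} (g : X ⟶ Y) : F.map g ≫ (τ Y).hom = (τ X).hom ≫ F'.map g := by
  induction g using Finsupp.induction_linear with
  | zero =>
    have h1 : F.map (0 : X ⟶ Y) ≫ (τ Y).hom = (τ X).hom ≫ F'.map (0 : X ⟶ Y) := by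
      rw [F.map_zero, F'.map_zero, Limits.zero_comp, Limits.comp_zero]
    exact h1
  | add x y hx hy =>
    have h1 : F.map ((x : X ⟶ Y) + (y : X ⟶ Y)) ≫ (τ Y).hom =
        (τ X).hom ≫ F'.map ((x : X ⟶ Y) + (y : X ⟶ Y)) := by
      rw [F.map_add, F'.map_add, Preadditive.add_comp, Preadditive.comp_add, hx, hy]
    exact h1
  | single p a =>
    have h1 : (Finsupp.single p a : X ⟶ Y) = a • (RepZero.ofPart p : X ⟶ Y) :=
      ((Finsupp.smul_single a p (1 : ℂ)).trans (by rw [smul_eq_mul, mul_one])).symm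
    have h2 : F.map (RepZero.ofPart p : X ⟶ Y) ≫ (τ Y).hom = (τ X).hom ≫ F'.map _ := h p
    rw [h1, F.map_smul, F'.map_smul, Linear.smul_comp, Linear.comp_smul, h2]

end Naturality

variable (f : mapNeutData F (genZero t) ⟶ mapNeutData F' (genZero t))

/-- The family of isomorphisms given by an isomorphism of the images of the generating object. -/
def fullApp (X : RepZero t) : F.obj X ≅ F'.obj X :=
  Graded.extend (Z := gradedOf F) (Z' := gradedOf F') f.iso X.n

theorem μ_fullApp (X Y : RepZero t) : μ F X Y ≫ (fullApp f (X ⊗ Y)).hom =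
    ((fullApp f X).hom ⊗ₘ (fullApp f Y).hom) ≫ μ F' X Y :=
  Graded.m_extend (Z := gradedOf F) (Z' := gradedOf F') f.iso X.n Y.n

theorem ε_fullApp : ε F ≫ (fullApp f (𝟙_ _)).hom = ε F' :=
  Graded.e_extend (Z := gradedOf F) (Z' := gradedOf F') f.iso

theorem fullApp_gen : (fullApp f (genZero t).A).hom = f.iso.hom :=
  Graded.extend_one (Z := gradedOf F) (Z' := gradedOf F') f.iso

/-- The natural isomorphism given by an isomorphism of the images of the generating object. -/
def fullIso : F ≅ F' :=
  NatIso.ofComponents (fullApp f) fun g => naturalOn_of_ofPart (τ := fullApp f)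
    (fun p => (isTensorClosed_naturalOn (μ_fullApp f) (ε_fullApp f) f (fullApp_gen f)).ofPart p) g

instance : NatTrans.IsMonoidal (fullIso f).hom where
  unit := ε_fullApp f
  tensor X Y := μ_fullApp f X Y

theorem fullIso_app : (fullIso f).hom.app (genZero t).A = f.iso.hom := fullApp_gen f

/-- Monoidal natural transformations are determined by the component of the generating object. -/
theorem monoidal_natTrans_ext {κ κ' : F ⟶ F'} [NatTrans.IsMonoidal κ] [NatTrans.IsMonoidal κ']
    (h : κ.app (genZero t).A = κ'.app (genZero t).A) : κ = κ' := by
  have key : ∀ n : ℕ, κ.app ⟨n⟩ = κ'.app ⟨n⟩ := by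
    intro n
    induction n with
    | zero =>
      refine (cancel_epi (ε F)).1 ?_
      exact (NatTrans.IsMonoidal.unit (τ := κ)).trans (NatTrans.IsMonoidal.unit (τ := κ')).symm
    | succ n ih =>
      refine (cancel_epi (μ F ⟨n⟩ (genZero t).A)).1 ?_
      refine (NatTrans.IsMonoidal.tensor (τ := κ) _ _).trans (Eq.trans ?_
        (NatTrans.IsMonoidal.tensor (τ := κ') _ _).symm)
      rw [ih, h]
  ext X
  exact key X.n

end Full

end

/-! ### The evaluation functor is an equivalence. -/

section

open Functor.LaxMonoidal Functor.OplaxMonoidal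

/-- Morphisms of objects with structure morphisms are invertible. -/
def NeutData.isoOfHom {C : Type u} [Category.{v} C] [MonoidalCategory C] {X Y : NeutData C}
    (f : X ⟶ Y) : X ≅ Y where
  hom := f
  inv :=
    { iso := f.iso.symm
      comm_α := by
        rw [← cancel_epi (f.iso.hom ⊗ₘ f.iso.hom), ← reassoc_of% f.comm_α]
        simp
      comm_β := by
        rw [← cancel_epi (f.iso.hom ⊗ₘ f.iso.hom), f.comm_β]
        simp
      comm_δ := by
        rw [← f.comm_δ]
        simp }
  hom_inv_id := NeutData.Hom.ext f.iso.self_symm_id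
  inv_hom_id := NeutData.Hom.ext f.iso.symm_self_id

theorem isRigidNeut_gen (t : ℂ) : IsRigidNeut t (gen t) := by
  rw [gen_eq, embNeut_eq]
  exact (isRigidNeut_genZero t).map _

theorem mapNeutData_comp {D E C : Type*} [Category* D] [MonoidalCategory D] [Category* E]
    [MonoidalCategory E] [Category* C] [MonoidalCategory C] (G : D ⥤ E) (F : E ⥤ C) [G.Monoidal]
    [F.Monoidal] (X : NeutData D) :
    mapNeutData (G ⋙ F) X = mapNeutData F (mapNeutData G X) := by
  have h1 : (mapNeutData (G ⋙ F) X).α = (mapNeutData F (mapNeutData G X)).α := by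
    simp [mapNeutData]
  have h2 : (mapNeutData (G ⋙ F) X).β = (mapNeutData F (mapNeutData G X)).β := by
    simp [mapNeutData]
  have h3 : (mapNeutData (G ⋙ F) X).δ = (mapNeutData F (mapNeutData G X)).δ := by
    simp [mapNeutData]
  change NeutData.mk _ _ _ _ = NeutData.mk _ _ _ _
  congr 1

theorem NeutData.eqToHom_iso_hom {C : Type*} [Category* C] [MonoidalCategory C] {X Y : NeutData C}
    (h : X = Y) : (eqToHom h).iso.hom = eqToHom (congrArg NeutData.A h) := by
  subst h
  rfl

variable {t : ℂ} {C : Type u} [Category.{v} C] [Preadditive C] [Linear ℂ C]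
  [MonoidalCategory C] [MonoidalPreadditive C] [SymmetricCategory C]

theorem mapNeutData_gen (F : RepH t ⥤ C) [F.Monoidal] :
    mapNeutData (emb (RepZero t) ⋙ F) (genZero t) = mapNeutData F (gen t) := by
  rw [gen_eq, embNeut_eq, mapNeutData_comp]

section

variable {F G : LinSymFunctor (RepH t) C}

/-- The restriction of an isomorphism of the images of the generating object. -/
def restrictHom (g : (evalAt C (gen t)).obj F ⟶ (evalAt C (gen t)).obj G) :
    mapNeutData (emb (RepZero t) ⋙ F.functor) (genZero t) ⟶
      mapNeutData (emb (RepZero t) ⋙ G.functor) (genZero t) :=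
  eqToHom (mapNeutData_gen F.functor) ≫ g ≫ eqToHom (mapNeutData_gen G.functor).symm

/-- The identified data have the same underlying object by definition, so the transports are
identities there. -/
theorem restrictHom_iso_hom (g : (evalAt C (gen t)).obj F ⟶ (evalAt C (gen t)).obj G) :
    (restrictHom g).iso.hom = g.iso.hom := by
  have h1 : (eqToHom (mapNeutData_gen F.functor)).iso.hom =
      𝟙 (F.functor.obj ((emb (RepZero t)).obj ⟨1⟩)) := NeutData.eqToHom_iso_hom _
  have h2 : (eqToHom (mapNeutData_gen G.functor).symm).iso.hom =
      𝟙 (G.functor.obj ((emb (RepZero t)).obj ⟨1⟩)) := NeutData.eqToHom_iso_hom _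
  refine (congrArg (fun x => x ≫ g.iso.hom ≫ _) h1).trans ?_
  refine (congrArg (fun x => 𝟙 (F.functor.obj ((emb (RepZero t)).obj ⟨1⟩)) ≫ g.iso.hom ≫ x) h2).trans ?_
  exact (Category.id_comp _).trans (Category.comp_id _)

end

/-- Additivity reduces a transformation on the envelope to its restriction to diagrams, and
monoidality reduces that to the component at `[1]`. -/
instance evalAt_gen_faithful : (evalAt C (gen t)).Faithful where
  map_injective {F G} τ σ h := by
    refine LinSymFunctor.Hom.ext (Iso.ext (natTrans_ext fun X => ?_))
    have h1 : τ.iso.hom.app (gen t).A = σ.iso.hom.app (gen t).A :=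
      congrArg (fun g : NeutData.Hom _ _ => g.iso.hom) h
    have h2 := monoidal_natTrans_ext (κ := Functor.whiskerLeft (emb (RepZero t)) τ.iso.hom)
      (κ' := Functor.whiskerLeft (emb (RepZero t)) σ.iso.hom) h1
    exact congrArg (fun κ => NatTrans.app κ X) h2

/-- The isomorphism at `[1]` is extended first over tensor powers and then over sums and summands;
neither extension alters the component at `[1]`. -/
instance evalAt_gen_full : (evalAt C (gen t)).Full where
  map_surjective {F G} g := by
    let τ := extendIso (fullIso (restrictHom g))
    refine ⟨⟨τ, inferInstance⟩, NeutData.Hom.ext (Iso.ext ?_)⟩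
    refine (extendIso_app (fullIso (restrictHom g)) (genZero t).A).trans ?_
    exact (fullIso_app _).trans (restrictHom_iso_hom g)

variable (t C) in
/-- The evaluation at the generating object, as a functor to rigid self-dual objects with
neutralizer. -/
def evalRig : LinSymFunctor (RepH t) C ⥤ RigNeut C t :=
  ObjectProperty.lift _ (evalAt C (gen t)) fun F => (isRigidNeut_gen t).map F.functor

instance : (evalRig t C).Faithful where
  map_injective h := (evalAt C (gen t)).map_injective (congrArg (fun g => g.hom) h)

instance : (evalRig t C).Full where
  map_surjective g := by
    obtain ⟨τ, hτ⟩ := (evalAt C (gen t)).map_surjective g.hom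
    exact ⟨τ, ObjectProperty.hom_ext _ hτ⟩

/-- The preimage of `N` is the functor on diagrams built from the tensor powers of its object,
extended to the envelope. -/
instance [MonoidalLinear ℂ C] [HasFiniteBiproducts C] [IsIdempotentComplete C] :
    (evalRig t C).EssSurj where
  mem_essImage N := by
    let F := (N.property.rel (FinPow.unitIso N.obj.A)).functor
    -- Morphisms of such data are isomorphisms by definition, so one compatible morphism is enough.
    let f : N.obj ⟶ (evalAt C (gen t)).obj ⟨extend F⟩ :=
      FinPow.evalIso N.property (FinPow.unitIso N.obj.A) ≫ extendEval F (genZero t)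
    exact ⟨⟨extend F⟩, ⟨ObjectProperty.isoMk _ (NeutData.isoOfHom f).symm⟩⟩

end

end HypDeligne

end

theorem mainTheorem5 (t : ℂ) (C : Type u) [Category.{v} C] [Preadditive C] [Linear ℂ C]
    [MonoidalCategory C] [MonoidalPreadditive C] [MonoidalLinear ℂ C] [SymmetricCategory C]
    [HasFiniteBiproducts C] [IsIdempotentComplete C] :
    ∃ e : HypDeligne.LinSymFunctor (HypDeligne.RepH t) C ≌ HypDeligne.RigNeut C t,
      Nonempty (e.functor ⋙ ObjectProperty.ι (fun X => HypDeligne.IsRigidNeut t X) ≅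
        HypDeligne.evalAt C (HypDeligne.gen t)) := by
  -- The three required properties are found as instances: faithful, full and essentially
  -- surjective.
  have : (HypDeligne.evalRig t C).IsEquivalence := {}
  exact ⟨(HypDeligne.evalRig t C).asEquivalence, ⟨ObjectProperty.liftCompιIso _ _ _⟩⟩
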